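/- **Conventions.** Composition of 1-cells is written in diagrammatic order ($fg$ means first $f$, then $g$), $\otimes$ denotes the tensor product and $I$ the unit object of a monoidal bicategory (a tricategory with one object), and objects also denote their identity 1-cells. A *braided monoidal bicategory* is a monoidal bicategory with a pseudonatural adjoint equivalence $c_{X,Y}\colon X\otimes Y\to Y\otimes X$ and two invertible modifications $R$, $S$ filling the two hexagons (for $c_{X,Y\otimes Z}$ and $c_{X\otimes Y,Z}$), subject to the four standard axioms; braided Gray monoids are a special case. A *braided monoidal pseudofunctor* $F\colon\mathcal M\to\mathcal N$ between braided monoidal bicategories is a pseudofunctor equipped with a pseudonatural transformation $\chi_{X,Y}\colon FX\otimes FY\to F(X\otimes Y)$, a 1-cell $\iota\colon I\to FI$, and invertible modifications $\omega$ (associativity), $\zeta,\xi$ (left and right unit) and $\upsilon_{X,Y}\colon c_{FX,FY}\,\chi_{Y,X}\cong\chi_{X,Y}\,F(c_{X,Y})$, satisfying the usual coherence conditions with respect to the pentagon, the middle unit cell, $R$ and $S$; $\chi$ and $\iota$ need not be equivalences. A *monoidal object* (pseudomonoid) of $\mathcal M$ is an object $A$ with 1-cells $m\colon A\otimes A\to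 A$, $j\colon I\to A$ and invertible associativity and unit 2-cells satisfying the pentagon and the unit (triangle) condition. A *centre piece* for $A$ with domain $U$ is a 1-cell $u\colon U\to A$ with an invertible 2-cell $$\gamma\colon (u\otimes A)\,m\;\Rightarrow\;c_{U,A}\,(A\otimes u)\,m$$ such that the two pastings $(u\otimes A\otimes A)(m\otimes A)\,m\Rightarrow c_{U,A\otimes A}\,(A\otimes A\otimes u)(A\otimes m)\,m$ (associativity 1-cells suppressed) agree: the one that uses $\gamma$ once, together with the pseudonaturality of $c$ at $m$ in its second variable, interchange and associativity of $m$, and the one built from $\gamma\otimes A$, associativity of $m$, $A\otimes\gamma$ and $R^{-1}$. A morphism $(u,\gamma)\to(v,\gamma')$ of centre pieces with domain $U$ is a 2-cell $\sigma\colon u\Rightarrow v$ with $\gamma'\circ\big((\sigma\otimes A)\,m\big)=\big(c_{U,A}\,(A\otimes\sigma)\,m\big)\circ\gamma$; this gives a category $\mathcal{CP}(U,A)$. A 1-cell $f\colon V\to U$ takes $(u,\gamma)$ to $fu$ with the 2-cell obtained by pasting the pseudonaturality isomorphism of $c$ at $f$ onto $\gamma$. A *centre* of $A$ is an object $Z_A$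 with a centre piece $i\colon Z_A\to A$ such that, for every object $U$, restriction of $i$ along 1-cells is an equivalence of categories $\mathcal M(U,Z_A)\simeq\mathcal{CP}(U,A)$. **Proposition.** Let $F\colon\mathcal M\to\mathcal N$ be a braided monoidal pseudofunctor between braided monoidal bicategories and let $A$ be a monoidal object of $\mathcal M$. 1. The object $FA$, with multiplication $\chi_{A,A}\,F(m)$, unit $\iota\,F(j)$, and the associativity and unit 2-cells induced from those of $A$ by $\chi$, $\omega$, $\zeta$, $\xi$, is a monoidal object of $\mathcal N$. 2. If $(u\colon U\to A,\gamma)$ is a centre piece for $A$, then $Fu\colon FU\to FA$ with the 2-cell $$(Fu\otimes FA)\,\chi\,Fm\cong\chi\,F(u\otimes A)\,Fm\overset{F\gamma}{\cong}\chi\,F(c_{U,A})\,F(A\otimes u)\,Fm\overset{\upsilon^{-1}}{\cong}c_{FU,FA}\,\chi\,F(A\otimes u)\,Fm\cong c_{FU,FA}\,(FA\otimes Fu)\,\chi\,Fm$$ (the unlabelled isomorphisms being pseudonaturality of $\chi$) is a centre piece for $FA$. 3. Suppose that $A$ has a centre $Z_A$ with universal centre piece $i$, and $FA$ has a centre $Z_{FA}$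 with universal centre piece $i'$. Then there are a 1-cell $k\colon FZ_A\to Z_{FA}$ and an isomorphism of centre pieces $\theta\colon k\,i'\cong Fi$, where $Fi$ carries the structure of part 2 and $k\,i'$ is the restriction of $i'$ along $k$. The pair $(k,\theta)$ is unique up to a unique invertible 2-cell: for any other such pair $(k',\theta')$ there is exactly one invertible 2-cell $e\colon k\cong k'$ with $\theta'\circ(e\,i')=\theta$. -/

import Mathlib

open CategoryTheory Bicategory

/-!
Conventions.  Composition of 1-cells is written in diagrammatic order (`f ≫ g` is "first `f`,
then `g`").  `◁` and `▷` are the whiskerings of the bicategory, `⊗≫` is composition of 2-cells with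
the bicategorical associators and unitors inserted.  Every invertible 2-cell is an `Iso`.
A pasting diagram is written as the sequence of its whiskered cells.
-/

universe w v u w₁ v₁ u₁ w₂ v₂ u₂

namespace BraidedBicat

/-! ### Squares of 1-cells filled by an invertible 2-cell, and mates -/

section Squares

variable {B : Type u} [Bicategory.{w, v} B]

/-- The identity square on a 1-cell. -/
def sqId {X Y : B} (k : X ⟶ Y) : k ≫ 𝟙 Y ≅ 𝟙 X ≫ k := ρ_ k ≪≫ (λ_ k).symm

/-- The square of a 1-cell `e` along identities. -/
def sqOne {X Y : B} (e : X ⟶ Y) : 𝟙 X ≫ e ≅ e ≫ 𝟙 Y := λ_ e ≪≫ (ρ_ e).symm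

/-- Pasting of two squares along a common edge `q`: the naturality square of a composite of two
pseudonatural transformations. -/
def sqComp {X X' Y Y' Z Z' : B} {p : X ⟶ X'} {e : X ⟶ Y} {e' : X' ⟶ Y'} {q : Y ⟶ Y'}
    {d : Y ⟶ Z} {d' : Y' ⟶ Z'} {r : Z ⟶ Z'}
    (s : p ≫ e' ≅ e ≫ q) (t : q ≫ d' ≅ d ≫ r) : p ≫ e' ≫ d' ≅ (e ≫ d) ≫ r :=
  (α_ p e' d').symm ≪≫ whiskerRightIso s d' ≪≫ α_ e q d' ≪≫ whiskerLeftIso e t ≪≫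
    (α_ e d r).symm

/-- Pasting of two squares along a common edge `e'`: the value of a pseudonatural transformation
at a composite 1-cell. -/
def sqVComp {X X' X'' Y Y' Y'' : B} {p : X ⟶ X'} {p' : X' ⟶ X''} {e : X ⟶ Y} {e' : X' ⟶ Y'}
    {e'' : X'' ⟶ Y''} {q : Y ⟶ Y'} {q' : Y' ⟶ Y''}
    (s : p ≫ e' ≅ e ≫ q) (t : p' ≫ e'' ≅ e' ≫ q') : (p ≫ p') ≫ e'' ≅ e ≫ q ≫ q' :=
  α_ p p' e'' ≪≫ whiskerLeftIso p t ≪≫ (α_ p e' q').symm ≪≫ whiskerRightIso s q' ≪≫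
    α_ e q q'

/-- The image of a square under a pseudofunctor. -/
def sqMap {C : Type u₁} [Bicategory.{w₁, v₁} C] (F : B ⥤ᵖ C)
    {X X' Y Y' : B} {p : X ⟶ X'} {e : X ⟶ Y} {e' : X' ⟶ Y'} {q : Y ⟶ Y'}
    (s : p ≫ e' ≅ e ≫ q) : F.map p ≫ F.map e' ≅ F.map e ≫ F.map q :=
  (F.mapComp p e').symm ≪≫ F.map₂Iso s ≪≫ F.mapComp e q

/-- Two 1-cells in opposite directions, mutually inverse up to specified invertible 2-cells. -/
structure InvPair {X Y : B} (f : X ⟶ Y) (f' : Y ⟶ X) where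
  /-- the unit -/
  unit : 𝟙 X ≅ f ≫ f'
  /-- the counit -/
  counit : f' ≫ f ≅ 𝟙 Y

/-- The inverse pair underlying an adjoint equivalence. -/
def eqvPair {X Y : B} (e : Bicategory.Equivalence X Y) : InvPair e.hom e.inv := ⟨e.unit, e.counit⟩

/-- The mate of a square whose sides `e`, `e'` are equivalences. -/
def sqInv {X X' Y Y' : B} {p : X ⟶ X'} {q : Y ⟶ Y'}
    (e : Bicategory.Equivalence X Y) (e' : Bicategory.Equivalence X' Y')
    (s : p ≫ e'.hom ≅ e.hom ≫ q) : q ≫ e'.inv ≅ e.inv ≫ p :=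
  (λ_ (q ≫ e'.inv)).symm ≪≫ whiskerRightIso e.counit.symm (q ≫ e'.inv) ≪⊗≫
    whiskerLeftIso e.inv (whiskerRightIso s.symm e'.inv) ≪⊗≫
    whiskerLeftIso (e.inv ≫ p) e'.unit.symm ≪≫ ρ_ (e.inv ≫ p)

section PentagonMates

/-! Mates of an invertible 2-cell `x : p ≫ q ≫ r ≅ s ≫ t` all of whose sides are equivalences. -/

variable {X₀ X₁ X₂ X₃ X₄ : B}
  {p : X₀ ⟶ X₁} {p' : X₁ ⟶ X₀} {q : X₁ ⟶ X₂} {q' : X₂ ⟶ X₁} {r : X₂ ⟶ X₃} {r' : X₃ ⟶ X₂}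
  {s : X₀ ⟶ X₄} {s' : X₄ ⟶ X₀} {t : X₄ ⟶ X₃} {t' : X₃ ⟶ X₄}

/-- `s t r⁻¹ ≅ p q` -/
def mateSTr (r₀ : InvPair r r') (x : p ≫ q ≫ r ≅ s ≫ t) : s ≫ t ≫ r' ≅ p ≫ q :=
  (α_ s t r').symm ≪≫ whiskerRightIso x.symm r' ≪⊗≫
    whiskerLeftIso (p ≫ q) r₀.unit.symm ≪≫ ρ_ (p ≫ q)

/-- `p⁻¹ s t r⁻¹ ≅ q` -/
def matepSTr (p₀ : InvPair p p') (r₀ : InvPair r r') (x : p ≫ q ≫ r ≅ s ≫ t) :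
    p' ≫ s ≫ t ≫ r' ≅ q :=
  whiskerLeftIso p' (mateSTr r₀ x) ≪≫ (α_ p' p q).symm ≪≫ whiskerRightIso p₀.counit q ≪≫ λ_ q

/-- `q r t⁻¹ ≅ p⁻¹ s` -/
def mateQRt (p₀ : InvPair p p') (t₀ : InvPair t t') (x : p ≫ q ≫ r ≅ s ≫ t) :
    q ≫ r ≫ t' ≅ p' ≫ s :=
  (λ_ (q ≫ r ≫ t')).symm ≪≫ whiskerRightIso p₀.counit.symm (q ≫ r ≫ t') ≪⊗≫
    whiskerLeftIso p' (whiskerRightIso x t') ≪⊗≫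
    whiskerLeftIso (p' ≫ s) t₀.unit.symm ≪≫ ρ_ (p' ≫ s)

/-- `s⁻¹ p q ≅ t r⁻¹` -/
def matesPQ (r₀ : InvPair r r') (s₀ : InvPair s s') (x : p ≫ q ≫ r ≅ s ≫ t) :
    s' ≫ p ≫ q ≅ t ≫ r' :=
  whiskerLeftIso s' (mateSTr r₀ x).symm ≪≫ (α_ s' s (t ≫ r')).symm ≪≫
    whiskerRightIso s₀.counit (t ≫ r') ≪≫ λ_ (t ≫ r')

/-- `q⁻¹ p⁻¹ s ≅ r t⁻¹` -/
def mateqpS (p₀ : InvPair p p') (q₀ : InvPair q q') (t₀ : InvPair t t')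
    (x : p ≫ q ≫ r ≅ s ≫ t) : q' ≫ p' ≫ s ≅ r ≫ t' :=
  whiskerLeftIso q' (mateQRt p₀ t₀ x).symm ≪≫ (α_ q' q (r ≫ t')).symm ≪≫
    whiskerRightIso q₀.counit (r ≫ t') ≪≫ λ_ (r ≫ t')

/-- `r t⁻¹ s⁻¹ p ≅ q⁻¹` -/
def mateRtsP (p₀ : InvPair p p') (q₀ : InvPair q q') (s₀ : InvPair s s') (t₀ : InvPair t t')
    (x : p ≫ q ≫ r ≅ s ≫ t) : r ≫ t' ≫ s' ≫ p ≅ q' :=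
  (α_ r t' (s' ≫ p)).symm ≪≫ whiskerRightIso (mateqpS p₀ q₀ t₀ x).symm (s' ≫ p) ≪⊗≫
    whiskerLeftIso (q' ≫ p') (whiskerRightIso s₀.unit.symm p) ≪⊗≫
    whiskerLeftIso q' p₀.counit ≪≫ ρ_ q'

/-- `r⁻¹ q⁻¹ p⁻¹ ≅ t⁻¹ s⁻¹` -/
def materqp (p₀ : InvPair p p') (q₀ : InvPair q q') (r₀ : InvPair r r') (s₀ : InvPair s s')
    (t₀ : InvPair t t') (x : p ≫ q ≫ r ≅ s ≫ t) : r' ≫ q' ≫ p' ≅ t' ≫ s' :=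
  whiskerLeftIso r' (whiskerLeftIso q' ((ρ_ p').symm ≪≫ whiskerLeftIso p' s₀.unit)) ≪⊗≫
    whiskerLeftIso r' (whiskerRightIso (mateqpS p₀ q₀ t₀ x) s') ≪⊗≫
    whiskerRightIso r₀.counit (t' ≫ s') ≪≫ λ_ (t' ≫ s')

end PentagonMates

end Squares

/-! ### Bicategories with a tensor product and a unit object -/

/-- A bicategory with a pseudofunctor `⊠ : B × B ⥤ B` (given through its components) and an
object `unitObj`. -/
class TensorBicategory (B : Type u) [Bicategory.{w, v} B] where
  /-- tensor product of objects -/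
  tObj : B → B → B
  /-- tensor product of 1-cells -/
  tHom {X X' Y Y' : B} : (X ⟶ X') → (Y ⟶ Y') → (tObj X Y ⟶ tObj X' Y')
  /-- tensor product of 2-cells -/
  tHom₂ {X X' Y Y' : B} {f f' : X ⟶ X'} {g g' : Y ⟶ Y'} :
    (f ⟶ f') → (g ⟶ g') → (tHom f g ⟶ tHom f' g')
  tHom₂_id {X X' Y Y' : B} (f : X ⟶ X') (g : Y ⟶ Y') : tHom₂ (𝟙 f) (𝟙 g) = 𝟙 (tHom f g)
  tHom₂_comp {X X' Y Y' : B} {f f' f'' : X ⟶ X'} {g g' g'' : Y ⟶ Y'}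
    (η : f ⟶ f') (η' : f' ⟶ f'') (θ : g ⟶ g') (θ' : g' ⟶ g'') :
    tHom₂ (η ≫ η') (θ ≫ θ') = tHom₂ η θ ≫ tHom₂ η' θ'
  /-- the comparison for identity 1-cells -/
  tId (X Y : B) : tHom (𝟙 X) (𝟙 Y) ≅ 𝟙 (tObj X Y)
  /-- the comparison for composition of 1-cells -/
  tComp {X X' X'' Y Y' Y'' : B} (f : X ⟶ X') (f' : X' ⟶ X'') (g : Y ⟶ Y') (g' : Y' ⟶ Y'') :
    tHom (f ≫ f') (g ≫ g') ≅ tHom f g ≫ tHom f' g'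
  tHom₂_whiskerLeft {X X' X'' Y Y' Y'' : B} (f : X ⟶ X') (g : Y ⟶ Y') {h h' : X' ⟶ X''}
    {k k' : Y' ⟶ Y''} (η : h ⟶ h') (θ : k ⟶ k') :
    tHom₂ (f ◁ η) (g ◁ θ) =
      (tComp f h g k).hom ≫ tHom f g ◁ tHom₂ η θ ≫ (tComp f h' g k').inv
  tHom₂_whiskerRight {X X' X'' Y Y' Y'' : B} {f f' : X ⟶ X'} {g g' : Y ⟶ Y'}
    (η : f ⟶ f') (θ : g ⟶ g') (h : X' ⟶ X'') (k : Y' ⟶ Y'') :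
    tHom₂ (η ▷ h) (θ ▷ k) =
      (tComp f h g k).hom ≫ tHom₂ η θ ▷ tHom h k ≫ (tComp f' h g' k).inv
  tHom₂_associator {X X' X'' X''' Y Y' Y'' Y''' : B} (f : X ⟶ X') (f' : X' ⟶ X'')
    (f'' : X'' ⟶ X''') (g : Y ⟶ Y') (g' : Y' ⟶ Y'') (g'' : Y'' ⟶ Y''') :
    tHom₂ (α_ f f' f'').hom (α_ g g' g'').hom =
      (tComp (f ≫ f') f'' (g ≫ g') g'').hom ≫ (tComp f f' g g').hom ▷ tHom f'' g'' ≫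
        (α_ (tHom f g) (tHom f' g') (tHom f'' g'')).hom ≫
        tHom f g ◁ (tComp f' f'' g' g'').inv ≫ (tComp f (f' ≫ f'') g (g' ≫ g'')).inv
  tHom₂_leftUnitor {X X' Y Y' : B} (f : X ⟶ X') (g : Y ⟶ Y') :
    tHom₂ (λ_ f).hom (λ_ g).hom =
      (tComp (𝟙 X) f (𝟙 Y) g).hom ≫ (tId X Y).hom ▷ tHom f g ≫ (λ_ (tHom f g)).hom
  tHom₂_rightUnitor {X X' Y Y' : B} (f : X ⟶ X') (g : Y ⟶ Y') :
    tHom₂ (ρ_ f).hom (ρ_ g).hom =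
      (tComp f (𝟙 X') g (𝟙 Y')).hom ≫ tHom f g ◁ (tId X' Y').hom ≫ (ρ_ (tHom f g)).hom
  /-- the unit object -/
  unitObj : B

/-- tensor product of objects -/
infixr:90 " ⊠ " => TensorBicategory.tObj
/-- tensor product of 1-cells -/
infixr:90 " ⊠₁ " => TensorBicategory.tHom
/-- tensor product of 2-cells -/
infixr:90 " ⊠₂ " => TensorBicategory.tHom₂

section Tensor

open TensorBicategory

variable {B : Type u} [Bicategory.{w, v} B] [TensorBicategory B]

/-- `X ⊠ f`, the tensor product of a 1-cell with the identity of `X` on the left. -/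
abbrev lw (X : B) {Y Y' : B} (f : Y ⟶ Y') : X ⊠ Y ⟶ X ⊠ Y' := 𝟙 X ⊠₁ f

/-- `f ⊠ Y`, the tensor product of a 1-cell with the identity of `Y` on the right. -/
abbrev rw {X X' : B} (f : X ⟶ X') (Y : B) : X ⊠ Y ⟶ X' ⊠ Y := f ⊠₁ 𝟙 Y

/-- tensor product of an object with a 1-cell -/
infixr:90 " ◁₁ " => lw
/-- tensor product of a 1-cell with an object -/
infixl:90 " ▷₁ " => rw

/-- Tensor product of invertible 2-cells. -/
def tIso {X X' Y Y' : B} {f f' : X ⟶ X'} {g g' : Y ⟶ Y'} (η : f ≅ f') (θ : g ≅ g') :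
    f ⊠₁ g ≅ f' ⊠₁ g' where
  hom := η.hom ⊠₂ θ.hom
  inv := η.inv ⊠₂ θ.inv
  hom_inv_id := by rw [← tHom₂_comp, η.hom_inv_id, θ.hom_inv_id, tHom₂_id]
  inv_hom_id := by rw [← tHom₂_comp, η.inv_hom_id, θ.inv_hom_id, tHom₂_id]

/-- The tensor product of two squares. -/
def sqTensor {X X' Y Y' Z Z' W W' : B} {p : X ⟶ X'} {e : X ⟶ Y} {e' : X' ⟶ Y'} {q : Y ⟶ Y'}
    {p₂ : Z ⟶ Z'} {d : Z ⟶ W} {d' : Z' ⟶ W'} {q₂ : W ⟶ W'}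
    (s : p ≫ e' ≅ e ≫ q) (t : p₂ ≫ d' ≅ d ≫ q₂) :
    p ⊠₁ p₂ ≫ e' ⊠₁ d' ≅ e ⊠₁ d ≫ q ⊠₁ q₂ :=
  (tComp p e' p₂ d').symm ≪≫ tIso s t ≪≫ tComp e q d q₂

/-- The 2-cell `X ⊠ η`. -/
def lwIso (X : B) {Y Y' : B} {f g : Y ⟶ Y'} (η : f ≅ g) : X ◁₁ f ≅ X ◁₁ g :=
  tIso (Iso.refl (𝟙 X)) η

/-- The 2-cell `η ⊠ Y`. -/
def rwIso {X X' : B} {f g : X ⟶ X'} (η : f ≅ g) (Y : B) : f ▷₁ Y ≅ g ▷₁ Y :=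
  tIso η (Iso.refl (𝟙 Y))

/-- `X ⊠ -` preserves composition of 1-cells. -/
def lwComp (X : B) {Y Y' Y'' : B} (f : Y ⟶ Y') (g : Y' ⟶ Y'') :
    X ◁₁ (f ≫ g) ≅ X ◁₁ f ≫ X ◁₁ g :=
  tIso (λ_ (𝟙 X)).symm (Iso.refl (f ≫ g)) ≪≫ tComp (𝟙 X) (𝟙 X) f g

/-- `- ⊠ Y` preserves composition of 1-cells. -/
def rwComp {X X' X'' : B} (f : X ⟶ X') (g : X' ⟶ X'') (Y : B) :
    (f ≫ g) ▷₁ Y ≅ f ▷₁ Y ≫ g ▷₁ Y :=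
  tIso (Iso.refl (f ≫ g)) (λ_ (𝟙 Y)).symm ≪≫ tComp f g (𝟙 Y) (𝟙 Y)

/-- `X ⊠ -` preserves ternary composites. -/
def lwComp₃ (X : B) {Y₀ Y₁ Y₂ Y₃ : B} (f : Y₀ ⟶ Y₁) (g : Y₁ ⟶ Y₂) (h : Y₂ ⟶ Y₃) :
    X ◁₁ (f ≫ g ≫ h) ≅ X ◁₁ f ≫ X ◁₁ g ≫ X ◁₁ h :=
  lwComp X f (g ≫ h) ≪≫ whiskerLeftIso (X ◁₁ f) (lwComp X g h)

/-- `- ⊠ Y` preserves ternary composites. -/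
def rwComp₃ {X₀ X₁ X₂ X₃ : B} (f : X₀ ⟶ X₁) (g : X₁ ⟶ X₂) (h : X₂ ⟶ X₃) (Y : B) :
    (f ≫ g ≫ h) ▷₁ Y ≅ f ▷₁ Y ≫ g ▷₁ Y ≫ h ▷₁ Y :=
  rwComp f (g ≫ h) Y ≪≫ whiskerLeftIso (f ▷₁ Y) (rwComp g h Y)

/-- The interchange 2-cell `(f ⊠ Y) (X' ⊠ g) ≅ (X ⊠ g) (f ⊠ Y')`. -/
def interchange {X X' Y Y' : B} (f : X ⟶ X') (g : Y ⟶ Y') :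
    f ▷₁ Y ≫ X' ◁₁ g ≅ X ◁₁ g ≫ f ▷₁ Y' :=
  (tComp f (𝟙 X') (𝟙 Y) g).symm ≪≫ tIso (ρ_ f ≪≫ (λ_ f).symm) (λ_ g ≪≫ (ρ_ g).symm) ≪≫
    tComp (𝟙 X) f g (𝟙 Y')

/-- `X ⊠ -` applied to an inverse pair. -/
def lwPair (X : B) {Y Y' : B} {f : Y ⟶ Y'} {f' : Y' ⟶ Y} (e : InvPair f f') :
    InvPair (X ◁₁ f) (X ◁₁ f') :=
  ⟨(tId X Y).symm ≪≫ lwIso X e.unit ≪≫ lwComp X f f',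
    (lwComp X f' f).symm ≪≫ lwIso X e.counit ≪≫ tId X Y'⟩

/-- `- ⊠ Y` applied to an inverse pair. -/
def rwPair {X X' : B} {f : X ⟶ X'} {f' : X' ⟶ X} (e : InvPair f f') (Y : B) :
    InvPair (f ▷₁ Y) (f' ▷₁ Y) :=
  ⟨(tId X Y).symm ≪≫ rwIso e.unit Y ≪≫ rwComp f f' Y,
    (rwComp f' f Y).symm ≪≫ rwIso e.counit Y ≪≫ tId X' Y⟩

/-!
`X ⊠ η` and `η ⊠ Y` for an invertible 2-cell `η` between composites; the two indices are the
numbers of factors of the source and of the target.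
-/

section Shapes

variable {Y₀ Y₁ Y₂ Y₃ Y₁' Y₂' : B}

/-- `X ⊠ η` -/
def lw₂₁ (X : B) {f : Y₀ ⟶ Y₁} {g : Y₁ ⟶ Y₃} {f' : Y₀ ⟶ Y₃} (η : f ≫ g ≅ f') :
    X ◁₁ f ≫ X ◁₁ g ≅ X ◁₁ f' :=
  (lwComp X f g).symm ≪≫ lwIso X η

/-- `X ⊠ η` -/
def lw₂₂ (X : B) {f : Y₀ ⟶ Y₁} {g : Y₁ ⟶ Y₃} {f' : Y₀ ⟶ Y₁'} {g' : Y₁' ⟶ Y₃}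
    (η : f ≫ g ≅ f' ≫ g') : X ◁₁ f ≫ X ◁₁ g ≅ X ◁₁ f' ≫ X ◁₁ g' :=
  (lwComp X f g).symm ≪≫ lwIso X η ≪≫ lwComp X f' g'

/-- `X ⊠ η` -/
def lw₂₃ (X : B) {f : Y₀ ⟶ Y₁} {g : Y₁ ⟶ Y₃} {f' : Y₀ ⟶ Y₁'} {g' : Y₁' ⟶ Y₂'} {h' : Y₂' ⟶ Y₃}
    (η : f ≫ g ≅ f' ≫ g' ≫ h') :
    X ◁₁ f ≫ X ◁₁ g ≅ X ◁₁ f' ≫ X ◁₁ g' ≫ X ◁₁ h' :=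
  (lwComp X f g).symm ≪≫ lwIso X η ≪≫ lwComp₃ X f' g' h'

/-- `X ⊠ η` -/
def lw₃₁ (X : B) {f : Y₀ ⟶ Y₁} {g : Y₁ ⟶ Y₂} {h : Y₂ ⟶ Y₃} {f' : Y₀ ⟶ Y₃}
    (η : f ≫ g ≫ h ≅ f') : X ◁₁ f ≫ X ◁₁ g ≫ X ◁₁ h ≅ X ◁₁ f' :=
  (lwComp₃ X f g h).symm ≪≫ lwIso X η

/-- `X ⊠ η` -/
def lw₃₂ (X : B) {f : Y₀ ⟶ Y₁} {g : Y₁ ⟶ Y₂} {h : Y₂ ⟶ Y₃} {f' : Y₀ ⟶ Y₁'} {g' : Y₁' ⟶ Y₃}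
    (η : f ≫ g ≫ h ≅ f' ≫ g') : X ◁₁ f ≫ X ◁₁ g ≫ X ◁₁ h ≅ X ◁₁ f' ≫ X ◁₁ g' :=
  (lwComp₃ X f g h).symm ≪≫ lwIso X η ≪≫ lwComp X f' g'

/-- `X ⊠ η` -/
def lw₃₃ (X : B) {f : Y₀ ⟶ Y₁} {g : Y₁ ⟶ Y₂} {h : Y₂ ⟶ Y₃} {f' : Y₀ ⟶ Y₁'} {g' : Y₁' ⟶ Y₂'}
    {h' : Y₂' ⟶ Y₃} (η : f ≫ g ≫ h ≅ f' ≫ g' ≫ h') :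
    X ◁₁ f ≫ X ◁₁ g ≫ X ◁₁ h ≅ X ◁₁ f' ≫ X ◁₁ g' ≫ X ◁₁ h' :=
  (lwComp₃ X f g h).symm ≪≫ lwIso X η ≪≫ lwComp₃ X f' g' h'

/-- `η ⊠ Y` -/
def rw₂₁ {f : Y₀ ⟶ Y₁} {g : Y₁ ⟶ Y₃} {f' : Y₀ ⟶ Y₃} (η : f ≫ g ≅ f') (Y : B) :
    f ▷₁ Y ≫ g ▷₁ Y ≅ f' ▷₁ Y :=
  (rwComp f g Y).symm ≪≫ rwIso η Y

/-- `η ⊠ Y` -/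
def rw₂₂ {f : Y₀ ⟶ Y₁} {g : Y₁ ⟶ Y₃} {f' : Y₀ ⟶ Y₁'} {g' : Y₁' ⟶ Y₃}
    (η : f ≫ g ≅ f' ≫ g') (Y : B) : f ▷₁ Y ≫ g ▷₁ Y ≅ f' ▷₁ Y ≫ g' ▷₁ Y :=
  (rwComp f g Y).symm ≪≫ rwIso η Y ≪≫ rwComp f' g' Y

/-- `η ⊠ Y` -/
def rw₂₃ {f : Y₀ ⟶ Y₁} {g : Y₁ ⟶ Y₃} {f' : Y₀ ⟶ Y₁'} {g' : Y₁' ⟶ Y₂'} {h' : Y₂' ⟶ Y₃}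
    (η : f ≫ g ≅ f' ≫ g' ≫ h') (Y : B) :
    f ▷₁ Y ≫ g ▷₁ Y ≅ f' ▷₁ Y ≫ g' ▷₁ Y ≫ h' ▷₁ Y :=
  (rwComp f g Y).symm ≪≫ rwIso η Y ≪≫ rwComp₃ f' g' h' Y

/-- `η ⊠ Y` -/
def rw₃₁ {f : Y₀ ⟶ Y₁} {g : Y₁ ⟶ Y₂} {h : Y₂ ⟶ Y₃} {f' : Y₀ ⟶ Y₃}
    (η : f ≫ g ≫ h ≅ f') (Y : B) : f ▷₁ Y ≫ g ▷₁ Y ≫ h ▷₁ Y ≅ f' ▷₁ Y :=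
  (rwComp₃ f g h Y).symm ≪≫ rwIso η Y

/-- `η ⊠ Y` -/
def rw₃₂ {f : Y₀ ⟶ Y₁} {g : Y₁ ⟶ Y₂} {h : Y₂ ⟶ Y₃} {f' : Y₀ ⟶ Y₁'} {g' : Y₁' ⟶ Y₃}
    (η : f ≫ g ≫ h ≅ f' ≫ g') (Y : B) :
    f ▷₁ Y ≫ g ▷₁ Y ≫ h ▷₁ Y ≅ f' ▷₁ Y ≫ g' ▷₁ Y :=
  (rwComp₃ f g h Y).symm ≪≫ rwIso η Y ≪≫ rwComp f' g' Y

/-- `η ⊠ Y` -/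
def rw₃₃ {f : Y₀ ⟶ Y₁} {g : Y₁ ⟶ Y₂} {h : Y₂ ⟶ Y₃} {f' : Y₀ ⟶ Y₁'} {g' : Y₁' ⟶ Y₂'}
    {h' : Y₂' ⟶ Y₃} (η : f ≫ g ≫ h ≅ f' ≫ g' ≫ h') (Y : B) :
    f ▷₁ Y ≫ g ▷₁ Y ≫ h ▷₁ Y ≅ f' ▷₁ Y ≫ g' ▷₁ Y ≫ h' ▷₁ Y :=
  (rwComp₃ f g h Y).symm ≪≫ rwIso η Y ≪≫ rwComp₃ f' g' h' Y

end Shapes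

end Tensor

/-! ### Monoidal bicategories -/

open TensorBicategory in
/-- A tensor bicategory with associativity and unit constraints, which are pseudonatural adjoint
equivalences. -/
class ConstraintBicategory (B : Type u) [Bicategory.{w, v} B] extends TensorBicategory B where
  /-- the associativity equivalence -/
  assoc (X Y Z : B) : Bicategory.Equivalence ((X ⊠ Y) ⊠ Z) (X ⊠ (Y ⊠ Z))
  /-- pseudonaturality of the associativity equivalence -/
  assocNat {X X' Y Y' Z Z' : B} (f : X ⟶ X') (g : Y ⟶ Y') (h : Z ⟶ Z') :
    (f ⊠₁ g) ⊠₁ h ≫ (assoc X' Y' Z').hom ≅ (assoc X Y Z).hom ≫ f ⊠₁ (g ⊠₁ h)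
  assocNat_naturality {X X' Y Y' Z Z' : B} {f f' : X ⟶ X'} {g g' : Y ⟶ Y'} {h h' : Z ⟶ Z'}
    (η : f ⟶ f') (θ : g ⟶ g') (κ : h ⟶ h') :
    ((η ⊠₂ θ) ⊠₂ κ) ▷ (assoc X' Y' Z').hom ≫ (assocNat f' g' h').hom =
      (assocNat f g h).hom ≫ (assoc X Y Z).hom ◁ (η ⊠₂ (θ ⊠₂ κ))
  assocNat_id (X Y Z : B) :
    (assocNat (𝟙 X) (𝟙 Y) (𝟙 Z)).hom ≫
        (assoc X Y Z).hom ◁ (𝟙 (𝟙 X) ⊠₂ (tId Y Z).hom ≫ (tId X (Y ⊠ Z)).hom) =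
      ((tId X Y).hom ⊠₂ 𝟙 (𝟙 Z) ≫ (tId (X ⊠ Y) Z).hom) ▷ (assoc X Y Z).hom ≫
        (sqOne (assoc X Y Z).hom).hom
  assocNat_comp {X X' X'' Y Y' Y'' Z Z' Z'' : B} (f : X ⟶ X') (f' : X' ⟶ X'')
    (g : Y ⟶ Y') (g' : Y' ⟶ Y'') (h : Z ⟶ Z') (h' : Z' ⟶ Z'') :
    (assocNat (f ≫ f') (g ≫ g') (h ≫ h')).hom ≫
        (assoc X Y Z).hom ◁ (𝟙 (f ≫ f') ⊠₂ (tComp g g' h h').hom ≫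
          (tComp f f' (g ⊠₁ h) (g' ⊠₁ h')).hom) =
      ((tComp f f' g g').hom ⊠₂ 𝟙 (h ≫ h') ≫
          (tComp (f ⊠₁ g) (f' ⊠₁ g') h h').hom) ▷ (assoc X'' Y'' Z'').hom ≫
        (sqVComp (assocNat f g h) (assocNat f' g' h')).hom
  /-- the left unit equivalence -/
  lUnit (X : B) : Bicategory.Equivalence (unitObj ⊠ X) X
  /-- pseudonaturality of the left unit equivalence -/
  lUnitNat {X X' : B} (f : X ⟶ X') :
    unitObj ◁₁ f ≫ (lUnit X').hom ≅ (lUnit X).hom ≫ f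
  lUnitNat_naturality {X X' : B} {f f' : X ⟶ X'} (η : f ⟶ f') :
    (𝟙 (𝟙 unitObj) ⊠₂ η) ▷ (lUnit X').hom ≫ (lUnitNat f').hom =
      (lUnitNat f).hom ≫ (lUnit X).hom ◁ η
  lUnitNat_id (X : B) :
    (lUnitNat (𝟙 X)).hom = (tId unitObj X).hom ▷ (lUnit X).hom ≫ (sqOne (lUnit X).hom).hom
  lUnitNat_comp {X X' X'' : B} (f : X ⟶ X') (f' : X' ⟶ X'') :
    (lUnitNat (f ≫ f')).hom =
      (lwComp unitObj f f').hom ▷ (lUnit X'').hom ≫ (sqVComp (lUnitNat f) (lUnitNat f')).hom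
  /-- the right unit equivalence -/
  rUnit (X : B) : Bicategory.Equivalence (X ⊠ unitObj) X
  /-- pseudonaturality of the right unit equivalence -/
  rUnitNat {X X' : B} (f : X ⟶ X') :
    f ▷₁ unitObj ≫ (rUnit X').hom ≅ (rUnit X).hom ≫ f
  rUnitNat_naturality {X X' : B} {f f' : X ⟶ X'} (η : f ⟶ f') :
    (η ⊠₂ 𝟙 (𝟙 unitObj)) ▷ (rUnit X').hom ≫ (rUnitNat f').hom =
      (rUnitNat f).hom ≫ (rUnit X).hom ◁ η
  rUnitNat_id (X : B) :
    (rUnitNat (𝟙 X)).hom = (tId X unitObj).hom ▷ (rUnit X).hom ≫ (sqOne (rUnit X).hom).hom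
  rUnitNat_comp {X X' X'' : B} (f : X ⟶ X') (f' : X' ⟶ X'') :
    (rUnitNat (f ≫ f')).hom =
      (rwComp f f' unitObj).hom ▷ (rUnit X'').hom ≫ (sqVComp (rUnitNat f) (rUnitNat f')).hom

section Constraints

open TensorBicategory ConstraintBicategory

variable {B : Type u} [Bicategory.{w, v} B] [ConstraintBicategory B]

/-- The associativity 1-cell `(X ⊠ Y) ⊠ Z ⟶ X ⊠ (Y ⊠ Z)`. -/
abbrev as (X Y Z : B) : (X ⊠ Y) ⊠ Z ⟶ X ⊠ (Y ⊠ Z) := (assoc X Y Z).hom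

/-- The inverse associativity 1-cell `X ⊠ (Y ⊠ Z) ⟶ (X ⊠ Y) ⊠ Z`. -/
abbrev as' (X Y Z : B) : X ⊠ (Y ⊠ Z) ⟶ (X ⊠ Y) ⊠ Z := (assoc X Y Z).inv

/-- The left unit 1-cell. -/
abbrev lu (X : B) : (unitObj : B) ⊠ X ⟶ X := (lUnit X).hom

/-- The right unit 1-cell. -/
abbrev ru (X : B) : X ⊠ (unitObj : B) ⟶ X := (rUnit X).hom

/-- The inverse pair of associativity 1-cells. -/
abbrev asPair (X Y Z : B) : InvPair (as X Y Z) (as' X Y Z) := eqvPair (assoc X Y Z)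

/-- Naturality of associativity in the first variable. -/
def asL {X X' : B} (f : X ⟶ X') (Y Z : B) :
    f ▷₁ Y ▷₁ Z ≫ as X' Y Z ≅ as X Y Z ≫ f ▷₁ (Y ⊠ Z) :=
  assocNat f (𝟙 Y) (𝟙 Z) ≪≫ whiskerLeftIso (as X Y Z) (tIso (Iso.refl f) (tId Y Z))

/-- Naturality of associativity in the second variable. -/
def asM (X : B) {Y Y' : B} (g : Y ⟶ Y') (Z : B) :
    (X ◁₁ g) ▷₁ Z ≫ as X Y' Z ≅ as X Y Z ≫ X ◁₁ (g ▷₁ Z) :=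
  assocNat (𝟙 X) g (𝟙 Z)

/-- Naturality of associativity in the third variable. -/
def asR (X Y : B) {Z Z' : B} (h : Z ⟶ Z') :
    (X ⊠ Y) ◁₁ h ≫ as X Y Z' ≅ as X Y Z ≫ X ◁₁ Y ◁₁ h :=
  whiskerRightIso (tIso (tId X Y).symm (Iso.refl h)) (as X Y Z') ≪≫ assocNat (𝟙 X) (𝟙 Y) h

/-- Naturality of inverse associativity. -/
def assocInvNat {X X' Y Y' Z Z' : B} (f : X ⟶ X') (g : Y ⟶ Y') (h : Z ⟶ Z') :
    f ⊠₁ (g ⊠₁ h) ≫ as' X' Y' Z' ≅ as' X Y Z ≫ (f ⊠₁ g) ⊠₁ h :=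
  sqInv (assoc X Y Z) (assoc X' Y' Z') (assocNat f g h)

/-- Naturality of inverse associativity in the first variable. -/
def asL' {X X' : B} (f : X ⟶ X') (Y Z : B) :
    f ▷₁ (Y ⊠ Z) ≫ as' X' Y Z ≅ as' X Y Z ≫ f ▷₁ Y ▷₁ Z :=
  sqInv (assoc X Y Z) (assoc X' Y Z) (asL f Y Z)

/-- Naturality of inverse associativity in the second variable. -/
def asM' (X : B) {Y Y' : B} (g : Y ⟶ Y') (Z : B) :
    X ◁₁ (g ▷₁ Z) ≫ as' X Y' Z ≅ as' X Y Z ≫ (X ◁₁ g) ▷₁ Z :=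
  sqInv (assoc X Y Z) (assoc X Y' Z) (asM X g Z)

/-- Naturality of inverse associativity in the third variable. -/
def asR' (X Y : B) {Z Z' : B} (h : Z ⟶ Z') :
    X ◁₁ Y ◁₁ h ≫ as' X Y Z' ≅ as' X Y Z ≫ (X ⊠ Y) ◁₁ h :=
  sqInv (assoc X Y Z) (assoc X Y Z') (asR X Y h)

end Constraints

open TensorBicategory ConstraintBicategory in
/-- A monoidal bicategory: a tricategory with one object. -/
class MonoidalBicategory (B : Type u) [Bicategory.{w, v} B] extends ConstraintBicategory B where
  /-- the pentagon modification -/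
  pent (W X Y Z : B) :
    as W X Y ▷₁ Z ≫ as W (X ⊠ Y) Z ≫ W ◁₁ as X Y Z ≅ as (W ⊠ X) Y Z ≫ as W X (Y ⊠ Z)
  pent_naturality {W W' X X' Y Y' Z Z' : B} (f : W ⟶ W') (g : X ⟶ X') (h : Y ⟶ Y')
    (k : Z ⟶ Z') :
    (((f ⊠₁ g) ⊠₁ h) ⊠₁ k) ◁ (pent W' X' Y' Z').hom ≫
        (sqComp (assocNat (f ⊠₁ g) h k) (assocNat f g (h ⊠₁ k))).hom =
      (sqComp (sqTensor (assocNat f g h) (sqId k))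
        (sqComp (assocNat f (g ⊠₁ h) k) (sqTensor (sqId f) (assocNat g h k)))).hom ≫
        (pent W X Y Z).hom ▷ (f ⊠₁ (g ⊠₁ (h ⊠₁ k)))
  /-- the middle unit modification -/
  midUnit (X Y : B) : as X unitObj Y ≫ X ◁₁ lu Y ≅ ru X ▷₁ Y
  midUnit_naturality {X X' Y Y' : B} (f : X ⟶ X') (g : Y ⟶ Y') :
    ((f ⊠₁ 𝟙 unitObj) ⊠₁ g) ◁ (midUnit X' Y').hom ≫
        (sqTensor (rUnitNat f) (sqId g)).hom =
      (sqComp (assocNat f (𝟙 unitObj) g) (sqTensor (sqId f) (lUnitNat g))).hom ≫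
        (midUnit X Y).hom ▷ (f ⊠₁ g)
  /-- the left unit modification -/
  leftUnit (X Y : B) : as unitObj X Y ≫ lu (X ⊠ Y) ≅ lu X ▷₁ Y
  leftUnit_naturality {X X' Y Y' : B} (f : X ⟶ X') (g : Y ⟶ Y') :
    ((𝟙 unitObj ⊠₁ f) ⊠₁ g) ◁ (leftUnit X' Y').hom ≫
        (sqTensor (lUnitNat f) (sqId g)).hom =
      (sqComp (assocNat (𝟙 unitObj) f g) (lUnitNat (f ⊠₁ g))).hom ≫
        (leftUnit X Y).hom ▷ (f ⊠₁ g)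
  /-- the right unit modification -/
  rightUnit (X Y : B) : as X Y unitObj ≫ X ◁₁ ru Y ≅ ru (X ⊠ Y)
  rightUnit_naturality {X X' Y Y' : B} (f : X ⟶ X') (g : Y ⟶ Y') :
    ((f ⊠₁ g) ⊠₁ 𝟙 unitObj) ◁ (rightUnit X' Y').hom ≫ (rUnitNat (f ⊠₁ g)).hom =
      (sqComp (assocNat f g (𝟙 unitObj)) (sqTensor (sqId f) (rUnitNat g))).hom ≫
        (rightUnit X Y).hom ▷ (f ⊠₁ g)
  /-- the nonabelian 4-cocycle condition -/
  cocycle (V W X Y Z : B) :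
    𝟙 (as V W X ▷₁ Y ▷₁ Z ≫ as V (W ⊠ X) Y ▷₁ Z ≫ (V ◁₁ as W X Y) ▷₁ Z ≫
        as V (W ⊠ (X ⊠ Y)) Z ≫ V ◁₁ as W (X ⊠ Y) Z ≫ V ◁₁ W ◁₁ as X Y Z) ⊗≫
      (rw₃₂ (pent V W X Y) Z).hom ▷
        (as V (W ⊠ (X ⊠ Y)) Z ≫ V ◁₁ as W (X ⊠ Y) Z ≫ V ◁₁ W ◁₁ as X Y Z) ⊗≫
      as (V ⊠ W) X Y ▷₁ Z ◁ ((pent V W (X ⊠ Y) Z).hom ▷ V ◁₁ W ◁₁ as X Y Z) ⊗≫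
      (as (V ⊠ W) X Y ▷₁ Z ≫ as (V ⊠ W) (X ⊠ Y) Z) ◁ (asR V W (as X Y Z)).inv ⊗≫
      (pent (V ⊠ W) X Y Z).hom ▷ as V W (X ⊠ (Y ⊠ Z)) ⊗≫
      𝟙 (as ((V ⊠ W) ⊠ X) Y Z ≫ as (V ⊠ W) X (Y ⊠ Z) ≫ as V W (X ⊠ (Y ⊠ Z))) =
    𝟙 (as V W X ▷₁ Y ▷₁ Z ≫ as V (W ⊠ X) Y ▷₁ Z ≫ (V ◁₁ as W X Y) ▷₁ Z ≫
        as V (W ⊠ (X ⊠ Y)) Z ≫ V ◁₁ as W (X ⊠ Y) Z ≫ V ◁₁ W ◁₁ as X Y Z) ⊗≫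
      (as V W X ▷₁ Y ▷₁ Z ≫ as V (W ⊠ X) Y ▷₁ Z) ◁
        ((asM V (as W X Y) Z).hom ▷ (V ◁₁ as W (X ⊠ Y) Z ≫ V ◁₁ W ◁₁ as X Y Z)) ⊗≫
      (as V W X ▷₁ Y ▷₁ Z ≫ as V (W ⊠ X) Y ▷₁ Z ≫ as V ((W ⊠ X) ⊠ Y) Z) ◁
        (lw₃₂ V (pent W X Y Z)).hom ⊗≫
      as V W X ▷₁ Y ▷₁ Z ◁ ((pent V (W ⊠ X) Y Z).hom ▷ V ◁₁ as W X (Y ⊠ Z)) ⊗≫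
      (asL (as V W X) Y Z).hom ▷ (as V (W ⊠ X) (Y ⊠ Z) ≫ V ◁₁ as W X (Y ⊠ Z)) ⊗≫
      as ((V ⊠ W) ⊠ X) Y Z ◁ (pent V W X (Y ⊠ Z)).hom ⊗≫
      𝟙 (as ((V ⊠ W) ⊠ X) Y Z ≫ as (V ⊠ W) X (Y ⊠ Z) ≫ as V W (X ⊠ (Y ⊠ Z)))
  /-- the left normalization condition -/
  leftNormalization (X Y Z : B) :
    𝟙 (as X unitObj Y ▷₁ Z ≫ as X (unitObj ⊠ Y) Z ≫ X ◁₁ as unitObj Y Z ≫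
        X ◁₁ lu (Y ⊠ Z)) ⊗≫
      (pent X unitObj Y Z).hom ▷ X ◁₁ lu (Y ⊠ Z) ⊗≫
      as (X ⊠ unitObj) Y Z ◁ (midUnit X (Y ⊠ Z)).hom ⊗≫ (asL (ru X) Y Z).inv ⊗≫
      𝟙 (ru X ▷₁ Y ▷₁ Z ≫ as X Y Z) =
    𝟙 (as X unitObj Y ▷₁ Z ≫ as X (unitObj ⊠ Y) Z ≫ X ◁₁ as unitObj Y Z ≫
        X ◁₁ lu (Y ⊠ Z)) ⊗≫
      (as X unitObj Y ▷₁ Z ≫ as X (unitObj ⊠ Y) Z) ◁ (lw₂₁ X (leftUnit Y Z)).hom ⊗≫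
      as X unitObj Y ▷₁ Z ◁ (asM X (lu Y) Z).inv ⊗≫
      (rw₂₁ (midUnit X Y) Z).hom ▷ as X Y Z ⊗≫
      𝟙 (ru X ▷₁ Y ▷₁ Z ≫ as X Y Z)
  /-- the right normalization condition -/
  rightNormalization (X Y Z : B) :
    𝟙 (as X Y unitObj ▷₁ Z ≫ as X (Y ⊠ unitObj) Z ≫ X ◁₁ as Y unitObj Z ≫
        X ◁₁ Y ◁₁ lu Z) ⊗≫
      (pent X Y unitObj Z).hom ▷ X ◁₁ Y ◁₁ lu Z ⊗≫
      as (X ⊠ Y) unitObj Z ◁ (asR X Y (lu Z)).inv ⊗≫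
      (midUnit (X ⊠ Y) Z).hom ▷ as X Y Z ⊗≫
      𝟙 (ru (X ⊠ Y) ▷₁ Z ≫ as X Y Z) =
    𝟙 (as X Y unitObj ▷₁ Z ≫ as X (Y ⊠ unitObj) Z ≫ X ◁₁ as Y unitObj Z ≫
        X ◁₁ Y ◁₁ lu Z) ⊗≫
      (as X Y unitObj ▷₁ Z ≫ as X (Y ⊠ unitObj) Z) ◁ (lw₂₁ X (midUnit Y Z)).hom ⊗≫
      as X Y unitObj ▷₁ Z ◁ (asM X (ru Y) Z).inv ⊗≫
      (rw₂₁ (rightUnit X Y) Z).hom ▷ as X Y Z ⊗≫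
      𝟙 (ru (X ⊠ Y) ▷₁ Z ≫ as X Y Z)

section Pentagon

open TensorBicategory ConstraintBicategory MonoidalBicategory

variable {B : Type u} [Bicategory.{w, v} B] [MonoidalBicategory B]

/-- The pentagon for the inverse associativity 1-cells, the mate of `pent`. -/
def pentInv (W X Y Z : B) :
    W ◁₁ as' X Y Z ≫ as' W (X ⊠ Y) Z ≫ as' W X Y ▷₁ Z ≅ as' W X (Y ⊠ Z) ≫ as' (W ⊠ X) Y Z :=
  materqp (rwPair (asPair W X Y) Z) (asPair W (X ⊠ Y) Z) (lwPair W (asPair X Y Z))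
    (asPair (W ⊠ X) Y Z) (asPair W X (Y ⊠ Z)) (pent W X Y Z)

end Pentagon

/-! ### Braidings -/

open TensorBicategory ConstraintBicategory in
/-- A monoidal bicategory with a pseudonatural adjoint equivalence `X ⊠ Y ⟶ Y ⊠ X`. -/
class SwapBicategory (B : Type u) [Bicategory.{w, v} B] extends MonoidalBicategory B where
  /-- the braiding equivalence -/
  braid (X Y : B) : Bicategory.Equivalence (X ⊠ Y) (Y ⊠ X)
  /-- pseudonaturality of the braiding -/
  braidNat {X X' Y Y' : B} (f : X ⟶ X') (g : Y ⟶ Y') :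
    f ⊠₁ g ≫ (braid X' Y').hom ≅ (braid X Y).hom ≫ g ⊠₁ f
  braidNat_naturality {X X' Y Y' : B} {f f' : X ⟶ X'} {g g' : Y ⟶ Y'}
    (η : f ⟶ f') (θ : g ⟶ g') :
    (η ⊠₂ θ) ▷ (braid X' Y').hom ≫ (braidNat f' g').hom =
      (braidNat f g).hom ≫ (braid X Y).hom ◁ (θ ⊠₂ η)
  braidNat_id (X Y : B) :
    (braidNat (𝟙 X) (𝟙 Y)).hom ≫ (braid X Y).hom ◁ (tId Y X).hom =
      (tId X Y).hom ▷ (braid X Y).hom ≫ (sqOne (braid X Y).hom).hom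
  braidNat_comp {X X' X'' Y Y' Y'' : B} (f : X ⟶ X') (f' : X' ⟶ X'')
    (g : Y ⟶ Y') (g' : Y' ⟶ Y'') :
    (braidNat (f ≫ f') (g ≫ g')).hom ≫ (braid X Y).hom ◁ (tComp g g' f f').hom =
      (tComp f f' g g').hom ▷ (braid X'' Y'').hom ≫
        (sqVComp (braidNat f g) (braidNat f' g')).hom

section Swap

open TensorBicategory ConstraintBicategory MonoidalBicategory SwapBicategory

variable {B : Type u} [Bicategory.{w, v} B] [SwapBicategory B]

/-- The braiding 1-cell `X ⊠ Y ⟶ Y ⊠ X`. -/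
abbrev br (X Y : B) : X ⊠ Y ⟶ Y ⊠ X := (braid X Y).hom

/-- Naturality of the braiding in the first variable. -/
def brL {X X' : B} (f : X ⟶ X') (Y : B) : f ▷₁ Y ≫ br X' Y ≅ br X Y ≫ Y ◁₁ f :=
  braidNat f (𝟙 Y)

/-- Naturality of the braiding in the second variable. -/
def brR (X : B) {Y Y' : B} (g : Y ⟶ Y') : X ◁₁ g ≫ br X Y' ≅ br X Y ≫ g ▷₁ X :=
  braidNat (𝟙 X) g

end Swap

open TensorBicategory ConstraintBicategory MonoidalBicategory SwapBicategory in
/-- A braided monoidal bicategory. -/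
class BraidedMonoidalBicategory (B : Type u) [Bicategory.{w, v} B] extends SwapBicategory B where
  /-- the modification for `braid X (Y ⊠ Z)` -/
  hexR (X Y Z : B) :
    as X Y Z ≫ br X (Y ⊠ Z) ≫ as Y Z X ≅ br X Y ▷₁ Z ≫ as Y X Z ≫ Y ◁₁ br X Z
  hexR_naturality {X X' Y Y' Z Z' : B} (f : X ⟶ X') (g : Y ⟶ Y') (h : Z ⟶ Z') :
    ((f ⊠₁ g) ⊠₁ h) ◁ (hexR X' Y' Z').hom ≫
        (sqComp (sqTensor (braidNat f g) (sqId h))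
          (sqComp (assocNat g f h) (sqTensor (sqId g) (braidNat f h)))).hom =
      (sqComp (assocNat f g h) (sqComp (braidNat f (g ⊠₁ h)) (assocNat g h f))).hom ≫
        (hexR X Y Z).hom ▷ (g ⊠₁ (h ⊠₁ f))
  /-- the modification for `braid (X ⊠ Y) Z` -/
  hexS (X Y Z : B) :
    as' X Y Z ≫ br (X ⊠ Y) Z ≫ as' Z X Y ≅ X ◁₁ br Y Z ≫ as' X Z Y ≫ br X Z ▷₁ Y
  hexS_naturality {X X' Y Y' Z Z' : B} (f : X ⟶ X') (g : Y ⟶ Y') (h : Z ⟶ Z') :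
    (f ⊠₁ (g ⊠₁ h)) ◁ (hexS X' Y' Z').hom ≫
        (sqComp (sqTensor (sqId f) (braidNat g h))
          (sqComp (assocInvNat f h g) (sqTensor (braidNat f h) (sqId g)))).hom =
      (sqComp (assocInvNat f g h) (sqComp (braidNat (f ⊠₁ g) h) (assocInvNat h f g))).hom ≫
        (hexS X Y Z).hom ▷ ((h ⊠₁ f) ⊠₁ g)
  /-- the two ways of moving `X` past `Y`, `Z`, `W` agree -/
  braid_one_three (X Y Z W : B) :
    𝟙 (as X Y Z ▷₁ W ≫ as X (Y ⊠ Z) W ≫ X ◁₁ as Y Z W ≫ br X (Y ⊠ (Z ⊠ W)) ≫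
        as Y (Z ⊠ W) X ≫ Y ◁₁ as Z W X) ⊗≫
      (pent X Y Z W).hom ▷ (br X (Y ⊠ (Z ⊠ W)) ≫ as Y (Z ⊠ W) X ≫ Y ◁₁ as Z W X) ⊗≫
      as (X ⊠ Y) Z W ◁ ((hexR X Y (Z ⊠ W)).hom ▷ Y ◁₁ as Z W X) ⊗≫
      (asL (br X Y) Z W).inv ▷ (as Y X (Z ⊠ W) ≫ Y ◁₁ br X (Z ⊠ W) ≫ Y ◁₁ as Z W X) ⊗≫
      br X Y ▷₁ Z ▷₁ W ◁
        ((pent Y X Z W).inv ▷ (Y ◁₁ br X (Z ⊠ W) ≫ Y ◁₁ as Z W X)) ⊗≫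
      (br X Y ▷₁ Z ▷₁ W ≫ as Y X Z ▷₁ W ≫ as Y (X ⊠ Z) W) ◁ (lw₃₃ Y (hexR X Z W)).hom ⊗≫
      (br X Y ▷₁ Z ▷₁ W ≫ as Y X Z ▷₁ W) ◁
        ((asM Y (br X Z) W).inv ▷ (Y ◁₁ as Z X W ≫ Y ◁₁ Z ◁₁ br X W)) ⊗≫
      𝟙 (br X Y ▷₁ Z ▷₁ W ≫ as Y X Z ▷₁ W ≫ (Y ◁₁ br X Z) ▷₁ W ≫ as Y (Z ⊠ X) W ≫
        Y ◁₁ as Z X W ≫ Y ◁₁ Z ◁₁ br X W) =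
    𝟙 (as X Y Z ▷₁ W ≫ as X (Y ⊠ Z) W ≫ X ◁₁ as Y Z W ≫ br X (Y ⊠ (Z ⊠ W)) ≫
        as Y (Z ⊠ W) X ≫ Y ◁₁ as Z W X) ⊗≫
      (as X Y Z ▷₁ W ≫ as X (Y ⊠ Z) W) ◁
        ((brR X (as Y Z W)).hom ▷ (as Y (Z ⊠ W) X ≫ Y ◁₁ as Z W X)) ⊗≫
      (as X Y Z ▷₁ W ≫ as X (Y ⊠ Z) W ≫ br X ((Y ⊠ Z) ⊠ W)) ◁ (pent Y Z W X).hom ⊗≫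
      as X Y Z ▷₁ W ◁ ((hexR X (Y ⊠ Z) W).hom ▷ as Y Z (W ⊠ X)) ⊗≫
      (as X Y Z ▷₁ W ≫ br X (Y ⊠ Z) ▷₁ W ≫ as (Y ⊠ Z) X W) ◁ (asR Y Z (br X W)).hom ⊗≫
      (as X Y Z ▷₁ W ≫ br X (Y ⊠ Z) ▷₁ W) ◁
        ((pent Y Z X W).inv ▷ Y ◁₁ Z ◁₁ br X W) ⊗≫
      (rw₃₃ (hexR X Y Z) W).hom ▷ (as Y (Z ⊠ X) W ≫ Y ◁₁ as Z X W ≫ Y ◁₁ Z ◁₁ br X W) ⊗≫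
      𝟙 (br X Y ▷₁ Z ▷₁ W ≫ as Y X Z ▷₁ W ≫ (Y ◁₁ br X Z) ▷₁ W ≫ as Y (Z ⊠ X) W ≫
        Y ◁₁ as Z X W ≫ Y ◁₁ Z ◁₁ br X W)
  /-- the two ways of moving `W` past `X`, `Y`, `Z` agree -/
  braid_three_one (X Y Z W : B) :
    𝟙 (X ◁₁ as' Y Z W ≫ as' X (Y ⊠ Z) W ≫ as' X Y Z ▷₁ W ≫ br ((X ⊠ Y) ⊠ Z) W ≫
        as' W (X ⊠ Y) Z ≫ as' W X Y ▷₁ Z) ⊗≫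
      (pentInv X Y Z W).hom ▷ (br ((X ⊠ Y) ⊠ Z) W ≫ as' W (X ⊠ Y) Z ≫ as' W X Y ▷₁ Z) ⊗≫
      as' X Y (Z ⊠ W) ◁ ((hexS (X ⊠ Y) Z W).hom ▷ as' W X Y ▷₁ Z) ⊗≫
      (asR' X Y (br Z W)).inv ▷ (as' (X ⊠ Y) W Z ≫ br (X ⊠ Y) W ▷₁ Z ≫ as' W X Y ▷₁ Z) ⊗≫
      X ◁₁ Y ◁₁ br Z W ◁
        ((pentInv X Y W Z).inv ▷ (br (X ⊠ Y) W ▷₁ Z ≫ as' W X Y ▷₁ Z)) ⊗≫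
      (X ◁₁ Y ◁₁ br Z W ≫ X ◁₁ as' Y W Z ≫ as' X (Y ⊠ W) Z) ◁ (rw₃₃ (hexS X Y W) Z).hom ⊗≫
      (X ◁₁ Y ◁₁ br Z W ≫ X ◁₁ as' Y W Z) ◁
        ((asM' X (br Y W) Z).inv ▷ (as' X W Y ▷₁ Z ≫ br X W ▷₁ Y ▷₁ Z)) ⊗≫
      𝟙 (X ◁₁ Y ◁₁ br Z W ≫ X ◁₁ as' Y W Z ≫ X ◁₁ (br Y W ▷₁ Z) ≫ as' X (W ⊠ Y) Z ≫
        as' X W Y ▷₁ Z ≫ br X W ▷₁ Y ▷₁ Z) =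
    𝟙 (X ◁₁ as' Y Z W ≫ as' X (Y ⊠ Z) W ≫ as' X Y Z ▷₁ W ≫ br ((X ⊠ Y) ⊠ Z) W ≫
        as' W (X ⊠ Y) Z ≫ as' W X Y ▷₁ Z) ⊗≫
      (X ◁₁ as' Y Z W ≫ as' X (Y ⊠ Z) W) ◁
        ((brL (as' X Y Z) W).hom ▷ (as' W (X ⊠ Y) Z ≫ as' W X Y ▷₁ Z)) ⊗≫
      (X ◁₁ as' Y Z W ≫ as' X (Y ⊠ Z) W ≫ br (X ⊠ (Y ⊠ Z)) W) ◁ (pentInv W X Y Z).hom ⊗≫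
      X ◁₁ as' Y Z W ◁ ((hexS X (Y ⊠ Z) W).hom ▷ as' (W ⊠ X) Y Z) ⊗≫
      (X ◁₁ as' Y Z W ≫ X ◁₁ br (Y ⊠ Z) W ≫ as' X W (Y ⊠ Z)) ◁ (asL' (br X W) Y Z).hom ⊗≫
      (X ◁₁ as' Y Z W ≫ X ◁₁ br (Y ⊠ Z) W) ◁
        ((pentInv X W Y Z).inv ▷ br X W ▷₁ Y ▷₁ Z) ⊗≫
      (lw₃₃ X (hexS Y Z W)).hom ▷ (as' X (W ⊠ Y) Z ≫ as' X W Y ▷₁ Z ≫ br X W ▷₁ Y ▷₁ Z) ⊗≫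
      𝟙 (X ◁₁ Y ◁₁ br Z W ≫ X ◁₁ as' Y W Z ≫ X ◁₁ (br Y W ▷₁ Z) ≫ as' X (W ⊠ Y) Z ≫
        as' X W Y ▷₁ Z ≫ br X W ▷₁ Y ▷₁ Z)
  /-- the two ways of moving `X`, `Y` past `Z`, `W` agree -/
  braid_two_two (X Y Z W : B) :
    𝟙 ((X ◁₁ br Y Z) ▷₁ W ≫ as' X Z Y ▷₁ W ≫ br X Z ▷₁ Y ▷₁ W ≫ as (Z ⊠ X) Y W ≫
        as Z X (Y ⊠ W) ≫ Z ◁₁ X ◁₁ br Y W ≫ Z ◁₁ as' X W Y ≫ Z ◁₁ (br X W ▷₁ Y)) ⊗≫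
      (rw₃₃ (hexS X Y Z) W).inv ▷
        (as (Z ⊠ X) Y W ≫ as Z X (Y ⊠ W) ≫ Z ◁₁ X ◁₁ br Y W ≫ Z ◁₁ as' X W Y ≫
          Z ◁₁ (br X W ▷₁ Y)) ⊗≫
      (as' X Y Z ▷₁ W ≫ br (X ⊠ Y) Z ▷₁ W ≫ as' Z X Y ▷₁ W ≫ as (Z ⊠ X) Y W ≫
        as Z X (Y ⊠ W)) ◁ (lw₃₃ Z (hexS X Y W)).inv ⊗≫
      (as' X Y Z ▷₁ W ≫ br (X ⊠ Y) Z ▷₁ W) ◁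
        ((matepSTr (rwPair (asPair Z X Y) W) (lwPair Z (asPair X Y W)) (pent Z X Y W)).hom ▷
          (Z ◁₁ br (X ⊠ Y) W ≫ Z ◁₁ as' W X Y)) ⊗≫
      as' X Y Z ▷₁ W ◁ ((hexR (X ⊠ Y) Z W).inv ▷ Z ◁₁ as' W X Y) ⊗≫
      𝟙 (as' X Y Z ▷₁ W ≫ as (X ⊠ Y) Z W ≫ br (X ⊠ Y) (Z ⊠ W) ≫ as Z W (X ⊠ Y) ≫
        Z ◁₁ as' W X Y) =
    𝟙 ((X ◁₁ br Y Z) ▷₁ W ≫ as' X Z Y ▷₁ W ≫ br X Z ▷₁ Y ▷₁ W ≫ as (Z ⊠ X) Y W ≫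
        as Z X (Y ⊠ W) ≫ Z ◁₁ X ◁₁ br Y W ≫ Z ◁₁ as' X W Y ≫ Z ◁₁ (br X W ▷₁ Y)) ⊗≫
      ((X ◁₁ br Y Z) ▷₁ W ≫ as' X Z Y ▷₁ W) ◁ ((asL (br X Z) Y W).hom ▷
        (as Z X (Y ⊠ W) ≫ Z ◁₁ X ◁₁ br Y W ≫ Z ◁₁ as' X W Y ≫ Z ◁₁ (br X W ▷₁ Y))) ⊗≫
      ((X ◁₁ br Y Z) ▷₁ W ≫ as' X Z Y ▷₁ W ≫ as (X ⊠ Z) Y W ≫ br X Z ▷₁ (Y ⊠ W)) ◁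
        ((asR Z X (br Y W)).inv ▷ (Z ◁₁ as' X W Y ≫ Z ◁₁ (br X W ▷₁ Y))) ⊗≫
      ((X ◁₁ br Y Z) ▷₁ W ≫ as' X Z Y ▷₁ W ≫ as (X ⊠ Z) Y W) ◁
        ((interchange (br X Z) (br Y W)).hom ▷
          (as Z X (W ⊠ Y) ≫ Z ◁₁ as' X W Y ≫ Z ◁₁ (br X W ▷₁ Y))) ⊗≫
      (X ◁₁ br Y Z) ▷₁ W ◁ ((asPair X (Z ⊠ Y) W).unit.hom ▷
        (as' X Z Y ▷₁ W ≫ as (X ⊠ Z) Y W ≫ (X ⊠ Z) ◁₁ br Y W ≫ br X Z ▷₁ (W ⊠ Y) ≫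
          as Z X (W ⊠ Y) ≫ Z ◁₁ as' X W Y ≫ Z ◁₁ (br X W ▷₁ Y))) ⊗≫
      (asM X (br Y Z) W).hom ▷
        (as' X (Z ⊠ Y) W ≫ as' X Z Y ▷₁ W ≫ as (X ⊠ Z) Y W ≫ (X ⊠ Z) ◁₁ br Y W ≫
          br X Z ▷₁ (W ⊠ Y) ≫ as Z X (W ⊠ Y) ≫ Z ◁₁ as' X W Y ≫ Z ◁₁ (br X W ▷₁ Y)) ⊗≫
      (as X (Y ⊠ Z) W ≫ X ◁₁ (br Y Z ▷₁ W)) ◁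
        ((mateqpS (rwPair (asPair X Z Y) W) (asPair X (Z ⊠ Y) W) (asPair X Z (Y ⊠ W))
          (pent X Z Y W)).hom ▷
        ((X ⊠ Z) ◁₁ br Y W ≫ br X Z ▷₁ (W ⊠ Y) ≫ as Z X (W ⊠ Y) ≫ Z ◁₁ as' X W Y ≫
          Z ◁₁ (br X W ▷₁ Y))) ⊗≫
      (as X (Y ⊠ Z) W ≫ X ◁₁ (br Y Z ▷₁ W) ≫ X ◁₁ as Z Y W) ◁
        ((asR' X Z (br Y W)).inv ▷
        (br X Z ▷₁ (W ⊠ Y) ≫ as Z X (W ⊠ Y) ≫ Z ◁₁ as' X W Y ≫ Z ◁₁ (br X W ▷₁ Y))) ⊗≫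
      as X (Y ⊠ Z) W ◁ ((lw₃₃ X (hexR Y Z W)).inv ▷
        (as' X Z (W ⊠ Y) ≫ br X Z ▷₁ (W ⊠ Y) ≫ as Z X (W ⊠ Y) ≫ Z ◁₁ as' X W Y ≫
          Z ◁₁ (br X W ▷₁ Y))) ⊗≫
      (as X (Y ⊠ Z) W ≫ X ◁₁ as Y Z W ≫ X ◁₁ br Y (Z ⊠ W) ≫ X ◁₁ as Z W Y ≫
        as' X Z (W ⊠ Y) ≫ br X Z ▷₁ (W ⊠ Y)) ◁
        ((asPair (Z ⊠ X) W Y).counit.inv ▷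
          (as Z X (W ⊠ Y) ≫ Z ◁₁ as' X W Y ≫ Z ◁₁ (br X W ▷₁ Y))) ⊗≫
      (as X (Y ⊠ Z) W ≫ X ◁₁ as Y Z W ≫ X ◁₁ br Y (Z ⊠ W) ≫ X ◁₁ as Z W Y ≫
        as' X Z (W ⊠ Y)) ◁ ((asL' (br X Z) W Y).hom ▷
          (as (Z ⊠ X) W Y ≫ as Z X (W ⊠ Y) ≫ Z ◁₁ as' X W Y ≫ Z ◁₁ (br X W ▷₁ Y))) ⊗≫
      (as X (Y ⊠ Z) W ≫ X ◁₁ as Y Z W ≫ X ◁₁ br Y (Z ⊠ W) ≫ X ◁₁ as Z W Y ≫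
        as' X Z (W ⊠ Y) ≫ as' (X ⊠ Z) W Y ≫ br X Z ▷₁ W ▷₁ Y) ◁
        ((mateSTr (lwPair Z (asPair X W Y)) (pent Z X W Y)).hom ▷ Z ◁₁ (br X W ▷₁ Y)) ⊗≫
      (as X (Y ⊠ Z) W ≫ X ◁₁ as Y Z W ≫ X ◁₁ br Y (Z ⊠ W) ≫ X ◁₁ as Z W Y ≫
        as' X Z (W ⊠ Y) ≫ as' (X ⊠ Z) W Y ≫ br X Z ▷₁ W ▷₁ Y ≫ as Z X W ▷₁ Y) ◁
        (asM Z (br X W) Y).inv ⊗≫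
      (as X (Y ⊠ Z) W ≫ X ◁₁ as Y Z W ≫ X ◁₁ br Y (Z ⊠ W) ≫ X ◁₁ as Z W Y ≫
        as' X Z (W ⊠ Y) ≫ as' (X ⊠ Z) W Y) ◁
        ((rw₃₃ (hexR X Z W) Y).inv ▷ as Z (W ⊠ X) Y) ⊗≫
      (as X (Y ⊠ Z) W ≫ X ◁₁ as Y Z W ≫ X ◁₁ br Y (Z ⊠ W)) ◁
        ((mateRtsP (rwPair (asPair X Z W) Y) (asPair X (Z ⊠ W) Y) (asPair (X ⊠ Z) W Y)
          (asPair X Z (W ⊠ Y)) (pent X Z W Y)).hom ▷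
        (br X (Z ⊠ W) ▷₁ Y ≫ as Z W X ▷₁ Y ≫ as Z (W ⊠ X) Y)) ⊗≫
      (as X (Y ⊠ Z) W ≫ X ◁₁ as Y Z W) ◁
        ((hexS X Y (Z ⊠ W)).inv ▷ (as Z W X ▷₁ Y ≫ as Z (W ⊠ X) Y)) ⊗≫
      (mateQRt (rwPair (asPair X Y Z) W) (asPair X Y (Z ⊠ W)) (pent X Y Z W)).hom ▷
        (br (X ⊠ Y) (Z ⊠ W) ≫ as' (Z ⊠ W) X Y ≫ as Z W X ▷₁ Y ≫ as Z (W ⊠ X) Y) ⊗≫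
      (as' X Y Z ▷₁ W ≫ as (X ⊠ Y) Z W ≫ br (X ⊠ Y) (Z ⊠ W)) ◁
        (matesPQ (lwPair Z (asPair W X Y)) (asPair (Z ⊠ W) X Y) (pent Z W X Y)).hom ⊗≫
      𝟙 (as' X Y Z ▷₁ W ≫ as (X ⊠ Y) Z W ≫ br (X ⊠ Y) (Z ⊠ W) ≫ as Z W (X ⊠ Y) ≫
        Z ◁₁ as' W X Y)
  /-- the two proofs of the Yang-Baxter equation agree -/
  yang_baxter (X Y Z : B) :
    𝟙 (br X Y ▷₁ Z ≫ as Y X Z ≫ Y ◁₁ br X Z ≫ as' Y Z X ≫ br Y Z ▷₁ X ≫ as Z Y X) ⊗≫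
      (hexR X Y Z).inv ▷ (as' Y Z X ≫ br Y Z ▷₁ X ≫ as Z Y X) ⊗≫
      (as X Y Z ≫ br X (Y ⊠ Z)) ◁ ((asPair Y Z X).unit.inv ▷ (br Y Z ▷₁ X ≫ as Z Y X)) ⊗≫
      as X Y Z ◁ ((brR X (br Y Z)).inv ▷ as Z Y X) ⊗≫
      (as X Y Z ≫ X ◁₁ br Y Z) ◁ ((asPair X Z Y).counit.inv ▷ (br X (Z ⊠ Y) ≫ as Z Y X)) ⊗≫
      (as X Y Z ≫ X ◁₁ br Y Z ≫ as' X Z Y) ◁ (hexR X Z Y).hom ⊗≫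
      𝟙 (as X Y Z ≫ X ◁₁ br Y Z ≫ as' X Z Y ≫ br X Z ▷₁ Y ≫ as Z X Y ≫ Z ◁₁ br X Y) =
    𝟙 (br X Y ▷₁ Z ≫ as Y X Z ≫ Y ◁₁ br X Z ≫ as' Y Z X ≫ br Y Z ▷₁ X ≫ as Z Y X) ⊗≫
      (br X Y ▷₁ Z ≫ as Y X Z) ◁ ((hexS Y X Z).inv ▷ as Z Y X) ⊗≫
      br X Y ▷₁ Z ◁ ((asPair Y X Z).unit.inv ▷ (br (Y ⊠ X) Z ≫ as' Z Y X ≫ as Z Y X)) ⊗≫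
      (br X Y ▷₁ Z ≫ br (Y ⊠ X) Z) ◁ (asPair Z Y X).counit.hom ⊗≫
      (brL (br X Y) Z).hom ⊗≫
      (asPair X Y Z).unit.hom ▷ (br (X ⊠ Y) Z ≫ Z ◁₁ br X Y) ⊗≫
      (as X Y Z ≫ as' X Y Z ≫ br (X ⊠ Y) Z) ◁ ((asPair Z X Y).counit.inv ▷ Z ◁₁ br X Y) ⊗≫
      as X Y Z ◁ ((hexS X Y Z).hom ▷ (as Z X Y ≫ Z ◁₁ br X Y)) ⊗≫
      𝟙 (as X Y Z ≫ X ◁₁ br Y Z ≫ as' X Z Y ≫ br X Z ▷₁ Y ≫ as Z X Y ≫ Z ◁₁ br X Y)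

/-! ### Braided monoidal pseudofunctors -/

section PseudofunctorShapes

variable {B : Type u₁} [Bicategory.{w₁, v₁} B] {C : Type u₂} [Bicategory.{w₂, v₂} C] (F : B ⥤ᵖ C)
  {Y₀ Y₁ Y₂ Y₃ Y₁' Y₂' : B}

/-! The image of an invertible 2-cell between composites under a pseudofunctor. -/

/-- `F` preserves ternary composites. -/
def mapComp₃ (f : Y₀ ⟶ Y₁) (g : Y₁ ⟶ Y₂) (h : Y₂ ⟶ Y₃) :
    F.map (f ≫ g ≫ h) ≅ F.map f ≫ F.map g ≫ F.map h :=
  F.mapComp f (g ≫ h) ≪≫ whiskerLeftIso (F.map f) (F.mapComp g h)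

/-- `F η` -/
def map₂₁ {f : Y₀ ⟶ Y₁} {g : Y₁ ⟶ Y₃} {f' : Y₀ ⟶ Y₃} (η : f ≫ g ≅ f') :
    F.map f ≫ F.map g ≅ F.map f' :=
  (F.mapComp f g).symm ≪≫ F.map₂Iso η

/-- `F η` -/
def map₂₃ {f : Y₀ ⟶ Y₁} {g : Y₁ ⟶ Y₃} {f' : Y₀ ⟶ Y₁'} {g' : Y₁' ⟶ Y₂'} {h' : Y₂' ⟶ Y₃}
    (η : f ≫ g ≅ f' ≫ g' ≫ h') :
    F.map f ≫ F.map g ≅ F.map f' ≫ F.map g' ≫ F.map h' :=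
  (F.mapComp f g).symm ≪≫ F.map₂Iso η ≪≫ mapComp₃ F f' g' h'

/-- `F η` -/
def map₃₂ {f : Y₀ ⟶ Y₁} {g : Y₁ ⟶ Y₂} {h : Y₂ ⟶ Y₃} {f' : Y₀ ⟶ Y₁'} {g' : Y₁' ⟶ Y₃}
    (η : f ≫ g ≫ h ≅ f' ≫ g') :
    F.map f ≫ F.map g ≫ F.map h ≅ F.map f' ≫ F.map g' :=
  (mapComp₃ F f g h).symm ≪≫ F.map₂Iso η ≪≫ F.mapComp f' g'

/-- `F η` -/
def map₃₃ {f : Y₀ ⟶ Y₁} {g : Y₁ ⟶ Y₂} {h : Y₂ ⟶ Y₃} {f' : Y₀ ⟶ Y₁'} {g' : Y₁' ⟶ Y₂'}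
    {h' : Y₂' ⟶ Y₃} (η : f ≫ g ≫ h ≅ f' ≫ g' ≫ h') :
    F.map f ≫ F.map g ≫ F.map h ≅ F.map f' ≫ F.map g' ≫ F.map h' :=
  (mapComp₃ F f g h).symm ≪≫ F.map₂Iso η ≪≫ mapComp₃ F f' g' h'

/-- `F` applied to an inverse pair. -/
def mapPair {f : Y₀ ⟶ Y₁} {f' : Y₁ ⟶ Y₀} (e : InvPair f f') : InvPair (F.map f) (F.map f') :=
  ⟨(F.mapId Y₀).symm ≪≫ F.map₂Iso e.unit ≪≫ F.mapComp f f',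
    (F.mapComp f' f).symm ≪≫ F.map₂Iso e.counit ≪≫ F.mapId Y₁⟩

end PseudofunctorShapes

open TensorBicategory ConstraintBicategory in
/-- A pseudofunctor `F` between monoidal bicategories with a pseudonatural transformation
`F X ⊠ F Y ⟶ F (X ⊠ Y)` and a 1-cell `unitObj ⟶ F unitObj`. -/
structure TensorPseudofunctor (M : Type u₁) [Bicategory.{w₁, v₁} M] [MonoidalBicategory M]
    (N : Type u₂) [Bicategory.{w₂, v₂} N] [MonoidalBicategory N] where
  /-- the underlying pseudofunctor -/
  F : M ⥤ᵖ N
  /-- the comparison for the tensor product -/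
  chi (X Y : M) : F.obj X ⊠ F.obj Y ⟶ F.obj (X ⊠ Y)
  /-- pseudonaturality of the comparison -/
  chiNat {X X' Y Y' : M} (f : X ⟶ X') (g : Y ⟶ Y') :
    F.map f ⊠₁ F.map g ≫ chi X' Y' ≅ chi X Y ≫ F.map (f ⊠₁ g)
  chiNat_naturality {X X' Y Y' : M} {f f' : X ⟶ X'} {g g' : Y ⟶ Y'} (η : f ⟶ f') (θ : g ⟶ g') :
    (F.map₂ η ⊠₂ F.map₂ θ) ▷ chi X' Y' ≫ (chiNat f' g').hom =
      (chiNat f g).hom ≫ chi X Y ◁ F.map₂ (η ⊠₂ θ)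
  chiNat_id (X Y : M) :
    (chiNat (𝟙 X) (𝟙 Y)).hom ≫ chi X Y ◁ (F.map₂ (tId X Y).hom ≫ (F.mapId (X ⊠ Y)).hom) =
      ((F.mapId X).hom ⊠₂ (F.mapId Y).hom ≫ (tId (F.obj X) (F.obj Y)).hom) ▷ chi X Y ≫
        (sqOne (chi X Y)).hom
  chiNat_comp {X X' X'' Y Y' Y'' : M} (f : X ⟶ X') (f' : X' ⟶ X'') (g : Y ⟶ Y')
    (g' : Y' ⟶ Y'') :
    (chiNat (f ≫ f') (g ≫ g')).hom ≫
        chi X Y ◁ (F.map₂ (tComp f f' g g').hom ≫ (F.mapComp (f ⊠₁ g) (f' ⊠₁ g')).hom) =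
      ((F.mapComp f f').hom ⊠₂ (F.mapComp g g').hom ≫
          (tComp (F.map f) (F.map f') (F.map g) (F.map g')).hom) ▷ chi X'' Y'' ≫
        (sqVComp (chiNat f g) (chiNat f' g')).hom
  /-- the comparison for the unit object -/
  iota : (unitObj : N) ⟶ F.obj unitObj

section TensorPseudofunctor

open TensorBicategory ConstraintBicategory

variable {M : Type u₁} [Bicategory.{w₁, v₁} M] [MonoidalBicategory M]
  {N : Type u₂} [Bicategory.{w₂, v₂} N] [MonoidalBicategory N] (T : TensorPseudofunctor M N)

/-- Naturality of the comparison in the first variable. -/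
def TensorPseudofunctor.chiL {X X' : M} (f : X ⟶ X') (Y : M) :
    T.F.map f ▷₁ T.F.obj Y ≫ T.chi X' Y ≅ T.chi X Y ≫ T.F.map (f ▷₁ Y) :=
  whiskerRightIso (tIso (Iso.refl (T.F.map f)) (T.F.mapId Y).symm) (T.chi X' Y) ≪≫
    T.chiNat f (𝟙 Y)

/-- Naturality of the comparison in the second variable. -/
def TensorPseudofunctor.chiR (X : M) {Y Y' : M} (g : Y ⟶ Y') :
    T.F.obj X ◁₁ T.F.map g ≫ T.chi X Y' ≅ T.chi X Y ≫ T.F.map (X ◁₁ g) :=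
  whiskerRightIso (tIso (T.F.mapId X).symm (Iso.refl (T.F.map g))) (T.chi X Y') ≪≫
    T.chiNat (𝟙 X) g

/-- The 1-cell `unitObj ⟶ F unitObj` as a square on the identity. -/
def TensorPseudofunctor.iotaSq :
    𝟙 (unitObj : N) ≫ T.iota ≅ T.iota ≫ T.F.map (𝟙 (unitObj : M)) :=
  sqOne T.iota ≪≫ whiskerLeftIso T.iota (T.F.mapId unitObj).symm

end TensorPseudofunctor

open TensorBicategory ConstraintBicategory MonoidalBicategory in
/-- A monoidal pseudofunctor between monoidal bicategories.  The comparisons `chi` and `iota` are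
not required to be equivalences; the coherence modifications are invertible. -/
structure MonoidalPseudofunctor (M : Type u₁) [Bicategory.{w₁, v₁} M] [MonoidalBicategory M]
    (N : Type u₂) [Bicategory.{w₂, v₂} N] [MonoidalBicategory N] extends
    TensorPseudofunctor M N where
  /-- the associativity modification -/
  omega (X Y Z : M) :
    chi X Y ▷₁ F.obj Z ≫ chi (X ⊠ Y) Z ≫ F.map (as X Y Z) ≅
      as (F.obj X) (F.obj Y) (F.obj Z) ≫ F.obj X ◁₁ chi Y Z ≫ chi X (Y ⊠ Z)
  omega_naturality {X X' Y Y' Z Z' : M} (f : X ⟶ X') (g : Y ⟶ Y') (h : Z ⟶ Z') :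
    ((F.map f ⊠₁ F.map g) ⊠₁ F.map h) ◁ (omega X' Y' Z').hom ≫
        (sqComp (assocNat (F.map f) (F.map g) (F.map h))
          (sqComp (sqTensor (sqId (F.map f)) (chiNat g h)) (chiNat f (g ⊠₁ h)))).hom =
      (sqComp (sqTensor (chiNat f g) (sqId (F.map h)))
        (sqComp (chiNat (f ⊠₁ g) h) (sqMap F (assocNat f g h)))).hom ≫
        (omega X Y Z).hom ▷ F.map (f ⊠₁ (g ⊠₁ h))
  /-- the left unit modification -/
  gamma (X : M) :
    iota ▷₁ F.obj X ≫ chi unitObj X ≫ F.map (lu X) ≅ lu (F.obj X)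
  gamma_naturality {X X' : M} (f : X ⟶ X') :
    (𝟙 unitObj ⊠₁ F.map f) ◁ (gamma X').hom ≫ (lUnitNat (F.map f)).hom =
      (sqComp (sqTensor toTensorPseudofunctor.iotaSq (sqId (F.map f)))
        (sqComp (chiNat (𝟙 unitObj) f) (sqMap F (lUnitNat f)))).hom ≫
        (gamma X).hom ▷ F.map f
  /-- the right unit modification -/
  delta (X : M) :
    F.obj X ◁₁ iota ≫ chi X unitObj ≫ F.map (ru X) ≅ ru (F.obj X)
  delta_naturality {X X' : M} (f : X ⟶ X') :
    (F.map f ⊠₁ 𝟙 unitObj) ◁ (delta X').hom ≫ (rUnitNat (F.map f)).hom =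
      (sqComp (sqTensor (sqId (F.map f)) toTensorPseudofunctor.iotaSq)
        (sqComp (chiNat f (𝟙 unitObj)) (sqMap F (rUnitNat f)))).hom ≫
        (delta X).hom ▷ F.map f
  /-- compatibility of `omega` with the pentagon modifications -/
  omega_pent (W X Y Z : M) :
    𝟙 (chi W X ▷₁ F.obj Y ▷₁ F.obj Z ≫ chi (W ⊠ X) Y ▷₁ F.obj Z ≫ chi ((W ⊠ X) ⊠ Y) Z ≫
        F.map (as W X Y ▷₁ Z) ≫ F.map (as W (X ⊠ Y) Z) ≫ F.map (W ◁₁ as X Y Z)) ⊗≫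
      (chi W X ▷₁ F.obj Y ▷₁ F.obj Z ≫ chi (W ⊠ X) Y ▷₁ F.obj Z ≫ chi ((W ⊠ X) ⊠ Y) Z) ◁
        (map₃₂ F (pent W X Y Z)).hom ⊗≫
      chi W X ▷₁ F.obj Y ▷₁ F.obj Z ◁
        ((omega (W ⊠ X) Y Z).hom ▷ F.map (as W X (Y ⊠ Z))) ⊗≫
      (asL (chi W X) (F.obj Y) (F.obj Z)).hom ▷
        (F.obj (W ⊠ X) ◁₁ chi Y Z ≫ chi (W ⊠ X) (Y ⊠ Z) ≫ F.map (as W X (Y ⊠ Z))) ⊗≫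
      as (F.obj W ⊠ F.obj X) (F.obj Y) (F.obj Z) ◁
        ((interchange (chi W X) (chi Y Z)).hom ▷
          (chi (W ⊠ X) (Y ⊠ Z) ≫ F.map (as W X (Y ⊠ Z)))) ⊗≫
      (as (F.obj W ⊠ F.obj X) (F.obj Y) (F.obj Z) ≫ (F.obj W ⊠ F.obj X) ◁₁ chi Y Z) ◁
        (omega W X (Y ⊠ Z)).hom ⊗≫
      as (F.obj W ⊠ F.obj X) (F.obj Y) (F.obj Z) ◁
        ((asR (F.obj W) (F.obj X) (chi Y Z)).hom ▷
          (F.obj W ◁₁ chi X (Y ⊠ Z) ≫ chi W (X ⊠ (Y ⊠ Z)))) ⊗≫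
      𝟙 (as (F.obj W ⊠ F.obj X) (F.obj Y) (F.obj Z) ≫
        as (F.obj W) (F.obj X) (F.obj Y ⊠ F.obj Z) ≫ F.obj W ◁₁ F.obj X ◁₁ chi Y Z ≫
        F.obj W ◁₁ chi X (Y ⊠ Z) ≫ chi W (X ⊠ (Y ⊠ Z))) =
    𝟙 (chi W X ▷₁ F.obj Y ▷₁ F.obj Z ≫ chi (W ⊠ X) Y ▷₁ F.obj Z ≫ chi ((W ⊠ X) ⊠ Y) Z ≫
        F.map (as W X Y ▷₁ Z) ≫ F.map (as W (X ⊠ Y) Z) ≫ F.map (W ◁₁ as X Y Z)) ⊗≫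
      (chi W X ▷₁ F.obj Y ▷₁ F.obj Z ≫ chi (W ⊠ X) Y ▷₁ F.obj Z) ◁
        ((toTensorPseudofunctor.chiL (as W X Y) Z).inv ▷
          (F.map (as W (X ⊠ Y) Z) ≫ F.map (W ◁₁ as X Y Z))) ⊗≫
      (rw₃₃ (omega W X Y) (F.obj Z)).hom ▷
        (chi (W ⊠ (X ⊠ Y)) Z ≫ F.map (as W (X ⊠ Y) Z) ≫ F.map (W ◁₁ as X Y Z)) ⊗≫
      (as (F.obj W) (F.obj X) (F.obj Y) ▷₁ F.obj Z ≫ (F.obj W ◁₁ chi X Y) ▷₁ F.obj Z) ◁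
        ((omega W (X ⊠ Y) Z).hom ▷ F.map (W ◁₁ as X Y Z)) ⊗≫
      (as (F.obj W) (F.obj X) (F.obj Y) ▷₁ F.obj Z ≫ (F.obj W ◁₁ chi X Y) ▷₁ F.obj Z ≫
        as (F.obj W) (F.obj (X ⊠ Y)) (F.obj Z) ≫ F.obj W ◁₁ chi (X ⊠ Y) Z) ◁
        (toTensorPseudofunctor.chiR W (as X Y Z)).inv ⊗≫
      as (F.obj W) (F.obj X) (F.obj Y) ▷₁ F.obj Z ◁
        ((asM (F.obj W) (chi X Y) (F.obj Z)).hom ▷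
          (F.obj W ◁₁ chi (X ⊠ Y) Z ≫ F.obj W ◁₁ F.map (as X Y Z) ≫
            chi W (X ⊠ (Y ⊠ Z)))) ⊗≫
      (as (F.obj W) (F.obj X) (F.obj Y) ▷₁ F.obj Z ≫
        as (F.obj W) (F.obj X ⊠ F.obj Y) (F.obj Z)) ◁
        ((lw₃₃ (F.obj W) (omega X Y Z)).hom ▷ chi W (X ⊠ (Y ⊠ Z))) ⊗≫
      (pent (F.obj W) (F.obj X) (F.obj Y) (F.obj Z)).hom ▷
        (F.obj W ◁₁ F.obj X ◁₁ chi Y Z ≫ F.obj W ◁₁ chi X (Y ⊠ Z) ≫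
          chi W (X ⊠ (Y ⊠ Z))) ⊗≫
      𝟙 (as (F.obj W ⊠ F.obj X) (F.obj Y) (F.obj Z) ≫
        as (F.obj W) (F.obj X) (F.obj Y ⊠ F.obj Z) ≫ F.obj W ◁₁ F.obj X ◁₁ chi Y Z ≫
        F.obj W ◁₁ chi X (Y ⊠ Z) ≫ chi W (X ⊠ (Y ⊠ Z)))
  /-- compatibility of `omega`, `gamma` and `delta` with the middle unit modifications -/
  omega_midUnit (X Y : M) :
    𝟙 ((F.obj X ◁₁ iota) ▷₁ F.obj Y ≫ chi X unitObj ▷₁ F.obj Y ≫ chi (X ⊠ unitObj) Y ≫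
        F.map (as X unitObj Y) ≫ F.map (X ◁₁ lu Y)) ⊗≫
      ((F.obj X ◁₁ iota) ▷₁ F.obj Y ≫ chi X unitObj ▷₁ F.obj Y ≫ chi (X ⊠ unitObj) Y) ◁
        (map₂₁ F (midUnit X Y)).hom ⊗≫
      ((F.obj X ◁₁ iota) ▷₁ F.obj Y ≫ chi X unitObj ▷₁ F.obj Y) ◁
        (toTensorPseudofunctor.chiL (ru X) Y).inv ⊗≫
      (rw₃₁ (delta X) (F.obj Y)).hom ▷ chi X Y ⊗≫
      𝟙 (ru (F.obj X) ▷₁ F.obj Y ≫ chi X Y) =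
    𝟙 ((F.obj X ◁₁ iota) ▷₁ F.obj Y ≫ chi X unitObj ▷₁ F.obj Y ≫ chi (X ⊠ unitObj) Y ≫
        F.map (as X unitObj Y) ≫ F.map (X ◁₁ lu Y)) ⊗≫
      (F.obj X ◁₁ iota) ▷₁ F.obj Y ◁ ((omega X unitObj Y).hom ▷ F.map (X ◁₁ lu Y)) ⊗≫
      ((F.obj X ◁₁ iota) ▷₁ F.obj Y ≫ as (F.obj X) (F.obj unitObj) (F.obj Y) ≫
        F.obj X ◁₁ chi unitObj Y) ◁ (toTensorPseudofunctor.chiR X (lu Y)).inv ⊗≫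
      (asM (F.obj X) iota (F.obj Y)).hom ▷
        (F.obj X ◁₁ chi unitObj Y ≫ F.obj X ◁₁ F.map (lu Y) ≫ chi X Y) ⊗≫
      as (F.obj X) unitObj (F.obj Y) ◁ ((lw₃₁ (F.obj X) (gamma Y)).hom ▷ chi X Y) ⊗≫
      (midUnit (F.obj X) (F.obj Y)).hom ▷ chi X Y ⊗≫
      𝟙 (ru (F.obj X) ▷₁ F.obj Y ≫ chi X Y)

section MonoidalPseudofunctor

variable {M : Type u₁} [Bicategory.{w₁, v₁} M] [MonoidalBicategory M]
  {N : Type u₂} [Bicategory.{w₂, v₂} N] [MonoidalBicategory N] (T : MonoidalPseudofunctor M N)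

/-- The mate of `omega` for the inverse associativity 1-cells. -/
def MonoidalPseudofunctor.omegaInv (X Y Z : M) :
    T.F.obj X ◁₁ T.chi Y Z ≫ T.chi X (Y ⊠ Z) ≫ T.F.map (as' X Y Z) ≅
      as' (T.F.obj X) (T.F.obj Y) (T.F.obj Z) ≫ T.chi X Y ▷₁ T.F.obj Z ≫ T.chi (X ⊠ Y) Z :=
  (λ_ _).symm ≪≫
    whiskerRightIso (asPair (T.F.obj X) (T.F.obj Y) (T.F.obj Z)).counit.symm
      (T.F.obj X ◁₁ T.chi Y Z ≫ T.chi X (Y ⊠ Z) ≫ T.F.map (as' X Y Z)) ≪⊗≫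
    whiskerLeftIso (as' (T.F.obj X) (T.F.obj Y) (T.F.obj Z))
      (whiskerRightIso (T.omega X Y Z).symm (T.F.map (as' X Y Z))) ≪⊗≫
    whiskerLeftIso (as' (T.F.obj X) (T.F.obj Y) (T.F.obj Z) ≫ T.chi X Y ▷₁ T.F.obj Z ≫
      T.chi (X ⊠ Y) Z) (mapPair T.F (asPair X Y Z)).unit.symm ≪⊗≫
    Iso.refl (as' (T.F.obj X) (T.F.obj Y) (T.F.obj Z) ≫ T.chi X Y ▷₁ T.F.obj Z ≫
      T.chi (X ⊠ Y) Z)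

end MonoidalPseudofunctor

open TensorBicategory ConstraintBicategory MonoidalBicategory SwapBicategory
  BraidedMonoidalBicategory in
/-- A braided monoidal pseudofunctor between braided monoidal bicategories. -/
structure BraidedMonoidalPseudofunctor
    (M : Type u₁) [Bicategory.{w₁, v₁} M] [BraidedMonoidalBicategory M]
    (N : Type u₂) [Bicategory.{w₂, v₂} N] [BraidedMonoidalBicategory N] extends
    MonoidalPseudofunctor M N where
  /-- the braiding modification -/
  upsilon (X Y : M) : br (F.obj X) (F.obj Y) ≫ chi Y X ≅ chi X Y ≫ F.map (br X Y)
  upsilon_naturality {X X' Y Y' : M} (f : X ⟶ X') (g : Y ⟶ Y') :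
    (F.map f ⊠₁ F.map g) ◁ (upsilon X' Y').hom ≫
        (sqComp (chiNat f g) (sqMap F (braidNat f g))).hom =
      (sqComp (braidNat (F.map f) (F.map g)) (chiNat g f)).hom ≫
        (upsilon X Y).hom ▷ F.map (g ⊠₁ f)
  /-- compatibility with the modifications `hexR` -/
  upsilon_hexR (X Y Z : M) :
    𝟙 (chi X Y ▷₁ F.obj Z ≫ chi (X ⊠ Y) Z ≫ F.map (as X Y Z) ≫ F.map (br X (Y ⊠ Z)) ≫
        F.map (as Y Z X)) ⊗≫
      (chi X Y ▷₁ F.obj Z ≫ chi (X ⊠ Y) Z) ◁ (map₃₃ F (hexR X Y Z)).hom ⊗≫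
      chi X Y ▷₁ F.obj Z ◁ ((toTensorPseudofunctor.chiL (br X Y) Z).inv ▷
        (F.map (as Y X Z) ≫ F.map (Y ◁₁ br X Z))) ⊗≫
      (rw₂₂ (upsilon X Y) (F.obj Z)).inv ▷
        (chi (Y ⊠ X) Z ≫ F.map (as Y X Z) ≫ F.map (Y ◁₁ br X Z)) ⊗≫
      br (F.obj X) (F.obj Y) ▷₁ F.obj Z ◁ ((omega Y X Z).hom ▷ F.map (Y ◁₁ br X Z)) ⊗≫
      (br (F.obj X) (F.obj Y) ▷₁ F.obj Z ≫ as (F.obj Y) (F.obj X) (F.obj Z) ≫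
        F.obj Y ◁₁ chi X Z) ◁ (toTensorPseudofunctor.chiR Y (br X Z)).inv ⊗≫
      (br (F.obj X) (F.obj Y) ▷₁ F.obj Z ≫ as (F.obj Y) (F.obj X) (F.obj Z)) ◁
        ((lw₂₂ (F.obj Y) (upsilon X Z)).inv ▷ chi Y (Z ⊠ X)) ⊗≫
      𝟙 (br (F.obj X) (F.obj Y) ▷₁ F.obj Z ≫ as (F.obj Y) (F.obj X) (F.obj Z) ≫
        F.obj Y ◁₁ br (F.obj X) (F.obj Z) ≫ F.obj Y ◁₁ chi Z X ≫ chi Y (Z ⊠ X)) =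
    𝟙 (chi X Y ▷₁ F.obj Z ≫ chi (X ⊠ Y) Z ≫ F.map (as X Y Z) ≫ F.map (br X (Y ⊠ Z)) ≫
        F.map (as Y Z X)) ⊗≫
      (omega X Y Z).hom ▷ (F.map (br X (Y ⊠ Z)) ≫ F.map (as Y Z X)) ⊗≫
      (as (F.obj X) (F.obj Y) (F.obj Z) ≫ F.obj X ◁₁ chi Y Z) ◁
        ((upsilon X (Y ⊠ Z)).inv ▷ F.map (as Y Z X)) ⊗≫
      as (F.obj X) (F.obj Y) (F.obj Z) ◁
        ((brR (F.obj X) (chi Y Z)).hom ▷ (chi (Y ⊠ Z) X ≫ F.map (as Y Z X))) ⊗≫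
      (as (F.obj X) (F.obj Y) (F.obj Z) ≫ br (F.obj X) (F.obj Y ⊠ F.obj Z)) ◁
        (omega Y Z X).hom ⊗≫
      (hexR (F.obj X) (F.obj Y) (F.obj Z)).hom ▷
        (F.obj Y ◁₁ chi Z X ≫ chi Y (Z ⊠ X)) ⊗≫
      𝟙 (br (F.obj X) (F.obj Y) ▷₁ F.obj Z ≫ as (F.obj Y) (F.obj X) (F.obj Z) ≫
        F.obj Y ◁₁ br (F.obj X) (F.obj Z) ≫ F.obj Y ◁₁ chi Z X ≫ chi Y (Z ⊠ X))
  /-- compatibility with the modifications `hexS` -/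
  upsilon_hexS (X Y Z : M) :
    𝟙 (F.obj X ◁₁ chi Y Z ≫ chi X (Y ⊠ Z) ≫ F.map (as' X Y Z) ≫ F.map (br (X ⊠ Y) Z) ≫
        F.map (as' Z X Y)) ⊗≫
      (F.obj X ◁₁ chi Y Z ≫ chi X (Y ⊠ Z)) ◁ (map₃₃ F (hexS X Y Z)).hom ⊗≫
      F.obj X ◁₁ chi Y Z ◁ ((toTensorPseudofunctor.chiR X (br Y Z)).inv ▷
        (F.map (as' X Z Y) ≫ F.map (br X Z ▷₁ Y))) ⊗≫
      (lw₂₂ (F.obj X) (upsilon Y Z)).inv ▷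
        (chi X (Z ⊠ Y) ≫ F.map (as' X Z Y) ≫ F.map (br X Z ▷₁ Y)) ⊗≫
      F.obj X ◁₁ br (F.obj Y) (F.obj Z) ◁
        ((toMonoidalPseudofunctor.omegaInv X Z Y).hom ▷ F.map (br X Z ▷₁ Y)) ⊗≫
      (F.obj X ◁₁ br (F.obj Y) (F.obj Z) ≫ as' (F.obj X) (F.obj Z) (F.obj Y) ≫
        chi X Z ▷₁ F.obj Y) ◁ (toTensorPseudofunctor.chiL (br X Z) Y).inv ⊗≫
      (F.obj X ◁₁ br (F.obj Y) (F.obj Z) ≫ as' (F.obj X) (F.obj Z) (F.obj Y)) ◁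
        ((rw₂₂ (upsilon X Z) (F.obj Y)).inv ▷ chi (Z ⊠ X) Y) ⊗≫
      𝟙 (F.obj X ◁₁ br (F.obj Y) (F.obj Z) ≫ as' (F.obj X) (F.obj Z) (F.obj Y) ≫
        br (F.obj X) (F.obj Z) ▷₁ F.obj Y ≫ chi Z X ▷₁ F.obj Y ≫ chi (Z ⊠ X) Y) =
    𝟙 (F.obj X ◁₁ chi Y Z ≫ chi X (Y ⊠ Z) ≫ F.map (as' X Y Z) ≫ F.map (br (X ⊠ Y) Z) ≫
        F.map (as' Z X Y)) ⊗≫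
      (toMonoidalPseudofunctor.omegaInv X Y Z).hom ▷
        (F.map (br (X ⊠ Y) Z) ≫ F.map (as' Z X Y)) ⊗≫
      (as' (F.obj X) (F.obj Y) (F.obj Z) ≫ chi X Y ▷₁ F.obj Z) ◁
        ((upsilon (X ⊠ Y) Z).inv ▷ F.map (as' Z X Y)) ⊗≫
      as' (F.obj X) (F.obj Y) (F.obj Z) ◁
        ((brL (chi X Y) (F.obj Z)).hom ▷ (chi Z (X ⊠ Y) ≫ F.map (as' Z X Y))) ⊗≫
      (as' (F.obj X) (F.obj Y) (F.obj Z) ≫ br (F.obj X ⊠ F.obj Y) (F.obj Z)) ◁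
        (toMonoidalPseudofunctor.omegaInv Z X Y).hom ⊗≫
      (hexS (F.obj X) (F.obj Y) (F.obj Z)).hom ▷
        (chi Z X ▷₁ F.obj Y ≫ chi (Z ⊠ X) Y) ⊗≫
      𝟙 (F.obj X ◁₁ br (F.obj Y) (F.obj Z) ≫ as' (F.obj X) (F.obj Z) (F.obj Y) ≫
        br (F.obj X) (F.obj Z) ▷₁ F.obj Y ≫ chi Z X ▷₁ F.obj Y ≫ chi (Z ⊠ X) Y)

/-! ### Monoidal objects and centre pieces -/

section MonoidalObject

open TensorBicategory ConstraintBicategory MonoidalBicategory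

/-- The data of a monoidal object, without the coherence conditions. -/
structure MonoidalObjectData (B : Type u) [Bicategory.{w, v} B] [MonoidalBicategory B] where
  /-- the underlying object -/
  A : B
  /-- the multiplication -/
  m : A ⊠ A ⟶ A
  /-- the unit -/
  j : unitObj ⟶ A
  /-- associativity up to an invertible 2-cell -/
  mAssoc : m ▷₁ A ≫ m ≅ as A A A ≫ A ◁₁ m ≫ m
  /-- left unitality up to an invertible 2-cell -/
  mLeft : j ▷₁ A ≫ m ≅ lu A
  /-- right unitality up to an invertible 2-cell -/
  mRight : A ◁₁ j ≫ m ≅ ru A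

variable {B : Type u} [Bicategory.{w, v} B] [MonoidalBicategory B]

/-- The coherence conditions on a monoidal object. -/
structure MonoidalObjectData.IsCoherent (D : MonoidalObjectData B) : Prop where
  /-- the pentagon condition -/
  pentagon :
    𝟙 (D.m ▷₁ D.A ▷₁ D.A ≫ D.m ▷₁ D.A ≫ D.m) ⊗≫
      D.m ▷₁ D.A ▷₁ D.A ◁ D.mAssoc.hom ⊗≫
      (asL D.m D.A D.A).hom ▷ (D.A ◁₁ D.m ≫ D.m) ⊗≫
      as (D.A ⊠ D.A) D.A D.A ◁ ((interchange D.m D.m).hom ▷ D.m) ⊗≫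
      (as (D.A ⊠ D.A) D.A D.A ≫ (D.A ⊠ D.A) ◁₁ D.m) ◁ D.mAssoc.hom ⊗≫
      as (D.A ⊠ D.A) D.A D.A ◁ ((asR D.A D.A D.m).hom ▷ (D.A ◁₁ D.m ≫ D.m)) ⊗≫
      𝟙 (as (D.A ⊠ D.A) D.A D.A ≫ as D.A D.A (D.A ⊠ D.A) ≫ D.A ◁₁ D.A ◁₁ D.m ≫
        D.A ◁₁ D.m ≫ D.m) =
    𝟙 (D.m ▷₁ D.A ▷₁ D.A ≫ D.m ▷₁ D.A ≫ D.m) ⊗≫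
      (rw₂₃ D.mAssoc D.A).hom ▷ D.m ⊗≫
      (as D.A D.A D.A ▷₁ D.A ≫ (D.A ◁₁ D.m) ▷₁ D.A) ◁ D.mAssoc.hom ⊗≫
      as D.A D.A D.A ▷₁ D.A ◁ ((asM D.A D.m D.A).hom ▷ (D.A ◁₁ D.m ≫ D.m)) ⊗≫
      (as D.A D.A D.A ▷₁ D.A ≫ as D.A (D.A ⊠ D.A) D.A) ◁
        ((lw₂₃ D.A D.mAssoc).hom ▷ D.m) ⊗≫
      (pent D.A D.A D.A D.A).hom ▷ (D.A ◁₁ D.A ◁₁ D.m ≫ D.A ◁₁ D.m ≫ D.m) ⊗≫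
      𝟙 (as (D.A ⊠ D.A) D.A D.A ≫ as D.A D.A (D.A ⊠ D.A) ≫ D.A ◁₁ D.A ◁₁ D.m ≫
        D.A ◁₁ D.m ≫ D.m)
  /-- the unit condition -/
  triangle :
    𝟙 ((D.A ◁₁ D.j) ▷₁ D.A ≫ D.m ▷₁ D.A ≫ D.m) ⊗≫
      (rw₂₁ D.mRight D.A).hom ▷ D.m ⊗≫
      𝟙 (ru D.A ▷₁ D.A ≫ D.m) =
    𝟙 ((D.A ◁₁ D.j) ▷₁ D.A ≫ D.m ▷₁ D.A ≫ D.m) ⊗≫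
      (D.A ◁₁ D.j) ▷₁ D.A ◁ D.mAssoc.hom ⊗≫
      (asM D.A D.j D.A).hom ▷ (D.A ◁₁ D.m ≫ D.m) ⊗≫
      as D.A unitObj D.A ◁ ((lw₂₁ D.A D.mLeft).hom ▷ D.m) ⊗≫
      (midUnit D.A D.A).hom ▷ D.m ⊗≫
      𝟙 (ru D.A ▷₁ D.A ≫ D.m)

/-- A monoidal object (pseudomonoid) of a monoidal bicategory. -/
structure MonoidalObject (B : Type u) [Bicategory.{w, v} B] [MonoidalBicategory B] extends
    MonoidalObjectData B where
  /-- the coherence conditions -/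
  coherent : toMonoidalObjectData.IsCoherent

end MonoidalObject

section CentrePiece

open TensorBicategory ConstraintBicategory MonoidalBicategory SwapBicategory
  BraidedMonoidalBicategory

variable {B : Type u} [Bicategory.{w, v} B] [BraidedMonoidalBicategory B]

/-- The condition on the 2-cell `γ` of a centre piece. -/
def IsCentrePiece (D : MonoidalObject B) {U : B} (x : U ⟶ D.A)
    (γ : x ▷₁ D.A ≫ D.m ≅ br U D.A ≫ D.A ◁₁ x ≫ D.m) : Prop :=
  𝟙 (x ▷₁ D.A ▷₁ D.A ≫ D.m ▷₁ D.A ≫ D.m) ⊗≫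
      x ▷₁ D.A ▷₁ D.A ◁ D.mAssoc.hom ⊗≫
      (asL x D.A D.A).hom ▷ (D.A ◁₁ D.m ≫ D.m) ⊗≫
      as U D.A D.A ◁ ((interchange x D.m).hom ▷ D.m) ⊗≫
      (as U D.A D.A ≫ U ◁₁ D.m) ◁ γ.hom ⊗≫
      as U D.A D.A ◁ ((brR U D.m).hom ▷ (D.A ◁₁ x ≫ D.m)) ⊗≫
      (as U D.A D.A ≫ br U (D.A ⊠ D.A)) ◁ ((interchange D.m x).hom ▷ D.m) ⊗≫
      (as U D.A D.A ≫ br U (D.A ⊠ D.A) ≫ (D.A ⊠ D.A) ◁₁ x) ◁ D.mAssoc.hom ⊗≫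
      (as U D.A D.A ≫ br U (D.A ⊠ D.A)) ◁ ((asR D.A D.A x).hom ▷ (D.A ◁₁ D.m ≫ D.m)) ⊗≫
      𝟙 (as U D.A D.A ≫ br U (D.A ⊠ D.A) ≫ as D.A D.A U ≫ D.A ◁₁ D.A ◁₁ x ≫
        D.A ◁₁ D.m ≫ D.m) =
    𝟙 (x ▷₁ D.A ▷₁ D.A ≫ D.m ▷₁ D.A ≫ D.m) ⊗≫
      (rw₂₃ γ D.A).hom ▷ D.m ⊗≫
      (br U D.A ▷₁ D.A ≫ (D.A ◁₁ x) ▷₁ D.A) ◁ D.mAssoc.hom ⊗≫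
      br U D.A ▷₁ D.A ◁ ((asM D.A x D.A).hom ▷ (D.A ◁₁ D.m ≫ D.m)) ⊗≫
      (br U D.A ▷₁ D.A ≫ as D.A U D.A) ◁ ((lw₂₃ D.A γ).hom ▷ D.m) ⊗≫
      (hexR U D.A D.A).inv ▷ (D.A ◁₁ D.A ◁₁ x ≫ D.A ◁₁ D.m ≫ D.m) ⊗≫
      𝟙 (as U D.A D.A ≫ br U (D.A ⊠ D.A) ≫ as D.A D.A U ≫ D.A ◁₁ D.A ◁₁ x ≫
        D.A ◁₁ D.m ≫ D.m)

/-- A centre piece for the monoidal object `D` with domain `U`. -/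
structure CentrePiece (D : MonoidalObject B) (U : B) where
  /-- the underlying 1-cell -/
  x : U ⟶ D.A
  /-- the invertible 2-cell -/
  γ : x ▷₁ D.A ≫ D.m ≅ br U D.A ≫ D.A ◁₁ x ≫ D.m
  /-- the condition on the 2-cell -/
  isCentrePiece : IsCentrePiece D x γ

/-- A morphism of centre pieces: a 2-cell compatible with the 2-cells `γ`. -/
@[ext]
structure CentrePiece.Hom {D : MonoidalObject B} {U : B} (P Q : CentrePiece D U) where
  /-- the underlying 2-cell -/
  σ : P.x ⟶ Q.x
  comm : (σ ⊠₂ 𝟙 (𝟙 D.A)) ▷ D.m ≫ Q.γ.hom =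
    P.γ.hom ≫ br U D.A ◁ ((𝟙 (𝟙 D.A) ⊠₂ σ) ▷ D.m)

/-- The category of centre pieces for `D` with domain `U`. -/
instance (D : MonoidalObject B) (U : B) : Category (CentrePiece D U) where
  Hom P Q := CentrePiece.Hom P Q
  id P := ⟨𝟙 P.x, by simp [tHom₂_id]⟩
  comp {P Q R} f g := ⟨f.σ ≫ g.σ, by
    have h₁ : ((f.σ ≫ g.σ) ⊠₂ 𝟙 (𝟙 D.A)) =
        (f.σ ⊠₂ 𝟙 (𝟙 D.A)) ≫ (g.σ ⊠₂ 𝟙 (𝟙 D.A)) := by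
      rw [← tHom₂_comp, Category.comp_id]
    have h₂ : (𝟙 (𝟙 D.A) ⊠₂ (f.σ ≫ g.σ)) =
        (𝟙 (𝟙 D.A) ⊠₂ f.σ) ≫ (𝟙 (𝟙 D.A) ⊠₂ g.σ) := by
      rw [← tHom₂_comp, Category.comp_id]
    rw [h₁, h₂]
    simp only [comp_whiskerRight, whiskerLeft_comp, Category.assoc]
    rw [g.comm, reassoc_of% f.comm]⟩
  id_comp f := CentrePiece.Hom.ext (Category.id_comp f.σ)
  comp_id f := CentrePiece.Hom.ext (Category.comp_id f.σ)
  assoc f g h := CentrePiece.Hom.ext (Category.assoc f.σ g.σ h.σ)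

/-- The 2-cell on `f ≫ x` obtained by pasting the pseudonaturality square of the braiding at `f`
onto `γ`. -/
def restrictCell (D : MonoidalObject B) {V U : B} (f : V ⟶ U) (x : U ⟶ D.A)
    (γ : x ▷₁ D.A ≫ D.m ≅ br U D.A ≫ D.A ◁₁ x ≫ D.m) :
    (f ≫ x) ▷₁ D.A ≫ D.m ≅ br V D.A ≫ D.A ◁₁ (f ≫ x) ≫ D.m :=
  whiskerRightIso (rwComp f x D.A) D.m ≪≫ α_ _ _ _ ≪≫ whiskerLeftIso (f ▷₁ D.A) γ ≪⊗≫
    whiskerRightIso (brL f D.A) (D.A ◁₁ x ≫ D.m) ≪⊗≫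
    whiskerLeftIso (br V D.A) (whiskerRightIso (lwComp D.A f x).symm D.m)

end CentrePiece

/-!
### Restriction of centre pieces

The results of this section show that `restrictCell` preserves centre pieces.
-/

section Abs
variable {B : Type u} [Bicategory.{w, v} B]

theorem paste_left {o0 o1 o2 p0 p1 p2 q0 q1 q2 w0 w1 z0 z1 y0 y1 A : B}
    {F2 : o0 ⟶ o1} {X2 : o1 ⟶ o2} {G2 : o0 ⟶ o2} {aV : o0 ⟶ p0} {aU : o1 ⟶ p1} {aA : o2 ⟶ p2}
    {F' : p0 ⟶ p1} {X' : p1 ⟶ p2} {G' : p0 ⟶ p2} {Vm : p0 ⟶ q0} {Um : p1 ⟶ q1} {Am : p2 ⟶ q2}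
    {F1 : q0 ⟶ q1} {X1 : q1 ⟶ q2} {G1 : q0 ⟶ q2} {mA : o2 ⟶ q2} {m : q2 ⟶ A}
    {bV : q0 ⟶ w0} {bU : q1 ⟶ w1} {LF : w0 ⟶ w1} {LX : w1 ⟶ q2} {LG : w0 ⟶ q2}
    {BV : p0 ⟶ z0} {BU : p1 ⟶ z1} {LLF : z0 ⟶ z1} {LLX : z1 ⟶ o2} {LLG : z0 ⟶ o2}
    {mV : z0 ⟶ w0} {mU : z1 ⟶ w1} {cV : z0 ⟶ y0} {cU : z1 ⟶ y1}
    {L2F : y0 ⟶ y1} {L2X : y1 ⟶ p2} {L2G : y0 ⟶ p2}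
    (s : G2 ≅ F2 ≫ X2) (t : G' ≅ F' ≫ X') (r : G1 ≅ F1 ≫ X1) (l : LG ≅ LF ≫ LX)
    (ll : LLG ≅ LLF ≫ LLX) (l2 : L2G ≅ L2F ≫ L2X)
    (MA : mA ≫ m ⟶ aA ≫ Am ≫ m)
    (aLG : G2 ≫ aA ⟶ aV ≫ G') (aLF : F2 ≫ aU ⟶ aV ≫ F') (aLX : X2 ≫ aA ⟶ aU ≫ X')
    (hL : aLG = s.hom ▷ aA ⊗≫ F2 ◁ aLX ⊗≫ aLF ▷ X' ⊗≫ aV ◁ t.inv)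
    (iG : G' ≫ Am ⟶ Vm ≫ G1) (iF : F' ≫ Um ⟶ Vm ≫ F1) (iX : X' ≫ Am ⟶ Um ≫ X1)
    (hi : iG = t.hom ▷ Am ⊗≫ F' ◁ iX ⊗≫ iF ▷ X1 ⊗≫ Vm ◁ r.inv)
    (γ : X1 ≫ m ⟶ bU ≫ LX ≫ m) (γG : G1 ≫ m ⟶ bV ≫ LG ≫ m)
    (brF : F1 ≫ bU ⟶ bV ≫ LF)
    (hγ : γG = r.hom ▷ m ⊗≫ F1 ◁ γ ⊗≫ brF ▷ (LX ≫ m) ⊗≫ bV ◁ (l.inv ▷ m))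
    (bRV : Vm ≫ bV ⟶ BV ≫ mV) (bRU : Um ≫ bU ⟶ BU ≫ mU)
    (jG : mV ≫ LG ⟶ LLG ≫ mA) (jF : mV ≫ LF ⟶ LLF ≫ mU) (jX : mU ≫ LX ⟶ LLX ≫ mA)
    (hj : jG = mV ◁ l.hom ⊗≫ jF ▷ LX ⊗≫ LLF ◁ jX ⊗≫ ll.inv ▷ mA)
    (aRG : LLG ≫ aA ⟶ cV ≫ L2G) (aRF : LLF ≫ cU ⟶ cV ≫ L2F) (aRX : LLX ≫ aA ⟶ cU ≫ L2X)
    (hR : aRG = ll.hom ▷ aA ⊗≫ LLF ◁ aRX ⊗≫ aRF ▷ L2X ⊗≫ cV ◁ l2.inv)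
    (brF' : F' ≫ BU ⟶ BV ≫ LLF)
    (h6 : 𝟙 (F' ≫ Um ≫ bU) ⊗≫ iF ▷ bU ⊗≫ Vm ◁ brF ⊗≫ bRV ▷ LF ⊗≫ BV ◁ jF =
      𝟙 (F' ≫ Um ≫ bU) ⊗≫ F' ◁ bRU ⊗≫ brF' ▷ mU ⊗≫ 𝟙 (BV ≫ LLF ≫ mU)) :
    𝟙 (G2 ≫ mA ≫ m) ⊗≫ G2 ◁ MA ⊗≫ aLG ▷ (Am ≫ m) ⊗≫ aV ◁ (iG ▷ m) ⊗≫ (aV ≫ Vm) ◁ γG ⊗≫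
      aV ◁ (bRV ▷ (LG ≫ m)) ⊗≫ (aV ≫ BV) ◁ (jG ▷ m) ⊗≫ (aV ≫ BV ≫ LLG) ◁ MA ⊗≫
      (aV ≫ BV) ◁ (aRG ▷ (Am ≫ m)) ⊗≫ 𝟙 (aV ≫ BV ≫ cV ≫ L2G ≫ Am ≫ m) =
    𝟙 (G2 ≫ mA ≫ m) ⊗≫ s.hom ▷ (mA ≫ m) ⊗≫ F2 ◁
      (𝟙 (X2 ≫ mA ≫ m) ⊗≫ X2 ◁ MA ⊗≫ aLX ▷ (Am ≫ m) ⊗≫ aU ◁ (iX ▷ m) ⊗≫ (aU ≫ Um) ◁ γ ⊗≫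
      aU ◁ (bRU ▷ (LX ≫ m)) ⊗≫ (aU ≫ BU) ◁ (jX ▷ m) ⊗≫ (aU ≫ BU ≫ LLX) ◁ MA ⊗≫
      (aU ≫ BU) ◁ (aRX ▷ (Am ≫ m)) ⊗≫ 𝟙 (aU ≫ BU ≫ cU ≫ L2X ≫ Am ≫ m)) ⊗≫
      (𝟙 (F2 ≫ aU ≫ BU ≫ cU) ⊗≫ aLF ▷ (BU ≫ cU) ⊗≫ aV ◁ (brF' ▷ cU) ⊗≫ (aV ≫ BV) ◁ aRF ⊗≫
        𝟙 (aV ≫ BV ≫ cV ≫ L2F)) ▷ (L2X ≫ Am ≫ m) ⊗≫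
      (aV ≫ BV ≫ cV) ◁ (l2.inv ▷ (Am ≫ m)) ⊗≫ 𝟙 (aV ≫ BV ≫ cV ≫ L2G ≫ Am ≫ m) := by
  symm
  calc
    _ = 𝟙 _ ⊗≫ s.hom ▷ (mA ≫ m) ⊗≫ (F2 ≫ X2) ◁ MA ⊗≫ F2 ◁ (aLX ▷ (Am ≫ m)) ⊗≫
      ((F2 ≫ aU) ◁ (𝟙 (X' ≫ Am ≫ m) ⊗≫ iX ▷ m ⊗≫ Um ◁ γ ⊗≫ bRU ▷ (LX ≫ m) ⊗≫
        BU ◁ (jX ▷ m) ⊗≫ (BU ≫ LLX) ◁ MA ⊗≫ BU ◁ (aRX ▷ (Am ≫ m)) ⊗≫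
        𝟙 (BU ≫ cU ≫ L2X ≫ Am ≫ m)) ≫
      aLF ▷ (BU ≫ cU ≫ L2X ≫ Am ≫ m)) ⊗≫ aV ◁ (brF' ▷ (cU ≫ L2X ≫ Am ≫ m)) ⊗≫
        (aV ≫ BV) ◁ (aRF ▷ (L2X ≫ Am ≫ m)) ⊗≫
      (aV ≫ BV ≫ cV) ◁ (l2.inv ▷ (Am ≫ m)) ⊗≫ 𝟙 (aV ≫ BV ≫ cV ≫ L2G ≫ Am ≫ m) := by
        bicategory
    _ = 𝟙 _ ⊗≫ s.hom ▷ (mA ≫ m) ⊗≫ (F2 ≫ X2) ◁ MA ⊗≫ F2 ◁ (aLX ▷ (Am ≫ m)) ⊗≫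
      aLF ▷ (X' ≫ Am ≫ m) ⊗≫
      (aV ≫ F') ◁ (𝟙 (X' ≫ Am ≫ m) ⊗≫ iX ▷ m ⊗≫ Um ◁ γ ⊗≫ bRU ▷ (LX ≫ m)) ⊗≫
      aV ◁ ((F' ≫ BU) ◁ (𝟙 (mU ≫ LX ≫ m) ⊗≫ jX ▷ m ⊗≫
        (LLX) ◁ MA ⊗≫ (aRX ▷ (Am ≫ m)) ⊗≫ 𝟙 (cU ≫ L2X ≫ Am ≫ m)) ≫
      brF' ▷ (cU ≫ L2X ≫ Am ≫ m)) ⊗≫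
        (aV ≫ BV) ◁ (aRF ▷ (L2X ≫ Am ≫ m)) ⊗≫
      (aV ≫ BV ≫ cV) ◁ (l2.inv ▷ (Am ≫ m)) ⊗≫ 𝟙 (aV ≫ BV ≫ cV ≫ L2G ≫ Am ≫ m) := by
        rw [whisker_exchange]; bicategory
    _ = 𝟙 _ ⊗≫ s.hom ▷ (mA ≫ m) ⊗≫ (F2 ≫ X2) ◁ MA ⊗≫ F2 ◁ (aLX ▷ (Am ≫ m)) ⊗≫
      aLF ▷ (X' ≫ Am ≫ m) ⊗≫
      (aV ≫ F') ◁ (𝟙 (X' ≫ Am ≫ m) ⊗≫ iX ▷ m ⊗≫ Um ◁ γ) ⊗≫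
      aV ◁ ((𝟙 (F' ≫ Um ≫ bU) ⊗≫ F' ◁ bRU ⊗≫ brF' ▷ mU ⊗≫ 𝟙 (BV ≫ LLF ≫ mU)) ▷ (LX ≫ m)) ⊗≫
      (aV ≫ BV ≫ LLF) ◁ (𝟙 (mU ≫ LX ≫ m) ⊗≫ jX ▷ m ⊗≫ LLX ◁ MA ⊗≫ aRX ▷ (Am ≫ m) ⊗≫
        𝟙 (cU ≫ L2X ≫ Am ≫ m)) ⊗≫
        (aV ≫ BV) ◁ (aRF ▷ (L2X ≫ Am ≫ m)) ⊗≫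
      (aV ≫ BV ≫ cV) ◁ (l2.inv ▷ (Am ≫ m)) ⊗≫ 𝟙 (aV ≫ BV ≫ cV ≫ L2G ≫ Am ≫ m) := by
        rw [whisker_exchange]; bicategory
    _ = 𝟙 _ ⊗≫ s.hom ▷ (mA ≫ m) ⊗≫ (F2 ≫ X2) ◁ MA ⊗≫ F2 ◁ (aLX ▷ (Am ≫ m)) ⊗≫
      aLF ▷ (X' ≫ Am ≫ m) ⊗≫
      (aV ≫ F') ◁ (iX ▷ m) ⊗≫ aV ◁ ((F' ≫ Um) ◁ γ ≫ iF ▷ (bU ≫ LX ≫ m)) ⊗≫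
      (aV ≫ Vm) ◁ (brF ▷ (LX ≫ m)) ⊗≫ aV ◁ (bRV ▷ (LF ≫ LX ≫ m)) ⊗≫
      (aV ≫ BV) ◁ (jF ▷ (LX ≫ m)) ⊗≫
      (aV ≫ BV ≫ LLF) ◁ (𝟙 (mU ≫ LX ≫ m) ⊗≫ jX ▷ m ⊗≫ LLX ◁ MA ⊗≫ aRX ▷ (Am ≫ m) ⊗≫
        𝟙 (cU ≫ L2X ≫ Am ≫ m)) ⊗≫
        (aV ≫ BV) ◁ (aRF ▷ (L2X ≫ Am ≫ m)) ⊗≫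
      (aV ≫ BV ≫ cV) ◁ (l2.inv ▷ (Am ≫ m)) ⊗≫ 𝟙 (aV ≫ BV ≫ cV ≫ L2G ≫ Am ≫ m) := by
        rw [← h6]; bicategory
    _ = 𝟙 _ ⊗≫ (s.hom ▷ (mA ≫ m) ≫ (F2 ≫ X2) ◁ MA) ⊗≫ F2 ◁ (aLX ▷ (Am ≫ m)) ⊗≫
      aLF ▷ (X' ≫ Am ≫ m) ⊗≫
      (aV ≫ F') ◁ (iX ▷ m) ⊗≫ aV ◁ (iF ▷ (X1 ≫ m)) ⊗≫ (aV ≫ Vm ≫ F1) ◁ γ ⊗≫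
      (aV ≫ Vm) ◁ (brF ▷ (LX ≫ m)) ⊗≫ aV ◁ (bRV ▷ (LF ≫ LX ≫ m)) ⊗≫
      (aV ≫ BV) ◁ (jF ▷ (LX ≫ m)) ⊗≫
      (aV ≫ BV ≫ LLF) ◁ (jX ▷ m) ⊗≫ (aV ≫ BV ≫ LLF ≫ LLX) ◁ MA ⊗≫
      (aV ≫ BV ≫ LLF) ◁ (aRX ▷ (Am ≫ m)) ⊗≫
        (aV ≫ BV) ◁ (aRF ▷ (L2X ≫ Am ≫ m)) ⊗≫
      (aV ≫ BV ≫ cV) ◁ (l2.inv ▷ (Am ≫ m)) ⊗≫ 𝟙 (aV ≫ BV ≫ cV ≫ L2G ≫ Am ≫ m) := by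
        rw [whisker_exchange]; bicategory
    _ = 𝟙 _ ⊗≫ G2 ◁ MA ⊗≫ s.hom ▷ (aA ≫ Am ≫ m) ⊗≫ F2 ◁ (aLX ▷ (Am ≫ m)) ⊗≫
      aLF ▷ (X' ≫ Am ≫ m) ⊗≫ aV ◁ ((t.inv ≫ t.hom) ▷ (Am ≫ m)) ⊗≫
      (aV ≫ F') ◁ (iX ▷ m) ⊗≫ aV ◁ (iF ▷ (X1 ≫ m)) ⊗≫
      (aV ≫ Vm) ◁ ((r.inv ≫ r.hom) ▷ m) ⊗≫ (aV ≫ Vm ≫ F1) ◁ γ ⊗≫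
      (aV ≫ Vm) ◁ (brF ▷ (LX ≫ m)) ⊗≫ aV ◁ (bRV ▷ (LF ≫ LX ≫ m)) ⊗≫
      (aV ≫ BV ≫ mV) ◁ ((l.inv ≫ l.hom) ▷ m) ⊗≫
      (aV ≫ BV) ◁ (jF ▷ (LX ≫ m)) ⊗≫
      (aV ≫ BV ≫ LLF) ◁ (jX ▷ m) ⊗≫
      (aV ≫ BV) ◁ ((ll.inv ≫ ll.hom) ▷ (mA ≫ m)) ⊗≫ (aV ≫ BV ≫ LLF ≫ LLX) ◁ MA ⊗≫
      (aV ≫ BV ≫ LLF) ◁ (aRX ▷ (Am ≫ m)) ⊗≫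
        (aV ≫ BV) ◁ (aRF ▷ (L2X ≫ Am ≫ m)) ⊗≫
      (aV ≫ BV ≫ cV) ◁ (l2.inv ▷ (Am ≫ m)) ⊗≫ 𝟙 (aV ≫ BV ≫ cV ≫ L2G ≫ Am ≫ m) := by
        simp only [Iso.inv_hom_id]
        rw [← whisker_exchange]; bicategory
    _ = 𝟙 _ ⊗≫ G2 ◁ MA ⊗≫ s.hom ▷ (aA ≫ Am ≫ m) ⊗≫ F2 ◁ (aLX ▷ (Am ≫ m)) ⊗≫
      aLF ▷ (X' ≫ Am ≫ m) ⊗≫ aV ◁ ((t.inv ≫ t.hom) ▷ (Am ≫ m)) ⊗≫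
      (aV ≫ F') ◁ (iX ▷ m) ⊗≫ aV ◁ (iF ▷ (X1 ≫ m)) ⊗≫
      (aV ≫ Vm) ◁ ((r.inv ≫ r.hom) ▷ m) ⊗≫ (aV ≫ Vm ≫ F1) ◁ γ ⊗≫
      (aV ≫ Vm) ◁ (brF ▷ (LX ≫ m)) ⊗≫
      aV ◁ ((Vm ≫ bV) ◁ (l.inv ▷ m) ≫ bRV ▷ (LG ≫ m)) ⊗≫
      (aV ≫ BV ≫ mV) ◁ (l.hom ▷ m) ⊗≫
      (aV ≫ BV) ◁ (jF ▷ (LX ≫ m)) ⊗≫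
      (aV ≫ BV ≫ LLF) ◁ (jX ▷ m) ⊗≫
      (aV ≫ BV) ◁ (ll.inv ▷ (mA ≫ m)) ⊗≫ (aV ≫ BV) ◁ (ll.hom ▷ (mA ≫ m) ≫ (LLF ≫ LLX) ◁ MA) ⊗≫
      (aV ≫ BV ≫ LLF) ◁ (aRX ▷ (Am ≫ m)) ⊗≫
        (aV ≫ BV) ◁ (aRF ▷ (L2X ≫ Am ≫ m)) ⊗≫
      (aV ≫ BV ≫ cV) ◁ (l2.inv ▷ (Am ≫ m)) ⊗≫ 𝟙 (aV ≫ BV ≫ cV ≫ L2G ≫ Am ≫ m) := by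
        rw [whisker_exchange bRV]; bicategory
    _ = _ := by
        rw [← whisker_exchange ll.hom, hL, hi, hγ, hj, hR]; bicategory

theorem paste_right {o0 o1 o2 p0 p1 p2 q2 z0 z1 y0 y1 A d0 d1 e0 e1 : B}
    {F2 : o0 ⟶ o1} {X2 : o1 ⟶ o2} {G2 : o0 ⟶ o2} {aV : o0 ⟶ p0} {aU : o1 ⟶ p1} {aA : o2 ⟶ p2}
    {Am : p2 ⟶ q2} {mA : o2 ⟶ q2} {m : q2 ⟶ A} {BV : p0 ⟶ z0} {BU : p1 ⟶ z1}
    {cV : z0 ⟶ y0} {cU : z1 ⟶ y1}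
    {L2F : y0 ⟶ y1} {L2X : y1 ⟶ p2} {L2G : y0 ⟶ p2}
    {bVA : o0 ⟶ d0} {bUA : o1 ⟶ d1} {HF : d0 ⟶ d1} {HX : d1 ⟶ o2} {HG : d0 ⟶ o2}
    {eV : d0 ⟶ e0} {eU : d1 ⟶ e1} {KF : e0 ⟶ e1} {KX : e1 ⟶ p2} {KG : e0 ⟶ p2}
    {AbV : e0 ⟶ y0} {AbU : e1 ⟶ y1}
    (s : G2 ≅ F2 ≫ X2) (l2 : L2G ≅ L2F ≫ L2X) (k : HG ≅ HF ≫ HX) (k' : KG ≅ KF ≫ KX)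
    (MA : mA ≫ m ⟶ aA ≫ Am ≫ m)
    (γr : X2 ≫ mA ⟶ bUA ≫ HX ≫ mA) (γrG : G2 ≫ mA ⟶ bVA ≫ HG ≫ mA)
    (brr : F2 ≫ bUA ⟶ bVA ≫ HF)
    (hγr : γrG = s.hom ▷ mA ⊗≫ F2 ◁ γr ⊗≫ brr ▷ (HX ≫ mA) ⊗≫ bVA ◁ (k.inv ▷ mA))
    (aMG : HG ≫ aA ⟶ eV ≫ KG) (aMF : HF ≫ eU ⟶ eV ≫ KF) (aMX : HX ≫ aA ⟶ eU ≫ KX)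
    (hM : aMG = k.hom ▷ aA ⊗≫ HF ◁ aMX ⊗≫ aMF ▷ KX ⊗≫ eV ◁ k'.inv)
    (γl : KX ≫ Am ⟶ AbU ≫ L2X ≫ Am) (γlG : KG ≫ Am ⟶ AbV ≫ L2G ≫ Am)
    (brl : KF ≫ AbU ⟶ AbV ≫ L2F)
    (hγl : γlG = k'.hom ▷ Am ⊗≫ KF ◁ γl ⊗≫ brl ▷ (L2X ≫ Am) ⊗≫ AbV ◁ (l2.inv ▷ Am))
    (RV : bVA ≫ eV ≫ AbV ⟶ aV ≫ BV ≫ cV) (RU : bUA ≫ eU ≫ AbU ⟶ aU ≫ BU ≫ cU)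
    (n : F2 ≫ aU ≫ BU ≫ cU ⟶ aV ≫ BV ≫ cV ≫ L2F)
    (h5 : F2 ◁ RU ≫ n =
      𝟙 (F2 ≫ bUA ≫ eU ≫ AbU) ⊗≫ brr ▷ (eU ≫ AbU) ⊗≫ bVA ◁ (aMF ▷ AbU) ⊗≫ (bVA ≫ eV) ◁ brl ⊗≫
        RV ▷ L2F ⊗≫ 𝟙 (aV ≫ BV ≫ cV ≫ L2F)) :
    𝟙 (G2 ≫ mA ≫ m) ⊗≫ γrG ▷ m ⊗≫ (bVA ≫ HG) ◁ MA ⊗≫ bVA ◁ (aMG ▷ (Am ≫ m)) ⊗≫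
      (bVA ≫ eV) ◁ (γlG ▷ m) ⊗≫ RV ▷ (L2G ≫ Am ≫ m) ⊗≫ 𝟙 (aV ≫ BV ≫ cV ≫ L2G ≫ Am ≫ m) =
    𝟙 (G2 ≫ mA ≫ m) ⊗≫ s.hom ▷ (mA ≫ m) ⊗≫ F2 ◁
      (𝟙 (X2 ≫ mA ≫ m) ⊗≫ γr ▷ m ⊗≫ (bUA ≫ HX) ◁ MA ⊗≫ bUA ◁ (aMX ▷ (Am ≫ m)) ⊗≫
      (bUA ≫ eU) ◁ (γl ▷ m) ⊗≫ RU ▷ (L2X ≫ Am ≫ m) ⊗≫ 𝟙 (aU ≫ BU ≫ cU ≫ L2X ≫ Am ≫ m)) ⊗≫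
      n ▷ (L2X ≫ Am ≫ m) ⊗≫
      (aV ≫ BV ≫ cV) ◁ (l2.inv ▷ (Am ≫ m)) ⊗≫ 𝟙 (aV ≫ BV ≫ cV ≫ L2G ≫ Am ≫ m) := by
  symm
  calc
    _ = 𝟙 _ ⊗≫ s.hom ▷ (mA ≫ m) ⊗≫ F2 ◁ (γr ▷ m) ⊗≫ (F2 ≫ bUA ≫ HX) ◁ MA ⊗≫
      (F2 ≫ bUA) ◁ (aMX ▷ (Am ≫ m)) ⊗≫ (F2 ≫ bUA ≫ eU) ◁ (γl ▷ m) ⊗≫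
      (F2 ◁ RU ≫ n) ▷ (L2X ≫ Am ≫ m) ⊗≫
      (aV ≫ BV ≫ cV) ◁ (l2.inv ▷ (Am ≫ m)) ⊗≫ 𝟙 (aV ≫ BV ≫ cV ≫ L2G ≫ Am ≫ m) := by
        bicategory
    _ = 𝟙 _ ⊗≫ s.hom ▷ (mA ≫ m) ⊗≫ F2 ◁ (γr ▷ m) ⊗≫ ((F2 ≫ bUA) ◁ (𝟙 (HX ≫ mA ≫ m) ⊗≫
      HX ◁ MA ⊗≫ aMX ▷ (Am ≫ m) ⊗≫ eU ◁ (γl ▷ m) ⊗≫ 𝟙 (eU ≫ AbU ≫ L2X ≫ Am ≫ m)) ≫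
      brr ▷ (eU ≫ AbU ≫ L2X ≫ Am ≫ m)) ⊗≫
      bVA ◁ (aMF ▷ (AbU ≫ L2X ≫ Am ≫ m)) ⊗≫ (bVA ≫ eV) ◁ (brl ▷ (L2X ≫ Am ≫ m)) ⊗≫
        (RV ▷ ((L2F ≫ L2X) ≫ Am ≫ m) ≫
      (aV ≫ BV ≫ cV) ◁ (l2.inv ▷ (Am ≫ m))) ⊗≫ 𝟙 (aV ≫ BV ≫ cV ≫ L2G ≫ Am ≫ m) := by
        rw [h5]; bicategory
    _ = 𝟙 _ ⊗≫ s.hom ▷ (mA ≫ m) ⊗≫ F2 ◁ (γr ▷ m) ⊗≫ brr ▷ (HX ≫ mA ≫ m) ⊗≫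
      (bVA ≫ HF ≫ HX) ◁ MA ⊗≫ (bVA ≫ HF) ◁ (aMX ▷ (Am ≫ m)) ⊗≫
      bVA ◁ ((HF ≫ eU) ◁ (γl ▷ m) ≫ aMF ▷ ((AbU ≫ L2X ≫ Am) ≫ m)) ⊗≫
      (bVA ≫ eV) ◁ (brl ▷ (L2X ≫ Am ≫ m)) ⊗≫
      (bVA ≫ eV ≫ AbV) ◁ (l2.inv ▷ (Am ≫ m)) ⊗≫
        RV ▷ (L2G ≫ Am ≫ m) ⊗≫ 𝟙 (aV ≫ BV ≫ cV ≫ L2G ≫ Am ≫ m) := by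
        rw [whisker_exchange brr, ← whisker_exchange RV]; bicategory
    _ = 𝟙 _ ⊗≫ s.hom ▷ (mA ≫ m) ⊗≫ F2 ◁ (γr ▷ m) ⊗≫ brr ▷ (HX ≫ mA ≫ m) ⊗≫
      bVA ◁ ((k.inv ≫ k.hom) ▷ (mA ≫ m)) ⊗≫ (bVA ≫ HF ≫ HX) ◁ MA ⊗≫ (bVA ≫ HF) ◁ (aMX ▷ (Am ≫ m)) ⊗≫
      bVA ◁ (aMF ▷ (KX ≫ Am ≫ m)) ⊗≫
      (bVA ≫ eV) ◁ ((k'.inv ≫ k'.hom) ▷ (Am ≫ m)) ⊗≫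
      (bVA ≫ eV ≫ KF) ◁ (γl ▷ m) ⊗≫
      (bVA ≫ eV) ◁ (brl ▷ (L2X ≫ Am ≫ m)) ⊗≫
      (bVA ≫ eV ≫ AbV) ◁ (l2.inv ▷ (Am ≫ m)) ⊗≫
        RV ▷ (L2G ≫ Am ≫ m) ⊗≫ 𝟙 (aV ≫ BV ≫ cV ≫ L2G ≫ Am ≫ m) := by
        simp only [Iso.inv_hom_id]
        rw [whisker_exchange aMF]; bicategory
    _ = 𝟙 _ ⊗≫ s.hom ▷ (mA ≫ m) ⊗≫ F2 ◁ (γr ▷ m) ⊗≫ brr ▷ (HX ≫ mA ≫ m) ⊗≫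
      bVA ◁ (k.inv ▷ (mA ≫ m)) ⊗≫
      bVA ◁ (k.hom ▷ (mA ≫ m) ≫ (HF ≫ HX) ◁ MA) ⊗≫ (bVA ≫ HF) ◁ (aMX ▷ (Am ≫ m)) ⊗≫
      bVA ◁ (aMF ▷ (KX ≫ Am ≫ m)) ⊗≫
      (bVA ≫ eV) ◁ ((k'.inv ≫ k'.hom) ▷ (Am ≫ m)) ⊗≫
      (bVA ≫ eV ≫ KF) ◁ (γl ▷ m) ⊗≫
      (bVA ≫ eV) ◁ (brl ▷ (L2X ≫ Am ≫ m)) ⊗≫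
      (bVA ≫ eV ≫ AbV) ◁ (l2.inv ▷ (Am ≫ m)) ⊗≫
        RV ▷ (L2G ≫ Am ≫ m) ⊗≫ 𝟙 (aV ≫ BV ≫ cV ≫ L2G ≫ Am ≫ m) := by
        bicategory
    _ = _ := by
        rw [← whisker_exchange k.hom, hγr, hM, hγl]; bicategory

theorem sqVComp_hom {X X' X'' Y Y' Y'' : B} {p : X ⟶ X'} {p' : X' ⟶ X''} {e : X ⟶ Y} {e' : X' ⟶ Y'}
    {e'' : X'' ⟶ Y''} {q : Y ⟶ Y'} {q' : Y' ⟶ Y''}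
    (s : p ≫ e' ≅ e ≫ q) (t : p' ≫ e'' ≅ e' ≫ q') :
    (sqVComp s t).hom = (α_ p p' e'').hom ≫ p ◁ t.hom ≫ (α_ p e' q').inv ≫ s.hom ▷ q' ≫
      (α_ e q q').hom := rfl

end Abs

section TensorLemmas

open TensorBicategory

variable {B : Type u} [Bicategory.{w, v} B] [TensorBicategory B]

/-- The tensor product of two 2-cells into composites, followed by the comparison. -/
def tSplit {X X' X'' Y Y' Y'' : B} {p : X ⟶ X''} {f : X ⟶ X'} {f' : X' ⟶ X''}
    {q : Y ⟶ Y''} {g : Y ⟶ Y'} {g' : Y' ⟶ Y''} (a : p ⟶ f ≫ f') (b : q ⟶ g ≫ g') :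
    p ⊠₁ q ⟶ f ⊠₁ g ≫ f' ⊠₁ g' :=
  a ⊠₂ b ≫ (tComp f f' g g').hom

section
variable {X X' X'' X''' Y Y' Y'' Y''' : B} {p p' : X ⟶ X''} {f f₁ : X ⟶ X'} {f' f₁' : X' ⟶ X''}
    {q q' : Y ⟶ Y''} {g g₁ : Y ⟶ Y'} {g' g₁' : Y' ⟶ Y''}

theorem tSplit_pre (η : p ⟶ p') (θ : q ⟶ q') (a : p' ⟶ f ≫ f') (b : q' ⟶ g ≫ g') :
    (η ⊠₂ θ) ≫ tSplit a b = tSplit (η ≫ a) (θ ≫ b) := by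
  simp [tSplit, tHom₂_comp]

theorem tSplit_right (a : p ⟶ f ≫ f') (b : q ⟶ g ≫ g') (η : f ⟶ f₁) (θ : g ⟶ g₁) :
    tSplit a b ≫ (η ⊠₂ θ) ▷ (f' ⊠₁ g') = tSplit (a ≫ η ▷ f') (b ≫ θ ▷ g') := by
  simp [tSplit, tHom₂_comp, tHom₂_whiskerRight]

theorem tSplit_left (a : p ⟶ f ≫ f') (b : q ⟶ g ≫ g') (η : f' ⟶ f₁') (θ : g' ⟶ g₁') :
    tSplit a b ≫ (f ⊠₁ g) ◁ (η ⊠₂ θ) = tSplit (a ≫ f ◁ η) (b ≫ g ◁ θ) := by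
  simp [tSplit, tHom₂_comp, tHom₂_whiskerLeft]

theorem tSplit_unit {p f' : X ⟶ X''} {q g' : Y ⟶ Y''} (a : p ⟶ 𝟙 X ≫ f') (b : q ⟶ 𝟙 Y ≫ g') :
    tSplit a b ≫ (tId X Y).hom ▷ (f' ⊠₁ g') ≫ (λ_ (f' ⊠₁ g')).hom =
      (a ≫ (λ_ f').hom) ⊠₂ (b ≫ (λ_ g').hom) := by
  simp [tSplit, tHom₂_comp, tHom₂_leftUnitor]

theorem tSplit_unit_right {p f' : X ⟶ X''} {q g' : Y ⟶ Y''} (a : p ⟶ f' ≫ 𝟙 X'')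
    (b : q ⟶ g' ≫ 𝟙 Y'') :
    tSplit a b ≫ (f' ⊠₁ g') ◁ (tId X'' Y'').hom ≫ (ρ_ (f' ⊠₁ g')).hom =
      (a ≫ (ρ_ f').hom) ⊠₂ (b ≫ (ρ_ g').hom) := by
  simp [tSplit, tHom₂_comp, tHom₂_rightUnitor]

theorem tSplit_assoc {P : X ⟶ X'''} {Q : Y ⟶ Y'''} {e : X'' ⟶ X'''} {k : Y'' ⟶ Y'''}
    {u : X' ⟶ X'''} {v : Y' ⟶ Y'''}
    (a : P ⟶ p ≫ e) (b : Q ⟶ q ≫ k) (c : p ⟶ f ≫ f') (d : q ⟶ g ≫ g')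
    (a' : P ⟶ f ≫ u) (b' : Q ⟶ g ≫ v) (c' : u ⟶ f' ≫ e) (d' : v ⟶ g' ≫ k)
    (h₁ : a ≫ c ▷ e ≫ (α_ _ _ _).hom = a' ≫ f ◁ c')
    (h₂ : b ≫ d ▷ k ≫ (α_ _ _ _).hom = b' ≫ g ◁ d') :
    tSplit a b ≫ tSplit c d ▷ (e ⊠₁ k) ≫ (α_ _ _ _).hom =
      tSplit a' b' ≫ (f ⊠₁ g) ◁ tSplit c' d' := by
  have e₁ : tSplit a b ≫ tSplit c d ▷ (e ⊠₁ k) ≫ (α_ _ _ _).hom =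
      tSplit (a ≫ c ▷ e) (b ≫ d ▷ k) ≫ (tComp f f' g g').hom ▷ (e ⊠₁ k) ≫ (α_ _ _ _).hom := by
    rw [← tSplit_right]; simp [tSplit]
  have e₂ : tSplit a' b' ≫ (f ⊠₁ g) ◁ tSplit c' d' =
      tSplit (a' ≫ f ◁ c') (b' ≫ g ◁ d') ≫ (f ⊠₁ g) ◁ (tComp f' e g' k).hom := by
    rw [← tSplit_left]; simp [tSplit]
  rw [e₁, e₂, ← h₁, ← h₂]
  have h := tHom₂_associator f f' e g g' k
  simp only [tSplit, ← Category.assoc a, ← Category.assoc b]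
  rw [tHom₂_comp (a ≫ c ▷ e), h]
  simp
end

@[simp] theorem tIso_hom {X X' Y Y' : B} {f f' : X ⟶ X'} {g g' : Y ⟶ Y'} (η : f ≅ f')
    (θ : g ≅ g') : (tIso η θ).hom = η.hom ⊠₂ θ.hom := rfl

@[simp] theorem tIso_inv {X X' Y Y' : B} {f f' : X ⟶ X'} {g g' : Y ⟶ Y'} (η : f ≅ f')
    (θ : g ≅ g') : (tIso η θ).inv = η.inv ⊠₂ θ.inv := rfl

theorem rwComp_hom {X X' X'' : B} (f : X ⟶ X') (g : X' ⟶ X'') (Y : B) :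
    (rwComp f g Y).hom = tSplit (𝟙 _) (λ_ (𝟙 Y)).inv := rfl

theorem lwComp_hom (X : B) {Y Y' Y'' : B} (f : Y ⟶ Y') (g : Y' ⟶ Y'') :
    (lwComp X f g).hom = tSplit (λ_ (𝟙 X)).inv (𝟙 _) := rfl


/-- `tSplit` for isomorphisms. -/
def tSplitIso {X X' X'' Y Y' Y'' : B} {p : X ⟶ X''} {f : X ⟶ X'} {f' : X' ⟶ X''}
    {q : Y ⟶ Y''} {g : Y ⟶ Y'} {g' : Y' ⟶ Y''} (a : p ≅ f ≫ f') (b : q ≅ g ≫ g') :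
    p ⊠₁ q ≅ f ⊠₁ g ≫ f' ⊠₁ g' :=
  tIso a b ≪≫ tComp f f' g g'

theorem tSplitIso_hom {X X' X'' Y Y' Y'' : B} {p : X ⟶ X''} {f : X ⟶ X'} {f' : X' ⟶ X''}
    {q : Y ⟶ Y''} {g : Y ⟶ Y'} {g' : Y' ⟶ Y''} (a : p ≅ f ≫ f') (b : q ≅ g ≫ g') :
    (tSplitIso a b).hom = tSplit a.hom b.hom := rfl

theorem interchange_spec {X X' Y Y' : B} (f : X ⟶ X') (g : Y ⟶ Y') :
    tSplit (ρ_ f).inv (λ_ g).inv ≫ (interchange f g).hom = tSplit (λ_ f).inv (ρ_ g).inv := by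
  simp only [tSplit, interchange, Iso.trans_hom, Iso.symm_hom, tIso_hom, Category.assoc,
    Iso.hom_inv_id_assoc]
  rw [← Category.assoc, ← tHom₂_comp]
  simp

theorem interchange_comp_left {X X' X'' Y Y' : B} (f : X ⟶ X') (x : X' ⟶ X'') (g : Y ⟶ Y') :
    (interchange (f ≫ x) g).hom = (rwComp f x Y).hom ▷ X'' ◁₁ g ⊗≫
      f ▷₁ Y ◁ (interchange x g).hom ⊗≫ (interchange f g).hom ▷ x ▷₁ Y' ⊗≫
      X ◁₁ g ◁ (rwComp f x Y').inv := by
  rw [← cancel_epi (tSplitIso (ρ_ (f ≫ x)).symm (λ_ g).symm).hom, tSplitIso_hom, Iso.symm_hom,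
    Iso.symm_hom, interchange_spec]
  rw [← cancel_mono (X ◁₁ g ◁ (rwComp f x Y').hom)]
  have h₁ := tSplit_assoc (ρ_ (f ≫ x)).inv (λ_ g).inv (𝟙 (f ≫ x)) (λ_ (𝟙 Y)).inv
    (𝟙 (f ≫ x)) (λ_ g).inv (ρ_ x).inv (λ_ g).inv (by simp) (by simp)
  have h₂ := tSplit_assoc (𝟙 (f ≫ x)) (ρ_ g).inv (ρ_ f).inv (λ_ g).inv
    (𝟙 (f ≫ x)) (λ_ g).inv (λ_ x).inv (ρ_ g).inv (by simp) (by simp)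
  have h₃ := tSplit_assoc (𝟙 (f ≫ x)) (ρ_ g).inv (λ_ f).inv (ρ_ g).inv
    (λ_ (f ≫ x)).inv (ρ_ g).inv (𝟙 (f ≫ x)) (λ_ (𝟙 Y')).inv (by simp) (by simp)
  rw [rwComp_hom, ← h₃, rwComp_hom, ← interchange_spec f g]
  calc
    _ = (tSplit (𝟙 (f ≫ x)) (ρ_ g).inv ≫ tSplit (ρ_ f).inv (λ_ g).inv ▷ x ▷₁ Y' ≫ (α_ _ _ _).hom) ≫
        (α_ _ _ _).inv ≫ (interchange f g).hom ▷ x ▷₁ Y' ≫ (α_ _ _ _).hom := by simp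
    _ = tSplit (𝟙 (f ≫ x)) (λ_ g).inv ≫
        f ▷₁ Y ◁ (tSplit (ρ_ x).inv (λ_ g).inv ≫ (interchange x g).hom) ≫
        (α_ _ _ _).inv ≫ (interchange f g).hom ▷ x ▷₁ Y' ≫ (α_ _ _ _).hom := by
      rw [h₂, interchange_spec]; simp
    _ = (tSplit (𝟙 (f ≫ x)) (λ_ g).inv ≫
        f ▷₁ Y ◁ tSplit (ρ_ x).inv (λ_ g).inv) ≫ f ▷₁ Y ◁ (interchange x g).hom ≫
        (α_ _ _ _).inv ≫ (interchange f g).hom ▷ x ▷₁ Y' ≫ (α_ _ _ _).hom := by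
      simp
    _ = _ := by
      rw [← h₁]
      have : X ◁₁ g ◁ (rwComp f x Y').inv ≫ X ◁₁ g ◁ tSplit (𝟙 (f ≫ x)) (λ_ (𝟙 Y')).inv =
          𝟙 _ := by
        rw [← rwComp_hom, whiskerLeft_inv_hom]
      simp [-unitors_equal, -unitors_inv_equal, bicategoricalComp, this]

theorem interchange_comp_right {X X' Y Y' Y'' : B} (g : X ⟶ X') (f : Y ⟶ Y') (x : Y' ⟶ Y'') :
    (interchange g (f ≫ x)).hom = g ▷₁ Y ◁ (lwComp X' f x).hom ⊗≫
      (interchange g f).hom ▷ X' ◁₁ x ⊗≫ X ◁₁ f ◁ (interchange g x).hom ⊗≫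
      (lwComp X f x).inv ▷ g ▷₁ Y'' := by
  rw [← cancel_epi (tSplitIso (ρ_ g).symm (λ_ (f ≫ x)).symm).hom, tSplitIso_hom, Iso.symm_hom,
    Iso.symm_hom, interchange_spec]
  rw [← cancel_mono ((lwComp X f x).hom ▷ g ▷₁ Y''), ← cancel_mono (α_ _ _ _).hom]
  have h₁ := tSplit_assoc (ρ_ g).inv (𝟙 (f ≫ x)) (ρ_ g).inv (λ_ f).inv
    (ρ_ g).inv (λ_ (f ≫ x)).inv (λ_ (𝟙 X')).inv (𝟙 (f ≫ x)) (by simp) (by simp)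
  have h₂ := tSplit_assoc (ρ_ g).inv (𝟙 (f ≫ x)) (λ_ g).inv (ρ_ f).inv
    (λ_ g).inv (𝟙 (f ≫ x)) (ρ_ g).inv (λ_ x).inv (by simp) (by simp)
  have h₃ := tSplit_assoc (λ_ g).inv (ρ_ (f ≫ x)).inv (λ_ (𝟙 X)).inv (𝟙 (f ≫ x))
    (λ_ g).inv (𝟙 (f ≫ x)) (λ_ g).inv (ρ_ x).inv (by simp) (by simp)
  simp only [Category.assoc]
  rw [lwComp_hom, h₃, lwComp_hom, ← interchange_spec g x]
  calc
    _ = (tSplit (λ_ g).inv (𝟙 (f ≫ x)) ≫ X ◁₁ f ◁ tSplit (ρ_ g).inv (λ_ x).inv) ≫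
        X ◁₁ f ◁ (interchange g x).hom := by simp
    _ = tSplit (ρ_ g).inv (𝟙 (f ≫ x)) ≫
        (tSplit (ρ_ g).inv (λ_ f).inv ≫ (interchange g f).hom) ▷ X' ◁₁ x ≫ (α_ _ _ _).hom ≫
        X ◁₁ f ◁ (interchange g x).hom := by
      rw [← h₂, interchange_spec]; simp
    _ = (tSplit (ρ_ g).inv (𝟙 (f ≫ x)) ≫
        tSplit (ρ_ g).inv (λ_ f).inv ▷ X' ◁₁ x ≫ (α_ _ _ _).hom) ≫ (α_ _ _ _).inv ≫
        (interchange g f).hom ▷ X' ◁₁ x ≫ (α_ _ _ _).hom ≫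
        X ◁₁ f ◁ (interchange g x).hom := by
      simp
    _ = _ := by
      rw [h₁]
      have : (lwComp X f x).inv ▷ g ▷₁ Y'' ≫ tSplit (λ_ (𝟙 X)).inv (𝟙 (f ≫ x)) ▷ g ▷₁ Y'' =
          𝟙 _ := by
        rw [← lwComp_hom, inv_hom_whiskerRight]
      simp [-unitors_equal, -unitors_inv_equal, bicategoricalComp, reassoc_of% this]

/-- The pseudofunctor `- ⊠ Y`. -/
def rwPf (Y : B) : B ⥤ᵖ B where
  obj X := X ⊠ Y
  map f := f ▷₁ Y
  map₂ η := η ⊠₂ 𝟙 (𝟙 Y)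
  map₂_id f := tHom₂_id _ _
  map₂_comp η θ := by rw [← tHom₂_comp, Category.comp_id]
  mapId X := tId X Y
  mapComp f g := rwComp f g Y
  map₂_whisker_left f g h η := by
    rw [← Category.assoc, Iso.eq_comp_inv, rwComp_hom, rwComp_hom, tSplit_pre, tSplit_left]
    simp
  map₂_whisker_right η h := by
    rw [← Category.assoc, Iso.eq_comp_inv, rwComp_hom, rwComp_hom, tSplit_pre, tSplit_right]
    simp
  map₂_associator f g h := by
    have h₁ := tSplit_assoc (𝟙 ((f ≫ g) ≫ h)) (λ_ (𝟙 Y)).inv (𝟙 (f ≫ g)) (λ_ (𝟙 Y)).inv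
      ((α_ f g h).hom) (λ_ (𝟙 Y)).inv (𝟙 (g ≫ h)) (λ_ (𝟙 Y)).inv (by simp) (by simp)
    have h₂ : tSplit (α_ f g h).hom (λ_ (𝟙 Y)).inv =
        ((α_ f g h).hom ⊠₂ 𝟙 (𝟙 Y)) ≫ (rwComp f (g ≫ h) Y).hom := by
      rw [rwComp_hom, tSplit_pre]; simp
    rw [h₂, ← rwComp_hom, ← rwComp_hom, ← rwComp_hom] at h₁
    have h₃ := congrArg (fun x => x ≫ f ▷₁ Y ◁ (rwComp g h Y).inv ≫ (rwComp f (g ≫ h) Y).inv) h₁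
    simpa using h₃.symm
  map₂_left_unitor f := by
    rw [rwComp_hom, tSplit_unit]; simp
  map₂_right_unitor f := by
    have h := tSplit_unit_right (𝟙 (f ≫ 𝟙 _)) (λ_ (𝟙 Y)).inv
    rw [rwComp_hom, h]; simp

/-- The pseudofunctor `X ⊠ -`. -/
def lwPf (X : B) : B ⥤ᵖ B where
  obj Y := X ⊠ Y
  map f := X ◁₁ f
  map₂ η := 𝟙 (𝟙 X) ⊠₂ η
  map₂_id f := tHom₂_id _ _
  map₂_comp η θ := by rw [← tHom₂_comp, Category.comp_id]
  mapId Y := tId X Y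
  mapComp f g := lwComp X f g
  map₂_whisker_left f g h η := by
    rw [← Category.assoc, Iso.eq_comp_inv, lwComp_hom, lwComp_hom, tSplit_pre, tSplit_left]
    simp
  map₂_whisker_right η h := by
    rw [← Category.assoc, Iso.eq_comp_inv, lwComp_hom, lwComp_hom, tSplit_pre, tSplit_right]
    simp
  map₂_associator f g h := by
    have h₁ := tSplit_assoc (λ_ (𝟙 X)).inv (𝟙 ((f ≫ g) ≫ h)) (λ_ (𝟙 X)).inv (𝟙 (f ≫ g))
      (λ_ (𝟙 X)).inv ((α_ f g h).hom) (λ_ (𝟙 X)).inv (𝟙 (g ≫ h)) (by simp) (by simp)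
    have h₂ : tSplit (λ_ (𝟙 X)).inv (α_ f g h).hom =
        (𝟙 (𝟙 X) ⊠₂ (α_ f g h).hom) ≫ (lwComp X f (g ≫ h)).hom := by
      rw [lwComp_hom, tSplit_pre]; simp
    rw [h₂, ← lwComp_hom, ← lwComp_hom, ← lwComp_hom] at h₁
    have h₃ := congrArg (fun x => x ≫ X ◁₁ f ◁ (lwComp X g h).inv ≫ (lwComp X f (g ≫ h)).inv) h₁
    simpa using h₃.symm
  map₂_left_unitor f := by
    rw [lwComp_hom, tSplit_unit]; simp
  map₂_right_unitor f := by
    have h := tSplit_unit_right (λ_ (𝟙 X)).inv (𝟙 (f ≫ 𝟙 _))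
    rw [lwComp_hom, h]; simp

end TensorLemmas

section

variable {B : Type u₁} [Bicategory.{w₁, v₁} B] {C : Type u₂} [Bicategory.{w₂, v₂} C] (G : B ⥤ᵖ C)

/-- A pseudofunctor applied to a pasting of the shape of `restrictCell`. -/
theorem map₂₃_paste {V U A A' W W' Z : B} {r : V ⟶ A} {f : V ⟶ U} {x : U ⟶ A} {m : A ⟶ Z}
    {bV : V ⟶ W} {bU : U ⟶ W'} {l : W ⟶ A'} {f' : W ⟶ W'} {x' : W' ⟶ A'} {m' : A' ⟶ Z}
    (ρ : r ≅ f ≫ x) (μ : l ≅ f' ≫ x') (γ : x ≫ m ≅ bU ≫ x' ≫ m') (β : f ≫ bU ≅ bV ≫ f')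
    (γ' : r ≫ m ≅ bV ≫ l ≫ m')
    (h : γ'.hom = ρ.hom ▷ m ⊗≫ f ◁ γ.hom ⊗≫ β.hom ▷ (x' ≫ m') ⊗≫ bV ◁ (μ.inv ▷ m')) :
    (map₂₃ G γ').hom = (G.map₂Iso ρ ≪≫ G.mapComp f x).hom ▷ G.map m ⊗≫
      G.map f ◁ (map₂₃ G γ).hom ⊗≫
      ((G.mapComp f bU).symm ≪≫ G.map₂Iso β ≪≫ G.mapComp bV f').hom ▷
        (G.map x' ≫ G.map m') ⊗≫
      G.map bV ◁ ((G.map₂Iso μ ≪≫ G.mapComp f' x').inv ▷ G.map m') := by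
  simp only [map₂₃, mapComp₃, Iso.trans_hom, Iso.symm_hom, PrelaxFunctor.map₂Iso_hom, h,
    bicategoricalComp]
  simp
  rw [G.mapComp_assoc_left_hom_assoc]
  have e : (G.mapComp f (bU ≫ x' ≫ m')).inv ≫ G.map₂ (α_ f bU (x' ≫ m')).inv ≫
      (G.mapComp (f ≫ bU) (x' ≫ m')).hom = G.map f ◁ (G.mapComp bU (x' ≫ m')).hom ≫
        (α_ (G.map f) (G.map bU) (G.map (x' ≫ m'))).inv ≫
          (G.mapComp f bU).inv ▷ G.map (x' ≫ m') := by
    rw [Iso.inv_comp_eq, G.mapComp_assoc_right_hom_assoc]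
    simp
  rw [← G.map₂_comp_assoc (α_ (f ≫ bU) x' m').inv, Iso.inv_hom_id, G.map₂_id, Category.id_comp,
    reassoc_of% e, ← whisker_exchange_assoc]
  simp
end

section Constraints

open TensorBicategory ConstraintBicategory

variable {B : Type u} [Bicategory.{w, v} B] [ConstraintBicategory B]

theorem assocNat_split {X X' X'' Y Y' Y'' Z Z' Z'' : B} {p : X ⟶ X''} {f : X ⟶ X'}
    {f' : X' ⟶ X''} {q : Y ⟶ Y''} {g : Y ⟶ Y'} {g' : Y' ⟶ Y''} {r : Z ⟶ Z''} {h : Z ⟶ Z'}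
    {h' : Z' ⟶ Z''} (a : p ⟶ f ≫ f') (b : q ⟶ g ≫ g') (c : r ⟶ h ≫ h') :
    (assocNat p q r).hom ≫ as X Y Z ◁ tSplit a (tSplit b c) =
      tSplit (tSplit a b) c ▷ as X'' Y'' Z'' ≫
        (sqVComp (assocNat f g h) (assocNat f' g' h')).hom := by
  have e₁ : tSplit a (tSplit b c) = (a ⊠₂ (b ⊠₂ c)) ≫
      (𝟙 (f ≫ f') ⊠₂ (tComp g g' h h').hom ≫ (tComp f f' (g ⊠₁ h) (g' ⊠₁ h')).hom) := by
    simp only [tSplit, ← Category.assoc, ← tHom₂_comp, Category.comp_id]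
  have e₂ : tSplit (tSplit a b) c = ((a ⊠₂ b) ⊠₂ c) ≫
      ((tComp f f' g g').hom ⊠₂ 𝟙 (h ≫ h') ≫ (tComp (f ⊠₁ g) (f' ⊠₁ g') h h').hom) := by
    simp only [tSplit, ← Category.assoc, ← tHom₂_comp, Category.comp_id]
  rw [e₁, e₂, whiskerLeft_comp, comp_whiskerRight, Category.assoc, ← assocNat_comp,
    reassoc_of% assocNat_naturality]

theorem asM_comp (X : B) {Y Y' Y'' : B} (f : Y ⟶ Y') (x : Y' ⟶ Y'') (Z : B) :
    (asM X (f ≫ x) Z).hom = (rwIso (lwComp X f x) Z ≪≫ rwComp (X ◁₁ f) (X ◁₁ x) Z).hom ▷ as X Y'' Z ⊗≫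
      (X ◁₁ f) ▷₁ Z ◁ (asM X x Z).hom ⊗≫ (asM X f Z).hom ▷ X ◁₁ (x ▷₁ Z) ⊗≫
      as X Y Z ◁ (lwIso X (rwComp f x Z) ≪≫ lwComp X (f ▷₁ Z) (x ▷₁ Z)).inv := by
  rw [← cancel_mono (as X Y Z ◁ (lwIso X (rwComp f x Z) ≪≫ lwComp X (f ▷₁ Z) (x ▷₁ Z)).hom)]
  have h := assocNat_split (λ_ (𝟙 X)).inv (𝟙 (f ≫ x)) (λ_ (𝟙 Z)).inv
  have e₁ : (rwIso (lwComp X f x) Z ≪≫ rwComp (X ◁₁ f) (X ◁₁ x) Z).hom =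
      tSplit (tSplit (λ_ (𝟙 X)).inv (𝟙 (f ≫ x))) (λ_ (𝟙 Z)).inv := by
    simp only [Iso.trans_hom, rwIso, tIso_hom, rwComp_hom, tSplit_pre, lwComp_hom, Iso.refl_hom,
      Category.comp_id, Category.id_comp]
  have e₂ : (lwIso X (rwComp f x Z) ≪≫ lwComp X (f ▷₁ Z) (x ▷₁ Z)).hom =
      tSplit (λ_ (𝟙 X)).inv (tSplit (𝟙 (f ≫ x)) (λ_ (𝟙 Z)).inv) := by
    simp only [Iso.trans_hom, lwIso, tIso_hom, rwComp_hom, tSplit_pre, lwComp_hom, Iso.refl_hom,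
      Category.comp_id, Category.id_comp]
  rw [← e₁, ← e₂] at h
  simp only [asM]
  rw [h, sqVComp_hom]
  simp [-whiskerLeft_comp, bicategoricalComp, ← whiskerLeft_comp]

theorem asL_comp {X X' X'' : B} (f : X ⟶ X') (x : X' ⟶ X'') (Y Z : B) :
    (asL (f ≫ x) Y Z).hom = (rwIso (rwComp f x Y) Z ≪≫ rwComp (f ▷₁ Y) (x ▷₁ Y) Z).hom ▷ as X'' Y Z ⊗≫
      f ▷₁ Y ▷₁ Z ◁ (asL x Y Z).hom ⊗≫ (asL f Y Z).hom ▷ x ▷₁ (Y ⊠ Z) ⊗≫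
      as X Y Z ◁ (rwComp f x (Y ⊠ Z)).inv := by
  rw [← cancel_mono (as X Y Z ◁ (rwComp f x (Y ⊠ Z)).hom)]
  have h := assocNat_split (𝟙 (f ≫ x)) (λ_ (𝟙 Y)).inv (λ_ (𝟙 Z)).inv
  have e₁ : (rwIso (rwComp f x Y) Z ≪≫ rwComp (f ▷₁ Y) (x ▷₁ Y) Z).hom =
      tSplit (tSplit (𝟙 (f ≫ x)) (λ_ (𝟙 Y)).inv) (λ_ (𝟙 Z)).inv := by
    simp only [Iso.trans_hom, rwIso, tIso_hom, rwComp_hom, tSplit_pre, Iso.refl_hom,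
      Category.comp_id, Category.id_comp]
  have e₃ : tSplit (λ_ (𝟙 Y)).inv (λ_ (𝟙 Z)).inv ≫ (tId Y Z).hom ▷ (𝟙 Y ⊠₁ 𝟙 Z) ≫
      𝟙 (Y ⊠ Z) ◁ (tId Y Z).hom = (tId Y Z).hom ≫ (λ_ (𝟙 (Y ⊠ Z))).inv := by
    have := tSplit_unit (λ_ (𝟙 Y)).inv (λ_ (𝟙 Z)).inv
    rw [Iso.inv_hom_id, Iso.inv_hom_id, tHom₂_id] at this
    rw [id_whiskerLeft, reassoc_of% this]
  have e₂ : (𝟙 (f ≫ x) ⊠₂ (tId Y Z).hom) ≫ (rwComp f x (Y ⊠ Z)).hom =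
      tSplit (𝟙 (f ≫ x)) (tSplit (λ_ (𝟙 Y)).inv (λ_ (𝟙 Z)).inv) ≫
        (𝟙 f ⊠₂ (tId Y Z).hom) ▷ (x ⊠₁ (𝟙 Y ⊠₁ 𝟙 Z)) ≫ (f ▷₁ (Y ⊠ Z)) ◁ (𝟙 x ⊠₂ (tId Y Z).hom) := by
    rw [reassoc_of% tSplit_right, tSplit_left, rwComp_hom, tSplit_pre]
    simp only [Category.assoc, e₃]
    simp
  rw [← e₁] at h
  generalize (rwIso (rwComp f x Y) Z ≪≫ rwComp (f ▷₁ Y) (x ▷₁ Y) Z).hom = s at *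
  simp only [asL, Iso.trans_hom, whiskerLeftIso_hom, tIso_hom, Iso.refl_hom, Category.assoc]
  rw [← whiskerLeft_comp, e₂, whiskerLeft_comp, reassoc_of% h, sqVComp_hom]
  have e₄ := Iso.inv_hom_id (rwComp f x (Y ⊠ Z))
  generalize (𝟙 f ⊠₂ (tId Y Z).hom) = τ, (𝟙 x ⊠₂ (tId Y Z).hom) = υ,
    (rwComp f x (Y ⊠ Z)).inv = t', (rwComp f x (Y ⊠ Z)).hom = t at *
  symm
  calc
    _ = s ▷ as X'' Y Z ⊗≫ f ▷₁ Y ▷₁ Z ◁ (assocNat x (𝟙 Y) (𝟙 Z)).hom ⊗≫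
        ((f ▷₁ Y ▷₁ Z ≫ as X' Y Z) ◁ υ ≫
          (assocNat f (𝟙 Y) (𝟙 Z)).hom ▷ x ▷₁ (Y ⊠ Z)) ⊗≫
        as X Y Z ◁ τ ▷ x ▷₁ (Y ⊠ Z) ⊗≫ as X Y Z ◁ (t' ≫ t) := by bicategory
    _ = s ▷ as X'' Y Z ⊗≫ f ▷₁ Y ▷₁ Z ◁ (assocNat x (𝟙 Y) (𝟙 Z)).hom ⊗≫
        (assocNat f (𝟙 Y) (𝟙 Z)).hom ▷ (x ⊠₁ (𝟙 Y ⊠₁ 𝟙 Z)) ⊗≫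
        as X Y Z ◁ ((f ⊠₁ (𝟙 Y ⊠₁ 𝟙 Z)) ◁ υ ≫ τ ▷ x ▷₁ (Y ⊠ Z)) := by
      rw [whisker_exchange, e₄]; bicategory
    _ = _ := by
      rw [whisker_exchange]; bicategory

theorem asR_comp (X Y : B) {Z Z' Z'' : B} (f : Z ⟶ Z') (x : Z' ⟶ Z'') :
    (asR X Y (f ≫ x)).hom = (lwComp (X ⊠ Y) f x).hom ▷ as X Y Z'' ⊗≫
      (X ⊠ Y) ◁₁ f ◁ (asR X Y x).hom ⊗≫ (asR X Y f).hom ▷ X ◁₁ Y ◁₁ x ⊗≫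
      as X Y Z ◁ (lwIso X (lwComp Y f x) ≪≫ lwComp X (Y ◁₁ f) (Y ◁₁ x)).inv := by
  rw [← cancel_epi (((tIso (tId X Y) (Iso.refl (f ≫ x))).hom) ▷ as X Y Z''),
    ← cancel_mono (as X Y Z ◁ (lwIso X (lwComp Y f x) ≪≫ lwComp X (Y ◁₁ f) (Y ◁₁ x)).hom)]
  have h := assocNat_split (λ_ (𝟙 X)).inv (λ_ (𝟙 Y)).inv (𝟙 (f ≫ x))
  have e₁ : (lwIso X (lwComp Y f x) ≪≫ lwComp X (Y ◁₁ f) (Y ◁₁ x)).hom =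
      tSplit (λ_ (𝟙 X)).inv (tSplit (λ_ (𝟙 Y)).inv (𝟙 (f ≫ x))) := by
    simp only [Iso.trans_hom, lwIso, tIso_hom, tSplit_pre, lwComp_hom, Iso.refl_hom,
      Category.comp_id, Category.id_comp]
  have e₃ : tSplit (λ_ (𝟙 X)).inv (λ_ (𝟙 Y)).inv ≫ (tId X Y).hom ▷ (𝟙 X ⊠₁ 𝟙 Y) ≫
      𝟙 (X ⊠ Y) ◁ (tId X Y).hom = (tId X Y).hom ≫ (λ_ (𝟙 (X ⊠ Y))).inv := by
    have := tSplit_unit (λ_ (𝟙 X)).inv (λ_ (𝟙 Y)).inv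
    rw [Iso.inv_hom_id, Iso.inv_hom_id, tHom₂_id] at this
    rw [id_whiskerLeft, reassoc_of% this]
  have e₂ : ((tId X Y).hom ⊠₂ 𝟙 (f ≫ x)) ≫ (lwComp (X ⊠ Y) f x).hom =
      tSplit (tSplit (λ_ (𝟙 X)).inv (λ_ (𝟙 Y)).inv) (𝟙 (f ≫ x)) ≫
        ((tId X Y).hom ⊠₂ 𝟙 f) ▷ ((𝟙 X ⊠₁ 𝟙 Y) ⊠₁ x) ≫ ((X ⊠ Y) ◁₁ f) ◁ ((tId X Y).hom ⊠₂ 𝟙 x) := by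
    rw [reassoc_of% tSplit_right, tSplit_left, lwComp_hom, tSplit_pre]
    simp only [Category.assoc, e₃]
    simp
  have e₅ : ∀ {W W' : B} (g : W ⟶ W'),
      ((tId X Y).inv ⊠₂ 𝟙 g) = (tIso (tId X Y) (Iso.refl g)).inv := fun _ => rfl
  have e₆ : ∀ {W W' : B} (g : W ⟶ W'),
      ((tId X Y).hom ⊠₂ 𝟙 g) = (tIso (tId X Y) (Iso.refl g)).hom := fun _ => rfl
  rw [← e₁] at h
  have e₇ := Iso.inv_hom_id (lwIso X (lwComp Y f x) ≪≫ lwComp X (Y ◁₁ f) (Y ◁₁ x))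
  have e₈ : ((tId X Y).hom ⊠₂ 𝟙 (f ≫ x)) ▷ as X Y Z'' ≫ (asR X Y (f ≫ x)).hom =
      (assocNat (𝟙 X) (𝟙 Y) (f ≫ x)).hom := by
    simp only [asR, Iso.trans_hom, whiskerRightIso_hom]
    exact hom_inv_whiskerRight_assoc (tIso (tId X Y) (Iso.refl (f ≫ x))) _ _
  rw [← e₆ (f ≫ x), e₈, h, sqVComp_hom]
  generalize (lwIso X (lwComp Y f x) ≪≫ lwComp X (Y ◁₁ f) (Y ◁₁ x)).hom = t,
    (lwIso X (lwComp Y f x) ≪≫ lwComp X (Y ◁₁ f) (Y ◁₁ x)).inv = t' at *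
  simp only [asR, Iso.trans_hom, whiskerRightIso_hom, tIso_hom, Iso.refl_hom, Iso.symm_hom,
    e₅]
  rw [e₆ f, e₆ x] at e₂
  generalize tIso (tId X Y) (Iso.refl f) = τ, tIso (tId X Y) (Iso.refl x) = υ at *
  generalize tSplit (tSplit (λ_ (𝟙 X)).inv (λ_ (𝟙 Y)).inv) (𝟙 (f ≫ x)) = s at *
  symm
  calc
    _ = (((tId X Y).hom ⊠₂ 𝟙 (f ≫ x)) ≫ (lwComp (X ⊠ Y) f x).hom) ▷ as X Y Z'' ⊗≫
        (X ⊠ Y) ◁₁ f ◁ (υ.inv ▷ as X Y Z'') ⊗≫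
        ((X ⊠ Y) ◁₁ f ◁ (assocNat (𝟙 X) (𝟙 Y) x).hom ⊗≫
        τ.inv ▷ (as X Y Z' ≫ X ◁₁ Y ◁₁ x)) ⊗≫
        (assocNat (𝟙 X) (𝟙 Y) f).hom ▷ X ◁₁ Y ◁₁ x ⊗≫ as X Y Z ◁ (t' ≫ t) := by bicategory
    _ = s ▷ as X Y Z'' ⊗≫ τ.hom ▷ (((𝟙 X ⊠₁ 𝟙 Y) ⊠₁ x) ≫ as X Y Z'') ⊗≫
        (X ⊠ Y) ◁₁ f ◁ ((υ.hom ≫ υ.inv) ▷ as X Y Z'') ⊗≫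
        ((X ⊠ Y) ◁₁ f ◁ (assocNat (𝟙 X) (𝟙 Y) x).hom ≫
        τ.inv ▷ (as X Y Z' ≫ X ◁₁ Y ◁₁ x)) ⊗≫
        (assocNat (𝟙 X) (𝟙 Y) f).hom ▷ X ◁₁ Y ◁₁ x ⊗≫ as X Y Z ◁ (t' ≫ t) := by
      rw [e₂]; bicategory
    _ = s ▷ as X Y Z'' ⊗≫ (τ.hom ≫ τ.inv) ▷ (((𝟙 X ⊠₁ 𝟙 Y) ⊠₁ x) ≫ as X Y Z'') ⊗≫
        ((𝟙 X ⊠₁ 𝟙 Y) ⊠₁ f) ◁ (assocNat (𝟙 X) (𝟙 Y) x).hom ⊗≫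
        (assocNat (𝟙 X) (𝟙 Y) f).hom ▷ X ◁₁ Y ◁₁ x ⊗≫ as X Y Z ◁ (t' ≫ t) := by
      rw [whisker_exchange, Iso.hom_inv_id]; bicategory
    _ = _ := by
      rw [e₇, Iso.hom_inv_id]; bicategory

end Constraints

section
open TensorBicategory
variable {B : Type u} [Bicategory.{w, v} B] [TensorBicategory B]

theorem sqTensor_sqId_right {X X' Y Y' : B} {p : X ⟶ X'} {e : X ⟶ Y} {e' : X' ⟶ Y'} {q : Y ⟶ Y'}
    (s : p ≫ e' ≅ e ≫ q) (Z : B) : (sqTensor s (sqId (𝟙 Z))).hom = (rw₂₂ s Z).hom := by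
  simp only [sqTensor, sqId, rw₂₂, rwComp, rwIso, Iso.trans_hom, Iso.symm_hom, Iso.trans_inv,
    tIso_hom, tIso_inv, Iso.refl_hom, Iso.refl_inv, Iso.symm_inv, Category.assoc]
  slice_rhs 2 4 => rw [← tHom₂_comp, ← tHom₂_comp]
  simp

theorem sqTensor_sqId_left {X X' Y Y' : B} {p : X ⟶ X'} {e : X ⟶ Y} {e' : X' ⟶ Y'} {q : Y ⟶ Y'}
    (s : p ≫ e' ≅ e ≫ q) (Z : B) : (sqTensor (sqId (𝟙 Z)) s).hom = (lw₂₂ Z s).hom := by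
  simp only [sqTensor, sqId, lw₂₂, lwComp, lwIso, Iso.trans_hom, Iso.symm_hom, Iso.trans_inv,
    tIso_hom, tIso_inv, Iso.refl_hom, Iso.refl_inv, Iso.symm_inv, Category.assoc]
  slice_rhs 2 4 => rw [← tHom₂_comp, ← tHom₂_comp]
  simp

end

section Swap

open TensorBicategory ConstraintBicategory MonoidalBicategory SwapBicategory

variable {B : Type u} [Bicategory.{w, v} B] [SwapBicategory B]

theorem braidNat_split {X X' X'' Y Y' Y'' : B} {p : X ⟶ X''} {f : X ⟶ X'}
    {f' : X' ⟶ X''} {q : Y ⟶ Y''} {g : Y ⟶ Y'} {g' : Y' ⟶ Y''}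
    (a : p ⟶ f ≫ f') (b : q ⟶ g ≫ g') :
    (braidNat p q).hom ≫ br X Y ◁ tSplit b a =
      tSplit a b ▷ br X'' Y'' ≫ (sqVComp (braidNat f g) (braidNat f' g')).hom := by
  rw [tSplit, tSplit, whiskerLeft_comp, comp_whiskerRight, Category.assoc, ← braidNat_comp,
    reassoc_of% braidNat_naturality]

theorem br_interchange {V U P Q : B} (f : V ⟶ U) (m : P ⟶ Q) :
    𝟙 (f ▷₁ P ≫ U ◁₁ m ≫ br U Q) ⊗≫ (interchange f m).hom ▷ br U Q ⊗≫
        V ◁₁ m ◁ (brL f Q).hom ⊗≫ (brR V m).hom ▷ Q ◁₁ f ⊗≫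
        br V P ◁ (interchange m f).hom =
      𝟙 (f ▷₁ P ≫ U ◁₁ m ≫ br U Q) ⊗≫ f ▷₁ P ◁ (brR U m).hom ⊗≫
        (brL f P).hom ▷ m ▷₁ U ⊗≫ 𝟙 (br V P ≫ P ◁₁ f ≫ m ▷₁ U) := by
  have h₁ := braidNat_split (ρ_ f).inv (λ_ m).inv
  have h₂ := braidNat_split (λ_ f).inv (ρ_ m).inv
  have e₁ := interchange_spec f m
  have e₂ := interchange_spec m f
  rw [sqVComp_hom] at h₁ h₂
  rw [← cancel_epi (α_ (f ▷₁ P) (U ◁₁ m) (br U Q)).hom,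
    ← cancel_epi ((tSplitIso (ρ_ f).symm (λ_ m).symm).hom ▷ br U Q)]
  calc
    _ = (tSplit (ρ_ f).inv (λ_ m).inv ≫ (interchange f m).hom) ▷ br U Q ≫
        (α_ (V ◁₁ m) (f ▷₁ Q) (br U Q)).hom ≫ V ◁₁ m ◁ (brL f Q).hom ≫
        (α_ (V ◁₁ m) (br V Q) (Q ◁₁ f)).inv ≫ (brR V m).hom ▷ Q ◁₁ f ≫
        (α_ (br V P) (m ▷₁ V) (Q ◁₁ f)).hom ≫ br V P ◁ (interchange m f).hom := by
      simp [tSplitIso_hom, bicategoricalComp]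
    _ = (braidNat f m).hom ≫ br V P ◁ (tSplit (ρ_ m).inv (λ_ f).inv ≫ (interchange m f).hom) := by
      rw [e₁, whiskerLeft_comp, reassoc_of% h₂]; rfl
    _ = tSplit (ρ_ f).inv (λ_ m).inv ▷ br U Q ≫ (α_ (f ▷₁ P) (U ◁₁ m) (br U Q)).hom ≫
        f ▷₁ P ◁ (brR U m).hom ≫ (α_ (f ▷₁ P) (br U P) (m ▷₁ U)).inv ≫
        (brL f P).hom ▷ m ▷₁ U ≫ (α_ (br V P) (P ◁₁ f) (m ▷₁ U)).hom := by
      rw [e₂, h₁]; rfl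
    _ = _ := by
      simp [tSplitIso_hom, bicategoricalComp]

end Swap

section Braided
open TensorBicategory ConstraintBicategory MonoidalBicategory SwapBicategory
  BraidedMonoidalBicategory
variable {B : Type u} [Bicategory.{w, v} B] [BraidedMonoidalBicategory B]

theorem hexR_naturality_left {V U : B} (f : V ⟶ U) (A : B) :
    f ▷₁ A ▷₁ A ◁ (hexR U A A).inv ≫
      (𝟙 (f ▷₁ A ▷₁ A ≫ as U A A ≫ br U (A ⊠ A) ≫ as A A U) ⊗≫
        (asL f A A).hom ▷ (br U (A ⊠ A) ≫ as A A U) ⊗≫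
        as V A A ◁ ((brL f (A ⊠ A)).hom ▷ as A A U) ⊗≫
        (as V A A ≫ br V (A ⊠ A)) ◁ (asR A A f).hom ⊗≫
        𝟙 (as V A A ≫ br V (A ⊠ A) ≫ as A A V ≫ A ◁₁ A ◁₁ f)) =
      𝟙 (f ▷₁ A ▷₁ A ≫ br U A ▷₁ A ≫ as A U A ≫ A ◁₁ br U A) ⊗≫
        (rw₂₂ (brL f A) A).hom ▷ (as A U A ≫ A ◁₁ br U A) ⊗≫
        br V A ▷₁ A ◁ ((asM A f A).hom ▷ A ◁₁ br U A) ⊗≫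
        (br V A ▷₁ A ≫ as A V A) ◁ (lw₂₂ A (brL f A)).hom ⊗≫
        (hexR V A A).inv ▷ A ◁₁ A ◁₁ f ⊗≫
        𝟙 (as V A A ≫ br V (A ⊠ A) ≫ as A A V ≫ A ◁₁ A ◁₁ f) := by
  have h := hexR_naturality f (𝟙 A) (𝟙 A)
  have hn : (braidNat f (𝟙 A ⊠₁ 𝟙 A)).hom = (𝟙 f ⊠₂ (tId A A).hom) ▷ br U (A ⊠ A) ≫
      (brL f (A ⊠ A)).hom ≫ br V (A ⊠ A) ◁ (tIso (tId A A).symm (Iso.refl f)).hom := by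
    rw [brL, reassoc_of% braidNat_naturality, tIso_hom, ← whiskerLeft_comp, ← tHom₂_comp]
    simp [tHom₂_id]
  have hL : (sqComp (assocNat f (𝟙 A) (𝟙 A))
      (sqComp (braidNat f (𝟙 A ⊠₁ 𝟙 A)) (assocNat (𝟙 A) (𝟙 A) f))).hom =
      𝟙 (f ▷₁ A ▷₁ A ≫ as U A A ≫ br U (A ⊠ A) ≫ as A A U) ⊗≫
        (asL f A A).hom ▷ (br U (A ⊠ A) ≫ as A A U) ⊗≫
        as V A A ◁ ((brL f (A ⊠ A)).hom ▷ as A A U) ⊗≫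
        (as V A A ≫ br V (A ⊠ A)) ◁ (asR A A f).hom ⊗≫
        𝟙 ((as V A A ≫ br V (A ⊠ A) ≫ as A A V) ≫ A ◁₁ A ◁₁ f) := by
    simp only [sqComp, asL, asR, Iso.trans_hom, Iso.symm_hom, whiskerLeftIso_hom,
      whiskerRightIso_hom, hn, tIso_hom, Iso.refl_hom, bicategoricalComp]
    bicategory
  have hR : (sqComp (sqTensor (braidNat f (𝟙 A)) (sqId (𝟙 A)))
      (sqComp (assocNat (𝟙 A) f (𝟙 A)) (sqTensor (sqId (𝟙 A)) (braidNat f (𝟙 A))))).hom =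
      𝟙 (f ▷₁ A ▷₁ A ≫ br U A ▷₁ A ≫ as A U A ≫ A ◁₁ br U A) ⊗≫
        (rw₂₂ (brL f A) A).hom ▷ (as A U A ≫ A ◁₁ br U A) ⊗≫
        br V A ▷₁ A ◁ ((asM A f A).hom ▷ A ◁₁ br U A) ⊗≫
        (br V A ▷₁ A ≫ as A V A) ◁ (lw₂₂ A (brL f A)).hom ⊗≫
        𝟙 ((br V A ▷₁ A ≫ as A V A ≫ A ◁₁ br V A) ≫ A ◁₁ A ◁₁ f) := by
    rw [← sqTensor_sqId_left, ← sqTensor_sqId_right]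
    simp only [sqComp, Iso.trans_hom, Iso.symm_hom, whiskerLeftIso_hom,
      whiskerRightIso_hom, asM, brL]
    bicategory
  rw [hL, hR] at h
  generalize (asL f A A).hom ▷ (br U (A ⊠ A) ≫ as A A U) = a₁,
    as V A A ◁ ((brL f (A ⊠ A)).hom ▷ as A A U) = a₂,
    (as V A A ≫ br V (A ⊠ A)) ◁ (asR A A f).hom = a₃,
    (rw₂₂ (brL f A) A).hom ▷ (as A U A ≫ A ◁₁ br U A) = b₁,
    br V A ▷₁ A ◁ ((asM A f A).hom ▷ A ◁₁ br U A) = b₂,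
    (br V A ▷₁ A ≫ as A V A) ◁ (lw₂₂ A (brL f A)).hom = b₃ at *
  calc
    _ = f ▷₁ A ▷₁ A ◁ (hexR U A A).inv ≫
      (𝟙 (f ▷₁ A ▷₁ A ≫ as U A A ≫ br U (A ⊠ A) ≫ as A A U) ⊗≫ a₁ ⊗≫ a₂ ⊗≫ a₃ ⊗≫
        𝟙 ((as V A A ≫ br V (A ⊠ A) ≫ as A A V) ≫ A ◁₁ A ◁₁ f)) ≫
      ((hexR V A A).hom ≫ (hexR V A A).inv) ▷ A ◁₁ A ◁₁ f ⊗≫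
        𝟙 (as V A A ≫ br V (A ⊠ A) ≫ as A A V ≫ A ◁₁ A ◁₁ f) := by
      rw [Iso.hom_inv_id]; bicategory
    _ = f ▷₁ A ▷₁ A ◁ (hexR U A A).inv ≫
      ((𝟙 (f ▷₁ A ▷₁ A ≫ as U A A ≫ br U (A ⊠ A) ≫ as A A U) ⊗≫ a₁ ⊗≫ a₂ ⊗≫ a₃ ⊗≫
        𝟙 ((as V A A ≫ br V (A ⊠ A) ≫ as A A V) ≫ A ◁₁ A ◁₁ f)) ≫
      (hexR V A A).hom ▷ A ◁₁ A ◁₁ f) ≫ (hexR V A A).inv ▷ A ◁₁ A ◁₁ f ⊗≫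
        𝟙 (as V A A ≫ br V (A ⊠ A) ≫ as A A V ≫ A ◁₁ A ◁₁ f) := by
      simp only [comp_whiskerRight, Category.assoc, bicategoricalComp]
    _ = f ▷₁ A ▷₁ A ◁ ((hexR U A A).inv ≫ (hexR U A A).hom) ≫
      (𝟙 (f ▷₁ A ▷₁ A ≫ br U A ▷₁ A ≫ as A U A ≫ A ◁₁ br U A) ⊗≫ b₁ ⊗≫ b₂ ⊗≫ b₃ ⊗≫
        𝟙 ((br V A ▷₁ A ≫ as A V A ≫ A ◁₁ br V A) ≫ A ◁₁ A ◁₁ f)) ≫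
      (hexR V A A).inv ▷ A ◁₁ A ◁₁ f ⊗≫
        𝟙 (as V A A ≫ br V (A ⊠ A) ≫ as A A V ≫ A ◁₁ A ◁₁ f) := by
      rw [← h]; simp only [whiskerLeft_comp, Category.assoc]
    _ = _ := by
      rw [Iso.inv_hom_id]; bicategory

theorem isCentrePiece_restrict (D : MonoidalObject B) {V U : B} (f : V ⟶ U) (x : U ⟶ D.A)
    (γ : x ▷₁ D.A ≫ D.m ≅ br U D.A ≫ D.A ◁₁ x ≫ D.m) (h : IsCentrePiece D x γ) :
    IsCentrePiece D (f ≫ x) (restrictCell D f x γ) := by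
  have hγ : (restrictCell D f x γ).hom = (rwComp f x D.A).hom ▷ D.m ⊗≫ f ▷₁ D.A ◁ γ.hom ⊗≫
      (brL f D.A).hom ▷ (D.A ◁₁ x ≫ D.m) ⊗≫ br V D.A ◁ ((lwComp D.A f x).inv ▷ D.m) := by
    simp [restrictCell, bicategoricalComp, bicategoricalIsoComp]
  have hγr : (rw₂₃ (restrictCell D f x γ) D.A).hom =
      (rwIso (rwComp f x D.A) D.A ≪≫ rwComp (f ▷₁ D.A) (x ▷₁ D.A) D.A).hom ▷ D.m ▷₁ D.A ⊗≫
      f ▷₁ D.A ▷₁ D.A ◁ (rw₂₃ γ D.A).hom ⊗≫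
      (rw₂₂ (brL f D.A) D.A).hom ▷ ((D.A ◁₁ x) ▷₁ D.A ≫ D.m ▷₁ D.A) ⊗≫
      br V D.A ▷₁ D.A ◁ ((rwIso (lwComp D.A f x) D.A ≪≫
        rwComp (D.A ◁₁ f) (D.A ◁₁ x) D.A).inv ▷ D.m ▷₁ D.A) :=
    map₂₃_paste (rwPf D.A) (rwComp f x D.A) (lwComp D.A f x) γ (brL f D.A) _ hγ
  have hγl : (lw₂₃ D.A (restrictCell D f x γ)).hom =
      (lwIso D.A (rwComp f x D.A) ≪≫ lwComp D.A (f ▷₁ D.A) (x ▷₁ D.A)).hom ▷ D.A ◁₁ D.m ⊗≫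
      D.A ◁₁ (f ▷₁ D.A) ◁ (lw₂₃ D.A γ).hom ⊗≫
      (lw₂₂ D.A (brL f D.A)).hom ▷ (D.A ◁₁ D.A ◁₁ x ≫ D.A ◁₁ D.m) ⊗≫
      D.A ◁₁ br V D.A ◁ ((lwIso D.A (lwComp D.A f x) ≪≫
        lwComp D.A (D.A ◁₁ f) (D.A ◁₁ x)).inv ▷ D.A ◁₁ D.m) :=
    map₂₃_paste (lwPf D.A) (rwComp f x D.A) (lwComp D.A f x) γ (brL f D.A) _ hγ
  refine (paste_left _ _ _ _ _ _ _ _ _ _ (asL_comp f x D.A D.A) _ _ _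
    (interchange_comp_left f x D.m) γ.hom _ _ hγ _ _ _ _ _ (interchange_comp_right D.m f x)
    _ _ _ (asR_comp D.A D.A f x) _ (br_interchange f D.m)).trans ?_
  rw [h]
  exact (paste_right _ _ _ _ _ _ _ _ hγr _ _ _ (asM_comp D.A f x D.A) _ _ _ hγl _ _ _
    (hexR_naturality_left f D.A)).symm

end Braided

/-! ### The centre -/

section Centre
open TensorBicategory ConstraintBicategory MonoidalBicategory SwapBicategory
  BraidedMonoidalBicategory
variable {B : Type u} [Bicategory.{w, v} B] [BraidedMonoidalBicategory B]

theorem restrictCell_naturality (D : MonoidalObject B) {V U : B} {f g : V ⟶ U} (τ : f ⟶ g)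
    (x : U ⟶ D.A) (γ : x ▷₁ D.A ≫ D.m ≅ br U D.A ≫ D.A ◁₁ x ≫ D.m) :
    ((τ ▷ x) ⊠₂ 𝟙 (𝟙 D.A)) ▷ D.m ≫ (restrictCell D g x γ).hom =
      (restrictCell D f x γ).hom ≫ br V D.A ◁ ((𝟙 (𝟙 D.A) ⊠₂ (τ ▷ x)) ▷ D.m) := by
  have h₁ : ((τ ▷ x) ⊠₂ 𝟙 (𝟙 D.A)) ≫ (rwComp g x D.A).hom =
      (rwComp f x D.A).hom ≫ (τ ⊠₂ 𝟙 (𝟙 D.A)) ▷ x ▷₁ D.A := by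
    have h := (rwPf D.A).map₂_whisker_right τ x
    exact (Iso.eq_comp_inv (rwComp g x D.A)).mp (h.trans (Category.assoc _ _ _).symm)
  have h₂ : (lwComp D.A f x).inv ≫ (𝟙 (𝟙 D.A) ⊠₂ (τ ▷ x)) =
      (𝟙 (𝟙 D.A) ⊠₂ τ) ▷ D.A ◁₁ x ≫ (lwComp D.A g x).inv := by
    have h := (lwPf D.A).map₂_whisker_right τ x
    exact (Iso.inv_comp_eq (lwComp D.A f x)).mpr h
  have h₃ : (τ ⊠₂ 𝟙 (𝟙 D.A)) ▷ br U D.A ≫ (brL g D.A).hom =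
      (brL f D.A).hom ≫ br V D.A ◁ (𝟙 (𝟙 D.A) ⊠₂ τ) :=
    braidNat_naturality τ (𝟙 (𝟙 D.A))
  have e : ∀ k : V ⟶ U, (restrictCell D k x γ).hom = (rwComp k x D.A).hom ▷ D.m ⊗≫
      k ▷₁ D.A ◁ γ.hom ⊗≫ (brL k D.A).hom ▷ (D.A ◁₁ x ≫ D.m) ⊗≫
      br V D.A ◁ ((lwComp D.A k x).inv ▷ D.m) := fun k => by
    simp [restrictCell, bicategoricalComp, bicategoricalIsoComp]
  rw [e, e]
  calc
    _ = (((τ ▷ x) ⊠₂ 𝟙 (𝟙 D.A)) ≫ (rwComp g x D.A).hom) ▷ D.m ⊗≫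
        g ▷₁ D.A ◁ γ.hom ⊗≫ (brL g D.A).hom ▷ (D.A ◁₁ x ≫ D.m) ⊗≫
        br V D.A ◁ ((lwComp D.A g x).inv ▷ D.m) := by bicategory
    _ = (rwComp f x D.A).hom ▷ D.m ⊗≫ ((τ ⊠₂ 𝟙 (𝟙 D.A)) ▷ (x ▷₁ D.A ≫ D.m) ≫
        g ▷₁ D.A ◁ γ.hom) ⊗≫ (brL g D.A).hom ▷ (D.A ◁₁ x ≫ D.m) ⊗≫
        br V D.A ◁ ((lwComp D.A g x).inv ▷ D.m) := by rw [h₁]; bicategory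
    _ = (rwComp f x D.A).hom ▷ D.m ⊗≫ f ▷₁ D.A ◁ γ.hom ⊗≫
        ((τ ⊠₂ 𝟙 (𝟙 D.A)) ▷ br U D.A ≫ (brL g D.A).hom) ▷ (D.A ◁₁ x ≫ D.m) ⊗≫
        br V D.A ◁ ((lwComp D.A g x).inv ▷ D.m) := by
      rw [← whisker_exchange]; bicategory
    _ = (rwComp f x D.A).hom ▷ D.m ⊗≫ f ▷₁ D.A ◁ γ.hom ⊗≫
        (brL f D.A).hom ▷ (D.A ◁₁ x ≫ D.m) ⊗≫
        br V D.A ◁ (((𝟙 (𝟙 D.A) ⊠₂ τ) ▷ D.A ◁₁ x ≫ (lwComp D.A g x).inv) ▷ D.m) := by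
      rw [h₃]; bicategory
    _ = _ := by
      rw [← h₂]; bicategory

/-- Restriction of a centre piece along a 1-cell. -/
def CentrePiece.restrict {D : MonoidalObject B} {V U : B} (f : V ⟶ U) (P : CentrePiece D U) :
    CentrePiece D V :=
  ⟨f ≫ P.x, restrictCell D f P.x P.γ, isCentrePiece_restrict D f P.x P.γ P.isCentrePiece⟩

/-- The functor sending a 1-cell `f` to the restriction along `f` of a fixed centre piece. -/
def CentrePiece.restrictFunctor {D : MonoidalObject B} {U : B} (P : CentrePiece D U) (V : B) :
    (V ⟶ U) ⥤ CentrePiece D V where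
  obj f := P.restrict f
  map τ := ⟨τ ▷ P.x, restrictCell_naturality D τ P.x P.γ⟩
  map_id f := CentrePiece.Hom.ext (id_whiskerRight f P.x)
  map_comp τ τ' := CentrePiece.Hom.ext (comp_whiskerRight τ τ' P.x)

/-- A centre of a monoidal object: a universal centre piece, that is, a birepresentation of the
centre pieces. -/
structure Centre (D : MonoidalObject B) where
  /-- the underlying object -/
  Z : B
  /-- the universal centre piece -/
  piece : CentrePiece D Z
  /-- restriction of the universal centre piece is an equivalence of categories -/
  isEquivalence (V : B) : (piece.restrictFunctor V).IsEquivalence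

end Centre

/-! ### Images under pseudofunctors -/

section Image

open TensorBicategory ConstraintBicategory MonoidalBicategory SwapBicategory
  BraidedMonoidalBicategory

section
variable {M : Type u₁} [Bicategory.{w₁, v₁} M] [MonoidalBicategory M]
  {N : Type u₂} [Bicategory.{w₂, v₂} N] [MonoidalBicategory N]

/-- The image of the data of a monoidal object under a monoidal pseudofunctor. -/
def MonoidalPseudofunctor.mapData (T : MonoidalPseudofunctor M N) (D : MonoidalObjectData M) :
    MonoidalObjectData N where
  A := T.F.obj D.A
  m := T.chi D.A D.A ≫ T.F.map D.m
  j := T.iota ≫ T.F.map D.j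
  mAssoc :=
    whiskerRightIso (rwComp (T.chi D.A D.A) (T.F.map D.m) (T.F.obj D.A))
        (T.chi D.A D.A ≫ T.F.map D.m) ≪⊗≫
      whiskerLeftIso (T.chi D.A D.A ▷₁ T.F.obj D.A)
        (whiskerRightIso (T.chiL D.m D.A) (T.F.map D.m)) ≪⊗≫
      whiskerLeftIso (T.chi D.A D.A ▷₁ T.F.obj D.A ≫ T.chi (D.A ⊠ D.A) D.A)
        (map₂₃ T.F D.mAssoc) ≪⊗≫
      whiskerRightIso (T.omega D.A D.A D.A) (T.F.map (D.A ◁₁ D.m) ≫ T.F.map D.m) ≪⊗≫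
      whiskerLeftIso (as (T.F.obj D.A) (T.F.obj D.A) (T.F.obj D.A) ≫
          T.F.obj D.A ◁₁ T.chi D.A D.A)
        (whiskerRightIso (T.chiR D.A D.m).symm (T.F.map D.m)) ≪⊗≫
      whiskerLeftIso (as (T.F.obj D.A) (T.F.obj D.A) (T.F.obj D.A))
        (whiskerRightIso (lwComp (T.F.obj D.A) (T.chi D.A D.A) (T.F.map D.m)).symm
          (T.chi D.A D.A ≫ T.F.map D.m))
  mLeft :=
    whiskerRightIso (rwComp T.iota (T.F.map D.j) (T.F.obj D.A))
        (T.chi D.A D.A ≫ T.F.map D.m) ≪⊗≫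
      whiskerLeftIso (T.iota ▷₁ T.F.obj D.A)
        (whiskerRightIso (T.chiL D.j D.A) (T.F.map D.m)) ≪⊗≫
      whiskerLeftIso (T.iota ▷₁ T.F.obj D.A ≫ T.chi unitObj D.A) (map₂₁ T.F D.mLeft) ≪⊗≫
      T.gamma D.A
  mRight :=
    whiskerRightIso (lwComp (T.F.obj D.A) T.iota (T.F.map D.j))
        (T.chi D.A D.A ≫ T.F.map D.m) ≪⊗≫
      whiskerLeftIso (T.F.obj D.A ◁₁ T.iota)
        (whiskerRightIso (T.chiR D.A D.j) (T.F.map D.m)) ≪⊗≫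
      whiskerLeftIso (T.F.obj D.A ◁₁ T.iota ≫ T.chi D.A unitObj) (map₂₁ T.F D.mRight) ≪⊗≫
      T.delta D.A

end

variable {M : Type u₁} [Bicategory.{w₁, v₁} M] [BraidedMonoidalBicategory M]
  {N : Type u₂} [Bicategory.{w₂, v₂} N] [BraidedMonoidalBicategory N]

/-- The 2-cell on `F x` induced by the 2-cell `γ` of a centre piece and a braided monoidal
pseudofunctor `F`. -/
def BraidedMonoidalPseudofunctor.mapCell (T : BraidedMonoidalPseudofunctor M N)
    (D : MonoidalObjectData M) {U : M} (x : U ⟶ D.A)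
    (γ : x ▷₁ D.A ≫ D.m ≅ br U D.A ≫ D.A ◁₁ x ≫ D.m) :
    T.F.map x ▷₁ (T.mapData D).A ≫ (T.mapData D).m ≅
      br (T.F.obj U) (T.mapData D).A ≫ (T.mapData D).A ◁₁ T.F.map x ≫ (T.mapData D).m :=
  (α_ (T.F.map x ▷₁ T.F.obj D.A) (T.chi D.A D.A) (T.F.map D.m)).symm ≪≫
    whiskerRightIso (T.chiL x D.A) (T.F.map D.m) ≪⊗≫
    whiskerLeftIso (T.chi U D.A) (map₂₃ T.F γ) ≪⊗≫
    whiskerRightIso (T.upsilon U D.A).symm (T.F.map (D.A ◁₁ x) ≫ T.F.map D.m) ≪⊗≫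
    whiskerLeftIso (br (T.F.obj U) (T.F.obj D.A))
      (whiskerRightIso (T.chiR D.A x).symm (T.F.map D.m) ≪≫
        α_ (T.F.obj D.A ◁₁ T.F.map x) (T.chi D.A D.A) (T.F.map D.m))

end Image

end BraidedBicat

open BraidedBicat

/-!
The proof lifts everything to the comma bicategory `Comma T` of the identity of `N` over the
underlying pseudofunctor `F` of `T`. Its objects are 1-cells `p : P' ⟶ F P`; its 1-cells are
squares filled by an invertible 2-cell, lying over a 1-cell of `N` (the top) and a 1-cell of `M`
(the base); its 2-cells are pairs of a 2-cell of `N` and a 2-cell of `M` compatible with the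
squares (`SqHom`). Pseudonaturality of `chi` makes `Comma T` a bicategory with a tensor product,
and the modifications `omega` and `upsilon` equip it with associativity and braiding 1-cells
(`Comma.asC`, `Comma.brC`) that are natural in the 1-cells of `Comma T`. Names ending in `C`
denote cells of `Comma T`.

For an object `X` of `M` let `of X` be the identity of `F X`. The axioms of `T` say exactly that
the pentagon, middle unit and hexagon cells of `N` at objects `F X` are the tops of 2-cells of
`Comma T` whose bases are the corresponding cells of `M` (`Comma.pentC`, `Comma.midUnitC`,
`Comma.hexRC`). Likewise the associativity and unit 2-cells of `F A`, and the 2-cell on `F x` for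
a centre piece `x`, are the tops of 2-cells over those of `A` and `x` (`Comma.mAssocC`,
`Comma.mLeftC`, `Comma.mRightC`, `Comma.centreCellC`); this is how they are defined. Hence both
sides of each coherence equation for `F A` and `F x` are the tops of two 2-cells of `Comma T`
whose bases are the two sides of the equation for `A` and `x`.

A 2-cell of `Comma T` with target object `of X` is determined by its base, since the leg of `of X`
is an identity (`Comma.hom₂_ext_of`). As all the equations are between 2-cells into `of A`, the
equations for `A` and `x` imply those for `F A` and `F x`.

The statement on centres follows formally: restriction of the universal centre piece of `F A`
along 1-cells `F Z ⟶ Z'` is an equivalence of categories, so the centre piece `F i` is isomorphic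
to the restriction along some `k`, and two such `k` are related by a unique compatible
isomorphism.
-/

namespace BraidedBicat

/-! ### Squares and their morphisms -/

section SquareCalculus

variable {B : Type u} [Bicategory.{w, v} B]

/-- A morphism of squares with common sides `e`, `e'`: a pair of 2-cells between the other sides
whose two pastings with the squares agree. -/
def SqHom {X X' Y Y' : B} {p p' : X ⟶ X'} {e : X ⟶ Y} {e' : X' ⟶ Y'} {q q' : Y ⟶ Y'}
    (s : p ≫ e' ≅ e ≫ q) (s' : p' ≫ e' ≅ e ≫ q') (η : p ⟶ p') (θ : q ⟶ q') : Prop :=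
  η ▷ e' ≫ s'.hom = s.hom ≫ e ◁ θ

/-- Replacement of the two parallel sides `e`, `e'` of a square by isomorphic 1-cells. -/
def sqConj {X X' Y Y' : B} {p : X ⟶ X'} {e d : X ⟶ Y} {e' d' : X' ⟶ Y'} {q : Y ⟶ Y'}
    (a : d ≅ e) (a' : d' ≅ e') (s : p ≫ e' ≅ e ≫ q) : p ≫ d' ≅ d ≫ q :=
  whiskerLeftIso p a' ≪≫ s ≪≫ whiskerRightIso a.symm q

theorem SqHom.conj {X X' Y Y' : B} {p p' : X ⟶ X'} {e d : X ⟶ Y} {e' d' : X' ⟶ Y'} {q q' : Y ⟶ Y'}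
    {s : p ≫ e' ≅ e ≫ q} {s' : p' ≫ e' ≅ e ≫ q'} {η : p ⟶ p'} {θ : q ⟶ q'}
    (h : SqHom s s' η θ) (a : d ≅ e) (a' : d' ≅ e') :
    SqHom (sqConj a a' s) (sqConj a a' s') η θ := by
  unfold SqHom at *
  simp only [sqConj, Iso.trans_hom, whiskerLeftIso_hom, whiskerRightIso_hom, Iso.symm_hom,
    Category.assoc]
  rw [← whisker_exchange_assoc, reassoc_of% h, whisker_exchange]

theorem SqHom.hcomp {X X' Y Y' Z Z' : B} {p p' : X ⟶ X'} {e : X ⟶ Y} {e' : X' ⟶ Y'}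
    {q q' : Y ⟶ Y'} {d : Y ⟶ Z} {d' : Y' ⟶ Z'} {r r' : Z ⟶ Z'}
    {s : p ≫ e' ≅ e ≫ q} {s' : p' ≫ e' ≅ e ≫ q'} {t : q ≫ d' ≅ d ≫ r} {t' : q' ≫ d' ≅ d ≫ r'}
    {η : p ⟶ p'} {θ : q ⟶ q'} {κ : r ⟶ r'} (h : SqHom s s' η θ) (h' : SqHom t t' θ κ) :
    SqHom (sqComp s t) (sqComp s' t') η κ := by
  unfold SqHom at *
  simp only [sqComp, Iso.trans_hom, whiskerLeftIso_hom, whiskerRightIso_hom, Iso.symm_hom,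
    Category.assoc]
  calc
    _ = 𝟙 _ ⊗≫ (η ▷ e' ≫ s'.hom) ▷ d' ⊗≫ e ◁ t'.hom ⊗≫ 𝟙 _ := by bicategory
    _ = 𝟙 _ ⊗≫ s.hom ▷ d' ⊗≫ e ◁ (θ ▷ d' ≫ t'.hom) ⊗≫ 𝟙 _ := by rw [h]; bicategory
    _ = _ := by rw [h']; bicategory

theorem sqVComp_sqConj {X X' X'' Y Y' Y'' : B} {p : X ⟶ X'} {p' : X' ⟶ X''} {e d : X ⟶ Y}
    {e' d' : X' ⟶ Y'} {e'' d'' : X'' ⟶ Y''} {q : Y ⟶ Y'} {q' : Y' ⟶ Y''}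
    (a : d ≅ e) (a' : d' ≅ e') (a'' : d'' ≅ e'')
    (s : p ≫ e' ≅ e ≫ q) (t : p' ≫ e'' ≅ e' ≫ q') :
    sqVComp (sqConj a a' s) (sqConj a' a'' t) = sqConj a a'' (sqVComp s t) := by
  ext
  simp only [sqConj, sqVComp, Iso.trans_hom, whiskerLeftIso_hom, whiskerRightIso_hom, Iso.symm_hom,
    Category.assoc]
  calc
    _ = 𝟙 _ ⊗≫ p ◁ p' ◁ a''.hom ⊗≫ p ◁ t.hom ⊗≫ p ◁ ((a'.inv ≫ a'.hom) ▷ q') ⊗≫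
        s.hom ▷ q' ⊗≫ a.inv ▷ q ▷ q' ⊗≫ 𝟙 _ := by bicategory
    _ = _ := by rw [Iso.inv_hom_id]; bicategory

theorem sqVComp_sqComp {X X' X'' Y Y' Y'' Z Z' Z'' : B} {p : X ⟶ X'} {p' : X' ⟶ X''} {e : X ⟶ Y}
    {e' : X' ⟶ Y'} {e'' : X'' ⟶ Y''} {q : Y ⟶ Y'} {q' : Y' ⟶ Y''} {d : Y ⟶ Z} {d' : Y' ⟶ Z'}
    {d'' : Y'' ⟶ Z''} {r : Z ⟶ Z'} {r' : Z' ⟶ Z''}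
    (s : p ≫ e' ≅ e ≫ q) (s' : p' ≫ e'' ≅ e' ≫ q') (t : q ≫ d' ≅ d ≫ r)
    (t' : q' ≫ d'' ≅ d' ≫ r') :
    sqVComp (sqComp s t) (sqComp s' t') = sqComp (sqVComp s s') (sqVComp t t') := by
  ext
  simp only [sqComp, sqVComp, Iso.trans_hom, whiskerLeftIso_hom, whiskerRightIso_hom, Iso.symm_hom]
  calc
    _ = 𝟙 _ ⊗≫ p ◁ s'.hom ▷ d'' ⊗≫ ((p ≫ e') ◁ t'.hom ≫ s.hom ▷ (d' ≫ r')) ⊗≫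
        e ◁ t.hom ▷ r' ⊗≫ 𝟙 _ := by bicategory
    _ = _ := by rw [whisker_exchange]; bicategory

end SquareCalculus

/-! ### The comma bicategory -/

section Comma

variable {M : Type u₁} [Bicategory.{w₁, v₁} M] [MonoidalBicategory M]
  {N : Type u₂} [Bicategory.{w₂, v₂} N] [MonoidalBicategory N]

/-- Objects of the comma bicategory of the identity of `N` over `F`. An object is a
1-cell `p : P' ⟶ F P`; the objects `of X`, with leg the identity of `F X`, have a constructor of
their own, so that the tensor product of two of them can be given the leg `chi` instead of a
composite with a tensor product of identities. -/
inductive Comma (T : TensorPseudofunctor M N)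
  | of (X : M) : Comma T
  | mk (P' : N) (P : M) (p : P' ⟶ T.F.obj P) : Comma T

namespace Comma

variable {T : TensorPseudofunctor M N}

/-- The object of `N` underlying an object of the comma bicategory. -/
@[reducible] def top : Comma T → N
  | of X => T.F.obj X
  | mk P' _ _ => P'

/-- The object of `M` underlying an object of the comma bicategory. -/
@[reducible] def base : Comma T → M
  | of X => X
  | mk _ P _ => P

/-- The 1-cell from the top to the image of the base. -/
@[reducible] def leg : (P : Comma T) → (P.top ⟶ T.F.obj P.base)
  | of X => 𝟙 (T.F.obj X)
  | mk _ _ p => p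

/-- A 1-cell of the comma bicategory: a 1-cell of `N`, a 1-cell of `M` and an invertible 2-cell
filling the square between the legs. -/
structure Hom₁ (P Q : Comma T) where
  top : P.top ⟶ Q.top
  base : P.base ⟶ Q.base
  sq : top ≫ Q.leg ≅ P.leg ≫ T.F.map base

/-- A 2-cell of the comma bicategory: a 2-cell of `N` and a 2-cell of `M` compatible with the
squares. -/
@[ext]
structure Hom₂ {P Q : Comma T} (f g : Hom₁ P Q) where
  top : f.top ⟶ g.top
  base : f.base ⟶ g.base
  comm : SqHom f.sq g.sq top (T.F.map₂ base)

instance (P Q : Comma T) : Category (Hom₁ P Q) where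
  Hom f g := Hom₂ f g
  id f := ⟨𝟙 _, 𝟙 _, by simp [SqHom]⟩
  comp η θ := ⟨η.top ≫ θ.top, η.base ≫ θ.base, by
    have h₁ := η.comm
    have h₂ := θ.comm
    unfold SqHom at *
    rw [comp_whiskerRight, Category.assoc, h₂, reassoc_of% h₁]
    simp⟩
  id_comp η := Hom₂.ext (Category.id_comp _) (Category.id_comp _)
  comp_id η := Hom₂.ext (Category.comp_id _) (Category.comp_id _)
  assoc η θ κ := Hom₂.ext (Category.assoc _ _ _) (Category.assoc _ _ _)

/-- The identity 1-cells of the comma bicategory. -/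
def idHom (P : Comma T) : Hom₁ P P :=
  ⟨𝟙 _, 𝟙 _, sqOne P.leg ≪≫ whiskerLeftIso P.leg (T.F.mapId P.base).symm⟩

/-- Composition of 1-cells of the comma bicategory. -/
def compHom {P Q R : Comma T} (f : Hom₁ P Q) (g : Hom₁ Q R) : Hom₁ P R :=
  ⟨f.top ≫ g.top, f.base ≫ g.base,
    sqVComp f.sq g.sq ≪≫ whiskerLeftIso P.leg (T.F.mapComp f.base g.base).symm⟩

/-- An invertible 2-cell of the comma bicategory. -/
def mkIso {P Q : Comma T} {f g : Hom₁ P Q} (t : f.top ≅ g.top) (b : f.base ≅ g.base)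
    (h : SqHom f.sq g.sq t.hom (T.F.map₂ b.hom)) : f ≅ g where
  hom := ⟨t.hom, b.hom, h⟩
  inv := ⟨t.inv, b.inv, by
    unfold SqHom at *
    rw [← cancel_epi (t.hom ▷ Q.leg), ← cancel_mono (P.leg ◁ T.F.map₂ b.hom)]
    simp [h, ← whiskerLeft_comp, ← PrelaxFunctor.map₂_comp, hom_inv_whiskerRight_assoc]⟩
  hom_inv_id := Hom₂.ext t.hom_inv_id b.hom_inv_id
  inv_hom_id := Hom₂.ext t.inv_hom_id b.inv_hom_id

instance : Bicategory (Comma T) where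
  Hom P Q := Hom₁ P Q
  id P := idHom P
  comp f g := compHom f g
  homCategory P Q := inferInstance
  whiskerLeft {P Q R} f {g h} η := ⟨f.top ◁ η.top, f.base ◁ η.base, by
    have h₁ := η.comm
    unfold SqHom at *
    simp only [compHom, sqVComp, Iso.trans_hom, whiskerLeftIso_hom, whiskerRightIso_hom,
      Iso.symm_hom, T.F.map₂_whisker_left, Category.assoc]
    calc
      _ = 𝟙 _ ⊗≫ f.top ◁ (η.top ▷ R.leg ≫ h.sq.hom) ⊗≫ f.sq.hom ▷ T.F.map h.base ⊗≫
          P.leg ◁ (T.F.mapComp f.base h.base).inv := by bicategory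
      _ = 𝟙 _ ⊗≫ f.top ◁ g.sq.hom ⊗≫ ((f.top ≫ Q.leg) ◁ T.F.map₂ η.base ≫
          f.sq.hom ▷ T.F.map h.base) ⊗≫ P.leg ◁ (T.F.mapComp f.base h.base).inv := by
        rw [h₁]; bicategory
      _ = 𝟙 _ ⊗≫ f.top ◁ g.sq.hom ⊗≫ f.sq.hom ▷ T.F.map g.base ⊗≫
          P.leg ◁ ((T.F.mapComp f.base g.base).inv ≫ (T.F.mapComp f.base g.base).hom) ⊗≫
          (P.leg ≫ T.F.map f.base) ◁ T.F.map₂ η.base ⊗≫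
          P.leg ◁ (T.F.mapComp f.base h.base).inv := by
        rw [whisker_exchange, Iso.inv_hom_id]; bicategory
      _ = _ := by bicategory⟩
  whiskerRight {P Q R} {f g} η h := ⟨η.top ▷ h.top, η.base ▷ h.base, by
    have h₁ := η.comm
    unfold SqHom at *
    simp only [compHom, sqVComp, Iso.trans_hom, whiskerLeftIso_hom, whiskerRightIso_hom,
      Iso.symm_hom, T.F.map₂_whisker_right, Category.assoc]
    calc
      _ = 𝟙 _ ⊗≫ (η.top ▷ (h.top ≫ R.leg) ≫ g.top ◁ h.sq.hom) ⊗≫ g.sq.hom ▷ T.F.map h.base ⊗≫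
          P.leg ◁ (T.F.mapComp g.base h.base).inv := by bicategory
      _ = 𝟙 _ ⊗≫ f.top ◁ h.sq.hom ⊗≫ (η.top ▷ Q.leg ≫ g.sq.hom) ▷ T.F.map h.base ⊗≫
          P.leg ◁ (T.F.mapComp g.base h.base).inv := by
        rw [← whisker_exchange]; bicategory
      _ = 𝟙 _ ⊗≫ f.top ◁ h.sq.hom ⊗≫ f.sq.hom ▷ T.F.map h.base ⊗≫
          P.leg ◁ ((T.F.mapComp f.base h.base).inv ≫ (T.F.mapComp f.base h.base).hom) ⊗≫
          P.leg ◁ (T.F.map₂ η.base ▷ T.F.map h.base) ⊗≫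
          P.leg ◁ (T.F.mapComp g.base h.base).inv := by
        rw [h₁, Iso.inv_hom_id]; bicategory
      _ = _ := by bicategory⟩
  associator {P Q R S} f g h := mkIso (α_ _ _ _) (α_ _ _ _) (by
    unfold SqHom
    simp only [compHom, sqVComp, Iso.trans_hom, whiskerLeftIso_hom, whiskerRightIso_hom,
      Iso.symm_hom, T.F.map₂_associator, Category.assoc]
    have h₁ := (T.F.mapComp (f.base ≫ g.base) h.base).inv_hom_id
    have h₂ := (T.F.mapComp f.base g.base).inv_hom_id
    symm
    calc
      _ = 𝟙 _ ⊗≫ (f.top ≫ g.top) ◁ h.sq.hom ⊗≫ f.top ◁ g.sq.hom ▷ T.F.map h.base ⊗≫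
          f.sq.hom ▷ T.F.map g.base ▷ T.F.map h.base ⊗≫
          P.leg ◁ ((T.F.mapComp f.base g.base).inv ▷ T.F.map h.base ⊗≫
            ((T.F.mapComp (f.base ≫ g.base) h.base).inv ≫
            (T.F.mapComp (f.base ≫ g.base) h.base).hom) ⊗≫
            (T.F.mapComp f.base g.base).hom ▷ T.F.map h.base) ⊗≫
          P.leg ◁ (T.F.map f.base ◁ (T.F.mapComp g.base h.base).inv ≫
            (T.F.mapComp f.base (g.base ≫ h.base)).inv) := by bicategory
      _ = 𝟙 _ ⊗≫ (f.top ≫ g.top) ◁ h.sq.hom ⊗≫ f.top ◁ g.sq.hom ▷ T.F.map h.base ⊗≫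
          f.sq.hom ▷ T.F.map g.base ▷ T.F.map h.base ⊗≫
          P.leg ◁ (((T.F.mapComp f.base g.base).inv ≫
            (T.F.mapComp f.base g.base).hom) ▷ T.F.map h.base) ⊗≫
          P.leg ◁ (T.F.map f.base ◁ (T.F.mapComp g.base h.base).inv ≫
            (T.F.mapComp f.base (g.base ≫ h.base)).inv) := by rw [h₁]; bicategory
      _ = 𝟙 _ ⊗≫ f.top ◁ (g.top ◁ h.sq.hom ⊗≫ g.sq.hom ▷ T.F.map h.base) ⊗≫
          (f.sq.hom ▷ (T.F.map g.base ≫ T.F.map h.base) ≫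
          (P.leg ≫ T.F.map f.base) ◁ (T.F.mapComp g.base h.base).inv) ⊗≫
            P.leg ◁ (T.F.mapComp f.base (g.base ≫ h.base)).inv := by rw [h₂]; bicategory
      _ = _ := by
        rw [← whisker_exchange]; bicategory)
  leftUnitor {P Q} f := mkIso (λ_ _) (λ_ _) (by
    unfold SqHom
    simp only [compHom, idHom, sqVComp, sqOne, Iso.trans_hom, whiskerLeftIso_hom,
      whiskerRightIso_hom, Iso.symm_hom, T.F.map₂_left_unitor, Category.assoc]
    have h₁ := (T.F.mapComp (𝟙 P.base) f.base).inv_hom_id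
    have h₂ := (T.F.mapId P.base).inv_hom_id
    symm
    calc
      _ = 𝟙 _ ⊗≫ f.sq.hom ⊗≫ P.leg ◁ ((T.F.mapId P.base).inv ▷ T.F.map f.base ⊗≫
          ((T.F.mapComp (𝟙 P.base) f.base).inv ≫ (T.F.mapComp (𝟙 P.base) f.base).hom) ⊗≫
          (T.F.mapId P.base).hom ▷ T.F.map f.base) ⊗≫ 𝟙 _ := by bicategory
      _ = 𝟙 _ ⊗≫ f.sq.hom ⊗≫ P.leg ◁ (((T.F.mapId P.base).inv ≫
          (T.F.mapId P.base).hom) ▷ T.F.map f.base) ⊗≫ 𝟙 _ := by rw [h₁]; bicategory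
      _ = _ := by rw [h₂]; bicategory)
  rightUnitor {P Q} f := mkIso (ρ_ _) (ρ_ _) (by
    unfold SqHom
    simp only [compHom, idHom, sqVComp, sqOne, Iso.trans_hom, whiskerLeftIso_hom,
      whiskerRightIso_hom, Iso.symm_hom, T.F.map₂_right_unitor, Category.assoc]
    have h₁ := (T.F.mapComp f.base (𝟙 Q.base)).inv_hom_id
    have h₂ := (T.F.mapId Q.base).inv_hom_id
    symm
    calc
      _ = 𝟙 _ ⊗≫ ((f.top ≫ Q.leg) ◁ (T.F.mapId Q.base).inv ≫ f.sq.hom ▷ T.F.map (𝟙 Q.base)) ⊗≫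
          P.leg ◁ (((T.F.mapComp f.base (𝟙 Q.base)).inv ≫ (T.F.mapComp f.base (𝟙 Q.base)).hom) ⊗≫
          T.F.map f.base ◁ (T.F.mapId Q.base).hom) ⊗≫ 𝟙 _ := by bicategory
      _ = 𝟙 _ ⊗≫ f.sq.hom ⊗≫ P.leg ◁ (T.F.map f.base ◁ ((T.F.mapId Q.base).inv ≫
          (T.F.mapId Q.base).hom)) ⊗≫ 𝟙 _ := by rw [h₁, whisker_exchange]; bicategory
      _ = _ := by rw [h₂]; bicategory)
  whiskerLeft_id _ _ := Hom₂.ext (whiskerLeft_id _ _) (whiskerLeft_id _ _)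
  whiskerLeft_comp _ _ _ _ _ _ := Hom₂.ext (whiskerLeft_comp _ _ _) (whiskerLeft_comp _ _ _)
  id_whiskerLeft _ := Hom₂.ext (id_whiskerLeft _) (id_whiskerLeft _)
  comp_whiskerLeft _ _ _ _ _ := Hom₂.ext (comp_whiskerLeft _ _ _) (comp_whiskerLeft _ _ _)
  id_whiskerRight _ _ := Hom₂.ext (id_whiskerRight _ _) (id_whiskerRight _ _)
  comp_whiskerRight _ _ _ := Hom₂.ext (comp_whiskerRight _ _ _) (comp_whiskerRight _ _ _)
  whiskerRight_id _ := Hom₂.ext (whiskerRight_id _) (whiskerRight_id _)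
  whiskerRight_comp _ _ _ := Hom₂.ext (whiskerRight_comp _ _ _) (whiskerRight_comp _ _ _)
  whisker_assoc _ _ _ _ _ := Hom₂.ext (whisker_assoc _ _ _) (whisker_assoc _ _ _)
  whisker_exchange _ _ := Hom₂.ext (whisker_exchange _ _) (whisker_exchange _ _)
  pentagon _ _ _ _ := Hom₂.ext (pentagon _ _ _ _) (pentagon _ _ _ _)
  triangle _ _ := Hom₂.ext (triangle _ _) (triangle _ _)

end Comma
end Comma
end BraidedBicat

namespace BraidedBicat

/-! ### Units and changes of side of squares -/

section SquareCalculus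

variable {B : Type u} [Bicategory.{w, v} B]

theorem SqHom.vcomp {X X' Y Y' : B} {p p' p'' : X ⟶ X'} {e : X ⟶ Y} {e' : X' ⟶ Y'}
    {q q' q'' : Y ⟶ Y'} {s : p ≫ e' ≅ e ≫ q} {s' : p' ≫ e' ≅ e ≫ q'} {s'' : p'' ≫ e' ≅ e ≫ q''}
    {η : p ⟶ p'} {θ : q ⟶ q'} {η' : p' ⟶ p''} {θ' : q' ⟶ q''}
    (h : SqHom s s' η θ) (h' : SqHom s' s'' η' θ') : SqHom s s'' (η ≫ η') (θ ≫ θ') := by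
  unfold SqHom at *
  rw [comp_whiskerRight, Category.assoc, h', reassoc_of% h, whiskerLeft_comp]

theorem SqHom.whiskerLeftIso {X X' Y Y' : B} {p p' : X ⟶ X'} {e : X ⟶ Y} {e' : X' ⟶ Y'}
    {q q' q'' : Y ⟶ Y'} {s : p ≫ e' ≅ e ≫ q} {s' : p' ≫ e' ≅ e ≫ q'}
    {η : p ⟶ p'} {θ : q ⟶ q''} (a : q' ≅ q'') (h : SqHom s s' η (θ ≫ a.inv)) :
    SqHom s (s' ≪≫ Bicategory.whiskerLeftIso e a) η θ := by
  unfold SqHom at *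
  simp only [Iso.trans_hom, whiskerLeftIso_hom, reassoc_of% h]
  simp

/-- A change of the side `q` along an isomorphism is a morphism of squares. -/
theorem SqHom.of_whiskerLeftIso {X X' Y Y' : B} {p : X ⟶ X'} {e : X ⟶ Y} {e' : X' ⟶ Y'}
    {q q' : Y ⟶ Y'} (s : p ≫ e' ≅ e ≫ q) (a : q ≅ q') :
    SqHom (s ≪≫ Bicategory.whiskerLeftIso e a) s (𝟙 p) a.inv := by
  simp [SqHom]

theorem sqOne_sqComp {X Y Z : B} (e : X ⟶ Y) (d : Y ⟶ Z) :
    sqComp (sqOne e) (sqOne d) = sqOne (e ≫ d) := by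
  ext
  simp only [sqComp, sqOne, Iso.trans_hom, whiskerLeftIso_hom, whiskerRightIso_hom, Iso.symm_hom]
  bicategory

theorem sqConj_sqOne {X Y : B} {d e : X ⟶ Y} (a : d ≅ e) :
    sqConj a a (sqOne e) = sqOne d := by
  ext
  simp only [sqConj, sqOne, Iso.trans_hom, whiskerLeftIso_hom, whiskerRightIso_hom, Iso.symm_hom]
  calc
    _ = 𝟙 _ ⊗≫ (a.hom ≫ a.inv) ⊗≫ 𝟙 _ := by bicategory
    _ = _ := by rw [Iso.hom_inv_id]; bicategory

end SquareCalculus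

/-! ### Tensor products of squares -/

section TensorSquares
open TensorBicategory
variable {B : Type u} [Bicategory.{w, v} B] [TensorBicategory B]

/-- Up to the comparison of composites, the tensor product of two squares is the tensor product of
their 2-cells. -/
theorem tSplit_id_sqTensor {X X' Y Y' Z Z' W W' : B} {p : X ⟶ X'} {e : X ⟶ Y} {e' : X' ⟶ Y'}
    {q : Y ⟶ Y'} {p₂ : Z ⟶ Z'} {d : Z ⟶ W} {d' : Z' ⟶ W'} {q₂ : W ⟶ W'}
    (s : p ≫ e' ≅ e ≫ q) (t : p₂ ≫ d' ≅ d ≫ q₂) {r : X ⟶ Y'} {r₂ : Z ⟶ W'} (a : r ⟶ p ≫ e')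
    (b : r₂ ⟶ p₂ ≫ d') :
    tSplit a b ≫ (sqTensor s t).hom = tSplit (a ≫ s.hom) (b ≫ t.hom) := by
  simp [tSplit, sqTensor, tHom₂_comp]

theorem SqHom.tensor {X X' Y Y' Z Z' W W' : B} {p p' : X ⟶ X'} {e : X ⟶ Y} {e' : X' ⟶ Y'}
    {q q' : Y ⟶ Y'} {p₂ p₂' : Z ⟶ Z'} {d : Z ⟶ W} {d' : Z' ⟶ W'} {q₂ q₂' : W ⟶ W'}
    {s : p ≫ e' ≅ e ≫ q} {s' : p' ≫ e' ≅ e ≫ q'} {t : p₂ ≫ d' ≅ d ≫ q₂}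
    {t' : p₂' ≫ d' ≅ d ≫ q₂'} {η : p ⟶ p'} {θ : q ⟶ q'} {η₂ : p₂ ⟶ p₂'} {θ₂ : q₂ ⟶ q₂'}
    (h : SqHom s s' η θ) (h₂ : SqHom t t' η₂ θ₂) :
    SqHom (sqTensor s t) (sqTensor s' t') (η ⊠₂ η₂) (θ ⊠₂ θ₂) := by
  unfold SqHom at *
  rw [← cancel_epi (tSplitIso (Iso.refl (p ≫ e')) (Iso.refl (p₂ ≫ d'))).hom, tSplitIso_hom,
    reassoc_of% tSplit_right, tSplit_id_sqTensor, reassoc_of% tSplit_id_sqTensor, tSplit_left]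
  simp [h, h₂]

/-- The comparisons of composites form a morphism from the tensor product of vertical pastings to
the vertical pasting of tensor products. -/
theorem sqTensor_sqVComp {X X' X'' Y Y' Y'' Z Z' Z'' W W' W'' : B}
    {p : X ⟶ X'} {p' : X' ⟶ X''} {e : X ⟶ Y} {e' : X' ⟶ Y'} {e'' : X'' ⟶ Y''}
    {q : Y ⟶ Y'} {q' : Y' ⟶ Y''} {p₂ : Z ⟶ Z'} {p₂' : Z' ⟶ Z''} {d : Z ⟶ W} {d' : Z' ⟶ W'}
    {d'' : Z'' ⟶ W''} {q₂ : W ⟶ W'} {q₂' : W' ⟶ W''}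
    (s : p ≫ e' ≅ e ≫ q) (s' : p' ≫ e'' ≅ e' ≫ q') (t : p₂ ≫ d' ≅ d ≫ q₂)
    (t' : p₂' ≫ d'' ≅ d' ≫ q₂') :
    SqHom (sqTensor (sqVComp s s') (sqVComp t t')) (sqVComp (sqTensor s t) (sqTensor s' t'))
      (tComp p p' p₂ p₂').hom (tComp q q' q₂ q₂').hom := by
  unfold SqHom
  have e₀ : ∀ {X₁ X₂ X₃ Y₁ Y₂ Y₃ : B} (f : X₁ ⟶ X₂) (f' : X₂ ⟶ X₃) (g : Y₁ ⟶ Y₂) (g' : Y₂ ⟶ Y₃),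
    (tComp f f' g g').hom = tSplit (𝟙 _) (𝟙 _) := fun f f' g g' => by
      simp [tSplit, tHom₂_id]
  rw [← cancel_epi (tSplitIso (Iso.refl ((p ≫ p') ≫ e'')) (Iso.refl ((p₂ ≫ p₂') ≫ d''))).hom,
    tSplitIso_hom, reassoc_of% tSplit_id_sqTensor, e₀, e₀]
  simp only [Iso.refl_hom, sqVComp_hom, Category.id_comp]
  have h₁ := tSplit_assoc (𝟙 ((p ≫ p') ≫ e'')) (𝟙 ((p₂ ≫ p₂') ≫ d'')) (𝟙 _) (𝟙 _)
    (α_ _ _ _).hom (α_ _ _ _).hom (𝟙 _) (𝟙 _) (by simp) (by simp)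
  have h₂ := tSplit_assoc ((α_ p p' e'').hom ≫ p ◁ s'.hom ≫ (α_ p e' q').inv)
    ((α_ p₂ p₂' d'').hom ≫ p₂ ◁ t'.hom ≫ (α_ p₂ d' q₂').inv) (𝟙 _) (𝟙 _)
    ((α_ p p' e'').hom ≫ p ◁ s'.hom) ((α_ p₂ p₂' d'').hom ≫ p₂ ◁ t'.hom) (𝟙 _) (𝟙 _)
    (by simp) (by simp)
  have h₃ := tSplit_assoc ((α_ p p' e'').hom ≫ p ◁ s'.hom ≫ (α_ p e' q').inv ≫ s.hom ▷ q')
    ((α_ p₂ p₂' d'').hom ≫ p₂ ◁ t'.hom ≫ (α_ p₂ d' q₂').inv ≫ t.hom ▷ q₂') (𝟙 _) (𝟙 _)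
    ((α_ p p' e'').hom ≫ p ◁ s'.hom ≫ (α_ p e' q').inv ≫ s.hom ▷ q' ≫ (α_ e q q').hom)
    ((α_ p₂ p₂' d'').hom ≫ p₂ ◁ t'.hom ≫ (α_ p₂ d' q₂').inv ≫ t.hom ▷ q₂' ≫ (α_ d q₂ q₂').hom)
    (𝟙 _) (𝟙 _)
    (by simp) (by simp)
  have h₄ : p ⊠₁ p₂ ◁ tSplit s'.hom t'.hom =
      p ⊠₁ p₂ ◁ (s'.hom ⊠₂ t'.hom) ≫ p ⊠₁ p₂ ◁ tSplit (𝟙 _) (𝟙 _) := by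
    rw [← whiskerLeft_comp, tSplit_pre]; simp
  have h₅ : tSplit s.hom t.hom ▷ q' ⊠₁ q₂' =
      (s.hom ⊠₂ t.hom) ▷ q' ⊠₁ q₂' ≫ tSplit (𝟙 _) (𝟙 _) ▷ q' ⊠₁ q₂' := by
    rw [← comp_whiskerRight, tSplit_pre]; simp
  have h₆ : tSplit (𝟙 _) (𝟙 _) ▷ q' ⊠₁ q₂' ≫ (sqTensor s t).hom ▷ q' ⊠₁ q₂' =
      tSplit s.hom t.hom ▷ q' ⊠₁ q₂' := by
    rw [← comp_whiskerRight, tSplit_id_sqTensor]; simp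
  rw [reassoc_of% h₁, ← whiskerLeft_comp_assoc, tSplit_id_sqTensor, Category.id_comp,
    Category.id_comp, h₄, Category.assoc, reassoc_of% tSplit_left, ← reassoc_of% h₂,
    Iso.hom_inv_id_assoc, reassoc_of% h₆, h₅, Category.assoc, reassoc_of% tSplit_right]
  simpa using h₃

theorem sqTensor_sqOne {X X' Y Y' : B} (f : X ⟶ X') (g : Y ⟶ Y') :
    SqHom (sqTensor (sqOne f) (sqOne g)) (sqOne (f ⊠₁ g)) (tId X Y).hom (tId X' Y').hom := by
  unfold SqHom
  have h₁ := tSplit_unit (𝟙 (𝟙 X ≫ f)) (𝟙 (𝟙 Y ≫ g))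
  have h₂ := tSplit_unit_right ((λ_ f).hom ≫ (ρ_ f).inv) ((λ_ g).hom ≫ (ρ_ g).inv)
  rw [← cancel_epi (tSplitIso (Iso.refl (𝟙 X ≫ f)) (Iso.refl (𝟙 Y ≫ g))).hom,
    tSplitIso_hom, reassoc_of% tSplit_id_sqTensor, ← cancel_mono (ρ_ (f ⊠₁ g)).hom]
  simp only [sqOne, Iso.refl_hom, Iso.trans_hom, Iso.symm_hom, Category.assoc, Iso.inv_hom_id,
    Category.comp_id, Category.id_comp] at h₁ h₂ ⊢
  rw [h₁, h₂]

end TensorSquares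

/-! ### The tensor product of the comma bicategory -/

namespace Comma
open TensorBicategory

variable {M : Type u₁} [Bicategory.{w₁, v₁} M] [MonoidalBicategory M]
  {N : Type u₂} [Bicategory.{w₂, v₂} N] [MonoidalBicategory N] {T : TensorPseudofunctor M N}

theorem id_sq (P : Comma T) : Hom₁.sq (𝟙 P) =
    sqOne P.leg ≪≫ whiskerLeftIso P.leg (T.F.mapId P.base).symm := rfl

theorem comp_sq {P Q R : Comma T} (f : P ⟶ Q) (g : Q ⟶ R) : Hom₁.sq (f ≫ g) =
    sqVComp f.sq g.sq ≪≫ whiskerLeftIso P.leg (T.F.mapComp f.base g.base).symm := rfl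

/-- The leg of a tensor product. It is `chi` for two objects of the form `of X`, and the tensor
product of the legs followed by `chi` otherwise. -/
@[reducible] def tLeg : (P Q : Comma T) → (P.top ⊠ Q.top ⟶ T.F.obj (P.base ⊠ Q.base))
  | of X, of Y => T.chi X Y
  | mk _ P p, Q => p ⊠₁ Q.leg ≫ T.chi P Q.base
  | of X, mk _ Q q => 𝟙 (T.F.obj X) ⊠₁ q ≫ T.chi X Q

/-- The leg of a tensor product is always isomorphic to the tensor product of the legs followed by
`chi`. -/
def tLegIso : (P Q : Comma T) → (tLeg P Q ≅ P.leg ⊠₁ Q.leg ≫ T.chi P.base Q.base)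
  | of X, of Y => (λ_ (T.chi X Y)).symm ≪≫
      whiskerRightIso (tId (T.F.obj X) (T.F.obj Y)).symm (T.chi X Y)
  | mk _ _ _, _ => Iso.refl _
  | of _, mk _ _ _ => Iso.refl _

/-- The tensor product of objects of the comma bicategory. -/
@[reducible] def tensorObj (P Q : Comma T) : Comma T :=
  mk (P.top ⊠ Q.top) (P.base ⊠ Q.base) (tLeg P Q)

/-- The tensor product of 1-cells: the tensor product of the squares, pasted with naturality of
`chi`. -/
def tensorHom {P P' Q Q' : Comma T} (f : P ⟶ P') (g : Q ⟶ Q') : tensorObj P Q ⟶ tensorObj P' Q' :=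
  ⟨f.top ⊠₁ g.top, f.base ⊠₁ g.base, sqConj (tLegIso P Q) (tLegIso P' Q')
    (sqComp (sqTensor f.sq g.sq) (T.chiNat f.base g.base))⟩

instance : TensorBicategory (Comma T) where
  tObj := tensorObj
  tHom := tensorHom
  tHom₂ η θ := ⟨η.top ⊠₂ θ.top, η.base ⊠₂ θ.base, SqHom.conj
    (SqHom.hcomp (SqHom.tensor η.comm θ.comm) (T.chiNat_naturality η.base θ.base)) _ _⟩
  tHom₂_id _ _ := Hom₂.ext (tHom₂_id _ _) (tHom₂_id _ _)
  tHom₂_comp _ _ _ _ := Hom₂.ext (tHom₂_comp _ _ _ _) (tHom₂_comp _ _ _ _)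
  tId P Q := mkIso (tId _ _) (tId _ _) (by
    rw [id_sq]
    refine SqHom.whiskerLeftIso _ ?_
    rw [← sqConj_sqOne (tLegIso P Q), ← sqOne_sqComp]
    refine SqHom.conj (SqHom.hcomp (θ := (T.F.mapId P.base).hom ⊠₂ (T.F.mapId Q.base).hom ≫
      (tId _ _).hom) ?_ (T.chiNat_id P.base Q.base).symm) _ _
    have h₁ := SqHom.tensor (SqHom.of_whiskerLeftIso (sqOne P.leg) (T.F.mapId P.base).symm)
      (SqHom.of_whiskerLeftIso (sqOne Q.leg) (T.F.mapId Q.base).symm)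
    have h := h₁.vcomp (sqTensor_sqOne P.leg Q.leg)
    simp only [tHom₂_id, Category.id_comp, Iso.symm_inv] at h
    exact h)
  tComp {P P' P'' Q Q' Q''} f f' g g' := mkIso (tComp _ _ _ _) (tComp _ _ _ _) (by
    rw [comp_sq]
    refine SqHom.whiskerLeftIso _ ?_
    dsimp only [tensorHom]
    rw [sqVComp_sqConj, sqVComp_sqComp]
    refine SqHom.conj (SqHom.hcomp (θ := (T.F.mapComp f.base f'.base).hom ⊠₂
      (T.F.mapComp g.base g'.base).hom ≫ (tComp _ _ _ _).hom) ?_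
      (T.chiNat_comp f.base f'.base g.base g'.base).symm) _ _
    have h₁ := SqHom.tensor
      (SqHom.of_whiskerLeftIso (sqVComp f.sq f'.sq) (T.F.mapComp f.base f'.base).symm)
      (SqHom.of_whiskerLeftIso (sqVComp g.sq g'.sq) (T.F.mapComp g.base g'.base).symm)
    have h := h₁.vcomp (sqTensor_sqVComp f.sq f'.sq g.sq g'.sq)
    simp only [tHom₂_id, Category.id_comp, Iso.symm_inv] at h
    exact h)
  tHom₂_whiskerLeft _ _ _ _ _ _ _ _ := Hom₂.ext (tHom₂_whiskerLeft _ _ _ _)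
    (tHom₂_whiskerLeft _ _ _ _)
  tHom₂_whiskerRight _ _ _ _ := Hom₂.ext (tHom₂_whiskerRight _ _ _ _) (tHom₂_whiskerRight _ _ _ _)
  tHom₂_associator _ _ _ _ _ _ := Hom₂.ext (tHom₂_associator _ _ _ _ _ _)
    (tHom₂_associator _ _ _ _ _ _)
  tHom₂_leftUnitor _ _ := Hom₂.ext (tHom₂_leftUnitor _ _) (tHom₂_leftUnitor _ _)
  tHom₂_rightUnitor _ _ := Hom₂.ext (tHom₂_rightUnitor _ _) (tHom₂_rightUnitor _ _)
  unitObj := mk unitObj unitObj T.iota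

end Comma

end BraidedBicat

namespace BraidedBicat

/-! ### Conjugation of squares, cubes and modifications -/

section SquareCalculus

variable {B : Type u} [Bicategory.{w, v} B]

theorem sqConj_sqConj {X X' Y Y' : B} {p : X ⟶ X'} {e d c : X ⟶ Y} {e' d' c' : X' ⟶ Y'}
    {q : Y ⟶ Y'} (a : d ≅ e) (a' : d' ≅ e') (b : c ≅ d) (b' : c' ≅ d') (s : p ≫ e' ≅ e ≫ q) :
    sqConj b b' (sqConj a a' s) = sqConj (b ≪≫ a) (b' ≪≫ a') s := by
  ext; simp [sqConj]

theorem sqComp_sqConj_left {X X' Y Y' Z Z' : B} {p : X ⟶ X'} {e c : X ⟶ Y} {e' c' : X' ⟶ Y'}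
    {q : Y ⟶ Y'} {d : Y ⟶ Z} {d' : Y' ⟶ Z'} {r : Z ⟶ Z'} (a : c ≅ e) (a' : c' ≅ e')
    (s : p ≫ e' ≅ e ≫ q) (t : q ≫ d' ≅ d ≫ r) :
    sqComp (sqConj a a' s) t =
      sqConj (whiskerRightIso a d) (whiskerRightIso a' d') (sqComp s t) := by
  ext
  simp only [sqConj, sqComp, Iso.trans_hom, whiskerLeftIso_hom, whiskerRightIso_hom, Iso.symm_hom,
    whiskerRightIso_inv]
  calc
    _ = 𝟙 _ ⊗≫ p ◁ a'.hom ▷ d' ⊗≫ s.hom ▷ d' ⊗≫ (a.inv ▷ (q ≫ d') ≫ c ◁ t.hom) ⊗≫ 𝟙 _ := by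
      bicategory
    _ = _ := by rw [← whisker_exchange]; bicategory

theorem sqComp_assoc {X X' Y Y' Z Z' W W' : B} {p : X ⟶ X'} {e : X ⟶ Y} {e' : X' ⟶ Y'}
    {q : Y ⟶ Y'} {d : Y ⟶ Z} {d' : Y' ⟶ Z'} {r : Z ⟶ Z'} {c : Z ⟶ W} {c' : Z' ⟶ W'} {o : W ⟶ W'}
    (s : p ≫ e' ≅ e ≫ q) (t : q ≫ d' ≅ d ≫ r) (x : r ≫ c' ≅ c ≫ o) :
    sqComp (sqComp s t) x = sqConj (α_ e d c) (α_ e' d' c') (sqComp s (sqComp t x)) := by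
  ext
  simp only [sqConj, sqComp, Iso.trans_hom, whiskerLeftIso_hom, whiskerRightIso_hom, Iso.symm_hom]
  bicategory

/-- A commutative cube, read as a morphism of squares between pastings of its other faces. -/
theorem sqHom_of_cube {X X' Y Y' Z Z' W W' : B} {F' : X ⟶ X'} {F : Y ⟶ Y'} {L : X ⟶ Y}
    {L' : X' ⟶ Y'} {a : X ⟶ Z} {a' : X' ⟶ Z'} {b : Y ⟶ W} {b' : Y' ⟶ W'} {G' : Z ⟶ Z'}
    {G : W ⟶ W'} {R : Z ⟶ W} {R' : Z' ⟶ W'} {φ : F' ≫ a' ≅ a ≫ G'} {ψ : F ≫ b' ≅ b ≫ G}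
    {S : F' ≫ L' ≅ L ≫ F} {S' : G' ≫ R' ≅ R ≫ G} {ℓ : L ≫ b ≅ a ≫ R} {ℓ' : L' ≫ b' ≅ a' ≫ R'}
    (h : (sqVComp φ ℓ').hom ≫ a ◁ S'.hom = S.hom ▷ b' ≫ (sqVComp ℓ ψ).hom) :
    SqHom (sqVComp S ℓ'.symm) (sqVComp ℓ.symm S') φ.hom ψ.hom := by
  unfold SqHom
  simp only [sqVComp, Iso.trans_hom, whiskerLeftIso_hom, whiskerRightIso_hom, Iso.symm_hom,
    Category.assoc] at h ⊢
  rw [← cancel_epi ((α_ F' L' b').hom ≫ F' ◁ ℓ'.hom ≫ (α_ F' a' R').inv)]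
  simp only [Category.assoc]
  have h' := congrArg (fun t => t ≫ (α_ a R G).inv ≫ ℓ.inv ▷ G ≫ (α_ L b G).hom) h
  simp only [Category.assoc] at h'
  rw [h']
  simp

/-- The modification axiom, read as a morphism of squares. -/
theorem sqHom_of_modification {X X' Y Y' Z Z' W W' : B} {F' : X ⟶ X'} {F : Y ⟶ Y'} {L : X ⟶ Y}
    {L' : X' ⟶ Y'} {a : X ⟶ Z} {a' : X' ⟶ Z'} {b : Y ⟶ W} {b' : Y' ⟶ W'} {G' : Z ⟶ Z'}
    {G : W ⟶ W'} {R : Z ⟶ W} {R' : Z' ⟶ W'} {φ : F' ≫ a' ≅ a ≫ G'} {ψ : F ≫ b' ≅ b ≫ G}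
    {S : F' ≫ L' ≅ L ≫ F} {S' : G' ≫ R' ≅ R ≫ G} {υ : a ≫ R ≅ L ≫ b} {υ' : a' ≫ R' ≅ L' ≫ b'}
    (h : F' ◁ υ'.hom ≫ (sqComp S ψ).hom = (sqComp φ S').hom ≫ υ.hom ▷ G) :
    SqHom (sqVComp S υ') (sqVComp υ S') φ.hom ψ.hom := by
  unfold SqHom
  simp only [sqVComp, sqComp, Iso.trans_hom, whiskerLeftIso_hom, whiskerRightIso_hom, Iso.symm_hom,
    Category.assoc] at h ⊢
  rw [← cancel_epi (α_ F' a' R').inv, ← cancel_mono (α_ L b G).inv]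
  simp only [Category.assoc, Iso.hom_inv_id, Category.comp_id, Iso.inv_hom_id_assoc] at h ⊢
  rw [h]

end SquareCalculus

/-! ### Tensor products of conjugated and pasted squares -/

section TensorSquares
open TensorBicategory
variable {B : Type u} [Bicategory.{w, v} B] [TensorBicategory B]

section
variable {X X' Y Y' Z Z' W W' : B} {p : X ⟶ X'} {e c : X ⟶ Y} {e' c' : X' ⟶ Y'}
    {q : Y ⟶ Y'} {p₂ : Z ⟶ Z'} {d : Z ⟶ W} {d' : Z' ⟶ W'} {q₂ : W ⟶ W'}

theorem sqTensor_sqConj_left (a : c ≅ e) (a' : c' ≅ e')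
    (s : p ≫ e' ≅ e ≫ q) (t : p₂ ≫ d' ≅ d ≫ q₂) :
    sqTensor (sqConj a a' s) t =
      sqConj (tIso a (Iso.refl d)) (tIso a' (Iso.refl d')) (sqTensor s t) := by
  ext
  rw [← cancel_epi (tSplitIso (Iso.refl (p ≫ c')) (Iso.refl (p₂ ≫ d'))).hom, tSplitIso_hom,
    tSplit_id_sqTensor]
  have h : tSplit (𝟙 (p ≫ c')) (𝟙 (p₂ ≫ d')) ≫ p ⊠₁ p₂ ◁ (a'.hom ⊠₂ 𝟙 d') =
      tSplit (p ◁ a'.hom) (𝟙 _) := by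
    rw [tSplit_left]; simp
  simp [sqConj, reassoc_of% h, reassoc_of% tSplit_id_sqTensor, tSplit_right]

theorem sqTensor_sqConj_right (a : c ≅ e) (a' : c' ≅ e')
    (s : p ≫ e' ≅ e ≫ q) (t : p₂ ≫ d' ≅ d ≫ q₂) :
    sqTensor t (sqConj a a' s) =
      sqConj (tIso (Iso.refl d) a) (tIso (Iso.refl d') a') (sqTensor t s) := by
  ext
  rw [← cancel_epi (tSplitIso (Iso.refl (p₂ ≫ d')) (Iso.refl (p ≫ c'))).hom, tSplitIso_hom,
    tSplit_id_sqTensor]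
  have h : tSplit (𝟙 (p₂ ≫ d')) (𝟙 (p ≫ c')) ≫ p₂ ⊠₁ p ◁ (𝟙 d' ⊠₂ a'.hom) =
      tSplit (𝟙 _) (p ◁ a'.hom) := by
    rw [tSplit_left]; simp
  simp [sqConj, reassoc_of% h, reassoc_of% tSplit_id_sqTensor, tSplit_right]

end

theorem sqComp_hom {B : Type u} [Bicategory.{w, v} B] {X X' Y Y' Z Z' : B} {p : X ⟶ X'}
    {e : X ⟶ Y} {e' : X' ⟶ Y'} {q : Y ⟶ Y'}
    {d : Y ⟶ Z} {d' : Y' ⟶ Z'} {r : Z ⟶ Z'}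
    (s : p ≫ e' ≅ e ≫ q) (t : q ≫ d' ≅ d ≫ r) : (sqComp s t).hom =
    (α_ p e' d').inv ≫ s.hom ▷ d' ≫ (α_ e q d').hom ≫ e ◁ t.hom ≫ (α_ e d r).inv := rfl

/-- Tensor products of squares commute with horizontal pasting, up to the comparisons of
composites. -/
theorem sqTensor_sqComp {X X' Y Y' Z Z' X₂ X₂' Y₂ Y₂' Z₂ Z₂' : B}
    {p : X ⟶ X'} {e : X ⟶ Y} {e' : X' ⟶ Y'} {q : Y ⟶ Y'} {d : Y ⟶ Z} {d' : Y' ⟶ Z'} {r : Z ⟶ Z'}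
    {p₂ : X₂ ⟶ X₂'} {e₂ : X₂ ⟶ Y₂} {e₂' : X₂' ⟶ Y₂'} {q₂ : Y₂ ⟶ Y₂'} {d₂ : Y₂ ⟶ Z₂}
    {d₂' : Y₂' ⟶ Z₂'} {r₂ : Z₂ ⟶ Z₂'}
    (s : p ≫ e' ≅ e ≫ q) (t : q ≫ d' ≅ d ≫ r) (s₂ : p₂ ≫ e₂' ≅ e₂ ≫ q₂)
    (t₂ : q₂ ≫ d₂' ≅ d₂ ≫ r₂) :
    sqTensor (sqComp s t) (sqComp s₂ t₂) = sqConj (tComp e d e₂ d₂) (tComp e' d' e₂' d₂')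
      (sqComp (sqTensor s s₂) (sqTensor t t₂)) := by
  ext
  have e₀ : ∀ {X₁ X₂ X₃ Y₁ Y₂ Y₃ : B} (f : X₁ ⟶ X₂) (f' : X₂ ⟶ X₃) (g : Y₁ ⟶ Y₂) (g' : Y₂ ⟶ Y₃),
    (tComp f f' g g').hom = tSplit (𝟙 _) (𝟙 _) := fun f f' g g' => by
      simp [tSplit, tHom₂_id]
  rw [← cancel_epi (tSplitIso (Iso.refl (p ≫ e' ≫ d')) (Iso.refl (p₂ ≫ e₂' ≫ d₂'))).hom,
    tSplitIso_hom, tSplit_id_sqTensor, ← cancel_mono ((tComp e d e₂ d₂).hom ▷ r ⊠₁ r₂),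
    ← cancel_mono (α_ _ _ _).hom]
  have h₁ := tSplit_assoc (α_ p e' d').inv (α_ p₂ e₂' d₂').inv (𝟙 _) (𝟙 _)
    (𝟙 (p ≫ e' ≫ d')) (𝟙 (p₂ ≫ e₂' ≫ d₂')) (𝟙 _) (𝟙 _) (by simp) (by simp)
  have h₂ := tSplit_assoc ((α_ p e' d').inv ≫ s.hom ▷ d') ((α_ p₂ e₂' d₂').inv ≫ s₂.hom ▷ d₂')
    (𝟙 _) (𝟙 _) ((α_ p e' d').inv ≫ s.hom ▷ d' ≫ (α_ e q d').hom)
    ((α_ p₂ e₂' d₂').inv ≫ s₂.hom ▷ d₂' ≫ (α_ e₂ q₂ d₂').hom) (𝟙 _) (𝟙 _) (by simp) (by simp)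
  have h₃ := tSplit_assoc (sqComp s t).hom (sqComp s₂ t₂).hom
    (𝟙 _) (𝟙 _) ((α_ p e' d').inv ≫ s.hom ▷ d' ≫ (α_ e q d').hom ≫ e ◁ t.hom)
    ((α_ p₂ e₂' d₂').inv ≫ s₂.hom ▷ d₂' ≫ (α_ e₂ q₂ d₂').hom ≫ e₂ ◁ t₂.hom) (𝟙 _) (𝟙 _)
    (by simp [sqComp_hom]) (by simp [sqComp_hom])
  have h₄ : tSplit s.hom s₂.hom ▷ d' ⊠₁ d₂' =
      (s.hom ⊠₂ s₂.hom) ▷ d' ⊠₁ d₂' ≫ tSplit (𝟙 _) (𝟙 _) ▷ d' ⊠₁ d₂' := by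
    rw [← comp_whiskerRight, tSplit_pre]; simp
  have h₅ : e ⊠₁ e₂ ◁ tSplit t.hom t₂.hom =
      e ⊠₁ e₂ ◁ (t.hom ⊠₂ t₂.hom) ≫ e ⊠₁ e₂ ◁ tSplit (𝟙 _) (𝟙 _) := by
    rw [← whiskerLeft_comp, tSplit_pre]; simp
  rw [e₀]
  simp only [Iso.refl_hom, Category.id_comp, Category.assoc]
  rw [h₃]
  simp only [sqConj, Iso.trans_hom, whiskerLeftIso_hom, whiskerRightIso_hom, Iso.symm_hom,
    Category.assoc, sqComp_hom]
  rw [e₀, ← reassoc_of% h₁, Iso.hom_inv_id_assoc, ← comp_whiskerRight_assoc, tSplit_id_sqTensor,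
    Category.id_comp, Category.id_comp, h₄, Category.assoc, reassoc_of% tSplit_right,
    reassoc_of% h₂, ← whiskerLeft_comp_assoc, tSplit_id_sqTensor, Category.id_comp,
    Category.id_comp, h₅, Category.assoc, reassoc_of% tSplit_left]
  have h₇ : (tComp e d e₂ d₂).inv ▷ r ⊠₁ r₂ ≫ tSplit (𝟙 (e ≫ d)) (𝟙 (e₂ ≫ d₂)) ▷ r ⊠₁ r₂ = 𝟙 _ := by
    rw [← e₀, inv_hom_whiskerRight]
  rw [reassoc_of% h₇]
  simp

end TensorSquares

end BraidedBicat

namespace BraidedBicat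

/-! ### Threefold tensor products of squares -/

section SquareCalculus

theorem sqConj_sqId {B : Type u} [Bicategory.{w, v} B] {X X' Y Y' : B} {p : X ⟶ X'} {e : X ⟶ Y}
    {e' : X' ⟶ Y'} {q : Y ⟶ Y'} (s : p ≫ e' ≅ e ≫ q) :
    sqConj (ρ_ e).symm (ρ_ e').symm (sqComp s (sqId q)) = s := by
  ext
  simp only [sqConj, sqComp, sqId, Iso.trans_hom, whiskerLeftIso_hom, whiskerRightIso_hom,
    Iso.symm_hom, Iso.symm_inv]
  bicategory

open TensorBicategory

variable {B : Type u} [Bicategory.{w, v} B] [TensorBicategory B]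
  {X X' Y Y' Z Z' X₃ X₃' Y₃ Y₃' W W' : B} {p : X ⟶ X'} {e : X ⟶ Y} {e' : X' ⟶ Y'} {q : Y ⟶ Y'}
  {d : Y ⟶ Z} {d' : Y' ⟶ Z'} {r : Z ⟶ Z'} {c : X ⟶ Z} {c' : X' ⟶ Z'}
  {p₃ : X₃ ⟶ X₃'} {e₃ : X₃ ⟶ Y₃} {e₃' : X₃' ⟶ Y₃'} {q₃ : Y₃ ⟶ Y₃'} {t : W ⟶ W'}

theorem sqConj_sqTensor_sqConj_left {k : Z ⊠ Y₃ ⟶ W} {k' : Z' ⊠ Y₃' ⟶ W'} {g : X ⊠ X₃ ⟶ W}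
    {g' : X' ⊠ X₃' ⟶ W'} (a : c ≅ e ≫ d) (a' : c' ≅ e' ≫ d') (E : g ≅ c ⊠₁ e₃ ≫ k)
    (E' : g' ≅ c' ⊠₁ e₃' ≫ k') (s : p ≫ e' ≅ e ≫ q) (x : q ≫ d' ≅ d ≫ r)
    (s₃ : p₃ ≫ e₃' ≅ e₃ ≫ q₃) (y : r ⊠₁ q₃ ≫ k' ≅ k ≫ t) :
    sqConj E E' (sqComp (sqTensor (sqConj a a' (sqComp s x)) s₃) y) =
      sqConj (E ≪≫ whiskerRightIso (tIso a (Iso.refl e₃) ≪≫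
          tSplitIso (Iso.refl _) (ρ_ e₃).symm) k ≪≫ α_ _ _ _)
        (E' ≪≫ whiskerRightIso (tIso a' (Iso.refl e₃') ≪≫
          tSplitIso (Iso.refl _) (ρ_ e₃').symm) k' ≪≫ α_ _ _ _)
        (sqComp (sqTensor s s₃) (sqComp (sqTensor x (sqId q₃)) y)) := by
  conv_lhs => rw [← sqConj_sqId s₃, sqTensor_sqConj_left, sqTensor_sqConj_right,
    sqTensor_sqComp]
  rw [sqConj_sqConj, sqConj_sqConj, sqComp_sqConj_left, sqComp_assoc, sqConj_sqConj, sqConj_sqConj]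
  congr 1 <;> ext <;> simp [tSplitIso]

theorem sqConj_sqTensor_sqConj_right {k : Y₃ ⊠ Z ⟶ W} {k' : Y₃' ⊠ Z' ⟶ W'} {g : X₃ ⊠ X ⟶ W}
    {g' : X₃' ⊠ X' ⟶ W'} (a : c ≅ e ≫ d) (a' : c' ≅ e' ≫ d') (E : g ≅ e₃ ⊠₁ c ≫ k)
    (E' : g' ≅ e₃' ⊠₁ c' ≫ k') (s : p ≫ e' ≅ e ≫ q) (x : q ≫ d' ≅ d ≫ r)
    (s₃ : p₃ ≫ e₃' ≅ e₃ ≫ q₃) (y : q₃ ⊠₁ r ≫ k' ≅ k ≫ t) :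
    sqConj E E' (sqComp (sqTensor s₃ (sqConj a a' (sqComp s x))) y) =
      sqConj (E ≪≫ whiskerRightIso (tIso (Iso.refl e₃) a ≪≫
          tSplitIso (ρ_ e₃).symm (Iso.refl _)) k ≪≫ α_ _ _ _)
        (E' ≪≫ whiskerRightIso (tIso (Iso.refl e₃') a' ≪≫
          tSplitIso (ρ_ e₃').symm (Iso.refl _)) k' ≪≫ α_ _ _ _)
        (sqComp (sqTensor s₃ s) (sqComp (sqTensor (sqId q₃) x) y)) := by
  conv_lhs => rw [← sqConj_sqId s₃, sqTensor_sqConj_right, sqTensor_sqConj_left,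
    sqTensor_sqComp]
  rw [sqConj_sqConj, sqConj_sqConj, sqComp_sqConj_left, sqComp_assoc, sqConj_sqConj, sqConj_sqConj]
  congr 1 <;> ext <;> simp [tSplitIso]

end SquareCalculus

/-! ### Associativity and braiding as maps of squares -/

section AssocCube
open TensorBicategory ConstraintBicategory
variable {B : Type u} [Bicategory.{w, v} B] [ConstraintBicategory B]

variable {X X' Y Y' X₂ X₂' Y₂ Y₂' X₃ X₃' Y₃ Y₃' : B}
    {p : X ⟶ X'} {e : X ⟶ Y} {e' : X' ⟶ Y'} {q : Y ⟶ Y'}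
    {p₂ : X₂ ⟶ X₂'} {e₂ : X₂ ⟶ Y₂} {e₂' : X₂' ⟶ Y₂'} {q₂ : Y₂ ⟶ Y₂'}
    {p₃ : X₃ ⟶ X₃'} {e₃ : X₃ ⟶ Y₃} {e₃' : X₃' ⟶ Y₃'} {q₃ : Y₃ ⟶ Y₃'}

/-- Pseudonaturality of the associativity 1-cells at the sides of three squares. -/
theorem assocNat_sqHom (s : p ≫ e' ≅ e ≫ q) (s₂ : p₂ ≫ e₂' ≅ e₂ ≫ q₂)
    (s₃ : p₃ ≫ e₃' ≅ e₃ ≫ q₃) :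
    SqHom (sqVComp (sqTensor (sqTensor s s₂) s₃) (assocNat e' e₂' e₃').symm)
      (sqVComp (assocNat e e₂ e₃).symm (sqTensor s (sqTensor s₂ s₃)))
      (assocNat p p₂ p₃).hom (assocNat q q₂ q₃).hom := by
  refine sqHom_of_cube ?_
  rw [← cancel_epi ((tSplitIso (tSplitIso (Iso.refl (p ≫ e')) (Iso.refl (p₂ ≫ e₂')))
    (Iso.refl (p₃ ≫ e₃'))).hom ▷ as Y' Y₂' Y₃'),
    tSplitIso_hom, tSplitIso_hom, ← comp_whiskerRight_assoc,
    tSplit_id_sqTensor, tSplit_id_sqTensor, ← assocNat_split, ← Category.assoc, ← assocNat_split,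
    Category.assoc, ← whiskerLeft_comp, tSplit_id_sqTensor, tSplit_id_sqTensor]

/-- Pseudonaturality of the braiding at the sides of two squares. -/
theorem braidNat_sqHom {B : Type u} [Bicategory.{w, v} B] [SwapBicategory B]
    {X X' Y Y' X₂ X₂' Y₂ Y₂' : B}
    {p : X ⟶ X'} {e : X ⟶ Y} {e' : X' ⟶ Y'} {q : Y ⟶ Y'}
    {p₂ : X₂ ⟶ X₂'} {e₂ : X₂ ⟶ Y₂} {e₂' : X₂' ⟶ Y₂'} {q₂ : Y₂ ⟶ Y₂'}
    (s : p ≫ e' ≅ e ≫ q) (s₂ : p₂ ≫ e₂' ≅ e₂ ≫ q₂) :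
    SqHom (sqVComp (sqTensor s s₂) (SwapBicategory.braidNat e' e₂').symm)
      (sqVComp (SwapBicategory.braidNat e e₂).symm (sqTensor s₂ s))
      (SwapBicategory.braidNat p p₂).hom (SwapBicategory.braidNat q q₂).hom := by
  refine sqHom_of_cube ?_
  rw [← cancel_epi ((tSplitIso (Iso.refl (p ≫ e')) (Iso.refl (p₂ ≫ e₂'))).hom ▷ br Y' Y₂'),
    tSplitIso_hom, ← comp_whiskerRight_assoc, tSplit_id_sqTensor, ← braidNat_split,
    ← Category.assoc, ← braidNat_split, Category.assoc, ← whiskerLeft_comp, tSplit_id_sqTensor]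

end AssocCube

/-! ### Threefold tensor products in the comma bicategory -/

namespace Comma
open TensorBicategory ConstraintBicategory MonoidalBicategory

section
variable {M : Type u₁} [Bicategory.{w₁, v₁} M] [MonoidalBicategory M]
  {N : Type u₂} [Bicategory.{w₂, v₂} N] [MonoidalBicategory N] {T : TensorPseudofunctor M N}

/-- The leg of `(P ⊠ Q) ⊠ R` as the tensor product of the legs followed by comparison 1-cells. -/
def tLegIsoLeft (P Q R : Comma T) : tLeg (P ⊠ Q) R ≅ ((P.leg ⊠₁ Q.leg) ⊠₁ R.leg) ≫
    T.chi P.base Q.base ▷₁ T.F.obj R.base ≫ T.chi (P.base ⊠ Q.base) R.base :=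
  tLegIso (P ⊠ Q) R ≪≫ whiskerRightIso (tIso (tLegIso P Q) (Iso.refl R.leg) ≪≫
    tSplitIso (Iso.refl _) (ρ_ R.leg).symm) (T.chi (P.base ⊠ Q.base) R.base) ≪≫ α_ _ _ _

/-- The leg of `P ⊠ (Q ⊠ R)` as the tensor product of the legs followed by comparison 1-cells. -/
def tLegIsoRight (P Q R : Comma T) : tLeg P (Q ⊠ R) ≅ (P.leg ⊠₁ (Q.leg ⊠₁ R.leg)) ≫
    T.F.obj P.base ◁₁ T.chi Q.base R.base ≫ T.chi P.base (Q.base ⊠ R.base) :=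
  tLegIso P (Q ⊠ R) ≪≫ whiskerRightIso (tIso (Iso.refl P.leg) (tLegIso Q R) ≪≫
    tSplitIso (ρ_ P.leg).symm (Iso.refl _)) (T.chi P.base (Q.base ⊠ R.base)) ≪≫ α_ _ _ _

theorem tensor_sq {P P' Q Q' : Comma T} (f : P ⟶ P') (g : Q ⟶ Q') : Hom₁.sq (f ⊠₁ g) =
    sqConj (tLegIso P Q) (tLegIso P' Q') (sqComp (sqTensor f.sq g.sq) (T.chiNat f.base g.base)) :=
  rfl

theorem tensor_tensor_sq_left {P P' Q Q' R R' : Comma T} (f : P ⟶ P') (g : Q ⟶ Q') (h : R ⟶ R') :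
    Hom₁.sq ((f ⊠₁ g) ⊠₁ h) = sqConj (tLegIsoLeft P Q R) (tLegIsoLeft P' Q' R')
      (sqComp (sqTensor (sqTensor f.sq g.sq) h.sq)
        (sqComp (sqTensor (T.chiNat f.base g.base) (sqId (T.F.map h.base)))
          (T.chiNat (f.base ⊠₁ g.base) h.base))) :=
  sqConj_sqTensor_sqConj_left _ _ _ _ _ _ _ _

theorem tensor_tensor_sq_right {P P' Q Q' R R' : Comma T} (f : P ⟶ P') (g : Q ⟶ Q') (h : R ⟶ R') :
    Hom₁.sq (f ⊠₁ (g ⊠₁ h)) = sqConj (tLegIsoRight P Q R) (tLegIsoRight P' Q' R')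
      (sqComp (sqTensor f.sq (sqTensor g.sq h.sq))
        (sqComp (sqTensor (sqId (T.F.map f.base)) (T.chiNat g.base h.base))
          (T.chiNat f.base (g.base ⊠₁ h.base)))) :=
  sqConj_sqTensor_sqConj_right _ _ _ _ _ _ _ _

end
end Comma

end BraidedBicat

namespace BraidedBicat
/-! ### Associativity and braiding 1-cells of the comma bicategory -/

open TensorBicategory ConstraintBicategory MonoidalBicategory

/-- A morphism of squares whose base is `F θ` between composites gives one whose base is `F θ`
itself. -/
theorem SqHom.map {B : Type u₁} [Bicategory.{w₁, v₁} B] {C : Type u₂} [Bicategory.{w₂, v₂} C]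
    {F : B ⥤ᵖ C} {X X' : C} {Y Y₁ Y₂ Y' : B} {p p' : X ⟶ X'} {e : X ⟶ F.obj Y}
    {e' : X' ⟶ F.obj Y'} {f : Y ⟶ Y₁} {g : Y₁ ⟶ Y'} {f' : Y ⟶ Y₂} {g' : Y₂ ⟶ Y'}
    {s : p ≫ e' ≅ e ≫ F.map f ≫ F.map g} {s' : p' ≫ e' ≅ e ≫ F.map f' ≫ F.map g'} {η : p ⟶ p'}
    {θ : f ≫ g ≅ f' ≫ g'} (h : SqHom s s' η (sqMap F θ).hom) :
    SqHom (s ≪≫ Bicategory.whiskerLeftIso e (F.mapComp f g).symm)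
      (s' ≪≫ Bicategory.whiskerLeftIso e (F.mapComp f' g').symm) η (F.map₂ θ.hom) := by
  refine SqHom.whiskerLeftIso _ ?_
  have h₄ := (SqHom.of_whiskerLeftIso s (F.mapComp f g).symm).vcomp h
  simpa only [Category.id_comp, sqMap, Iso.trans_hom, Iso.symm_hom, Iso.symm_inv,
    Iso.hom_inv_id_assoc, PrelaxFunctor.map₂Iso_hom] using h₄

section
variable {M : Type u₁} [Bicategory.{w₁, v₁} M] [MonoidalBicategory M]
  {N : Type u₂} [Bicategory.{w₂, v₂} N] [MonoidalBicategory N] (T : MonoidalPseudofunctor M N)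

/-- The inverse of `omega` as a square on the associativity 1-cells. -/
def MonoidalPseudofunctor.omegaSq (X Y Z : M) :
    as (T.F.obj X) (T.F.obj Y) (T.F.obj Z) ≫ T.F.obj X ◁₁ T.chi Y Z ≫ T.chi X (Y ⊠ Z) ≅
      (T.chi X Y ▷₁ T.F.obj Z ≫ T.chi (X ⊠ Y) Z) ≫ T.F.map (as X Y Z) :=
  (T.omega X Y Z).symm ≪≫ (α_ _ _ _).symm

/-- The modification axiom of `omega`. -/
theorem MonoidalPseudofunctor.omegaSq_sqHom {X X' Y Y' Z Z' : M} (f : X ⟶ X') (g : Y ⟶ Y')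
    (h : Z ⟶ Z') :
    SqHom (sqVComp (sqComp (sqTensor (T.chiNat f g) (sqId (T.F.map h))) (T.chiNat (f ⊠₁ g) h))
        (T.omegaSq X' Y' Z'))
      (sqVComp (T.omegaSq X Y Z)
        (sqComp (sqTensor (sqId (T.F.map f)) (T.chiNat g h)) (T.chiNat f (g ⊠₁ h))))
      (assocNat (T.F.map f) (T.F.map g) (T.F.map h)).hom (sqMap T.F (assocNat f g h)).hom := by
  refine sqHom_of_modification ?_
  have hn := T.omega_naturality f g h
  rw [sqComp_assoc]
  simp only [MonoidalPseudofunctor.omegaSq, Iso.trans_hom, Iso.symm_hom, sqConj,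
    whiskerLeftIso_hom, whiskerRightIso_hom, comp_whiskerRight, whiskerLeft_comp, Category.assoc,
    whiskerLeft_inv_hom_assoc]
  rw [← cancel_epi (((T.F.map f ⊠₁ T.F.map g) ⊠₁ T.F.map h) ◁ (T.omega X' Y' Z').hom),
    reassoc_of% hn]
  simp

end

namespace Comma

section
variable {M : Type u₁} [Bicategory.{w₁, v₁} M] [MonoidalBicategory M]
  {N : Type u₂} [Bicategory.{w₂, v₂} N] [MonoidalBicategory N] {T : MonoidalPseudofunctor M N}

/-- The associativity 1-cell of the comma bicategory, lying over those of `N` and `M`. -/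
def asC (P Q R : Comma T.toTensorPseudofunctor) : (P ⊠ Q) ⊠ R ⟶ P ⊠ (Q ⊠ R) :=
  ⟨as P.top Q.top R.top, as P.base Q.base R.base,
    sqConj (tLegIsoLeft P Q R) (tLegIsoRight P Q R)
      (sqComp (assocNat P.leg Q.leg R.leg).symm (T.omegaSq P.base Q.base R.base))⟩

variable {P P' Q Q' R R' : Comma T.toTensorPseudofunctor}

theorem assocNatC_comm (f : P ⟶ P') (g : Q ⟶ Q') (h : R ⟶ R') :
    SqHom (Hom₁.sq ((f ⊠₁ g) ⊠₁ h ≫ asC P' Q' R')) (Hom₁.sq (asC P Q R ≫ f ⊠₁ (g ⊠₁ h)))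
      (assocNat f.top g.top h.top).hom (T.F.map₂ (assocNat f.base g.base h.base).hom) := by
  have h₃ := SqHom.conj ((assocNat_sqHom f.sq g.sq h.sq).hcomp
    (T.omegaSq_sqHom f.base g.base h.base)) (tLegIsoLeft P Q R) (tLegIsoRight P' Q' R')
  rw [← sqVComp_sqComp, ← sqVComp_sqComp, ← sqVComp_sqConj _ (tLegIsoLeft P' Q' R'),
    ← sqVComp_sqConj _ (tLegIsoRight P Q R)] at h₃
  rw [comp_sq, comp_sq, tensor_tensor_sq_left, tensor_tensor_sq_right]
  exact h₃.map

/-- Naturality of the associativity 1-cell. -/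
def assocNatC (f : P ⟶ P') (g : Q ⟶ Q') (h : R ⟶ R') :
    (f ⊠₁ g) ⊠₁ h ≫ asC P' Q' R' ≅ asC P Q R ≫ f ⊠₁ (g ⊠₁ h) :=
  mkIso (assocNat f.top g.top h.top) (assocNat f.base g.base h.base) (assocNatC_comm f g h)

/-- Naturality of associativity in the first variable. -/
def asLC (f : P ⟶ P') (Q R : Comma T.toTensorPseudofunctor) :
    f ▷₁ Q ▷₁ R ≫ asC P' Q R ≅ asC P Q R ≫ f ▷₁ (Q ⊠ R) :=
  assocNatC f (𝟙 Q) (𝟙 R) ≪≫ whiskerLeftIso (asC P Q R) (tIso (Iso.refl f) (tId Q R))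

/-- Naturality of associativity in the second variable. -/
def asMC (P : Comma T.toTensorPseudofunctor) (g : Q ⟶ Q') (R : Comma T.toTensorPseudofunctor) :
    (P ◁₁ g) ▷₁ R ≫ asC P Q' R ≅ asC P Q R ≫ P ◁₁ (g ▷₁ R) :=
  assocNatC (𝟙 P) g (𝟙 R)

/-- Naturality of associativity in the third variable. -/
def asRC (P Q : Comma T.toTensorPseudofunctor) (h : R ⟶ R') :
    (P ⊠ Q) ◁₁ h ≫ asC P Q R' ≅ asC P Q R ≫ P ◁₁ Q ◁₁ h :=
  whiskerRightIso (tIso (tId P Q).symm (Iso.refl h)) (asC P Q R') ≪≫ assocNatC (𝟙 P) (𝟙 Q) h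

end

section
open SwapBicategory BraidedMonoidalBicategory
variable {M : Type u₁} [Bicategory.{w₁, v₁} M] [BraidedMonoidalBicategory M]
  {N : Type u₂} [Bicategory.{w₂, v₂} N] [BraidedMonoidalBicategory N]
  {T : BraidedMonoidalPseudofunctor M N}

/-- The braiding 1-cell of the comma bicategory, lying over those of `N` and `M`. -/
def brC (P Q : Comma T.toTensorPseudofunctor) : P ⊠ Q ⟶ Q ⊠ P :=
  ⟨br P.top Q.top, br P.base Q.base, sqConj (tLegIso P Q) (tLegIso Q P)
    (sqComp (braidNat P.leg Q.leg).symm (T.upsilon P.base Q.base))⟩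

variable {P P' Q Q' : Comma T.toTensorPseudofunctor}

theorem braidNatC_comm (f : P ⟶ P') (g : Q ⟶ Q') :
    SqHom (Hom₁.sq (f ⊠₁ g ≫ brC P' Q')) (Hom₁.sq (brC P Q ≫ g ⊠₁ f))
      (braidNat f.top g.top).hom (T.F.map₂ (braidNat f.base g.base).hom) := by
  have h₃ := SqHom.conj ((braidNat_sqHom f.sq g.sq).hcomp
    (sqHom_of_modification (T.upsilon_naturality f.base g.base))) (tLegIso P Q) (tLegIso Q' P')
  rw [← sqVComp_sqComp, ← sqVComp_sqComp, ← sqVComp_sqConj _ (tLegIso P' Q'),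
    ← sqVComp_sqConj _ (tLegIso Q P)] at h₃
  rw [comp_sq, comp_sq, tensor_sq, tensor_sq]
  exact h₃.map

/-- Naturality of the braiding 1-cell. -/
def braidNatC (f : P ⟶ P') (g : Q ⟶ Q') : f ⊠₁ g ≫ brC P' Q' ≅ brC P Q ≫ g ⊠₁ f :=
  mkIso (braidNat f.top g.top) (braidNat f.base g.base) (braidNatC_comm f g)

/-- Naturality of the braiding in the second variable. -/
def brRC (P : Comma T.toTensorPseudofunctor) (g : Q ⟶ Q') :
    P ◁₁ g ≫ brC P Q' ≅ brC P Q ≫ g ▷₁ P :=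
  braidNatC (𝟙 P) g

end

end Comma
end BraidedBicat

namespace BraidedBicat

/-! ### Inverses of pasted squares -/

section
variable {B : Type u} [Bicategory.{w, v} B]

theorem sqComp_inv {X X' Y Y' Z Z' : B} {p : X ⟶ X'} {e : X ⟶ Y} {e' : X' ⟶ Y'} {q : Y ⟶ Y'}
    {d : Y ⟶ Z} {d' : Y' ⟶ Z'} {r : Z ⟶ Z'}
    (s : p ≫ e' ≅ e ≫ q) (t : q ≫ d' ≅ d ≫ r) : (sqComp s t).inv =
    𝟙 _ ⊗≫ e ◁ t.inv ⊗≫ s.inv ▷ d' ⊗≫ 𝟙 _ := by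
  simp [sqComp, bicategoricalComp]

theorem sqVComp_inv {X X' X'' Y Y' Y'' : B} {p : X ⟶ X'} {p' : X' ⟶ X''} {e : X ⟶ Y}
    {e' : X' ⟶ Y'} {e'' : X'' ⟶ Y''} {q : Y ⟶ Y'} {q' : Y' ⟶ Y''}
    (s : p ≫ e' ≅ e ≫ q) (t : p' ≫ e'' ≅ e' ≫ q') : (sqVComp s t).inv =
    𝟙 _ ⊗≫ s.inv ▷ q' ⊗≫ p ◁ t.inv ⊗≫ 𝟙 _ := by
  simp [sqVComp, bicategoricalComp]

theorem SqHom.of_inv {X X' Y Y' : B} {p p' : X ⟶ X'} {e : X ⟶ Y} {e' : X' ⟶ Y'} {q q' : Y ⟶ Y'}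
    {s : p ≫ e' ≅ e ≫ q} {s' : p' ≫ e' ≅ e ≫ q'} {η : p ⟶ p'} {θ : q ⟶ q'}
    (h : e ◁ θ ≫ s'.inv = s.inv ≫ η ▷ e') : SqHom s s' η θ := by
  unfold SqHom
  rw [← Iso.inv_comp_eq, ← Category.assoc, ← h, Category.assoc, Iso.inv_hom_id, Category.comp_id]

end

/-! ### Tensor products of a square with an identity -/

section
open TensorBicategory
variable {B : Type u} [Bicategory.{w, v} B] [TensorBicategory B]
  {X X' Y Y' Z W W' : B} {t : X ⟶ X'} {q : X' ⟶ Y'} {p : X ⟶ Y} {b : Y ⟶ Y'} {j : Z ⟶ Z}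
  {w' : W ⟶ W'}

theorem sqTensor_sqOne_right (s : t ≫ q ≅ p ≫ b) (i : j ≅ 𝟙 Z) :
    sqTensor s (sqOne (𝟙 Z) ≪≫ whiskerLeftIso (𝟙 Z) i.symm) =
      rw₂₂ s Z ≪≫ whiskerLeftIso (p ▷₁ Z) (tIso (Iso.refl b) i.symm) := by
  have h : sqOne (𝟙 Z) = sqId (𝟙 Z) := by ext; simp [sqOne, sqId]
  ext
  rw [Iso.trans_hom, ← sqTensor_sqId_right, ← h]
  have := tHom₂_whiskerLeft p (𝟙 Z) (𝟙 b) i.inv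
  simp only [whiskerLeft_id] at this
  simp only [sqTensor, Iso.trans_hom, Iso.symm_hom, tIso_hom, Category.assoc, whiskerLeftIso_hom,
    Iso.refl_hom]
  have h' := tHom₂_comp s.hom (𝟙 (p ≫ b)) (sqOne (𝟙 Z)).hom (𝟙 Z ◁ i.inv)
  rw [Category.comp_id, this] at h'
  rw [h']
  simp only [Category.assoc, Iso.inv_hom_id, Category.comp_id]

theorem sqTensor_sqOne_left (s : t ≫ q ≅ p ≫ b) (i : j ≅ 𝟙 Z) :
    sqTensor (sqOne (𝟙 Z) ≪≫ whiskerLeftIso (𝟙 Z) i.symm) s =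
      lw₂₂ Z s ≪≫ whiskerLeftIso (Z ◁₁ p) (tIso i.symm (Iso.refl b)) := by
  have h : sqOne (𝟙 Z) = sqId (𝟙 Z) := by ext; simp [sqOne, sqId]
  ext
  rw [Iso.trans_hom, ← sqTensor_sqId_left, ← h]
  have := tHom₂_whiskerLeft (𝟙 Z) p i.inv (𝟙 b)
  simp only [whiskerLeft_id] at this
  simp only [sqTensor, Iso.trans_hom, Iso.symm_hom, tIso_hom, Category.assoc, whiskerLeftIso_hom,
    Iso.refl_hom]
  have h' := tHom₂_comp (sqOne (𝟙 Z)).hom (𝟙 Z ◁ i.inv) s.hom (𝟙 (p ≫ b))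
  rw [Category.comp_id, this] at h'
  rw [h']
  simp only [Category.assoc, Iso.inv_hom_id, Category.comp_id]

/-- The square of `f ⊠ Z` when both legs are arbitrary. -/
theorem sqComp_sqTensor_sqOne_right (s : t ≫ q ≅ p ≫ b) (i : j ≅ 𝟙 Z) {c : Y ⊠ Z ⟶ W}
    {c' : Y' ⊠ Z ⟶ W'} (n : b ⊠₁ j ≫ c' ≅ c ≫ w') :
    sqComp (sqTensor s (sqOne (𝟙 Z) ≪≫ whiskerLeftIso (𝟙 Z) i.symm)) n =
      sqComp (rw₂₂ s Z) (whiskerRightIso (tIso (Iso.refl b) i.symm) c' ≪≫ n) := by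
  rw [sqTensor_sqOne_right]
  ext
  simp only [sqComp, Iso.trans_hom, whiskerLeftIso_hom, whiskerRightIso_hom, Iso.symm_hom]
  bicategory

/-- The square of `Z ⊠ f` when both legs are arbitrary. -/
theorem sqComp_sqTensor_sqOne_left (s : t ≫ q ≅ p ≫ b) (i : j ≅ 𝟙 Z) {c : Z ⊠ Y ⟶ W}
    {c' : Z ⊠ Y' ⟶ W'} (n : j ⊠₁ b ≫ c' ≅ c ≫ w') :
    sqComp (sqTensor (sqOne (𝟙 Z) ≪≫ whiskerLeftIso (𝟙 Z) i.symm) s) n =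
      sqComp (lw₂₂ Z s) (whiskerRightIso (tIso i.symm (Iso.refl b)) c' ≪≫ n) := by
  rw [sqTensor_sqOne_left]
  ext
  simp only [sqComp, Iso.trans_hom, whiskerLeftIso_hom, whiskerRightIso_hom, Iso.symm_hom]
  bicategory

theorem rw₂₂_inv_unit {b : Y ⟶ X'} (s : t ≫ 𝟙 X' ≅ p ≫ b) :
    (rw₂₂ s Z).inv ≫ t ▷₁ Z ◁ (tId X' Z).hom = (rw₂₁ (s.symm ≪≫ ρ_ t) Z).hom ≫ (ρ_ _).inv := by
  have h := (rwPf Z).map₂_right_unitor t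
  change (ρ_ t).hom ⊠₂ 𝟙 (𝟙 Z) = (rwComp t (𝟙 X') Z).hom ≫ t ▷₁ Z ◁ (tId X' Z).hom ≫ (ρ_ _).hom at h
  rw [← Iso.inv_comp_eq] at h
  rw [Iso.eq_comp_inv]
  simp only [rw₂₂, rw₂₁, rwIso, Iso.trans_inv, Iso.trans_hom, Iso.symm_inv, Category.assoc, ← h,
    Iso.symm_hom, Iso.hom_inv_id_assoc, tIso_hom, tIso_inv, Iso.refl_inv, Iso.refl_hom]
  rw [← tHom₂_comp, Category.comp_id]

theorem lw₂₂_inv_unit {b : Y ⟶ X'} (s : t ≫ 𝟙 X' ≅ p ≫ b) :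
    (lw₂₂ Z s).inv ≫ Z ◁₁ t ◁ (tId Z X').hom = (lw₂₁ Z (s.symm ≪≫ ρ_ t)).hom ≫ (ρ_ _).inv := by
  have h := (lwPf Z).map₂_right_unitor t
  change 𝟙 (𝟙 Z) ⊠₂ (ρ_ t).hom = (lwComp Z t (𝟙 X')).hom ≫ Z ◁₁ t ◁ (tId Z X').hom ≫ (ρ_ _).hom at h
  rw [← Iso.inv_comp_eq] at h
  rw [Iso.eq_comp_inv]
  simp only [lw₂₂, lw₂₁, lwIso, Iso.trans_inv, Iso.trans_hom, Iso.symm_inv, Category.assoc, ← h,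
    Iso.symm_hom, Iso.hom_inv_id_assoc, tIso_hom, tIso_inv, Iso.refl_inv, Iso.refl_hom]
  rw [← tHom₂_comp, Category.comp_id]

/-- The square of `f ⊠ Z` when the second leg is an identity. -/
theorem sqConj_sqComp_rw_inv {b : Y ⟶ X'} (s : t ≫ 𝟙 X' ≅ p ≫ b) {c : Y ⊠ Z ⟶ W} {c' : X' ⊠ Z ⟶ W'}
    (n : b ▷₁ Z ≫ c' ≅ c ≫ w') :
    (sqConj (Iso.refl _) ((λ_ c').symm ≪≫ whiskerRightIso (tId X' Z).symm c')
      (sqComp (rw₂₂ s Z) n)).inv =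
    𝟙 _ ⊗≫ p ▷₁ Z ◁ n.inv ⊗≫ (rw₂₁ (s.symm ≪≫ ρ_ t) Z).hom ▷ c' ⊗≫ 𝟙 _ := by
  simp only [sqConj, Iso.trans_inv, sqComp_inv, whiskerLeftIso_inv, whiskerRightIso_inv,
    Iso.symm_inv]
  calc
    _ = 𝟙 _ ⊗≫ p ▷₁ Z ◁ n.inv ⊗≫ ((rw₂₂ s Z).inv ≫ t ▷₁ Z ◁ (tId X' Z).hom) ▷ c' ⊗≫ 𝟙 _ := by
      simp [bicategoricalComp]
    _ = _ := by rw [rw₂₂_inv_unit]; bicategory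

/-- The square of `Z ⊠ f` when the second leg is an identity. -/
theorem sqConj_sqComp_lw_inv {b : Y ⟶ X'} (s : t ≫ 𝟙 X' ≅ p ≫ b) {c : Z ⊠ Y ⟶ W} {c' : Z ⊠ X' ⟶ W'}
    (n : Z ◁₁ b ≫ c' ≅ c ≫ w') :
    (sqConj (Iso.refl _) ((λ_ c').symm ≪≫ whiskerRightIso (tId Z X').symm c')
      (sqComp (lw₂₂ Z s) n)).inv =
    𝟙 _ ⊗≫ Z ◁₁ p ◁ n.inv ⊗≫ (lw₂₁ Z (s.symm ≪≫ ρ_ t)).hom ▷ c' ⊗≫ 𝟙 _ := by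
  simp only [sqConj, Iso.trans_inv, sqComp_inv, whiskerLeftIso_inv, whiskerRightIso_inv,
    Iso.symm_inv]
  calc
    _ = 𝟙 _ ⊗≫ Z ◁₁ p ◁ n.inv ⊗≫ ((lw₂₂ Z s).inv ≫ Z ◁₁ t ◁ (tId Z X').hom) ▷ c' ⊗≫ 𝟙 _ := by
      simp [bicategoricalComp]
    _ = _ := by rw [lw₂₂_inv_unit]; bicategory

theorem rw₂₁_unit (t : X ⟶ X') (Z : B) :
    (rw₂₁ ((sqId t).symm ≪≫ ρ_ t) Z).hom = (tId X Z).hom ▷ t ▷₁ Z ≫ (λ_ _).hom := by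
  have h := (rwPf Z).map₂_left_unitor t
  change (λ_ t).hom ⊠₂ 𝟙 (𝟙 Z) = (rwComp (𝟙 X) t Z).hom ≫ (tId X Z).hom ▷ t ▷₁ Z ≫ (λ_ _).hom at h
  rw [← Iso.inv_comp_eq] at h
  rw [← h]
  simp [rw₂₁, rwIso, sqId]

theorem lw₂₁_unit (t : X ⟶ X') (Z : B) :
    (lw₂₁ Z ((sqId t).symm ≪≫ ρ_ t)).hom = (tId Z X).hom ▷ Z ◁₁ t ≫ (λ_ _).hom := by
  have h := (lwPf Z).map₂_left_unitor t
  change 𝟙 (𝟙 Z) ⊠₂ (λ_ t).hom = (lwComp Z (𝟙 X) t).hom ≫ (tId Z X).hom ▷ Z ◁₁ t ≫ (λ_ _).hom at h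
  rw [← Iso.inv_comp_eq] at h
  rw [← h]
  simp [lw₂₁, lwIso, sqId]

/-- The square of `f ⊠ Z` when both legs are identities. -/
theorem sqConj_sqComp_rw_sqId {c : X ⊠ Z ⟶ W} {c' : X' ⊠ Z ⟶ W'}
    (n : t ▷₁ Z ≫ c' ≅ c ≫ w') :
    sqConj ((λ_ c).symm ≪≫ whiskerRightIso (tId X Z).symm c)
      ((λ_ c').symm ≪≫ whiskerRightIso (tId X' Z).symm c')
      (sqComp (rw₂₂ (sqId t) Z) n) = n := by
  have h := sqConj_sqComp_rw_inv (sqId t) n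
  rw [rw₂₁_unit] at h
  apply Iso.ext_inv
  calc
    _ = ((λ_ c).inv ≫ (tId X Z).inv ▷ c) ▷ w' ≫ (sqConj (Iso.refl _) ((λ_ c').symm ≪≫
        whiskerRightIso (tId X' Z).symm c') (sqComp (rw₂₂ (sqId t) Z) n)).inv := by
      simp [sqConj]
    _ = 𝟙 _ ⊗≫ ((tId X Z).inv ▷ (c ≫ w') ≫ 𝟙 X ▷₁ Z ◁ n.inv) ⊗≫
        (tId X Z).hom ▷ (t ▷₁ Z ≫ c') ⊗≫ 𝟙 _ := by
      rw [h]; bicategory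
    _ = 𝟙 _ ⊗≫ n.inv ⊗≫ ((tId X Z).inv ≫ (tId X Z).hom) ▷ (t ▷₁ Z ≫ c') ⊗≫ 𝟙 _ := by
      rw [← whisker_exchange]; bicategory
    _ = _ := by rw [Iso.inv_hom_id]; bicategory

/-- The square of `Z ⊠ f` when both legs are identities. -/
theorem sqConj_sqComp_lw_sqId {c : Z ⊠ X ⟶ W} {c' : Z ⊠ X' ⟶ W'}
    (n : Z ◁₁ t ≫ c' ≅ c ≫ w') :
    sqConj ((λ_ c).symm ≪≫ whiskerRightIso (tId Z X).symm c)
      ((λ_ c').symm ≪≫ whiskerRightIso (tId Z X').symm c')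
      (sqComp (lw₂₂ Z (sqId t)) n) = n := by
  have h := sqConj_sqComp_lw_inv (sqId t) n
  rw [lw₂₁_unit] at h
  apply Iso.ext_inv
  calc
    _ = ((λ_ c).inv ≫ (tId Z X).inv ▷ c) ▷ w' ≫ (sqConj (Iso.refl _) ((λ_ c').symm ≪≫
        whiskerRightIso (tId Z X').symm c') (sqComp (lw₂₂ Z (sqId t)) n)).inv := by
      simp [sqConj]
    _ = 𝟙 _ ⊗≫ ((tId Z X).inv ▷ (c ≫ w') ≫ Z ◁₁ 𝟙 X ◁ n.inv) ⊗≫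
        (tId Z X).hom ▷ (Z ◁₁ t ≫ c') ⊗≫ 𝟙 _ := by
      rw [h]; bicategory
    _ = 𝟙 _ ⊗≫ n.inv ⊗≫ ((tId Z X).inv ≫ (tId Z X).hom) ▷ (Z ◁₁ t ≫ c') ⊗≫ 𝟙 _ := by
      rw [← whisker_exchange]; bicategory
    _ = _ := by rw [Iso.inv_hom_id]; bicategory

end

/-! ### Associativity squares with two identity legs -/

section
open TensorBicategory ConstraintBicategory
variable {B : Type u} [Bicategory.{w, v} B] [ConstraintBicategory B]

/-- The comparison between `f ⊠ g` and `(f ⊠ Y) (X' ⊠ g)`. -/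
def tRL {X X' Y Y' : B} (f : X ⟶ X') (g : Y ⟶ Y') : f ⊠₁ g ≅ f ▷₁ Y ≫ X' ◁₁ g :=
  tSplitIso (ρ_ f).symm (λ_ g).symm

/-- The comparison between `f ⊠ g` and `(X ⊠ g) (f ⊠ Y')`. -/
def tLR {X X' Y Y' : B} (f : X ⟶ X') (g : Y ⟶ Y') : f ⊠₁ g ≅ X ◁₁ g ≫ f ▷₁ Y' :=
  tSplitIso (λ_ f).symm (ρ_ g).symm

theorem tRL_inv_tLR {X X' Y Y' : B} (f : X ⟶ X') (g : Y ⟶ Y') :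
    (tRL f g).inv ≫ (tLR f g).hom = (interchange f g).hom := by
  rw [Iso.inv_comp_eq]
  exact (interchange_spec f g).symm

end

section
variable {B : Type u} [Bicategory.{w, v} B] {X X' Y Y' Z Z' W W' : B} {e : X ⟶ Y} {e' : X' ⟶ Y'}
  {x : X ⟶ X'} {x' : Y ⟶ Y'} {c : Y ⟶ Z} {k : Z ⟶ W} {t : W ⟶ W'} {d : Y' ⟶ Z'} {k' : Z' ⟶ W'}
  {g : X ⟶ Z} {g' : X' ⟶ Z'}

theorem sqConj_sqComp_symm_inv (E : g ≅ e ≫ c) (E' : g' ≅ e' ≫ d) (a : e ≫ x' ≅ x ≫ e')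
    (ω : c ≫ k ≫ t ≅ x' ≫ d ≫ k') :
    (sqConj (Iso.refl _ ≪≫ whiskerRightIso E k ≪≫ α_ _ _ _)
      (Iso.refl _ ≪≫ whiskerRightIso E' k' ≪≫ α_ _ _ _)
      (sqComp a.symm (ω.symm ≪≫ (α_ _ _ _).symm))).inv =
    𝟙 _ ⊗≫ E.hom ▷ (k ≫ t) ⊗≫ e ◁ ω.hom ⊗≫ a.hom ▷ (d ≫ k') ⊗≫ x ◁ (E'.inv ▷ k') := by
  simp only [sqConj, Iso.trans_inv, sqComp_inv, whiskerLeftIso_inv, whiskerRightIso_inv,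
    Iso.symm_inv, Iso.trans_hom, whiskerRightIso_hom, Iso.refl_hom, Iso.refl_inv]
  bicategory

/-- If `e`, `e'` are isomorphic to identities compatibly with `E`, `E'` and `a`, pasting them onto
`ω` has no effect. -/
theorem paste_unit {X X' Z Z' W W' : B} {x : X ⟶ X'} {c : X ⟶ Z} {k : Z ⟶ W} {t : W ⟶ W'}
    {d : X' ⟶ Z'} {k' : Z' ⟶ W'} {e : X ⟶ X} {e' : X' ⟶ X'}
    (E : c ≅ e ≫ c) (E' : d ≅ e' ≫ d) (a : e ≫ x ≅ x ≫ e') (ω : c ≫ k ≫ t ≅ x ≫ d ≫ k')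
    (u : e ≅ 𝟙 X) (v : e' ≅ 𝟙 X') (hE : E.hom ≫ u.hom ▷ c ≫ (λ_ c).hom = 𝟙 c)
    (hE' : E'.hom ≫ v.hom ▷ d ≫ (λ_ d).hom = 𝟙 d)
    (ha : a.hom ≫ x ◁ v.hom = u.hom ▷ x ≫ (sqOne x).hom) :
    𝟙 ((c ≫ k) ≫ t) ⊗≫ E.hom ▷ (k ≫ t) ⊗≫ e ◁ ω.hom ⊗≫ a.hom ▷ (d ≫ k') ⊗≫
      x ◁ (E'.inv ▷ k') =
    𝟙 _ ⊗≫ ω.hom := by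
  have hE₁ : E'.inv = v.hom ▷ d ≫ (λ_ d).hom := by
    rw [← cancel_epi E'.hom, hE', Iso.hom_inv_id]
  rw [hE₁]
  calc
    _ = 𝟙 _ ⊗≫ E.hom ▷ (k ≫ t) ⊗≫ e ◁ ω.hom ⊗≫ (a.hom ≫ x ◁ v.hom) ▷ (d ≫ k') ⊗≫ 𝟙 _ := by
      bicategory
    _ = 𝟙 _ ⊗≫ E.hom ▷ (k ≫ t) ⊗≫ (e ◁ ω.hom ≫ u.hom ▷ (x ≫ d ≫ k')) ⊗≫ 𝟙 _ := by
      rw [ha]; simp only [sqOne, Iso.trans_hom, Iso.symm_hom]; bicategory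
    _ = 𝟙 _ ⊗≫ (E.hom ≫ u.hom ▷ c ≫ (λ_ c).hom) ▷ (k ≫ t) ⊗≫ ω.hom := by
      rw [whisker_exchange]; bicategory
    _ = _ := by rw [hE]; bicategory

end

section
open TensorBicategory ConstraintBicategory
variable {B : Type u} [Bicategory.{w, v} B] [ConstraintBicategory B] {P X Y Z W W' V V' : B}

/-- The associativity square for three identity legs. -/
theorem sqConj_assocNat_id_inv {c : X ⊠ Y ⟶ W} {c' : Y ⊠ Z ⟶ W'} {k : W ⊠ Z ⟶ V}
    {k' : X ⊠ W' ⟶ V'} {t : V ⟶ V'} (ω : c ▷₁ Z ≫ k ≫ t ≅ as X Y Z ≫ X ◁₁ c' ≫ k') :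
    (sqConj (Iso.refl _ ≪≫ whiskerRightIso (tIso ((λ_ c).symm ≪≫ whiskerRightIso (tId X Y).symm c)
        (Iso.refl (𝟙 Z)) ≪≫ tSplitIso (Iso.refl _) (ρ_ (𝟙 Z)).symm) k ≪≫ α_ _ _ _)
      (Iso.refl _ ≪≫ whiskerRightIso (tIso (Iso.refl (𝟙 X)) ((λ_ c').symm ≪≫
        whiskerRightIso (tId Y Z).symm c') ≪≫ tSplitIso (ρ_ (𝟙 X)).symm (Iso.refl _)) k' ≪≫
        α_ _ _ _)
      (sqComp (assocNat (𝟙 X) (𝟙 Y) (𝟙 Z)).symm (ω.symm ≪≫ (α_ _ _ _).symm))).inv =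
      𝟙 _ ⊗≫ ω.hom := by
  rw [sqConj_sqComp_symm_inv]
  refine paste_unit _ _ _ _ (tIso (tId X Y) (Iso.refl (𝟙 Z)) ≪≫ tId (X ⊠ Y) Z)
    (tIso (Iso.refl (𝟙 X)) (tId Y Z) ≪≫ tId X (Y ⊠ Z)) ?_ ?_ (assocNat_id X Y Z)
  · have h := tSplit_right (p := c) (q := 𝟙 Z) ((λ_ c).inv ≫ (tId X Y).inv ▷ c) (ρ_ (𝟙 Z)).inv
      (tId X Y).hom (𝟙 (𝟙 Z))
    have h' := tSplit_unit (λ_ c).inv (λ_ (𝟙 Z)).inv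
    simp [tHom₂_id] at h h'
    simp [tSplitIso_hom, reassoc_of% tSplit_pre, reassoc_of% h, h']
  · have h := tSplit_right (p := 𝟙 X) (q := c') (ρ_ (𝟙 X)).inv ((λ_ c').inv ≫ (tId Y Z).inv ▷ c')
      (𝟙 (𝟙 X)) (tId Y Z).hom
    have h' := tSplit_unit (λ_ (𝟙 X)).inv (λ_ c').inv
    simp [tHom₂_id] at h h'
    simp [tSplitIso_hom, reassoc_of% tSplit_pre, reassoc_of% h, h']

/-- The associativity square for legs `p`, `𝟙 Y`, `𝟙 Z`. -/
theorem sqConj_assocNat_left_inv (p : P ⟶ X) {c : X ⊠ Y ⟶ W} {c' : Y ⊠ Z ⟶ W'} {k : W ⊠ Z ⟶ V}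
    {k' : X ⊠ W' ⟶ V'} {t : V ⟶ V'} (ω : c ▷₁ Z ≫ k ≫ t ≅ as X Y Z ≫ X ◁₁ c' ≫ k') :
    (sqConj (Iso.refl _ ≪≫ whiskerRightIso (tIso (Iso.refl (p ▷₁ Y ≫ c))
        (Iso.refl (𝟙 Z)) ≪≫ tSplitIso (Iso.refl _) (ρ_ (𝟙 Z)).symm) k ≪≫ α_ _ _ _)
      (Iso.refl _ ≪≫ whiskerRightIso (tIso (Iso.refl p) ((λ_ c').symm ≪≫
        whiskerRightIso (tId Y Z).symm c') ≪≫ tSplitIso (ρ_ p).symm (Iso.refl _)) k' ≪≫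
        α_ _ _ _)
      (sqComp (assocNat p (𝟙 Y) (𝟙 Z)).symm (ω.symm ≪≫ (α_ _ _ _).symm))).inv =
      𝟙 _ ⊗≫ (rwComp (p ▷₁ Y) c Z).hom ▷ (k ≫ t) ⊗≫ p ▷₁ Y ▷₁ Z ◁ ω.hom ⊗≫
        (asL p Y Z).hom ▷ (X ◁₁ c' ≫ k') ⊗≫ as P Y Z ◁ ((tRL p c').inv ▷ k') := by
  rw [sqConj_sqComp_symm_inv]
  have h₁ : (tIso (Iso.refl (p ▷₁ Y ≫ c)) (Iso.refl (𝟙 Z)) ≪≫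
      tSplitIso (Iso.refl _) (ρ_ (𝟙 Z)).symm).hom = (rwComp (p ▷₁ Y) c Z).hom := by
    simp [rwComp_hom, tSplitIso_hom, tHom₂_id]
  have h₂ : (tIso (Iso.refl p) ((λ_ c').symm ≪≫ whiskerRightIso (tId Y Z).symm c') ≪≫
      tSplitIso (ρ_ p).symm (Iso.refl _)).inv =
      (𝟙 p ⊠₂ (tId Y Z).hom) ▷ X ◁₁ c' ≫ (tRL p c').inv := by
    rw [Iso.eq_comp_inv, Iso.inv_comp_eq, Iso.trans_hom, tSplitIso_hom, tIso_hom]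
    rw [Category.assoc, tSplit_right, tSplit_pre]
    simp [tRL, tSplitIso_hom]
  rw [h₁, h₂]
  simp only [asL, Iso.trans_hom, whiskerLeftIso_hom, tIso_hom, Iso.refl_hom]
  bicategory

/-- The associativity square for legs `𝟙 X`, `p`, `𝟙 Z`. -/
theorem sqConj_assocNat_middle_inv (p : P ⟶ Y) {c : X ⊠ Y ⟶ W} {c' : Y ⊠ Z ⟶ W'} {k : W ⊠ Z ⟶ V}
    {k' : X ⊠ W' ⟶ V'} {t : V ⟶ V'} (ω : c ▷₁ Z ≫ k ≫ t ≅ as X Y Z ≫ X ◁₁ c' ≫ k') :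
    (sqConj (Iso.refl _ ≪≫ whiskerRightIso (tIso (Iso.refl (X ◁₁ p ≫ c))
        (Iso.refl (𝟙 Z)) ≪≫ tSplitIso (Iso.refl _) (ρ_ (𝟙 Z)).symm) k ≪≫ α_ _ _ _)
      (Iso.refl _ ≪≫ whiskerRightIso (tIso (Iso.refl (𝟙 X)) (Iso.refl (p ▷₁ Z ≫ c')) ≪≫
        tSplitIso (ρ_ (𝟙 X)).symm (Iso.refl _)) k' ≪≫ α_ _ _ _)
      (sqComp (assocNat (𝟙 X) p (𝟙 Z)).symm (ω.symm ≪≫ (α_ _ _ _).symm))).inv =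
      𝟙 _ ⊗≫ (rwComp (X ◁₁ p) c Z).hom ▷ (k ≫ t) ⊗≫ (X ◁₁ p) ▷₁ Z ◁ ω.hom ⊗≫
        (asM X p Z).hom ▷ (X ◁₁ c' ≫ k') ⊗≫ as X P Z ◁ ((lwComp X (p ▷₁ Z) c').inv ▷ k') := by
  rw [sqConj_sqComp_symm_inv]
  have h₁ : (tIso (Iso.refl (X ◁₁ p ≫ c)) (Iso.refl (𝟙 Z)) ≪≫
      tSplitIso (Iso.refl _) (ρ_ (𝟙 Z)).symm).hom = (rwComp (X ◁₁ p) c Z).hom := by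
    simp [rwComp_hom, tSplitIso_hom, tHom₂_id]
  have h₂ : (tIso (Iso.refl (𝟙 X)) (Iso.refl (p ▷₁ Z ≫ c')) ≪≫
      tSplitIso (ρ_ (𝟙 X)).symm (Iso.refl _)) = lwComp X (p ▷₁ Z) c' := by
    ext; simp [lwComp_hom, tSplitIso_hom, tHom₂_id]
  rw [h₁, h₂, asM]

/-- The associativity square for legs `𝟙 X`, `𝟙 Y`, `p`. -/
theorem sqConj_assocNat_right_inv (p : P ⟶ Z) {c : X ⊠ Y ⟶ W} {c' : Y ⊠ Z ⟶ W'} {k : W ⊠ Z ⟶ V}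
    {k' : X ⊠ W' ⟶ V'} {t : V ⟶ V'} (ω : c ▷₁ Z ≫ k ≫ t ≅ as X Y Z ≫ X ◁₁ c' ≫ k') :
    (sqConj (Iso.refl _ ≪≫ whiskerRightIso (tIso ((λ_ c).symm ≪≫ whiskerRightIso (tId X Y).symm c)
        (Iso.refl p) ≪≫ tSplitIso (Iso.refl _) (ρ_ p).symm) k ≪≫ α_ _ _ _)
      (Iso.refl _ ≪≫ whiskerRightIso (tIso (Iso.refl (𝟙 X)) (Iso.refl (Y ◁₁ p ≫ c')) ≪≫
        tSplitIso (ρ_ (𝟙 X)).symm (Iso.refl _)) k' ≪≫ α_ _ _ _)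
      (sqComp (assocNat (𝟙 X) (𝟙 Y) p).symm (ω.symm ≪≫ (α_ _ _ _).symm))).inv =
      𝟙 _ ⊗≫ (tLR c p).hom ▷ (k ≫ t) ⊗≫ (X ⊠ Y) ◁₁ p ◁ ω.hom ⊗≫
        (asR X Y p).hom ▷ (X ◁₁ c' ≫ k') ⊗≫ as X Y P ◁ ((lwComp X (Y ◁₁ p) c').inv ▷ k') := by
  rw [sqConj_sqComp_symm_inv]
  have h₁ : (tIso ((λ_ c).symm ≪≫ whiskerRightIso (tId X Y).symm c)
        (Iso.refl p) ≪≫ tSplitIso (Iso.refl _) (ρ_ p).symm).hom =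
      (tLR c p).hom ≫ ((tId X Y).inv ⊠₂ 𝟙 p) ▷ c ▷₁ Z := by
    simp only [tLR, tSplitIso_hom, Iso.trans_hom, tIso_hom]
    rw [tSplit_right, tSplit_pre]
    simp
  have h₂ : (tIso (Iso.refl (𝟙 X)) (Iso.refl (Y ◁₁ p ≫ c')) ≪≫
      tSplitIso (ρ_ (𝟙 X)).symm (Iso.refl _)) = lwComp X (Y ◁₁ p) c' := by
    ext; simp [lwComp_hom, tSplitIso_hom, tHom₂_id]
  rw [h₁, h₂]
  simp only [asR, Iso.trans_hom, whiskerRightIso_hom, tIso_hom, Iso.refl_hom, Iso.symm_hom]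
  calc
    _ = 𝟙 _ ⊗≫ (tLR c p).hom ▷ (k ≫ t) ⊗≫ (((tId X Y).inv ⊠₂ 𝟙 p) ▷ (c ▷₁ Z ≫ k ≫ t) ≫
          ((𝟙 X ⊠₁ 𝟙 Y) ⊠₁ p) ◁ ω.hom) ⊗≫
        (assocNat (𝟙 X) (𝟙 Y) p).hom ▷ (X ◁₁ c' ≫ k') ⊗≫
        as X Y P ◁ ((lwComp X (Y ◁₁ p) c').inv ▷ k') := by bicategory
    _ = _ := by rw [← whisker_exchange]; bicategory

end

end BraidedBicat

namespace BraidedBicat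

/-! ### Images of squares under pseudofunctors -/

section
variable {B : Type u₁} [Bicategory.{w₁, v₁} B] {C : Type u₂} [Bicategory.{w₂, v₂} C] (G : B ⥤ᵖ C)

theorem sqMap_symm_inv {X Y Y' Z Z' W : B} {c : X ⟶ Y} {k : Y ⟶ Z} {t : Z ⟶ W} {x : X ⟶ Y'}
    {d : Y' ⟶ Z'} {k' : Z' ⟶ W} (ω : c ≫ k ≫ t ≅ x ≫ d ≫ k') :
    (sqMap G (ω.symm ≪≫ (α_ c k t).symm)).inv = 𝟙 _ ⊗≫ (G.mapComp c k).hom ▷ G.map t ⊗≫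
      ((mapComp₃ G c k t).symm ≪≫ G.map₂Iso ω ≪≫ mapComp₃ G x d k').hom ⊗≫
      G.map x ◁ (G.mapComp d k').inv := by
  simp only [sqMap, mapComp₃, Iso.trans_inv, Iso.trans_hom, Iso.symm_inv, Iso.symm_hom,
    PrelaxFunctor.map₂Iso_hom, PrelaxFunctor.map₂Iso_inv, whiskerLeftIso_hom, whiskerLeftIso_inv,
    bicategoricalComp, PrelaxFunctor.map₂_comp, Category.assoc, G.map₂_associator]
  simp

theorem map₂₁_associator {X Y Z W : B} {c : X ⟶ Y} {k : Y ⟶ Z} {t : Z ⟶ W} {x : X ⟶ W}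
    (ω : c ≫ k ≫ t ≅ x) :
    (map₂₁ G (α_ c k t ≪≫ ω)).hom = 𝟙 _ ⊗≫ (G.mapComp c k).hom ▷ G.map t ⊗≫
      ((mapComp₃ G c k t).symm ≪≫ G.map₂Iso ω).hom := by
  simp only [map₂₁, mapComp₃, Iso.trans_hom, Iso.trans_inv, Iso.symm_hom,
    PrelaxFunctor.map₂Iso_hom, whiskerLeftIso_inv,
    bicategoricalComp, PrelaxFunctor.map₂_comp, Category.assoc, G.map₂_associator]
  simp

end

section
open TensorBicategory
variable {B : Type u} [Bicategory.{w, v} B] [TensorBicategory B]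
  {X Y Y' Z Z' W : B} {c : X ⟶ Y} {k : Y ⟶ Z} {t : Z ⟶ W} {x : X ⟶ Y'}
  {d : Y' ⟶ Z'} {k' : Z' ⟶ W}

theorem rw₂₂_symm_inv (ω : c ≫ k ≫ t ≅ x ≫ d ≫ k') (V : B) :
    (rw₂₂ (ω.symm ≪≫ (α_ c k t).symm) V).inv = 𝟙 _ ⊗≫ (rwComp c k V).hom ▷ t ▷₁ V ⊗≫
      (rw₃₃ ω V).hom ⊗≫ x ▷₁ V ◁ (rwComp d k' V).inv :=
  sqMap_symm_inv (rwPf V) ω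

theorem lw₂₂_symm_inv (ω : c ≫ k ≫ t ≅ x ≫ d ≫ k') (V : B) :
    (lw₂₂ V (ω.symm ≪≫ (α_ c k t).symm)).inv = 𝟙 _ ⊗≫ (lwComp V c k).hom ▷ V ◁₁ t ⊗≫
      (lw₃₃ V ω).hom ⊗≫ V ◁₁ x ◁ (lwComp V d k').inv :=
  sqMap_symm_inv (lwPf V) ω

theorem rw₂₁_associator {x : X ⟶ W} (ω : c ≫ k ≫ t ≅ x) (V : B) :
    (rw₂₁ (α_ c k t ≪≫ ω) V).hom = 𝟙 _ ⊗≫ (rwComp c k V).hom ▷ t ▷₁ V ⊗≫ (rw₃₁ ω V).hom :=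
  map₂₁_associator (rwPf V) ω

theorem lw₂₁_associator {x : X ⟶ W} (ω : c ≫ k ≫ t ≅ x) (V : B) :
    (lw₂₁ V (α_ c k t ≪≫ ω)).hom = 𝟙 _ ⊗≫ (lwComp V c k).hom ▷ V ◁₁ t ⊗≫ (lw₃₁ V ω).hom :=
  map₂₁_associator (lwPf V) ω

end

section
variable {B : Type u} [Bicategory.{w, v} B]

theorem sqConj_refl {X X' Y Y' : B} {p : X ⟶ X'} {e : X ⟶ Y} {e' : X' ⟶ Y'} {q : Y ⟶ Y'}
    (s : p ≫ e' ≅ e ≫ q) : sqConj (Iso.refl _) (Iso.refl _) s = s := by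
  ext; simp [sqConj]

/-- Pasting an identity component `a` of a pseudonatural transformation onto `υ` has no effect. -/
theorem sqConj_unit_sqComp {X X' Y Y' : B} {x : X ⟶ X'} {c : X ⟶ Y} {d : X' ⟶ Y'} {t : Y ⟶ Y'}
    {e : X ⟶ X} {e' : X' ⟶ X'} (u : e ≅ 𝟙 X) (v : e' ≅ 𝟙 X') (a : e ≫ x ≅ x ≫ e')
    (υ : x ≫ d ≅ c ≫ t) (ha : a.hom ≫ x ◁ v.hom = u.hom ▷ x ≫ (sqOne x).hom) :
    sqConj ((λ_ c).symm ≪≫ whiskerRightIso u.symm c) ((λ_ d).symm ≪≫ whiskerRightIso v.symm d)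
      (sqComp a.symm υ) = υ := by
  apply Iso.ext_inv
  simp only [sqConj, Iso.trans_inv, sqComp_inv, whiskerLeftIso_inv, whiskerRightIso_inv,
    Iso.symm_inv, Iso.trans_hom, whiskerRightIso_hom, Iso.symm_hom]
  calc
    _ = 𝟙 _ ⊗≫ (u.inv ▷ (c ≫ t) ≫ e ◁ υ.inv) ⊗≫ (a.hom ≫ x ◁ v.hom) ▷ d ⊗≫ 𝟙 _ := by
      bicategory
    _ = 𝟙 _ ⊗≫ υ.inv ⊗≫ (u.inv ≫ u.hom) ▷ (x ≫ d) ⊗≫ 𝟙 _ := by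
      rw [ha, ← whisker_exchange]; simp only [sqOne, Iso.trans_hom, Iso.symm_hom]; bicategory
    _ = _ := by rw [Iso.inv_hom_id]; bicategory

end

/-! ### Squares of whiskered, associativity and braiding 1-cells over `M` -/

namespace Comma
open TensorBicategory ConstraintBicategory MonoidalBicategory

section
variable {M : Type u₁} [Bicategory.{w₁, v₁} M] [MonoidalBicategory M]
  {N : Type u₂} [Bicategory.{w₂, v₂} N] [MonoidalBicategory N] {T : TensorPseudofunctor M N}

theorem whiskerRight_sq {P' Q' : N} {P Q : M} {p : P' ⟶ T.F.obj P} {q : Q' ⟶ T.F.obj Q}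
    (f : (mk P' P p : Comma T) ⟶ mk Q' Q q) (Z : M) :
    Hom₁.sq (f ▷₁ (of Z : Comma T)) = sqComp (rw₂₂ f.sq (T.F.obj Z)) (T.chiL f.base Z) :=
  (sqConj_refl _).trans (sqComp_sqTensor_sqOne_right f.sq (T.F.mapId Z) _)

theorem whiskerLeft_sq {P' Q' : N} {P Q : M} {p : P' ⟶ T.F.obj P} {q : Q' ⟶ T.F.obj Q}
    (f : (mk P' P p : Comma T) ⟶ mk Q' Q q) (Z : M) :
    Hom₁.sq ((of Z : Comma T) ◁₁ f) = sqComp (lw₂₂ (T.F.obj Z) f.sq) (T.chiR Z f.base) :=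
  (sqConj_refl _).trans (sqComp_sqTensor_sqOne_left f.sq (T.F.mapId Z) _)

theorem whiskerRight_sq_of {P' : N} {P Q : M} {p : P' ⟶ T.F.obj P}
    (f : (mk P' P p : Comma T) ⟶ of Q) (Z : M) :
    (Hom₁.sq (f ▷₁ (of Z : Comma T))).inv =
      𝟙 ((p ▷₁ T.F.obj Z ≫ T.chi P Z) ≫ T.F.map (f.base ▷₁ Z)) ⊗≫
      p ▷₁ T.F.obj Z ◁ (T.chiL f.base Z).inv ⊗≫
      (rw₂₁ (f.sq.symm ≪≫ ρ_ f.top) (T.F.obj Z)).hom ▷ T.chi Q Z ⊗≫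
      𝟙 (f.top ▷₁ T.F.obj Z ≫ T.chi Q Z) := by
  rw [← sqConj_sqComp_rw_inv]
  exact congrArg (fun s => Iso.inv (sqConj _ _ s))
    (sqComp_sqTensor_sqOne_right f.sq (T.F.mapId Z) _)

theorem whiskerLeft_sq_of {P' : N} {P Q : M} {p : P' ⟶ T.F.obj P}
    (f : (mk P' P p : Comma T) ⟶ of Q) (Z : M) :
    (Hom₁.sq ((of Z : Comma T) ◁₁ f)).inv =
      𝟙 ((T.F.obj Z ◁₁ p ≫ T.chi Z P) ≫ T.F.map (Z ◁₁ f.base)) ⊗≫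
      T.F.obj Z ◁₁ p ◁ (T.chiR Z f.base).inv ⊗≫
      (lw₂₁ (T.F.obj Z) (f.sq.symm ≪≫ ρ_ f.top)).hom ▷ T.chi Z Q ⊗≫
      𝟙 (T.F.obj Z ◁₁ f.top ≫ T.chi Z Q) := by
  rw [← sqConj_sqComp_lw_inv]
  exact congrArg (fun s => Iso.inv (sqConj _ _ s))
    (sqComp_sqTensor_sqOne_left f.sq (T.F.mapId Z) _)

/-- The 1-cell `F f` over `f`. -/
def ofMap {X Y : M} (f : X ⟶ Y) : (of X : Comma T) ⟶ of Y := ⟨T.F.map f, f, sqId (T.F.map f)⟩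

theorem whiskerRight_ofMap_sq {X Y : M} (f : X ⟶ Y) (Z : M) :
    Hom₁.sq (ofMap f ▷₁ (of Z : Comma T)) = T.chiL f Z := by
  rw [← sqConj_sqComp_rw_sqId (T.chiL f Z)]
  exact congrArg (fun s => sqConj _ _ s)
    (sqComp_sqTensor_sqOne_right (sqId (T.F.map f)) (T.F.mapId Z) _)

theorem whiskerLeft_ofMap_sq {X Y : M} (f : X ⟶ Y) (Z : M) :
    Hom₁.sq ((of Z : Comma T) ◁₁ ofMap f) = T.chiR Z f := by
  rw [← sqConj_sqComp_lw_sqId (T.chiR Z f)]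
  exact congrArg (fun s => sqConj _ _ s)
    (sqComp_sqTensor_sqOne_left (sqId (T.F.map f)) (T.F.mapId Z) _)

end

section
variable {M : Type u₁} [Bicategory.{w₁, v₁} M] [MonoidalBicategory M]
  {N : Type u₂} [Bicategory.{w₂, v₂} N] [MonoidalBicategory N] {T : MonoidalPseudofunctor M N}

theorem asC_of_sq (X Y Z : M) :
    Hom₁.sq (asC (of X : Comma T.toTensorPseudofunctor) (of Y) (of Z)) = T.omegaSq X Y Z := by
  apply Iso.ext_inv
  refine (sqConj_assocNat_id_inv (T.omega X Y Z)).trans ?_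
  simp [MonoidalPseudofunctor.omegaSq, bicategoricalComp]

theorem asC_left_sq_inv {P' : N} {P : M} (p : P' ⟶ T.F.obj P) (Y Z : M) :
    (Hom₁.sq (asC (mk P' P p : Comma T.toTensorPseudofunctor) (of Y) (of Z))).inv =
      𝟙 (((p ▷₁ T.F.obj Y ≫ T.chi P Y) ▷₁ T.F.obj Z ≫ T.chi (P ⊠ Y) Z) ≫ T.F.map (as P Y Z)) ⊗≫
        (rwComp (p ▷₁ T.F.obj Y) (T.chi P Y) (T.F.obj Z)).hom ▷ (T.chi (P ⊠ Y) Z ≫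
          T.F.map (as P Y Z)) ⊗≫ p ▷₁ T.F.obj Y ▷₁ T.F.obj Z ◁ (T.omega P Y Z).hom ⊗≫
        (asL p (T.F.obj Y) (T.F.obj Z)).hom ▷ (T.F.obj P ◁₁ T.chi Y Z ≫ T.chi P (Y ⊠ Z)) ⊗≫
        as P' (T.F.obj Y) (T.F.obj Z) ◁ ((tRL p (T.chi Y Z)).inv ▷ T.chi P (Y ⊠ Z)) :=
  sqConj_assocNat_left_inv p (T.omega P Y Z)

theorem asC_middle_sq_inv {P' : N} {P : M} (p : P' ⟶ T.F.obj P) (X Z : M) :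
    (Hom₁.sq (asC (of X) (mk P' P p : Comma T.toTensorPseudofunctor) (of Z))).inv =
      𝟙 (((T.F.obj X ◁₁ p ≫ T.chi X P) ▷₁ T.F.obj Z ≫ T.chi (X ⊠ P) Z) ≫ T.F.map (as X P Z)) ⊗≫
        (rwComp (T.F.obj X ◁₁ p) (T.chi X P) (T.F.obj Z)).hom ▷ (T.chi (X ⊠ P) Z ≫
          T.F.map (as X P Z)) ⊗≫ (T.F.obj X ◁₁ p) ▷₁ T.F.obj Z ◁ (T.omega X P Z).hom ⊗≫
        (asM (T.F.obj X) p (T.F.obj Z)).hom ▷ (T.F.obj X ◁₁ T.chi P Z ≫ T.chi X (P ⊠ Z)) ⊗≫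
        as (T.F.obj X) P' (T.F.obj Z) ◁
          ((lwComp (T.F.obj X) (p ▷₁ T.F.obj Z) (T.chi P Z)).inv ▷ T.chi X (P ⊠ Z)) :=
  sqConj_assocNat_middle_inv p (T.omega X P Z)

theorem asC_right_sq_inv {P' : N} {P : M} (p : P' ⟶ T.F.obj P) (X Y : M) :
    (Hom₁.sq (asC (of X) (of Y) (mk P' P p : Comma T.toTensorPseudofunctor))).inv =
      𝟙 ((T.chi X Y ⊠₁ p ≫ T.chi (X ⊠ Y) P) ≫ T.F.map (as X Y P)) ⊗≫
        (tLR (T.chi X Y) p).hom ▷ (T.chi (X ⊠ Y) P ≫ T.F.map (as X Y P)) ⊗≫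
        (T.F.obj X ⊠ T.F.obj Y) ◁₁ p ◁ (T.omega X Y P).hom ⊗≫
        (asR (T.F.obj X) (T.F.obj Y) p).hom ▷ (T.F.obj X ◁₁ T.chi Y P ≫ T.chi X (Y ⊠ P)) ⊗≫
        as (T.F.obj X) (T.F.obj Y) P' ◁
          ((lwComp (T.F.obj X) (T.F.obj Y ◁₁ p) (T.chi Y P)).inv ▷ T.chi X (Y ⊠ P)) :=
  sqConj_assocNat_right_inv p (T.omega X Y P)

end

section
open SwapBicategory BraidedMonoidalBicategory
variable {M : Type u₁} [Bicategory.{w₁, v₁} M] [BraidedMonoidalBicategory M]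
  {N : Type u₂} [Bicategory.{w₂, v₂} N] [BraidedMonoidalBicategory N]
  {T : BraidedMonoidalPseudofunctor M N}

theorem brC_of_sq (X Y : M) :
    Hom₁.sq (brC (of X : Comma T.toTensorPseudofunctor) (of Y)) = T.upsilon X Y :=
  sqConj_unit_sqComp _ _ _ _ (braidNat_id (T.F.obj X) (T.F.obj Y))

theorem brC_right_sq {P' : N} {P : M} (p : P' ⟶ T.F.obj P) (X : M) :
    Hom₁.sq (brC (of X : Comma T.toTensorPseudofunctor) (mk P' P p)) =
      sqComp (brR (T.F.obj X) p).symm (T.upsilon X P) :=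
  sqConj_refl _

end

end Comma
end BraidedBicat

namespace BraidedBicat

/-! ### The pentagon pasting -/

section
variable {B : Type u} [Bicategory.{w, v} B]

/-- The pasting behind the lift of the pentagon cell: `h` has the shape of the axiom relating
`omega` to the pentagon, and the conclusion is the compatibility of `π` and `P` with the composite
squares of the two sides of the pentagon. -/
theorem sqHom_pentagon {n0 n1 n2 n3 n4 a0 a1 c0 c1 c2 d0 d1 d2 d3 k0 k1 m0 m1 m2 m3 m4 : B}
    {t1 : n0 ⟶ n1} {t2 : n1 ⟶ n2} {t3 : n2 ⟶ n3} {t4 : n0 ⟶ n4} {t5 : n4 ⟶ n3}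
    {b1 : m0 ⟶ m1} {b2 : m1 ⟶ m2} {b3 : m2 ⟶ m3} {b4 : m0 ⟶ m4} {b5 : m4 ⟶ m3}
    {b23 : m1 ⟶ m3} {b123 b45 : m0 ⟶ m3} (μ1 : b123 ≅ b1 ≫ b23) (μ2 : b23 ≅ b2 ≫ b3)
    (μ3 : b45 ≅ b4 ≫ b5) (P : b123 ≅ b45)
    {C0 : n0 ⟶ a0} {C1 : a0 ⟶ a1} {C2 : a1 ⟶ m0} {G0 : n0 ⟶ a1} (R0 : G0 ≅ C0 ≫ C1)
    {D0 : n1 ⟶ c0} {D1 : c0 ⟶ c1} {D2 : c1 ⟶ m1} {G1 : n1 ⟶ c1} (R1 : G1 ≅ D0 ≫ D1)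
    {E0 : n2 ⟶ d0} {E1 : d0 ⟶ d1} {E2 : d1 ⟶ m2} {G2 : n2 ⟶ d1} (L2 : G2 ≅ E0 ≫ E1)
    {H0 : n3 ⟶ d2} {H1 : d2 ⟶ d3} {H2 : d3 ⟶ m3} {G3 : n3 ⟶ d3} (L3 : G3 ≅ H0 ≫ H1)
    {K0 : n4 ⟶ k0} {K1 : k0 ⟶ c2} {K0' : n4 ⟶ k1} {K1' : k1 ⟶ c2} {K2 : c2 ⟶ m4}
    {G4 : n4 ⟶ c2} (RL : G4 ≅ K0 ≫ K1) (LR : G4 ≅ K0' ≫ K1')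
    {v1 : a1 ⟶ c1} {v3 : d1 ⟶ d3} {u2 : c0 ⟶ d0} {u4 : a0 ⟶ k0} {u5 : k1 ⟶ d2}
    (π : t1 ≫ t2 ≫ t3 ≅ t4 ≫ t5)
    (χ1 : v1 ≫ D2 ≅ C2 ≫ b1) (ω1 : C0 ≫ C1 ≫ v1 ≅ t1 ≫ D0 ≫ D1)
    (ω2 : D1 ≫ D2 ≫ b2 ≅ u2 ≫ E1 ≫ E2) (α2 : D0 ≫ u2 ≅ t2 ≫ E0)
    (χ3 : v3 ≫ H2 ≅ E2 ≫ b3) (ω3 : E0 ≫ E1 ≫ v3 ≅ t3 ≫ H0 ≫ H1)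
    (ω4 : C1 ≫ C2 ≫ b4 ≅ u4 ≫ K1 ≫ K2) (α4 : C0 ≫ u4 ≅ t4 ≫ K0)
    (ω5 : K1' ≫ K2 ≫ b5 ≅ u5 ≫ H1 ≫ H2) (α5 : K0' ≫ u5 ≅ t5 ≫ H0)
    (I : K0 ≫ K1 ≅ K0' ≫ K1') (hI : RL.inv ≫ LR.hom = I.hom)
    (r1 : t1 ≫ G1 ≅ G0 ≫ v1) (r3 : t3 ≫ G3 ≅ G2 ≫ v3)
    (hr1 : r1.inv = 𝟙 (G0 ≫ v1) ⊗≫ R0.hom ▷ v1 ⊗≫ ω1.hom ⊗≫ t1 ◁ R1.inv)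
    (hr3 : r3.inv = 𝟙 (G2 ≫ v3) ⊗≫ L2.hom ▷ v3 ⊗≫ ω3.hom ⊗≫ t3 ◁ L3.inv)
    (s2 : t2 ≫ G2 ≫ E2 ≅ (G1 ≫ D2) ≫ b2)
    (hs2 : s2.inv = 𝟙 ((G1 ≫ D2) ≫ b2) ⊗≫ R1.hom ▷ (D2 ≫ b2) ⊗≫ D0 ◁ ω2.hom ⊗≫
      α2.hom ▷ (E1 ≫ E2) ⊗≫ t2 ◁ (L2.inv ▷ E2))
    (s4 : t4 ≫ G4 ≫ K2 ≅ (G0 ≫ C2) ≫ b4)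
    (hs4 : s4.inv = 𝟙 ((G0 ≫ C2) ≫ b4) ⊗≫ R0.hom ▷ (C2 ≫ b4) ⊗≫ C0 ◁ ω4.hom ⊗≫
      α4.hom ▷ (K1 ≫ K2) ⊗≫ t4 ◁ (RL.inv ▷ K2))
    (s5 : t5 ≫ G3 ≫ H2 ≅ (G4 ≫ K2) ≫ b5)
    (hs5 : s5.inv = 𝟙 ((G4 ≫ K2) ≫ b5) ⊗≫ LR.hom ▷ (K2 ≫ b5) ⊗≫ K0' ◁ ω5.hom ⊗≫
      α5.hom ▷ (H1 ≫ H2) ⊗≫ t5 ◁ (L3.inv ▷ H2))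
    (s1 : t1 ≫ G1 ≫ D2 ≅ (G0 ≫ C2) ≫ b1) (hs1 : s1 = sqComp r1 χ1)
    (s3 : t3 ≫ G3 ≫ H2 ≅ (G2 ≫ E2) ≫ b3) (hs3 : s3 = sqComp r3 χ3)
    (h : 𝟙 (C0 ≫ C1 ≫ C2 ≫ b1 ≫ b2 ≫ b3) ⊗≫
      (C0 ≫ C1 ≫ C2) ◁ ((μ1 ≪≫ whiskerLeftIso b1 μ2).symm ≪≫ P ≪≫ μ3).hom ⊗≫
      C0 ◁ (ω4.hom ▷ b5) ⊗≫ α4.hom ▷ (K1 ≫ K2 ≫ b5) ⊗≫ t4 ◁ (I.hom ▷ (K2 ≫ b5)) ⊗≫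
      (t4 ≫ K0') ◁ ω5.hom ⊗≫ t4 ◁ (α5.hom ▷ (H1 ≫ H2)) ⊗≫ 𝟙 (t4 ≫ t5 ≫ H0 ≫ H1 ≫ H2) =
      𝟙 (C0 ≫ C1 ≫ C2 ≫ b1 ≫ b2 ≫ b3) ⊗≫ (C0 ≫ C1) ◁ (χ1.inv ▷ (b2 ≫ b3)) ⊗≫
      ω1.hom ▷ (D2 ≫ b2 ≫ b3) ⊗≫ (t1 ≫ D0) ◁ (ω2.hom ▷ b3) ⊗≫
      (t1 ≫ D0 ≫ u2 ≫ E1) ◁ χ3.inv ⊗≫ t1 ◁ (α2.hom ▷ (E1 ≫ v3 ≫ H2)) ⊗≫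
      (t1 ≫ t2) ◁ (ω3.hom ▷ H2) ⊗≫ π.hom ▷ (H0 ≫ H1 ≫ H2) ⊗≫
      𝟙 (t4 ≫ t5 ≫ H0 ≫ H1 ≫ H2)) :
    SqHom (sqVComp s1 (sqVComp s2 s3 ≪≫
        whiskerLeftIso (G1 ≫ D2) μ2.symm) ≪≫ whiskerLeftIso (G0 ≫ C2) μ1.symm)
      (sqVComp s4 s5 ≪≫ whiskerLeftIso (G0 ≫ C2) μ3.symm) π.hom P.hom := by
  subst hs1 hs3
  apply SqHom.of_inv
  simp only [Iso.trans_inv, sqVComp_inv, sqComp_inv, whiskerLeftIso_inv, Iso.symm_inv]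
  rw [hr1, hr3, hs2, hs4, hs5]
  -- Conjugate `P` by the comparisons for composites of 1-cells: `q` is the conjugate, as in `h`.
  obtain ⟨m, q, hm, hq, hmq⟩ : ∃ (m : b123 ⟶ b1 ≫ b2 ≫ b3) (q : b1 ≫ b2 ≫ b3 ⟶ b4 ≫ b5),
      m = μ1.hom ≫ b1 ◁ μ2.hom ∧ q = ((μ1 ≪≫ whiskerLeftIso b1 μ2).symm ≪≫ P ≪≫ μ3).hom ∧
        P.hom ≫ μ3.hom = m ≫ q :=
    ⟨_, _, rfl, rfl, by simp [← whiskerLeft_comp_assoc]⟩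
  rw [← hq] at h
  clear hq
  calc
    _ = 𝟙 _ ⊗≫ (G0 ◁ (C2 ◁ (P.hom ≫ μ3.hom)) ≫ R0.hom ▷ (C2 ≫ b4 ≫ b5)) ⊗≫
        C0 ◁ (ω4.hom ▷ b5) ⊗≫ α4.hom ▷ (K1 ≫ K2 ≫ b5) ⊗≫
        t4 ◁ ((RL.inv ≫ LR.hom) ▷ (K2 ≫ b5)) ⊗≫
        (t4 ≫ K0') ◁ ω5.hom ⊗≫ t4 ◁ (α5.hom ▷ (H1 ≫ H2)) ⊗≫ (t4 ≫ t5) ◁ (L3.inv ▷ H2) := by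
      bicategory
    _ = 𝟙 _ ⊗≫ R0.hom ▷ (C2 ≫ b123) ⊗≫ (C0 ≫ C1 ≫ C2) ◁ (m ≫ q) ⊗≫
        C0 ◁ (ω4.hom ▷ b5) ⊗≫ α4.hom ▷ (K1 ≫ K2 ≫ b5) ⊗≫ t4 ◁ (I.hom ▷ (K2 ≫ b5)) ⊗≫
        (t4 ≫ K0') ◁ ω5.hom ⊗≫ t4 ◁ (α5.hom ▷ (H1 ≫ H2)) ⊗≫ (t4 ≫ t5) ◁ (L3.inv ▷ H2) := by
      rw [whisker_exchange, hI, hmq]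
      bicategory
    _ = 𝟙 _ ⊗≫ R0.hom ▷ (C2 ≫ b123) ⊗≫ (C0 ≫ C1 ≫ C2) ◁ m ⊗≫
        (𝟙 (C0 ≫ C1 ≫ C2 ≫ b1 ≫ b2 ≫ b3) ⊗≫
        (C0 ≫ C1 ≫ C2) ◁ q ⊗≫
        C0 ◁ (ω4.hom ▷ b5) ⊗≫ α4.hom ▷ (K1 ≫ K2 ≫ b5) ⊗≫ t4 ◁ (I.hom ▷ (K2 ≫ b5)) ⊗≫
        (t4 ≫ K0') ◁ ω5.hom ⊗≫ t4 ◁ (α5.hom ▷ (H1 ≫ H2)) ⊗≫ 𝟙 (t4 ≫ t5 ≫ H0 ≫ H1 ≫ H2)) ⊗≫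
        (t4 ≫ t5) ◁ (L3.inv ▷ H2) := by
      bicategory
    _ = 𝟙 _ ⊗≫ R0.hom ▷ (C2 ≫ b123) ⊗≫ (C0 ≫ C1 ≫ C2) ◁ μ1.hom ⊗≫
        (C0 ≫ C1) ◁ ((C2 ≫ b1) ◁ μ2.hom ≫ χ1.inv ▷ (b2 ≫ b3)) ⊗≫
        ω1.hom ▷ (D2 ≫ b2 ≫ b3) ⊗≫ (t1 ≫ D0) ◁ (ω2.hom ▷ b3) ⊗≫
        t1 ◁ ((D0 ≫ u2) ◁ (E1 ◁ χ3.inv) ≫ α2.hom ▷ (E1 ≫ v3 ≫ H2)) ⊗≫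
        (t1 ≫ t2) ◁ (ω3.hom ▷ H2) ⊗≫ (π.hom ▷ ((H0 ≫ H1) ≫ H2) ≫
        (t4 ≫ t5) ◁ (L3.inv ▷ H2)) := by
      rw [h, hm]; bicategory
    _ = 𝟙 _ ⊗≫ R0.hom ▷ (C2 ≫ b123) ⊗≫ (C0 ≫ C1 ≫ C2) ◁ μ1.hom ⊗≫
        (C0 ≫ C1) ◁ (χ1.inv ▷ b23) ⊗≫ ((C0 ≫ C1 ≫ v1) ◁ (D2 ◁ μ2.hom) ≫
        ω1.hom ▷ (D2 ≫ b2 ≫ b3)) ⊗≫ (t1 ≫ D0) ◁ (ω2.hom ▷ b3) ⊗≫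
        t1 ◁ (α2.hom ▷ (E1 ≫ E2 ≫ b3)) ⊗≫ (t1 ≫ t2 ≫ E0 ≫ E1) ◁ χ3.inv ⊗≫
        (t1 ≫ t2) ◁ (ω3.hom ▷ H2) ⊗≫ (t1 ≫ t2 ≫ t3) ◁ (L3.inv ▷ H2) ⊗≫ π.hom ▷ (G3 ≫ H2) := by
      rw [whisker_exchange, whisker_exchange, ← whisker_exchange π.hom]; bicategory
    _ = 𝟙 _ ⊗≫ (R0.hom ▷ (C2 ≫ b123) ≫ (C0 ≫ C1) ◁ (C2 ◁ μ1.hom ⊗≫ χ1.inv ▷ b23)) ⊗≫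
        ω1.hom ▷ (D2 ≫ b23) ⊗≫ t1 ◁ ((D0 ≫ D1) ◁ (D2 ◁ μ2.hom) ≫
        (R1.inv ≫ R1.hom) ▷ (D2 ≫ b2 ≫ b3)) ⊗≫ (t1 ≫ D0) ◁ (ω2.hom ▷ b3) ⊗≫
        t1 ◁ (α2.hom ▷ (E1 ≫ E2 ≫ b3)) ⊗≫ (t1 ≫ t2) ◁ ((E0 ≫ E1) ◁ χ3.inv ≫
        (L2.inv ≫ L2.hom) ▷ (v3 ≫ H2)) ⊗≫
        (t1 ≫ t2) ◁ (ω3.hom ▷ H2) ⊗≫ (t1 ≫ t2 ≫ t3) ◁ (L3.inv ▷ H2) ⊗≫ π.hom ▷ (G3 ≫ H2) := by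
      rw [whisker_exchange, Iso.inv_hom_id, Iso.inv_hom_id]; bicategory
    _ = 𝟙 _ ⊗≫ G0 ◁ (C2 ◁ μ1.hom ⊗≫ χ1.inv ▷ b23) ⊗≫ R0.hom ▷ (v1 ≫ D2 ≫ b23) ⊗≫
        ω1.hom ▷ (D2 ≫ b23) ⊗≫ t1 ◁ ((D0 ≫ D1) ◁ (D2 ◁ μ2.hom) ≫ R1.inv ▷ (D2 ≫ b2 ≫ b3)) ⊗≫
        t1 ◁ (R1.hom ▷ (D2 ≫ b2 ≫ b3)) ⊗≫ (t1 ≫ D0) ◁ (ω2.hom ▷ b3) ⊗≫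
        t1 ◁ (α2.hom ▷ (E1 ≫ E2 ≫ b3)) ⊗≫ (t1 ≫ t2) ◁ ((E0 ≫ E1) ◁ χ3.inv ≫
        L2.inv ▷ (v3 ≫ H2)) ⊗≫ (t1 ≫ t2) ◁ (L2.hom ▷ (v3 ≫ H2)) ⊗≫
        (t1 ≫ t2) ◁ (ω3.hom ▷ H2) ⊗≫ (t1 ≫ t2 ≫ t3) ◁ (L3.inv ▷ H2) ⊗≫ π.hom ▷ (G3 ≫ H2) := by
      rw [← whisker_exchange R0.hom]; bicategory
    _ = _ := by
      rw [whisker_exchange, whisker_exchange]; bicategory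

end

end BraidedBicat

namespace BraidedBicat

/-! ### The hexagon and middle unit pastings -/

section
variable {B : Type u} [Bicategory.{w, v} B]

/-- The pasting behind the lift of the hexagon cell: `h` has the shape of the axiom relating
`upsilon` to `hexR`. -/
theorem sqHom_hexagon {n0 n1 n2 n3 n4 n5 c0 d0 e0 g0 h0 k0 m0 m1 m2 m3 m4 m5 : B}
    {t1 : n0 ⟶ n1} {t2 : n1 ⟶ n2} {t3 : n2 ⟶ n3} {t4 : n0 ⟶ n4} {t5 : n4 ⟶ n5} {t6 : n5 ⟶ n3}
    {b1 : m0 ⟶ m1} {b2 : m1 ⟶ m2} {b3 : m2 ⟶ m3} {b4 : m0 ⟶ m4} {b5 : m4 ⟶ m5} {b6 : m5 ⟶ m3}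
    {b23 : m1 ⟶ m3} {b56 : m4 ⟶ m3} {b123 b456 : m0 ⟶ m3} (μ1 : b123 ≅ b1 ≫ b23)
    (μ2 : b23 ≅ b2 ≫ b3) (μ3 : b456 ≅ b4 ≫ b56) (μ4 : b56 ≅ b5 ≫ b6) (P : b123 ≅ b456)
    {C0 : n0 ⟶ c0} {C1 : c0 ⟶ m0} {D0 : n1 ⟶ d0} {D1 : d0 ⟶ m1} {E0 : n2 ⟶ e0} {E1 : e0 ⟶ m2}
    {G0 : n3 ⟶ g0} {G1 : g0 ⟶ m3} {H0 : n4 ⟶ h0} {H1 : h0 ⟶ m4} {K0 : n5 ⟶ k0} {K1 : k0 ⟶ m5}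
    {u2 : d0 ⟶ e0} {u4 : c0 ⟶ h0} {u6 : k0 ⟶ g0}
    (π : t1 ≫ t2 ≫ t3 ≅ t4 ≫ t5 ≫ t6)
    (ω1 : C0 ≫ C1 ≫ b1 ≅ t1 ≫ D0 ≫ D1) (β : D0 ≫ u2 ≅ t2 ≫ E0) (υ : u2 ≫ E1 ≅ D1 ≫ b2)
    (ω3 : E0 ≫ E1 ≫ b3 ≅ t3 ≫ G0 ≫ G1) (r4 : t4 ≫ H0 ≅ C0 ≫ u4) (χ4 : u4 ≫ H1 ≅ C1 ≫ b4)
    (ω5 : H0 ≫ H1 ≫ b5 ≅ t5 ≫ K0 ≫ K1) (r6 : t6 ≫ G0 ≅ K0 ≫ u6) (χ6 : u6 ≫ G1 ≅ K1 ≫ b6)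
    (s1 : t1 ≫ D0 ≫ D1 ≅ (C0 ≫ C1) ≫ b1) (hs1 : s1 = ω1.symm ≪≫ (α_ _ _ _).symm)
    (s2 : t2 ≫ E0 ≫ E1 ≅ (D0 ≫ D1) ≫ b2) (hs2 : s2 = sqComp β.symm υ)
    (s3 : t3 ≫ G0 ≫ G1 ≅ (E0 ≫ E1) ≫ b3) (hs3 : s3 = ω3.symm ≪≫ (α_ _ _ _).symm)
    (s4 : t4 ≫ H0 ≫ H1 ≅ (C0 ≫ C1) ≫ b4) (hs4 : s4 = sqComp r4 χ4)
    (s5 : t5 ≫ K0 ≫ K1 ≅ (H0 ≫ H1) ≫ b5) (hs5 : s5 = ω5.symm ≪≫ (α_ _ _ _).symm)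
    (s6 : t6 ≫ G0 ≫ G1 ≅ (K0 ≫ K1) ≫ b6) (hs6 : s6 = sqComp r6 χ6)
    (h : 𝟙 (C0 ≫ C1 ≫ b1 ≫ b2 ≫ b3) ⊗≫
      (C0 ≫ C1) ◁ ((μ1 ≪≫ whiskerLeftIso b1 μ2).symm ≪≫ P ≪≫
        (μ3 ≪≫ whiskerLeftIso b4 μ4)).hom ⊗≫
      C0 ◁ (χ4.inv ▷ (b5 ≫ b6)) ⊗≫ r4.inv ▷ (H1 ≫ b5 ≫ b6) ⊗≫ t4 ◁ (ω5.hom ▷ b6) ⊗≫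
      (t4 ≫ t5 ≫ K0) ◁ χ6.inv ⊗≫ (t4 ≫ t5) ◁ (r6.inv ▷ G1) ⊗≫
      𝟙 (t4 ≫ t5 ≫ t6 ≫ G0 ≫ G1) =
      𝟙 (C0 ≫ C1 ≫ b1 ≫ b2 ≫ b3) ⊗≫ ω1.hom ▷ (b2 ≫ b3) ⊗≫ (t1 ≫ D0) ◁ (υ.inv ▷ b3) ⊗≫
      t1 ◁ (β.hom ▷ (E1 ≫ b3)) ⊗≫ (t1 ≫ t2) ◁ ω3.hom ⊗≫ π.hom ▷ (G0 ≫ G1) ⊗≫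
      𝟙 (t4 ≫ t5 ≫ t6 ≫ G0 ≫ G1)) :
    SqHom (sqVComp s1 (sqVComp s2 s3 ≪≫ whiskerLeftIso (D0 ≫ D1) μ2.symm) ≪≫
        whiskerLeftIso (C0 ≫ C1) μ1.symm)
      (sqVComp s4 (sqVComp s5 s6 ≪≫ whiskerLeftIso (H0 ≫ H1) μ4.symm) ≪≫
        whiskerLeftIso (C0 ≫ C1) μ3.symm) π.hom P.hom := by
  subst hs1 hs2 hs3 hs4 hs5 hs6
  apply SqHom.of_inv
  simp only [Iso.trans_inv, sqVComp_inv, sqComp_inv, whiskerLeftIso_inv, Iso.symm_inv]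
  -- Conjugate `P` by the comparisons for composites of 1-cells: `q` is the conjugate, as in `h`.
  obtain ⟨m, m', q, hm, hm', hq, hmq⟩ : ∃ (m : b123 ⟶ b1 ≫ b2 ≫ b3) (m' : b456 ⟶ b4 ≫ b5 ≫ b6)
      (q : b1 ≫ b2 ≫ b3 ⟶ b4 ≫ b5 ≫ b6),
      m = μ1.hom ≫ b1 ◁ μ2.hom ∧ m' = μ3.hom ≫ b4 ◁ μ4.hom ∧
      q = ((μ1 ≪≫ whiskerLeftIso b1 μ2).symm ≪≫ P ≪≫ (μ3 ≪≫ whiskerLeftIso b4 μ4)).hom ∧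
        P.hom ≫ m' = m ≫ q :=
    ⟨_, _, _, rfl, rfl, rfl, by simp [← whiskerLeft_comp_assoc]⟩
  rw [← hq] at h
  clear hq
  calc
    _ = 𝟙 _ ⊗≫ (C0 ≫ C1) ◁ P.hom ⊗≫ (C0 ≫ C1) ◁ μ3.hom ⊗≫ C0 ◁ (χ4.inv ▷ b56) ⊗≫
        (r4.inv ▷ (H1 ≫ b56) ≫ (t4 ≫ H0) ◁ (H1 ◁ μ4.hom)) ⊗≫ t4 ◁ (ω5.hom ▷ b6) ⊗≫
        (t4 ≫ t5 ≫ K0) ◁ χ6.inv ⊗≫ (t4 ≫ t5) ◁ (r6.inv ▷ G1) ⊗≫ 𝟙 _ := by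
      bicategory
    _ = 𝟙 _ ⊗≫ (C0 ≫ C1) ◁ P.hom ⊗≫ (C0 ≫ C1) ◁ μ3.hom ⊗≫
        C0 ◁ (χ4.inv ▷ b56 ≫ (u4 ≫ H1) ◁ μ4.hom) ⊗≫
        r4.inv ▷ (H1 ≫ b5 ≫ b6) ⊗≫ t4 ◁ (ω5.hom ▷ b6) ⊗≫
        (t4 ≫ t5 ≫ K0) ◁ χ6.inv ⊗≫ (t4 ≫ t5) ◁ (r6.inv ▷ G1) ⊗≫ 𝟙 _ := by
      rw [← whisker_exchange]; bicategory
    _ = 𝟙 _ ⊗≫ (C0 ≫ C1) ◁ (P.hom ≫ μ3.hom ≫ b4 ◁ μ4.hom) ⊗≫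
        C0 ◁ (χ4.inv ▷ (b5 ≫ b6)) ⊗≫
        r4.inv ▷ (H1 ≫ b5 ≫ b6) ⊗≫ t4 ◁ (ω5.hom ▷ b6) ⊗≫
        (t4 ≫ t5 ≫ K0) ◁ χ6.inv ⊗≫ (t4 ≫ t5) ◁ (r6.inv ▷ G1) ⊗≫ 𝟙 _ := by
      rw [← whisker_exchange]; bicategory
    _ = 𝟙 _ ⊗≫ (C0 ≫ C1) ◁ m ⊗≫ (𝟙 (C0 ≫ C1 ≫ b1 ≫ b2 ≫ b3) ⊗≫ (C0 ≫ C1) ◁ q ⊗≫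
        C0 ◁ (χ4.inv ▷ (b5 ≫ b6)) ⊗≫
        r4.inv ▷ (H1 ≫ b5 ≫ b6) ⊗≫ t4 ◁ (ω5.hom ▷ b6) ⊗≫
        (t4 ≫ t5 ≫ K0) ◁ χ6.inv ⊗≫ (t4 ≫ t5) ◁ (r6.inv ▷ G1) ⊗≫
        𝟙 (t4 ≫ t5 ≫ t6 ≫ G0 ≫ G1)) ⊗≫ 𝟙 _ := by
      rw [← hm', hmq]; bicategory
    _ = 𝟙 _ ⊗≫ (C0 ≫ C1) ◁ μ1.hom ⊗≫ ((C0 ≫ C1 ≫ b1) ◁ μ2.hom ≫ ω1.hom ▷ (b2 ≫ b3)) ⊗≫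
        (t1 ≫ D0) ◁ (υ.inv ▷ b3) ⊗≫
        t1 ◁ (β.hom ▷ (E1 ≫ b3)) ⊗≫ (t1 ≫ t2) ◁ ω3.hom ⊗≫ π.hom ▷ (G0 ≫ G1) := by
      rw [h, hm]; bicategory
    _ = _ := by
      rw [whisker_exchange]; bicategory

/-- The pasting behind the lift of the middle unit cell: `h` has the shape of the axiom relating
`omega`, `gamma` and `delta` to the middle unit. -/
theorem sqHom_midUnit {n0 n1 n2 a0 a1 d0 d1 m0 m1 m2 : B}
    {t1 : n0 ⟶ n1} {t2 : n1 ⟶ n2} {t3 : n0 ⟶ n2} {b1 : m0 ⟶ m1} {b2 : m1 ⟶ m2}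
    {b12 b3 : m0 ⟶ m2} (μ : b12 ≅ b1 ≫ b2) (P : b12 ≅ b3)
    {C0 : n0 ⟶ a0} {C1 : a0 ⟶ a1} {C2 : a1 ⟶ m0} {G0 : n0 ⟶ a1} (R0 : G0 ≅ C0 ≫ C1)
    {D0 : n1 ⟶ d0} {D1 : d0 ⟶ d1} {D2 : d1 ⟶ m1} {G1 : n1 ⟶ d1} (L1 : G1 ≅ D0 ≫ D1)
    {E : n2 ⟶ m2} {V : d1 ⟶ n2} {U : a1 ⟶ n2} {u1 : a0 ⟶ d0}
    (π : t1 ≫ t2 ≅ t3) (ω : C1 ≫ C2 ≫ b1 ≅ u1 ≫ D1 ≫ D2) (α : C0 ≫ u1 ≅ t1 ≫ D0)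
    (χ2 : V ≫ E ≅ D2 ≫ b2) (γ : D0 ≫ D1 ≫ V ≅ t2) (χ3 : U ≫ E ≅ C2 ≫ b3)
    (δ : C0 ≫ C1 ≫ U ≅ t3) (γ' : G1 ≫ V ≅ t2) (hγ : γ'.hom = 𝟙 _ ⊗≫ L1.hom ▷ V ⊗≫ γ.hom)
    (δ' : G0 ≫ U ≅ t3) (hδ : δ'.hom = 𝟙 _ ⊗≫ R0.hom ▷ U ⊗≫ δ.hom)
    (s1 : t1 ≫ G1 ≫ D2 ≅ (G0 ≫ C2) ≫ b1)
    (hs1 : s1.inv = 𝟙 ((G0 ≫ C2) ≫ b1) ⊗≫ R0.hom ▷ (C2 ≫ b1) ⊗≫ C0 ◁ ω.hom ⊗≫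
      α.hom ▷ (D1 ≫ D2) ⊗≫ t1 ◁ (L1.inv ▷ D2))
    (s2 : t2 ≫ E ≅ (G1 ≫ D2) ≫ b2)
    (hs2 : s2.inv = 𝟙 ((G1 ≫ D2) ≫ b2) ⊗≫ G1 ◁ χ2.inv ⊗≫ γ'.hom ▷ E ⊗≫ 𝟙 (t2 ≫ E))
    (s3 : t3 ≫ E ≅ (G0 ≫ C2) ≫ b3)
    (hs3 : s3.inv = 𝟙 ((G0 ≫ C2) ≫ b3) ⊗≫ G0 ◁ χ3.inv ⊗≫ δ'.hom ▷ E ⊗≫ 𝟙 (t3 ≫ E))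
    (h : 𝟙 (C0 ≫ C1 ≫ C2 ≫ b1 ≫ b2) ⊗≫ (C0 ≫ C1 ≫ C2) ◁ (μ.symm ≪≫ P).hom ⊗≫
      (C0 ≫ C1) ◁ χ3.inv ⊗≫ δ.hom ▷ E ⊗≫ 𝟙 (t3 ≫ E) =
      𝟙 (C0 ≫ C1 ≫ C2 ≫ b1 ≫ b2) ⊗≫ C0 ◁ (ω.hom ▷ b2) ⊗≫ (C0 ≫ u1 ≫ D1) ◁ χ2.inv ⊗≫
      α.hom ▷ (D1 ≫ V ≫ E) ⊗≫ t1 ◁ (γ.hom ▷ E) ⊗≫ π.hom ▷ E ⊗≫ 𝟙 (t3 ≫ E)) :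
    SqHom (sqVComp s1 s2 ≪≫ whiskerLeftIso (G0 ≫ C2) μ.symm) s3 π.hom P.hom := by
  apply SqHom.of_inv
  simp only [Iso.trans_inv, sqVComp_inv, whiskerLeftIso_inv, Iso.symm_inv]
  rw [hs1, hs2, hs3, hγ, hδ]
  obtain ⟨q, hq, hmq⟩ : ∃ q : b1 ≫ b2 ⟶ b3, q = (μ.symm ≪≫ P).hom ∧ P.hom = μ.hom ≫ q :=
    ⟨_, rfl, by simp⟩
  rw [← hq] at h
  clear hq
  calc
    _ = 𝟙 _ ⊗≫ (G0 ≫ C2) ◁ P.hom ⊗≫ (G0 ◁ χ3.inv ≫ R0.hom ▷ (U ≫ E)) ⊗≫ δ.hom ▷ E ⊗≫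
        𝟙 (t3 ≫ E) := by
      bicategory
    _ = 𝟙 _ ⊗≫ (G0 ◁ (C2 ◁ P.hom) ≫ R0.hom ▷ (C2 ≫ b3)) ⊗≫ (C0 ≫ C1) ◁ χ3.inv ⊗≫ δ.hom ▷ E ⊗≫
        𝟙 (t3 ≫ E) := by
      rw [whisker_exchange]; bicategory
    _ = 𝟙 _ ⊗≫ R0.hom ▷ (C2 ≫ b12) ⊗≫ (C0 ≫ C1 ≫ C2) ◁ μ.hom ⊗≫
        (𝟙 (C0 ≫ C1 ≫ C2 ≫ b1 ≫ b2) ⊗≫ (C0 ≫ C1 ≫ C2) ◁ q ⊗≫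
      (C0 ≫ C1) ◁ χ3.inv ⊗≫ δ.hom ▷ E ⊗≫ 𝟙 (t3 ≫ E)) := by
      rw [whisker_exchange, hmq]; bicategory
    _ = 𝟙 _ ⊗≫ (R0.hom ▷ (C2 ≫ b12) ≫ (C0 ≫ C1) ◁ (C2 ◁ μ.hom)) ⊗≫
        C0 ◁ (ω.hom ▷ b2) ⊗≫ ((C0 ≫ u1) ◁ (D1 ◁ χ2.inv) ≫
      α.hom ▷ (D1 ≫ V ≫ E)) ⊗≫ t1 ◁ (γ.hom ▷ E) ⊗≫ π.hom ▷ E ⊗≫ 𝟙 (t3 ≫ E) := by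
      rw [h]; bicategory
    _ = 𝟙 _ ⊗≫ G0 ◁ (C2 ◁ μ.hom) ⊗≫ R0.hom ▷ (C2 ≫ b1 ≫ b2) ⊗≫
        C0 ◁ (ω.hom ▷ b2) ⊗≫ α.hom ▷ (D1 ≫ D2 ≫ b2) ⊗≫
        t1 ◁ ((L1.inv ≫ L1.hom) ▷ (D2 ≫ b2) ≫ (D0 ≫ D1) ◁ χ2.inv) ⊗≫
        t1 ◁ (γ.hom ▷ E) ⊗≫ π.hom ▷ E ⊗≫ 𝟙 (t3 ≫ E) := by
      rw [whisker_exchange α.hom, ← whisker_exchange R0.hom, Iso.inv_hom_id]; bicategory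
    _ = 𝟙 _ ⊗≫ G0 ◁ (C2 ◁ μ.hom) ⊗≫ R0.hom ▷ (C2 ≫ b1 ≫ b2) ⊗≫
        C0 ◁ (ω.hom ▷ b2) ⊗≫ α.hom ▷ (D1 ≫ D2 ≫ b2) ⊗≫ t1 ◁ (L1.inv ▷ (D2 ≫ b2)) ⊗≫
        t1 ◁ (L1.hom ▷ (D2 ≫ b2) ≫ (D0 ≫ D1) ◁ χ2.inv) ⊗≫
        t1 ◁ (γ.hom ▷ E) ⊗≫ π.hom ▷ E ⊗≫ 𝟙 (t3 ≫ E) := by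
      bicategory
    _ = _ := by
      rw [← whisker_exchange L1.hom]; bicategory

end

end BraidedBicat

namespace BraidedBicat
/-! ### Constraint cells of the comma bicategory -/

namespace Comma
open TensorBicategory ConstraintBicategory MonoidalBicategory

section
variable {M : Type u₁} [Bicategory.{w₁, v₁} M] [MonoidalBicategory M]
  {N : Type u₂} [Bicategory.{w₂, v₂} N] [MonoidalBicategory N] {T : MonoidalPseudofunctor M N}

/-- The pentagon cell over the pentagon cell of `M`. -/
def pentC (W X Y Z : M) :
    asC (of W : Comma T.toTensorPseudofunctor) (of X) (of Y) ▷₁ (of Z) ≫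
      asC (of W) (of X ⊠ of Y) (of Z) ≫ (of W) ◁₁ asC (of X) (of Y) (of Z) ≅
    asC (of W ⊠ of X) (of Y) (of Z) ≫ asC (of W) (of X) (of Y ⊠ of Z) :=
  mkIso (pent (T.F.obj W) (T.F.obj X) (T.F.obj Y) (T.F.obj Z)) (pent W X Y Z) <| by
    have h1 := whiskerRight_sq (asC (of W : Comma T.toTensorPseudofunctor) (of X) (of Y)) Z
    have h3 := whiskerLeft_sq (asC (of X : Comma T.toTensorPseudofunctor) (of Y) (of Z)) W
    rw [asC_of_sq] at h1 h3
    have h2 := asC_middle_sq_inv (T := T) (T.chi X Y) W Z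
    have h4 := asC_left_sq_inv (T := T) (T.chi W X) Y Z
    have h5 := asC_right_sq_inv (T := T) (T.chi Y Z) W X
    exact sqHom_pentagon (T.F.mapComp _ _) (T.F.mapComp _ _) (T.F.mapComp _ _)
      (T.F.map₂Iso (pent W X Y Z)) (rwComp _ _ _) (rwComp _ _ _) (lwComp _ _ _) (lwComp _ _ _)
      (tRL _ _) (tLR _ _) (pent (T.F.obj W) (T.F.obj X) (T.F.obj Y) (T.F.obj Z))
      (T.chiL (as W X Y) Z) (rw₃₃ (T.omega W X Y) (T.F.obj Z)) (T.omega W (X ⊠ Y) Z)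
      (asM (T.F.obj W) (T.chi X Y) (T.F.obj Z)) (T.chiR W (as X Y Z))
      (lw₃₃ (T.F.obj W) (T.omega X Y Z)) (T.omega (W ⊠ X) Y Z)
      (asL (T.chi W X) (T.F.obj Y) (T.F.obj Z)) (T.omega W X (Y ⊠ Z))
      (asR (T.F.obj W) (T.F.obj X) (T.chi Y Z)) (interchange (T.chi W X) (T.chi Y Z))
      (tRL_inv_tLR _ _) (rw₂₂ (T.omegaSq W X Y) (T.F.obj Z)) (lw₂₂ (T.F.obj W) (T.omegaSq X Y Z))
      (rw₂₂_symm_inv _ _) (lw₂₂_symm_inv _ _) _ h2 _ h4 _ h5 _ h1 _ h3 (T.omega_pent W X Y Z)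

/-- The left unit 1-cell. -/
def luC (Y : M) : (unitObj : Comma T.toTensorPseudofunctor) ⊠ of Y ⟶ of Y :=
  ⟨lu (T.F.obj Y), lu Y, ρ_ _ ≪≫ (T.gamma Y).symm ≪≫ (α_ _ _ _).symm⟩

/-- The right unit 1-cell. -/
def ruC (X : M) : (of X : Comma T.toTensorPseudofunctor) ⊠ unitObj ⟶ of X :=
  ⟨ru (T.F.obj X), ru X, ρ_ _ ≪≫ (T.delta X).symm ≪≫ (α_ _ _ _).symm⟩

/-- The middle unit cell over the middle unit cell of `M`. -/
def midUnitC (X Y : M) :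
    asC (of X : Comma T.toTensorPseudofunctor) unitObj (of Y) ≫ (of X) ◁₁ luC Y ≅
      ruC X ▷₁ (of Y) :=
  mkIso (midUnit (T.F.obj X) (T.F.obj Y)) (midUnit X Y) <| by
    have h1 := asC_middle_sq_inv (T := T) T.iota X Y
    have h2 := whiskerLeft_sq_of (luC (T := T) Y) X
    have h3 := whiskerRight_sq_of (ruC (T := T) X) Y
    have e2 : (luC (T := T) Y).sq.symm ≪≫ ρ_ _ = α_ _ _ _ ≪≫ T.gamma Y := by
      ext; simp [luC]
    have e3 : (ruC (T := T) X).sq.symm ≪≫ ρ_ _ = α_ _ _ _ ≪≫ T.delta X := by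
      ext; simp [ruC]
    rw [e2] at h2
    rw [e3] at h3
    exact sqHom_midUnit (T.F.mapComp _ _) (T.F.map₂Iso (midUnit X Y)) (rwComp _ _ _)
      (lwComp _ _ _) (midUnit (T.F.obj X) (T.F.obj Y)) (T.omega X unitObj Y)
      (asM (T.F.obj X) T.iota (T.F.obj Y)) (T.chiR X (lu Y)) (lw₃₁ (T.F.obj X) (T.gamma Y))
      (T.chiL (ru X) Y) (rw₃₁ (T.delta X) (T.F.obj Y)) _ (lw₂₁_associator _ _) _
      (rw₂₁_associator _ _) _ h1 _ h2 _ h3 (T.omega_midUnit X Y)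

end

section
open SwapBicategory BraidedMonoidalBicategory
variable {M : Type u₁} [Bicategory.{w₁, v₁} M] [BraidedMonoidalBicategory M]
  {N : Type u₂} [Bicategory.{w₂, v₂} N] [BraidedMonoidalBicategory N]
  {T : BraidedMonoidalPseudofunctor M N}

/-- The hexagon cell over the hexagon cell of `M`. -/
def hexRC (X Y Z : M) :
    asC (of X : Comma T.toTensorPseudofunctor) (of Y) (of Z) ≫ brC (of X) (of Y ⊠ of Z) ≫
      asC (of Y) (of Z) (of X) ≅
    brC (of X) (of Y) ▷₁ of Z ≫ asC (of Y) (of X) (of Z) ≫ of Y ◁₁ brC (of X) (of Z) :=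
  mkIso (hexR (T.F.obj X) (T.F.obj Y) (T.F.obj Z)) (hexR X Y Z) <| by
    have h1 := asC_of_sq (T := T.toMonoidalPseudofunctor) X Y Z
    have h2 := brC_right_sq (T := T) (T.chi Y Z) X
    have h3 := asC_of_sq (T := T.toMonoidalPseudofunctor) Y Z X
    have h4 := whiskerRight_sq (brC (of X : Comma T.toTensorPseudofunctor) (of Y)) Z
    have h5 := asC_of_sq (T := T.toMonoidalPseudofunctor) Y X Z
    have h6 := whiskerLeft_sq (brC (of X : Comma T.toTensorPseudofunctor) (of Z)) Y
    rw [brC_of_sq] at h4 h6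
    exact sqHom_hexagon (T.F.mapComp _ _) (T.F.mapComp _ _) (T.F.mapComp _ _) (T.F.mapComp _ _)
      (T.F.map₂Iso (hexR X Y Z)) (hexR (T.F.obj X) (T.F.obj Y) (T.F.obj Z)) (T.omega X Y Z)
      (brR (T.F.obj X) (T.chi Y Z)) (T.upsilon X (Y ⊠ Z)) (T.omega Y Z X)
      (rw₂₂ (T.upsilon X Y) (T.F.obj Z)) (T.chiL (br X Y) Z) (T.omega Y X Z)
      (lw₂₂ (T.F.obj Y) (T.upsilon X Z)) (T.chiR Y (br X Z)) _ h1 _ h2 _ h3 _ h4 _ h5 _ h6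
      (T.upsilon_hexR X Y Z)

end

end Comma
end BraidedBicat

namespace BraidedBicat

/-! ### Pastings for multiplications, units and centre pieces -/

section
variable {B : Type u} [Bicategory.{w, v} B]

theorem bicategoricalIsoComp_hom {X Y : B} {f g h i : X ⟶ Y} [BicategoricalCoherence g h]
    (η : f ≅ g) (θ : h ≅ i) : (η ≪⊗≫ θ).hom = η.hom ⊗≫ θ.hom := rfl

/-- The 2-cell that `chi` and `omega` induce from an associativity cell `P` is compatible with
`P`. -/
theorem sqHom_mAssoc {n0 n1 n2 n c0 d0 m0 m1 m2 : B} {t1 : n0 ⟶ n2} {t3 : n0 ⟶ n1} {t4 : n1 ⟶ n2}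
    {b1 : m0 ⟶ m2} {b3 : m0 ⟶ m1} {b4 : m1 ⟶ m2} {f : m2 ⟶ n} {b1f b34f : m0 ⟶ n} {b4f : m1 ⟶ n}
    (μ1 : b1f ≅ b1 ≫ f) (μ2 : b34f ≅ b3 ≫ b4f) (μ3 : b4f ≅ b4 ≫ f) (P : b1f ≅ b34f)
    {C0 : n0 ⟶ c0} {C1 : c0 ⟶ m0} {D0 : n1 ⟶ d0} {D1 : d0 ⟶ m1} {E : n2 ⟶ m2}
    {v1 : c0 ⟶ n2} {v4 : d0 ⟶ n2} (r1 : t1 ≅ C0 ≫ v1) (χ1 : v1 ≫ E ≅ C1 ≫ b1)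
    (ω : C0 ≫ C1 ≫ b3 ≅ t3 ≫ D0 ≫ D1) (r4 : t4 ≅ D0 ≫ v4) (χ4 : v4 ≫ E ≅ D1 ≫ b4)
    (s1 : t1 ≫ E ≅ (C0 ≫ C1) ≫ b1)
    (hs1 : s1.inv = 𝟙 ((C0 ≫ C1) ≫ b1) ⊗≫ C0 ◁ χ1.inv ⊗≫ r1.inv ▷ E ⊗≫ 𝟙 (t1 ≫ E))
    (s3 : t3 ≫ D0 ≫ D1 ≅ (C0 ≫ C1) ≫ b3) (hs3 : s3 = ω.symm ≪≫ (α_ _ _ _).symm)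
    (s4 : t4 ≫ E ≅ (D0 ≫ D1) ≫ b4)
    (hs4 : s4.inv = 𝟙 ((D0 ≫ D1) ≫ b4) ⊗≫ D0 ◁ χ4.inv ⊗≫ r4.inv ▷ E ⊗≫ 𝟙 (t4 ≫ E)) :
    SqHom (sqVComp s1 (ρ_ (E ≫ f)) ≪≫ whiskerLeftIso (C0 ≫ C1) μ1.symm)
      (sqVComp s3 (sqVComp s4 (ρ_ (E ≫ f)) ≪≫ whiskerLeftIso (D0 ≫ D1) μ3.symm) ≪≫
        whiskerLeftIso (C0 ≫ C1) μ2.symm)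
      (whiskerRightIso r1 (E ≫ f) ≪⊗≫ whiskerLeftIso C0 (whiskerRightIso χ1 f) ≪⊗≫
        whiskerLeftIso (C0 ≫ C1) (μ1.symm ≪≫ P ≪≫ (μ2 ≪≫ whiskerLeftIso b3 μ3)) ≪⊗≫
        whiskerRightIso ω (b4 ≫ f) ≪⊗≫ whiskerLeftIso (t3 ≫ D0) (whiskerRightIso χ4.symm f) ≪⊗≫
        whiskerLeftIso t3 (whiskerRightIso r4.symm (E ≫ f))).hom P.hom := by
  subst hs3
  apply SqHom.of_inv
  simp only [Iso.trans_inv, sqVComp_inv, whiskerLeftIso_inv, Iso.symm_inv,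
    bicategoricalIsoComp_hom, whiskerLeftIso_hom, whiskerRightIso_hom, Iso.symm_hom, Iso.trans_hom]
  rw [hs1, hs4]
  symm
  calc
    _ = 𝟙 _ ⊗≫ (C0 ≫ C1) ◁ μ1.hom ⊗≫ C0 ◁ (χ1.inv ▷ f) ⊗≫ (r1.inv ≫ r1.hom) ▷ (E ≫ f) ⊗≫
        C0 ◁ (χ1.hom ▷ f) ⊗≫ (C0 ≫ C1) ◁ (μ1.inv ≫ P.hom ≫ μ2.hom ≫ b3 ◁ μ3.hom) ⊗≫
        ω.hom ▷ (b4 ≫ f) ⊗≫ (t3 ≫ D0) ◁ (χ4.inv ▷ f) ⊗≫ t3 ◁ (r4.inv ▷ (E ≫ f)) ⊗≫ 𝟙 _ := by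
      bicategory
    _ = 𝟙 _ ⊗≫ (C0 ≫ C1) ◁ μ1.hom ⊗≫ C0 ◁ ((χ1.inv ≫ χ1.hom) ▷ f) ⊗≫
        (C0 ≫ C1) ◁ (μ1.inv ≫ P.hom ≫ μ2.hom ≫ b3 ◁ μ3.hom) ⊗≫
        ω.hom ▷ (b4 ≫ f) ⊗≫ (t3 ≫ D0) ◁ (χ4.inv ▷ f) ⊗≫ t3 ◁ (r4.inv ▷ (E ≫ f)) ⊗≫ 𝟙 _ := by
      rw [Iso.inv_hom_id]; bicategory
    _ = 𝟙 _ ⊗≫ (C0 ≫ C1) ◁ ((μ1.hom ≫ μ1.inv) ≫ P.hom ≫ μ2.hom) ⊗≫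
        ((C0 ≫ C1 ≫ b3) ◁ μ3.hom ≫ ω.hom ▷ (b4 ≫ f)) ⊗≫
        (t3 ≫ D0) ◁ (χ4.inv ▷ f) ⊗≫ t3 ◁ (r4.inv ▷ (E ≫ f)) ⊗≫ 𝟙 _ := by
      rw [Iso.inv_hom_id]; bicategory
    _ = _ := by
      rw [whisker_exchange, Iso.hom_inv_id, Category.id_comp]; bicategory

/-- The 2-cell that `chi` and a unit modification `γ` induce from a unit cell `P` is compatible
with `P`. -/
theorem sqHom_mUnit {n0 n2 n c0 m0 m2 : B} {t1 : n0 ⟶ n2}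
    {b1 : m0 ⟶ m2} {f : m2 ⟶ n} {b1f b : m0 ⟶ n} (μ1 : b1f ≅ b1 ≫ f) (P : b1f ≅ b)
    {C0 : n0 ⟶ c0} {C1 : c0 ⟶ m0} {E : n2 ⟶ m2} {l : n0 ⟶ n}
    {v1 : c0 ⟶ n2} (r1 : t1 ≅ C0 ≫ v1) (χ1 : v1 ≫ E ≅ C1 ≫ b1) (γ : C0 ≫ C1 ≫ b ≅ l)
    (s1 : t1 ≫ E ≅ (C0 ≫ C1) ≫ b1)
    (hs1 : s1.inv = 𝟙 ((C0 ≫ C1) ≫ b1) ⊗≫ C0 ◁ χ1.inv ⊗≫ r1.inv ▷ E ⊗≫ 𝟙 (t1 ≫ E)) :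
    SqHom (sqVComp s1 (ρ_ (E ≫ f)) ≪≫ whiskerLeftIso (C0 ≫ C1) μ1.symm)
      (ρ_ l ≪≫ γ.symm ≪≫ (α_ _ _ _).symm)
      (whiskerRightIso r1 (E ≫ f) ≪⊗≫ whiskerLeftIso C0 (whiskerRightIso χ1 f) ≪⊗≫
        whiskerLeftIso (C0 ≫ C1) (μ1.symm ≪≫ P) ≪⊗≫ γ).hom P.hom := by
  apply SqHom.of_inv
  simp only [Iso.trans_inv, sqVComp_inv, whiskerLeftIso_inv, Iso.symm_inv,
    bicategoricalIsoComp_hom, whiskerLeftIso_hom, whiskerRightIso_hom, Iso.symm_hom, Iso.trans_hom]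
  rw [hs1]
  symm
  calc
    _ = 𝟙 _ ⊗≫ (C0 ≫ C1) ◁ μ1.hom ⊗≫ C0 ◁ (χ1.inv ▷ f) ⊗≫ (r1.inv ≫ r1.hom) ▷ (E ≫ f) ⊗≫
        C0 ◁ (χ1.hom ▷ f) ⊗≫ (C0 ≫ C1) ◁ (μ1.inv ≫ P.hom) ⊗≫ γ.hom ⊗≫ 𝟙 _ := by
      bicategory
    _ = 𝟙 _ ⊗≫ (C0 ≫ C1) ◁ μ1.hom ⊗≫ C0 ◁ ((χ1.inv ≫ χ1.hom) ▷ f) ⊗≫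
        (C0 ≫ C1) ◁ (μ1.inv ≫ P.hom) ⊗≫ γ.hom ⊗≫ 𝟙 _ := by
      rw [Iso.inv_hom_id]; bicategory
    _ = 𝟙 _ ⊗≫ (C0 ≫ C1) ◁ ((μ1.hom ≫ μ1.inv) ≫ P.hom) ⊗≫ γ.hom ⊗≫ 𝟙 _ := by
      rw [Iso.inv_hom_id]; bicategory
    _ = _ := by
      rw [Iso.hom_inv_id, Category.id_comp]; bicategory

/-- The 2-cell that `chi` (through `s1`, `s4`) and `upsilon` (through `s3`) induce from the 2-cell
`P` of a centre piece is compatible with `P`. -/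
theorem sqHom_centrePiece {n0 n1 n2 n m0 m1 m2 : B} {t1 : n0 ⟶ n2} {t3 : n0 ⟶ n1} {t4 : n1 ⟶ n2}
    {b1 : m0 ⟶ m2} {b3 : m0 ⟶ m1} {b4 : m1 ⟶ m2} {f : m2 ⟶ n} {b1f b34f : m0 ⟶ n} {b4f : m1 ⟶ n}
    (μ1 : b1f ≅ b1 ≫ f) (μ2 : b34f ≅ b3 ≫ b4f) (μ3 : b4f ≅ b4 ≫ f) (P : b1f ≅ b34f)
    {C : n0 ⟶ m0} {D : n1 ⟶ m1} {E : n2 ⟶ m2}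
    (s1 s1' : t1 ≫ E ≅ C ≫ b1) (hs1 : s1' = s1) (s3 s3' : t3 ≫ D ≅ C ≫ b3) (hs3 : s3' = s3)
    (s4 s4' : t4 ≫ E ≅ D ≫ b4) (hs4 : s4' = s4) :
    SqHom (sqVComp s1' (ρ_ (E ≫ f)) ≪≫ whiskerLeftIso C μ1.symm)
      (sqVComp s3' (sqVComp s4' (ρ_ (E ≫ f)) ≪≫ whiskerLeftIso D μ3.symm) ≪≫
        whiskerLeftIso C μ2.symm)
      ((α_ t1 E f).symm ≪≫ whiskerRightIso s1 f ≪⊗≫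
        whiskerLeftIso C (μ1.symm ≪≫ P ≪≫ (μ2 ≪≫ whiskerLeftIso b3 μ3)) ≪⊗≫
        whiskerRightIso s3.symm (b4 ≫ f) ≪⊗≫
        whiskerLeftIso t3 (whiskerRightIso s4.symm f ≪≫ α_ t4 E f)).hom P.hom := by
  subst hs1 hs3 hs4
  apply SqHom.of_inv
  simp only [Iso.trans_inv, sqVComp_inv, whiskerLeftIso_inv, Iso.symm_inv,
    bicategoricalIsoComp_hom, whiskerLeftIso_hom, whiskerRightIso_hom, Iso.symm_hom, Iso.trans_hom]
  symm
  calc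
    _ = 𝟙 _ ⊗≫ C ◁ μ1.hom ⊗≫ (s1'.inv ≫ s1'.hom) ▷ f ⊗≫
        C ◁ (μ1.inv ≫ P.hom ≫ μ2.hom ≫ b3 ◁ μ3.hom) ⊗≫ s3'.inv ▷ (b4 ≫ f) ⊗≫
        t3 ◁ (s4'.inv ▷ f) ⊗≫ 𝟙 _ := by
      bicategory
    _ = 𝟙 _ ⊗≫ C ◁ ((μ1.hom ≫ μ1.inv) ≫ P.hom ≫ μ2.hom) ⊗≫
        ((C ≫ b3) ◁ μ3.hom ≫ s3'.inv ▷ (b4 ≫ f)) ⊗≫ t3 ◁ (s4'.inv ▷ f) ⊗≫ 𝟙 _ := by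
      rw [Iso.inv_hom_id]; bicategory
    _ = _ := by
      rw [whisker_exchange, Iso.hom_inv_id, Category.id_comp]; bicategory

end

end BraidedBicat

namespace BraidedBicat
/-! ### Lifting monoidal objects and centre pieces -/

open TensorBicategory ConstraintBicategory MonoidalBicategory

section
variable {B : Type u} [Bicategory.{w, v} B] [TensorBicategory B]

theorem rw₂₁_refl {X Y Z : B} (f : X ⟶ Y) (g : Y ⟶ Z) (W : B) :
    (rw₂₁ (Iso.refl (f ≫ g)) W).hom = (rwComp f g W).inv := by
  simp [rw₂₁, rwIso, tIso, tHom₂_id]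

theorem lw₂₁_refl {X Y Z : B} (f : X ⟶ Y) (g : Y ⟶ Z) (W : B) :
    (lw₂₁ W (Iso.refl (f ≫ g))).hom = (lwComp W f g).inv := by
  simp [lw₂₁, lwIso, tIso, tHom₂_id]

end

namespace Comma

section
variable {M : Type u₁} [Bicategory.{w₁, v₁} M] [MonoidalBicategory M]
  {N : Type u₂} [Bicategory.{w₂, v₂} N] [MonoidalBicategory N]

/-- A 2-cell into an object with identity leg is determined by its base, so an equation of 2-cells
in `M` lifts to the comma bicategory. -/
theorem hom₂_ext_of {T : TensorPseudofunctor M N} {P : Comma T} {X : M} {f g : P ⟶ of X}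
    {η θ : f ⟶ g} (h : η.base = θ.base) : η = θ := by
  refine Hom₂.ext ?_ h
  have h₁ := η.comm
  have h₂ := θ.comm
  unfold SqHom at h₁ h₂
  rw [h, ← h₂] at h₁
  have h₃ : η.top ▷ 𝟙 (T.F.obj X) = θ.top ▷ 𝟙 (T.F.obj X) := (cancel_mono g.sq.hom).1 h₁
  rwa [whiskerRight_id, whiskerRight_id, cancel_epi, cancel_mono] at h₃

variable {T : MonoidalPseudofunctor M N} (D : MonoidalObjectData M)

/-- The multiplication of `F A` over the multiplication of `A`. -/
def mC : (of D.A : Comma T.toTensorPseudofunctor) ⊠ of D.A ⟶ of D.A :=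
  ⟨T.chi D.A D.A ≫ T.F.map D.m, D.m, ρ_ _⟩

/-- The unit of `F A` over the unit of `A`. -/
def jC : (unitObj : Comma T.toTensorPseudofunctor) ⟶ of D.A :=
  ⟨T.iota ≫ T.F.map D.j, D.j, ρ_ _⟩

theorem mC_whiskerRight_sq : (Hom₁.sq (mC (T := T) D ▷₁ of D.A)).inv =
    𝟙 ((T.chi D.A D.A ▷₁ T.F.obj D.A ≫ T.chi (D.A ⊠ D.A) D.A) ≫ T.F.map (D.m ▷₁ D.A)) ⊗≫
      T.chi D.A D.A ▷₁ T.F.obj D.A ◁ (T.chiL D.m D.A).inv ⊗≫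
      (rwComp (T.chi D.A D.A) (T.F.map D.m) (T.F.obj D.A)).inv ▷ T.chi D.A D.A ⊗≫
      𝟙 ((T.chi D.A D.A ≫ T.F.map D.m) ▷₁ T.F.obj D.A ≫ T.chi D.A D.A) := by
  have h := whiskerRight_sq_of (mC (T := T) D) D.A
  have e : (mC (T := T) D).sq.symm ≪≫ ρ_ _ = Iso.refl (T.chi D.A D.A ≫ T.F.map D.m) :=
    Iso.symm_self_id _
  rw [e] at h
  rw [← rw₂₁_refl]
  exact h

theorem mC_whiskerLeft_sq : (Hom₁.sq (of D.A ◁₁ mC (T := T) D)).inv =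
    𝟙 ((T.F.obj D.A ◁₁ T.chi D.A D.A ≫ T.chi D.A (D.A ⊠ D.A)) ≫ T.F.map (D.A ◁₁ D.m)) ⊗≫
      T.F.obj D.A ◁₁ T.chi D.A D.A ◁ (T.chiR D.A D.m).inv ⊗≫
      (lwComp (T.F.obj D.A) (T.chi D.A D.A) (T.F.map D.m)).inv ▷ T.chi D.A D.A ⊗≫
      𝟙 (T.F.obj D.A ◁₁ (T.chi D.A D.A ≫ T.F.map D.m) ≫ T.chi D.A D.A) := by
  have h := whiskerLeft_sq_of (mC (T := T) D) D.A
  have e : (mC (T := T) D).sq.symm ≪≫ ρ_ _ = Iso.refl (T.chi D.A D.A ≫ T.F.map D.m) :=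
    Iso.symm_self_id _
  rw [e] at h
  rw [← lw₂₁_refl]
  exact h

theorem jC_whiskerRight_sq : (Hom₁.sq (jC (T := T) D ▷₁ of D.A)).inv =
    𝟙 ((T.iota ▷₁ T.F.obj D.A ≫ T.chi unitObj D.A) ≫ T.F.map (D.j ▷₁ D.A)) ⊗≫
      T.iota ▷₁ T.F.obj D.A ◁ (T.chiL D.j D.A).inv ⊗≫
      (rwComp T.iota (T.F.map D.j) (T.F.obj D.A)).inv ▷ T.chi D.A D.A ⊗≫
      𝟙 ((T.iota ≫ T.F.map D.j) ▷₁ T.F.obj D.A ≫ T.chi D.A D.A) := by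
  have h := whiskerRight_sq_of (jC (T := T) D) D.A
  have e : (jC (T := T) D).sq.symm ≪≫ ρ_ _ = Iso.refl (T.iota ≫ T.F.map D.j) :=
    Iso.symm_self_id _
  rw [e] at h
  rw [← rw₂₁_refl]
  exact h

theorem jC_whiskerLeft_sq : (Hom₁.sq (of D.A ◁₁ jC (T := T) D)).inv =
    𝟙 ((T.F.obj D.A ◁₁ T.iota ≫ T.chi D.A unitObj) ≫ T.F.map (D.A ◁₁ D.j)) ⊗≫
      T.F.obj D.A ◁₁ T.iota ◁ (T.chiR D.A D.j).inv ⊗≫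
      (lwComp (T.F.obj D.A) T.iota (T.F.map D.j)).inv ▷ T.chi D.A D.A ⊗≫
      𝟙 (T.F.obj D.A ◁₁ (T.iota ≫ T.F.map D.j) ≫ T.chi D.A D.A) := by
  have h := whiskerLeft_sq_of (jC (T := T) D) D.A
  have e : (jC (T := T) D).sq.symm ≪≫ ρ_ _ = Iso.refl (T.iota ≫ T.F.map D.j) :=
    Iso.symm_self_id _
  rw [e] at h
  rw [← lw₂₁_refl]
  exact h

/-- The associativity cell of `F A` over that of `A`. -/
def mAssocC : mC (T := T) D ▷₁ of D.A ≫ mC D ≅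
    asC (of D.A) (of D.A) (of D.A) ≫ of D.A ◁₁ mC D ≫ mC D :=
  mkIso (T.mapData D).mAssoc D.mAssoc <|
    sqHom_mAssoc (T.F.mapComp _ _) (T.F.mapComp _ _) (T.F.mapComp _ _) (T.F.map₂Iso D.mAssoc)
      (rwComp _ _ _) (T.chiL D.m D.A) (T.omega D.A D.A D.A) (lwComp _ _ _) (T.chiR D.A D.m)
      _ (mC_whiskerRight_sq D) _ (asC_of_sq _ _ _) _ (mC_whiskerLeft_sq D)

/-- The left unit cell of `F A` over that of `A`. -/
def mLeftC : jC (T := T) D ▷₁ of D.A ≫ mC D ≅ luC D.A :=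
  mkIso (T.mapData D).mLeft D.mLeft <|
    sqHom_mUnit (T.F.mapComp _ _) (T.F.map₂Iso D.mLeft) (rwComp _ _ _) (T.chiL D.j D.A)
      (T.gamma D.A) _ (jC_whiskerRight_sq D)

/-- The right unit cell of `F A` over that of `A`. -/
def mRightC : of D.A ◁₁ jC (T := T) D ≫ mC D ≅ ruC D.A :=
  mkIso (T.mapData D).mRight D.mRight <|
    sqHom_mUnit (T.F.mapComp _ _) (T.F.map₂Iso D.mRight) (lwComp _ _ _) (T.chiR D.A D.j)
      (T.delta D.A) _ (jC_whiskerLeft_sq D)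

/-- The pentagon of `A`, lifted to the comma bicategory. -/
theorem pentagonC (h : D.IsCoherent) :
    𝟙 (mC (T := T) D ▷₁ of D.A ▷₁ of D.A ≫ mC D ▷₁ of D.A ≫ mC D) ⊗≫
      mC D ▷₁ of D.A ▷₁ of D.A ◁ (mAssocC D).hom ⊗≫
      (asLC (mC D) (of D.A) (of D.A)).hom ▷ (of D.A ◁₁ mC D ≫ mC D) ⊗≫
      asC (of D.A ⊠ of D.A) (of D.A) (of D.A) ◁ ((interchange (mC D) (mC D)).hom ▷ mC D) ⊗≫
      (asC (of D.A ⊠ of D.A) (of D.A) (of D.A) ≫ (of D.A ⊠ of D.A) ◁₁ mC D) ◁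
        (mAssocC D).hom ⊗≫
      asC (of D.A ⊠ of D.A) (of D.A) (of D.A) ◁
        ((asRC (of D.A) (of D.A) (mC D)).hom ▷ (of D.A ◁₁ mC D ≫ mC D)) ⊗≫
      𝟙 (asC (of D.A ⊠ of D.A) (of D.A) (of D.A) ≫ asC (of D.A) (of D.A) (of D.A ⊠ of D.A) ≫
        of D.A ◁₁ of D.A ◁₁ mC D ≫ of D.A ◁₁ mC D ≫ mC D) =
    𝟙 (mC (T := T) D ▷₁ of D.A ▷₁ of D.A ≫ mC D ▷₁ of D.A ≫ mC D) ⊗≫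
      (rw₂₃ (mAssocC D) (of D.A)).hom ▷ mC D ⊗≫
      (asC (of D.A) (of D.A) (of D.A) ▷₁ of D.A ≫ (of D.A ◁₁ mC D) ▷₁ of D.A) ◁
        (mAssocC D).hom ⊗≫
      asC (of D.A) (of D.A) (of D.A) ▷₁ of D.A ◁
        ((asMC (of D.A) (mC D) (of D.A)).hom ▷ (of D.A ◁₁ mC D ≫ mC D)) ⊗≫
      (asC (of D.A) (of D.A) (of D.A) ▷₁ of D.A ≫ asC (of D.A) (of D.A ⊠ of D.A) (of D.A)) ◁
        ((lw₂₃ (of D.A) (mAssocC D)).hom ▷ mC D) ⊗≫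
      (pentC D.A D.A D.A D.A).hom ▷
        (of D.A ◁₁ of D.A ◁₁ mC D ≫ of D.A ◁₁ mC D ≫ mC D) ⊗≫
      𝟙 (asC (of D.A ⊠ of D.A) (of D.A) (of D.A) ≫ asC (of D.A) (of D.A) (of D.A ⊠ of D.A) ≫
        of D.A ◁₁ of D.A ◁₁ mC D ≫ of D.A ◁₁ mC D ≫ mC D) :=
  hom₂_ext_of h.pentagon

/-- The unit condition of `A`, lifted to the comma bicategory. -/
theorem triangleC (h : D.IsCoherent) :
    𝟙 ((of D.A ◁₁ jC (T := T) D) ▷₁ of D.A ≫ mC D ▷₁ of D.A ≫ mC D) ⊗≫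
      (rw₂₁ (mRightC D) (of D.A)).hom ▷ mC D ⊗≫
      𝟙 (ruC D.A ▷₁ of D.A ≫ mC D) =
    𝟙 ((of D.A ◁₁ jC (T := T) D) ▷₁ of D.A ≫ mC D ▷₁ of D.A ≫ mC D) ⊗≫
      (of D.A ◁₁ jC D) ▷₁ of D.A ◁ (mAssocC D).hom ⊗≫
      (asMC (of D.A) (jC D) (of D.A)).hom ▷ (of D.A ◁₁ mC D ≫ mC D) ⊗≫
      asC (of D.A) unitObj (of D.A) ◁ ((lw₂₁ (of D.A) (mLeftC D)).hom ▷ mC D) ⊗≫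
      (midUnitC D.A D.A).hom ▷ mC D ⊗≫
      𝟙 (ruC D.A ▷₁ of D.A ≫ mC D) :=
  hom₂_ext_of h.triangle

/-- The coherence conditions of `F A` are the tops of the lifted conditions of `A`. -/
theorem isCoherent_mapData (h : D.IsCoherent) : (T.mapData D).IsCoherent where
  pentagon := congrArg Hom₂.top (pentagonC (T := T) D h)
  triangle := congrArg Hom₂.top (triangleC (T := T) D h)

end

section
open SwapBicategory BraidedMonoidalBicategory
variable {M : Type u₁} [Bicategory.{w₁, v₁} M] [BraidedMonoidalBicategory M]
  {N : Type u₂} [Bicategory.{w₂, v₂} N] [BraidedMonoidalBicategory N]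
  {T : BraidedMonoidalPseudofunctor M N}

/-- The 2-cell of the image of a centre piece over the 2-cell of the centre piece. -/
def centreCellC (D : MonoidalObjectData M) {U : M} (x : U ⟶ D.A)
    (γ : x ▷₁ D.A ≫ D.m ≅ br U D.A ≫ D.A ◁₁ x ≫ D.m) :
    ofMap (T := T.toTensorPseudofunctor) x ▷₁ of D.A ≫ mC D ≅
      brC (of U) (of D.A) ≫ of D.A ◁₁ ofMap x ≫ mC D :=
  mkIso (T.mapCell D x γ) γ <|
    sqHom_centrePiece (T.F.mapComp _ _) (T.F.mapComp _ _) (T.F.mapComp _ _) (T.F.map₂Iso γ)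
      (T.chiL x D.A) _ (whiskerRight_ofMap_sq x D.A) (T.upsilon U D.A) _ (brC_of_sq U D.A)
      (T.chiR D.A x) _ (whiskerLeft_ofMap_sq x D.A)

/-- The condition on a centre piece for `A`, lifted to the comma bicategory. -/
theorem centrePieceC (D : MonoidalObject M) {U : M} (x : U ⟶ D.A)
    (γ : x ▷₁ D.A ≫ D.m ≅ br U D.A ≫ D.A ◁₁ x ≫ D.m) (h : IsCentrePiece D x γ) :
    letI A : Comma T.toTensorPseudofunctor := of D.A
    letI V : Comma T.toTensorPseudofunctor := of U
    letI m : A ⊠ A ⟶ A := mC D.toMonoidalObjectData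
    letI y : V ⟶ A := ofMap x
    letI mA : m ▷₁ A ≫ m ≅ asC A A A ≫ A ◁₁ m ≫ m := mAssocC D.toMonoidalObjectData
    letI c : y ▷₁ A ≫ m ≅ brC V A ≫ A ◁₁ y ≫ m := centreCellC D.toMonoidalObjectData x γ
    𝟙 (y ▷₁ A ▷₁ A ≫ m ▷₁ A ≫ m) ⊗≫
      y ▷₁ A ▷₁ A ◁ mA.hom ⊗≫
      (asLC y A A).hom ▷ (A ◁₁ m ≫ m) ⊗≫
      asC V A A ◁ ((interchange y m).hom ▷ m) ⊗≫
      (asC V A A ≫ V ◁₁ m) ◁ c.hom ⊗≫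
      asC V A A ◁ ((brRC V m).hom ▷ (A ◁₁ y ≫ m)) ⊗≫
      (asC V A A ≫ brC V (A ⊠ A)) ◁ ((interchange m y).hom ▷ m) ⊗≫
      (asC V A A ≫ brC V (A ⊠ A) ≫ (A ⊠ A) ◁₁ y) ◁ mA.hom ⊗≫
      (asC V A A ≫ brC V (A ⊠ A)) ◁ ((asRC A A y).hom ▷ (A ◁₁ m ≫ m)) ⊗≫
      𝟙 (asC V A A ≫ brC V (A ⊠ A) ≫ asC A A V ≫ A ◁₁ A ◁₁ y ≫ A ◁₁ m ≫ m) =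
    𝟙 (y ▷₁ A ▷₁ A ≫ m ▷₁ A ≫ m) ⊗≫
      (rw₂₃ c A).hom ▷ m ⊗≫
      (brC V A ▷₁ A ≫ (A ◁₁ y) ▷₁ A) ◁ mA.hom ⊗≫
      brC V A ▷₁ A ◁ ((asMC A y A).hom ▷ (A ◁₁ m ≫ m)) ⊗≫
      (brC V A ▷₁ A ≫ asC A V A) ◁ ((lw₂₃ A c).hom ▷ m) ⊗≫
      (hexRC U D.A D.A).inv ▷ (A ◁₁ A ◁₁ y ≫ A ◁₁ m ≫ m) ⊗≫
      𝟙 (asC V A A ≫ brC V (A ⊠ A) ≫ asC A A V ≫ A ◁₁ A ◁₁ y ≫ A ◁₁ m ≫ m) :=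
  hom₂_ext_of h

/-- The centre piece condition for `F x` is the top of the lifted condition for `x`. -/
theorem isCentrePiece_mapCell (D : MonoidalObject M)
    (hA : (T.mapData D.toMonoidalObjectData).IsCoherent) {U : M} (x : U ⟶ D.A)
    (γ : x ▷₁ D.A ≫ D.m ≅ br U D.A ≫ D.A ◁₁ x ≫ D.m) (h : IsCentrePiece D x γ) :
    IsCentrePiece (⟨T.mapData D.toMonoidalObjectData, hA⟩ : MonoidalObject N) (T.F.map x)
      (T.mapCell D.toMonoidalObjectData x γ) :=
  congrArg Hom₂.top (centrePieceC (T := T) D x γ h)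

end

end Comma
end BraidedBicat

theorem proposition2p2 {M : Type u₁} [Bicategory.{w₁, v₁} M] [BraidedMonoidalBicategory M]
    {N : Type u₂} [Bicategory.{w₂, v₂} N] [BraidedMonoidalBicategory N]
    (T : BraidedMonoidalPseudofunctor M N) (A : MonoidalObject M) :
    ∃ hA : (T.mapData A.toMonoidalObjectData).IsCoherent,
      ∃ hP : ∀ (U : M) (P : CentrePiece A U),
        IsCentrePiece (⟨T.mapData A.toMonoidalObjectData, hA⟩ : MonoidalObject N)
          (T.F.map P.x) (T.mapCell A.toMonoidalObjectData P.x P.γ),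
      ∀ (ZA : Centre A)
        (ZFA : Centre (⟨T.mapData A.toMonoidalObjectData, hA⟩ : MonoidalObject N)),
        ∃ (k : T.F.obj ZA.Z ⟶ ZFA.Z)
          (θ : (ZFA.piece.restrictFunctor (T.F.obj ZA.Z)).obj k ≅
            ⟨T.F.map ZA.piece.x, T.mapCell A.toMonoidalObjectData ZA.piece.x ZA.piece.γ,
              hP ZA.Z ZA.piece⟩),
          ∀ (k' : T.F.obj ZA.Z ⟶ ZFA.Z)
            (θ' : (ZFA.piece.restrictFunctor (T.F.obj ZA.Z)).obj k' ≅
              ⟨T.F.map ZA.piece.x, T.mapCell A.toMonoidalObjectData ZA.piece.x ZA.piece.γ,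
                hP ZA.Z ZA.piece⟩),
            ∃! e : k ≅ k',
              (ZFA.piece.restrictFunctor (T.F.obj ZA.Z)).map e.hom ≫ θ'.hom = θ.hom := by
  have hA := Comma.isCoherent_mapData (T := T.toMonoidalPseudofunctor) A.toMonoidalObjectData
    A.coherent
  refine ⟨hA, fun U P => Comma.isCentrePiece_mapCell A hA P.x P.γ P.isCentrePiece,
    fun ZA ZFA => ?_⟩
  -- Essential surjectivity gives `k` and `θ`; full faithfulness gives the comparison `e`.
  have := ZFA.isEquivalence (T.F.obj ZA.Z)
  refine ⟨(ZFA.piece.restrictFunctor (T.F.obj ZA.Z)).objPreimage _,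
    (ZFA.piece.restrictFunctor (T.F.obj ZA.Z)).objObjPreimageIso _, fun k' θ' => ?_⟩
  refine ⟨(ZFA.piece.restrictFunctor (T.F.obj ZA.Z)).preimageIso
    ((ZFA.piece.restrictFunctor (T.F.obj ZA.Z)).objObjPreimageIso _ ≪≫ θ'.symm), ?_, ?_⟩
  · simp
  · intro e he
    ext
    apply (ZFA.piece.restrictFunctor (T.F.obj ZA.Z)).map_injective
    rw [← cancel_mono θ'.hom, he]
    simp
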